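/- Let $k\ge 1$ be an integer, $\alpha>0$, $\mathbb R^+=(0,\infty)$, and $$\mathscr L_{\alpha,k}=\partial_{rr}+\frac{2\alpha-1}{r}\,\partial_r+\frac{r^2}{4}\,\Delta_\sigma ,\qquad (r,\sigma)\in\mathbb R^+\times\mathbb R^k .$$ Let $\Sigma^+$ be the set of (complex-valued) $\varphi\in C^\infty(\mathbb R^+\times\mathbb R^k)$ such that, for all $\ell,m\in\mathbb N_0$ and all multi-indices $\beta\in\mathbb N_0^k$, $$\sup_{r>0,\ \sigma\in\mathbb R^k}\Big|r^\ell\big(\tfrac1r\partial_r\big)^m\partial_\sigma^\beta\varphi(r,\sigma)\Big|<\infty .$$ Given $\varphi\in\Sigma^+$, a *solution* means a function $u((r,\sigma),t)$, defined for $r>0$, $\sigma\in\mathbb R^k$, $t\ge 0$, such that * $u$ is of class $C^{2,1}$ for $t>0$ (the derivatives in $(r,\sigma)$ of order at most $2$ and the first derivative in $t$ exist and are jointly continuous), and $u$ extends to a continuous function on $[0,\infty)\times\mathbb R^k\times[0,\infty)$; * for every $T>0$ there are $A,a\in\mathbb R$ with $|u((r,\sigma),t)|\le A\,e^{a(r^2+|\sigma|)}$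 for all $r>0$, $\sigma\in\mathbb R^k$, $0\le t\le T$; * $\partial_t u-\mathscr L_{\alpha,k}u=0$ for $r>0$, $\sigma\in\mathbb R^k$, $t>0$, and $u((r,\sigma),0)=\varphi(r,\sigma)$ for $r>0$, $\sigma\in\mathbb R^k$; * $\lim_{r\to0^+}r^{2\alpha-1}\partial_r u((r,\sigma),t)=0$ for every $\sigma\in\mathbb R^k$ and $t>0$. **Theorem.** For every $\varphi\in\Sigma^+$ there is exactly one solution. For $t>0$ it is given by $$u((r,\sigma),t)=\int_0^\infty\!\int_{\mathbb R^k}\mathscr K_{\alpha,k}((r,\sigma),(\rho,\sigma'),t)\,\varphi(\rho,\sigma')\,d\sigma'\,\rho^{2\alpha-1}\,d\rho ,$$ where, with $I_\nu(z)=\sum_{n\ge0}\frac{(z/2)^{\nu+2n}}{n!\,\Gamma(\nu+n+1)}$ the modified Bessel function of the first kind, $$\mathscr K_{\alpha,k}((r,\sigma),(\rho,\sigma'),t)=\frac{(r\rho)^{1-\alpha}}{\pi^k(2t)^{k+1}}\int_{\mathbb R^k}e^{-\frac it\langle\sigma'-\sigma,\lambda\rangle}\,\frac{|\lambda|}{\sinh|\lambda|}\,e^{-\frac{|\lambda|}{\tanh|\lambda|}\frac{r^2+\rho^2}{4t}}\,I_{\alpha-1}\!\Big(\frac{|\lambda|\rho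 r}{2t\sinh|\lambda|}\Big)\,d\lambda ,$$ and the integral over $\lambda$, the inner integral over $\sigma'$ (for every $\rho>0$) and the outer integral over $\rho$ all converge absolutely. -/

import Mathlib

open MeasureTheory Set
open scoped ENNReal ContDiff

noncomputable section

namespace BaouendiGrushin

/-- The space of the variable `σ`: `ℝ^k` with its Euclidean structure and Lebesgue measure. -/
abbrev E (k : ℕ) : Type := EuclideanSpace ℝ (Fin k)

/-- The open half space `ℝ^+ × ℝ^k` of points `(r, σ)` with `r > 0`. -/
def halfSpace (k : ℕ) : Set (ℝ × E k) := Ioi 0 ×ˢ univ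

/-- The operator `(1/r) ∂_r`. -/
def radialOp {k : ℕ} (f : ℝ × E k → ℂ) : ℝ × E k → ℂ :=
  fun p => ((1 / p.1 : ℝ) : ℂ) * deriv (fun s : ℝ => f (s, p.2)) p.1

/-- The partial derivative `∂_{σ_i}`. -/
def sigmaPartial {k : ℕ} (i : Fin k) (f : ℝ × E k → ℂ) : ℝ × E k → ℂ :=
  fun p => lineDeriv ℝ (fun y : E k => f (p.1, y)) p.2 (EuclideanSpace.single i 1)

/-- The partial derivative `∂_σ^β = ∂_{σ_1}^{β_1} ⋯ ∂_{σ_k}^{β_k}` for a multi-index `β`. -/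
def sigmaMulti {k : ℕ} (β : Fin k → ℕ) (f : ℝ × E k → ℂ) : ℝ × E k → ℂ :=
  (List.finRange k).foldr (fun i g => (sigmaPartial i)^[β i] g) f

/-- The seminorm `γ_{ℓ,m,β}(φ) = sup_{r > 0, σ} |r^ℓ ((1/r) ∂_r)^m ∂_σ^β φ(r,σ)|`,
with values in `[0, ∞]`. -/
def gammaSeminorm {k : ℕ} (l m : ℕ) (β : Fin k → ℕ) (f : ℝ × E k → ℂ) : ℝ≥0∞ :=
  ⨆ p ∈ halfSpace k, ‖((p.1 ^ l : ℝ) : ℂ) * (radialOp^[m] (sigmaMulti β f)) p‖ₑ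

/-- The class `Σ^+` of smooth functions on `ℝ^+ × ℝ^k` all of whose seminorms are finite.
Only the values at points with `r > 0` matter. -/
def SigmaPlus (k : ℕ) : Set (ℝ × E k → ℂ) :=
  {f | ContDiffOn ℝ ∞ f (halfSpace k) ∧
    ∀ (l m : ℕ) (β : Fin k → ℕ), gammaSeminorm l m β f < ⊤}

/-- The modified Bessel function of the first kind `I_ν(z)`, for `z > 0` and `ν > -1`. -/
def besselI (ν z : ℝ) : ℝ :=
  ∑' n : ℕ, (z / 2) ^ (ν + 2 * (n : ℝ)) / ((n.factorial : ℝ) * Real.Gamma (ν + (n : ℝ) + 1))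

/-- The integrand, as a function of `ξ ∈ ℝ^k`, in the generalized Mehler kernel at the points
`p = (r, σ)`, `q = (ρ, σ')` and time `t`. -/
def mehlerIntegrand {k : ℕ} (α : ℝ) (p q : ℝ × E k) (t : ℝ) (ξ : E k) : ℂ :=
  Complex.exp (-(Complex.I / (t : ℂ)) * ((inner ℝ (q.2 - p.2) ξ : ℝ) : ℂ)) *
    ((‖ξ‖ / Real.sinh ‖ξ‖ *
        Real.exp (-(‖ξ‖ / Real.tanh ‖ξ‖) * ((p.1 ^ 2 + q.1 ^ 2) / (4 * t))) *
        besselI (α - 1) (‖ξ‖ * q.1 * p.1 / (2 * t * Real.sinh ‖ξ‖)) : ℝ) : ℂ)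

/-- The generalized Mehler kernel `𝒦_{α,k}(p, q, t)`. -/
def mehlerKernel {k : ℕ} (α : ℝ) (p q : ℝ × E k) (t : ℝ) : ℂ :=
  (((p.1 * q.1) ^ (1 - α) / (Real.pi ^ k * (2 * t) ^ (k + 1)) : ℝ) : ℂ) *
    ∫ ξ : E k, mehlerIntegrand α p q t ξ

/-- The function `∫_0^∞ ∫_{ℝ^k} 𝒦_{α,k}(p, (ρ,σ'), t) φ(ρ,σ') dσ' ρ^{2α-1} dρ` for `t > 0`,
with the value `φ(p)` at `t = 0`. -/
def mehlerSolution {k : ℕ} (α : ℝ) (φ : ℝ × E k → ℂ) (p : ℝ × E k) (t : ℝ) : ℂ :=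
  if 0 < t then
    ∫ ρ in Ioi (0 : ℝ), (∫ σ' : E k, mehlerKernel α p (ρ, σ') t * φ (ρ, σ')) *
      ((ρ ^ (2 * α - 1) : ℝ) : ℂ)
  else φ p

/-- `u` is of class `C^{2,1}` for `(r,σ) ∈ ℝ^+ × ℝ^k` and `t > 0`: all derivatives in `(r,σ)` of
order at most two and the first derivative in `t` exist and are jointly continuous. -/
structure IsC21 {k : ℕ} (u : ℝ × E k → ℝ → ℂ) : Prop where
  space : ∀ t : ℝ, 0 < t → ContDiffOn ℝ 2 (fun p => u p t) (halfSpace k)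
  space_cont : ∀ j : ℕ, j ≤ 2 →
    ContinuousOn (fun x : (ℝ × E k) × ℝ => iteratedFDeriv ℝ j (fun p => u p x.2) x.1)
      (halfSpace k ×ˢ Ioi (0 : ℝ))
  time : ∀ p ∈ halfSpace k, DifferentiableOn ℝ (u p) (Ioi (0 : ℝ))
  time_cont : ContinuousOn (fun x : (ℝ × E k) × ℝ => deriv (u x.1) x.2)
    (halfSpace k ×ˢ Ioi (0 : ℝ))

/-- The operator `ℒ_{α,k} f = ∂_rr f + ((2α-1)/r) ∂_r f + (r²/4) Δ_σ f` at the point `(r, σ)`. -/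
def grushinOp {k : ℕ} (α : ℝ) (f : ℝ × E k → ℂ) (p : ℝ × E k) : ℂ :=
  iteratedDeriv 2 (fun s : ℝ => f (s, p.2)) p.1
    + (((2 * α - 1) / p.1 : ℝ) : ℂ) * deriv (fun s : ℝ => f (s, p.2)) p.1
    + ((p.1 ^ 2 / 4 : ℝ) : ℂ) * Laplacian.laplacian (fun y : E k => f (p.1, y)) p.2

/-- Classical solutions `u((r,σ),t)`, `r > 0`, `t ≥ 0`, of the Cauchy problem
`∂_t u = ℒ_{α,k} u`, `u(·,0) = φ`, with the reflecting condition `r^{2α-1} ∂_r u → 0` as `r → 0^+`.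
They are continuous up to `t = 0` and `r = 0`, and on bounded time intervals grow at most like
`exp (a (r² + |σ|))`: the growth condition of Tychonoff for this operator. -/
structure IsSolution {k : ℕ} (α : ℝ) (φ : ℝ × E k → ℂ) (u : ℝ × E k → ℝ → ℂ) : Prop where
  regular : IsC21 u
  extends_continuously : ∃ U : (ℝ × E k) × ℝ → ℂ,
    ContinuousOn U ((Ici (0 : ℝ) ×ˢ univ) ×ˢ Ici (0 : ℝ)) ∧
      ∀ p ∈ halfSpace k, ∀ t : ℝ, 0 ≤ t → U (p, t) = u p t
  growth : ∀ T : ℝ, 0 < T → ∃ A a : ℝ, ∀ p ∈ halfSpace k, ∀ t ∈ Icc 0 T,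
    ‖u p t‖ ≤ A * Real.exp (a * (p.1 ^ 2 + ‖p.2‖))
  equation : ∀ p ∈ halfSpace k, ∀ t : ℝ, 0 < t →
    deriv (u p) t - grushinOp α (fun x => u x t) p = 0
  initial : ∀ p ∈ halfSpace k, u p 0 = φ p
  neumann : ∀ (σ : E k) (t : ℝ), 0 < t →
    Filter.Tendsto
      (fun r : ℝ => ((r ^ (2 * α - 1) : ℝ) : ℂ) * deriv (fun s : ℝ => u (s, σ) t) r)
      (nhdsWithin 0 (Ioi 0)) (nhds 0)

end BaouendiGrushin

end

namespace BaouendiGrushin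

open Filter Topology

/-! ### Maximum principle -/

/-! Uniqueness is a maximum principle. `comparison` shows that a function satisfying `∂_t w ≤ ℒ w`,
with vanishing weighted flux at `r = 0`, growth at most `exp (a (r² + |σ|))` and `w ≤ 0` initially,
stays `≤ 0`. Infinity is handled by the strict supersolution `barrier`, and the degenerate boundary
`r = 0` by `radialBarrier`, which is annihilated by the radial part of `ℒ` and has flux exactly `1`.
Applying it to the real part of `γ (u - v)` gives `IsSolution.eq`.

For existence, a Fourier transform in `σ` turns `ℒ` into `∂_rr + (2α-1)/r ∂_r - w² r²` with `w =
|ξ|/2`. Gaussians `exp (-a r²)` stay Gaussian under this evolution: the exponent solves a Riccati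
equation, so it moves by a Möbius map of determinant one (`gaussEvol`). Multiplying by `exp (i⟨ξ,
σ⟩)` and integrating over `(a, ξ)` gives explicit solutions (`superpose`), including those with
initial values `exp (-r²) G (r², σ)` for Schwartz `G`.

The kernel is identified by its Laplace transform. Weber's integral shows that `radialSym`
propagates Gaussians with real exponent, and analytic continuation extends this to complex exponents
(`integral_radialSym_mul_cexp`). The Mehler kernel is the Fourier transform in `σ` of `radialSym`
(`mehlerKernel_eq`), so on product data it acts as the explicit evolution (`integral_kernF_tensor`).

Absolute convergence in `σ'` is not visible from the oscillating formula; it comes from positivity.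
Testing the kernel against nonnegative bump functions and using the maximum principle for
superpositions shows that it is real and nonnegative (`re_mul_kernF_nonpos`). A nonnegative Fourier
transform of an integrable function continuous at `0` is integrable
(`integrable_fourier_of_nonneg`). Hence the kernel defines measures `heatMeasure` of mass at most
one, which act on every bounded continuous function.

For data in `Σ⁺` put `s = r²`. Then `(1/r) ∂_r = 2 ∂_s`, and the class becomes that of functions
with rapidly weighted bounded derivatives on `s > 0` (`Tame`), which is stable under `ℒ` because `ℒ`
has polynomial coefficients in `s`. Shifting `s` by `c > 0` and cutting off makes such a function
the restriction of a compactly supported smooth one, so the explicit evolutions apply. As `c → 0`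
the bounds are uniform, and the equation passes to the limit in integrated form: in time
(`HeatApprox.heat_sub_time`), and in `r` with the flux written as a weighted integral of `∂_t u -
(r²/4) Δ_σ u` (`HeatApprox.heat_sub_radial`). Since the right-hand sides are again evolutions of
tame functions, hence continuous, the integrated identities can be differentiated, which gives
`C^{2,1}` regularity, the equation and the boundary condition (`Tame.isSolution`). -/

theorem second_deriv_nonpos_of_isLocalMax {f f' : ℝ → ℝ} {d x : ℝ} (h : IsLocalMax f x)
    (hf : ∀ᶠ y in 𝓝 x, HasDerivAt f (f' y) y) (hf' : HasDerivAt f' d x) : d ≤ 0 := by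
  by_contra! hd
  have e1 : deriv f =ᶠ[𝓝 x] f' := hf.mono fun y hy => hy.deriv
  have e2 : deriv (deriv f) x = d := by rw [e1.deriv_eq, hf'.deriv]
  have hmin := isLocalMin_of_deriv_deriv_pos (f := f) (x₀ := x) (by rw [e2]; exact hd)
    h.deriv_eq_zero hf.self_of_nhds.continuousAt
  -- If `d` were positive, `x` would also be a local minimum; then `f` is locally constant, which
  -- forces `d = 0`.
  have hc : f =ᶠ[𝓝 x] fun _ => f x := by
    filter_upwards [h, hmin] with y h1 h2 using le_antisymm h1 h2
  have hc' : deriv f =ᶠ[𝓝 x] fun _ => 0 := by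
    have := hc.deriv
    simpa using this
  have := hc'.deriv_eq
  rw [e2] at this
  simp at this
  exact hd.ne' this

/-- The coordinate-line derivatives entering the Grushin heat equation. -/
structure HasGrushinDerivs {k : ℕ} (w wr wrr wt : ℝ → E k → ℝ → ℝ)
    (ws wss : Fin k → ℝ → E k → ℝ → ℝ) : Prop where
  r : ∀ r : ℝ, 0 < r → ∀ σ t, 0 < t → HasDerivAt (fun s => w s σ t) (wr r σ t) r
  rr : ∀ r : ℝ, 0 < r → ∀ σ t, 0 < t → HasDerivAt (fun s => wr s σ t) (wrr r σ t) r
  s : ∀ i (r : ℝ), 0 < r → ∀ σ t, 0 < t →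
    HasDerivAt (fun τ : ℝ => w r (σ + τ • EuclideanSpace.single i (1 : ℝ)) t) (ws i r σ t) 0
  ss : ∀ i (r : ℝ), 0 < r → ∀ σ t, 0 < t →
    HasDerivAt (fun τ : ℝ => ws i r (σ + τ • EuclideanSpace.single i (1 : ℝ)) t) (wss i r σ t) 0
  t : ∀ r : ℝ, 0 < r → ∀ σ t, 0 < t → HasDerivAt (fun τ => w r σ τ) (wt r σ t) t

theorem HasGrushinDerivs.add {k : ℕ} {w wr wrr wt v vr vrr vt : ℝ → E k → ℝ → ℝ}
    {ws wss vs vss : Fin k → ℝ → E k → ℝ → ℝ} (hw : HasGrushinDerivs w wr wrr wt ws wss)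
    (hv : HasGrushinDerivs v vr vrr vt vs vss) :
    HasGrushinDerivs (fun r σ t => w r σ t + v r σ t) (fun r σ t => wr r σ t + vr r σ t)
      (fun r σ t => wrr r σ t + vrr r σ t) (fun r σ t => wt r σ t + vt r σ t)
      (fun i r σ t => ws i r σ t + vs i r σ t) (fun i r σ t => wss i r σ t + vss i r σ t) where
  r r hr σ t ht := (hw.r r hr σ t ht).add (hv.r r hr σ t ht)
  rr r hr σ t ht := (hw.rr r hr σ t ht).add (hv.rr r hr σ t ht)
  s i r hr σ t ht := (hw.s i r hr σ t ht).add (hv.s i r hr σ t ht)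
  ss i r hr σ t ht := (hw.ss i r hr σ t ht).add (hv.ss i r hr σ t ht)
  t r hr σ t ht := (hw.t r hr σ t ht).add (hv.t r hr σ t ht)

theorem HasGrushinDerivs.const_mul {k : ℕ} {w wr wrr wt : ℝ → E k → ℝ → ℝ}
    {ws wss : Fin k → ℝ → E k → ℝ → ℝ} (hw : HasGrushinDerivs w wr wrr wt ws wss) (c : ℝ) :
    HasGrushinDerivs (fun r σ t => c * w r σ t) (fun r σ t => c * wr r σ t)
      (fun r σ t => c * wrr r σ t) (fun r σ t => c * wt r σ t)
      (fun i r σ t => c * ws i r σ t) (fun i r σ t => c * wss i r σ t) where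
  r r hr σ t ht := (hw.r r hr σ t ht).const_mul c
  rr r hr σ t ht := (hw.rr r hr σ t ht).const_mul c
  s i r hr σ t ht := (hw.s i r hr σ t ht).const_mul c
  ss i r hr σ t ht := (hw.ss i r hr σ t ht).const_mul c
  t r hr σ t ht := (hw.t r hr σ t ht).const_mul c

/-- The first radial derivative vanishes at the maximum, so the singular coefficient `1/r` does not
matter, and the second derivatives are `≤ 0`. In time only earlier values are compared, so a maximum
at the final time is covered. -/
theorem HasGrushinDerivs.op_le_time_deriv_at_max {k : ℕ} {w wr wrr wt : ℝ → E k → ℝ → ℝ}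
    {ws wss : Fin k → ℝ → E k → ℝ → ℝ} (hw : HasGrushinDerivs w wr wrr wt ws wss)
    (α : ℝ) {r t : ℝ} {σ : E k} (hr : 0 < r) (ht : 0 < t)
    (h1 : IsLocalMax (fun s => w s σ t) r)
    (h2 : ∀ i, IsLocalMax
      (fun τ : ℝ => w r (σ + τ • EuclideanSpace.single i (1 : ℝ)) t) 0)
    (h3 : ∀ᶠ τ in 𝓝[<] t, w r σ τ ≤ w r σ t) :
    wrr r σ t + (2 * α - 1) / r * wr r σ t + r ^ 2 / 4 * ∑ i, wss i r σ t ≤ wt r σ t := by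
  have a1 : wr r σ t = 0 := h1.hasDerivAt_eq_zero (hw.r r hr σ t ht)
  have a2 : wrr r σ t ≤ 0 := by
    refine second_deriv_nonpos_of_isLocalMax h1 ?_ (hw.rr r hr σ t ht)
    filter_upwards [lt_mem_nhds hr] with y hy using hw.r y hy σ t ht
  have a3 : ∀ i, wss i r σ t ≤ 0 := by
    intro i
    refine second_deriv_nonpos_of_isLocalMax (h2 i) (Eventually.of_forall fun y => ?_)
      (hw.ss i r hr σ t ht)
    have := hw.s i r hr (σ + y • EuclideanSpace.single i (1 : ℝ)) t ht
    have h' : HasDerivAt (fun τ : ℝ => w r (σ + y • EuclideanSpace.single i (1 : ℝ) +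
      τ • EuclideanSpace.single i (1 : ℝ)) t)
      (ws i r (σ + y • EuclideanSpace.single i (1 : ℝ)) t) (y - y) := by rwa [sub_self]
    refine (h'.comp_sub_const y y).congr_of_eventuallyEq (Eventually.of_forall fun τ => ?_)
    simp only
    congr 1
    module
  have a4 : 0 ≤ wt r σ t := by
    have hd := (hw.t r hr σ t ht).hasDerivWithinAt (s := Iio t)
    rw [hasDerivWithinAt_iff_tendsto_slope' (by simp)] at hd
    refine ge_of_tendsto hd ?_
    filter_upwards [h3, self_mem_nhdsWithin] with τ hτ hlt
    rw [slope_def_field]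
    exact div_nonneg_of_nonpos (by linarith) (by simp at hlt; linarith)
  have a5 : ∑ i, wss i r σ t ≤ 0 := Finset.sum_nonpos fun i _ => a3 i
  rw [a1]
  have : r ^ 2 / 4 * ∑ i, wss i r σ t ≤ 0 := mul_nonpos_of_nonneg_of_nonpos (by positivity) a5
  linarith

/-! ### The barriers -/

/-- The lateral factor of the barrier. -/
noncomputable def coshSum {k : ℕ} (b : ℝ) (σ : E k) : ℝ := 1 + ∑ i, Real.cosh (b * σ i)

/-- The barrier at infinity. -/
noncomputable def barrier {k : ℕ} (b c t₀ : ℝ) (r : ℝ) (σ : E k) (t : ℝ) : ℝ :=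
  Real.exp (b * (1 + c * (t - t₀)) * (1 + r ^ 2)) * coshSum b σ

theorem one_le_coshSum {k : ℕ} (b : ℝ) (σ : E k) : 1 ≤ coshSum b σ := by
  have : 0 ≤ ∑ i, Real.cosh (b * σ i) := Finset.sum_nonneg fun i _ => (Real.cosh_pos _).le
  unfold coshSum; linarith

theorem barrier_pos {k : ℕ} (b c t₀ r : ℝ) (σ : E k) (t : ℝ) : 0 < barrier b c t₀ r σ t :=
  mul_pos (Real.exp_pos _) (lt_of_lt_of_le one_pos (one_le_coshSum b σ))

theorem continuous_barrier {k : ℕ} (b c t₀ : ℝ) :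
    Continuous fun x : (ℝ × E k) × ℝ => barrier b c t₀ x.1.1 x.1.2 x.2 := by
  unfold barrier coshSum; fun_prop

theorem hasDerivAt_coshSum_line {k : ℕ} (b : ℝ) (σ : E k) (i : Fin k) :
    HasDerivAt (fun τ : ℝ => coshSum b (σ + τ • EuclideanSpace.single i (1 : ℝ)))
      (b * Real.sinh (b * σ i)) 0 := by
  unfold coshSum
  have : ∀ j ∈ Finset.univ, HasDerivAt (fun τ : ℝ => Real.cosh (b * (σ +
      τ • EuclideanSpace.single i (1 : ℝ)) j)) (if j = i then b * Real.sinh (b * σ i) else 0) 0 := by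
    intro j _
    by_cases h : j = i
    · subst h
      have h0 : HasDerivAt (fun τ : ℝ => b * (σ j + τ)) b 0 := by
        simpa using ((hasDerivAt_id (0 : ℝ)).const_add (σ j)).const_mul b
      simpa [mul_comm] using h0.cosh
    · simpa [h] using hasDerivAt_const (0 : ℝ) (Real.cosh (b * σ j))
  have := (HasDerivAt.fun_sum this).const_add 1
  simpa using this

theorem hasDerivAt_sinh_line {k : ℕ} (b : ℝ) (σ : E k) (i : Fin k) :
    HasDerivAt (fun τ : ℝ => b * Real.sinh (b * (σ + τ • EuclideanSpace.single i (1 : ℝ)) i))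
      (b ^ 2 * Real.cosh (b * σ i)) 0 := by
  have h0 : HasDerivAt (fun τ : ℝ => b * (σ i + τ)) b 0 := by
    simpa using ((hasDerivAt_id (0 : ℝ)).const_add (σ i)).const_mul b
  have := (h0.sinh.const_mul b).congr_deriv
    (show _ = b ^ 2 * Real.cosh (b * σ i) by rw [add_zero]; ring)
  simpa using this

theorem hasGrushinDerivs_barrier {k : ℕ} (b c t₀ : ℝ) :
    HasGrushinDerivs (k := k) (barrier b c t₀)
      (fun r σ t => 2 * (b * (1 + c * (t - t₀))) * r * barrier b c t₀ r σ t)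
      (fun r σ t => (4 * (b * (1 + c * (t - t₀))) ^ 2 * r ^ 2 + 2 * (b * (1 + c * (t - t₀)))) *
        barrier b c t₀ r σ t)
      (fun r σ t => b * c * (1 + r ^ 2) * barrier b c t₀ r σ t)
      (fun i r σ t => Real.exp (b * (1 + c * (t - t₀)) * (1 + r ^ 2)) *
        (b * Real.sinh (b * σ i)))
      (fun i r σ t => Real.exp (b * (1 + c * (t - t₀)) * (1 + r ^ 2)) *
        (b ^ 2 * Real.cosh (b * σ i))) := by
  have key : ∀ r (σ : E k) t, HasDerivAt (fun s => barrier b c t₀ s σ t)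
      (2 * (b * (1 + c * (t - t₀))) * r * barrier b c t₀ r σ t) r := by
    intro r σ t
    have h0 : HasDerivAt (fun s : ℝ => b * (1 + c * (t - t₀)) * (1 + s ^ 2))
        (b * (1 + c * (t - t₀)) * (2 * r)) r := by
      simpa using ((hasDerivAt_pow 2 r).const_add 1).const_mul (b * (1 + c * (t - t₀)))
    have := h0.exp.mul_const (coshSum b σ)
    refine this.congr_deriv ?_
    unfold barrier; ring
  refine ⟨fun r _ σ t _ => key r σ t, fun r _ σ t _ => ?_, fun i r _ σ t _ => ?_,
    fun i r _ σ t _ => ?_, fun r _ σ t _ => ?_⟩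
  · have h0 : HasDerivAt (fun s : ℝ => 2 * (b * (1 + c * (t - t₀))) * s)
        (2 * (b * (1 + c * (t - t₀)))) r := by
      simpa using (hasDerivAt_id r).const_mul (2 * (b * (1 + c * (t - t₀))))
    refine (h0.mul (key r σ t)).congr_deriv ?_
    ring
  · exact (hasDerivAt_coshSum_line b σ i).const_mul _
  · exact (hasDerivAt_sinh_line b σ i).const_mul _
  · have h0 : HasDerivAt (fun s : ℝ => b * (1 + c * (s - t₀)) * (1 + r ^ 2))
        (b * c * (1 + r ^ 2)) t := by
      simpa using (((((hasDerivAt_id t).sub_const t₀).const_mul c).const_add 1).const_mul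
        b).mul_const (1 + r ^ 2)
    refine (h0.exp.mul_const (coshSum b σ)).congr_deriv ?_
    unfold barrier; ring

/-- The time restriction keeps `B = b (1 + c (t - t₀))` in `[b, 2b]`. Relative to the barrier the
operator then contributes at most `4B²r² + 4αB + b²r²/4 ≤ (16 + 1/4) b² r² + 8αb`, and the time
derivative contributes `b c (1 + r²)`. The value `c = 17b + 8α + 1` is chosen to win. -/
theorem barrier_strict_super {k : ℕ} {α b t₀ r t : ℝ} (hα : 0 < α) (hb : 0 < b) (hr : 0 < r)
    (ht : t₀ ≤ t) (ht' : (17 * b + 8 * α + 1) * (t - t₀) ≤ 1) (σ : E k) :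
    (4 * (b * (1 + (17 * b + 8 * α + 1) * (t - t₀))) ^ 2 * r ^ 2 +
        2 * (b * (1 + (17 * b + 8 * α + 1) * (t - t₀)))) *
        barrier b (17 * b + 8 * α + 1) t₀ r σ t +
      (2 * α - 1) / r * (2 * (b * (1 + (17 * b + 8 * α + 1) * (t - t₀))) * r *
        barrier b (17 * b + 8 * α + 1) t₀ r σ t) +
      r ^ 2 / 4 * ∑ i, Real.exp (b * (1 + (17 * b + 8 * α + 1) * (t - t₀)) * (1 + r ^ 2)) *
        (b ^ 2 * Real.cosh (b * σ i)) <
    b * (17 * b + 8 * α + 1) * (1 + r ^ 2) * barrier b (17 * b + 8 * α + 1) t₀ r σ t := by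
  set c := 17 * b + 8 * α + 1 with hc
  set B := b * (1 + c * (t - t₀)) with hB
  have hcp : 0 ≤ c * (t - t₀) := mul_nonneg (by positivity) (by linarith)
  have hB1 : b ≤ B := by rw [hB]; nlinarith
  have hB2 : B ≤ 2 * b := by rw [hB]; nlinarith
  have hsum : ∑ i, Real.exp (B * (1 + r ^ 2)) * (b ^ 2 * Real.cosh (b * σ i)) ≤
      b ^ 2 * barrier b c t₀ r σ t := by
    rw [← Finset.mul_sum, ← Finset.mul_sum]
    unfold barrier coshSum
    rw [← hB]
    have : 0 < Real.exp (B * (1 + r ^ 2)) := Real.exp_pos _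
    have : 0 ≤ b ^ 2 * Real.exp (B * (1 + r ^ 2)) := by positivity
    linarith
  have hpos := barrier_pos b c t₀ r σ t
  set h := barrier b c t₀ r σ t
  have e : (2 * α - 1) / r * (2 * B * r * h) = (2 * α - 1) * (2 * B) * h := by field_simp
  rw [e]
  have h4 : r ^ 2 / 4 * ∑ i, Real.exp (B * (1 + r ^ 2)) * (b ^ 2 * Real.cosh (b * σ i)) ≤
      r ^ 2 / 4 * (b ^ 2 * h) := mul_le_mul_of_nonneg_left hsum (by positivity)
  have h5 : 4 * B ^ 2 * r ^ 2 + 4 * α * B + r ^ 2 / 4 * b ^ 2 < b * c * (1 + r ^ 2) := by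
    have hBB : B ^ 2 ≤ 4 * b ^ 2 := by nlinarith
    have h6 : B ^ 2 * r ^ 2 ≤ 4 * b ^ 2 * r ^ 2 := mul_le_mul_of_nonneg_right hBB (by positivity)
    have h7 : α * B ≤ α * (2 * b) := mul_le_mul_of_nonneg_left hB2 hα.le
    have h8 : 0 < b * α * r ^ 2 := by positivity
    have h9 : 0 < b * r ^ 2 := by positivity
    have h10 : 0 < b ^ 2 * r ^ 2 := by positivity
    have h11 : 0 < b ^ 2 := by positivity
    rw [hc]
    nlinarith
  have h6 := mul_lt_mul_of_pos_right h5 hpos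
  nlinarith

/-- Some coordinate satisfies `‖σ‖ ≤ (k + 1) |σ i|`, since otherwise `‖σ‖ ≤ ∑ |σ i|` would be too
small. This coordinate alone suffices, by `exp x ≤ 2 cosh x`. Using `k + 1` instead of `k` avoids a
separate case `k = 0`. -/
theorem exp_norm_le_coshSum {k : ℕ} {a : ℝ} (ha : 0 ≤ a) (σ : E k) :
    Real.exp (a * ‖σ‖) ≤ 2 * coshSum ((k + 1) * a) σ := by
  rcases eq_or_lt_of_le (norm_nonneg σ) with h0 | h0
  · rw [← h0]; have := one_le_coshSum ((k + 1) * a) σ; simp; linarith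
  have : ∃ i, ‖σ‖ ≤ (k + 1) * |σ i| := by
    by_contra! hcon
    have h1 : ‖σ‖ ≤ ∑ i, |σ i| := by
      have : σ = ∑ i, EuclideanSpace.single i (σ i) := by
        ext j; simp [Finset.sum_apply, Pi.single_apply]
      calc ‖σ‖ = ‖∑ i, EuclideanSpace.single i (σ i)‖ := by rw [← this]
        _ ≤ ∑ i, ‖EuclideanSpace.single i (σ i)‖ := norm_sum_le _ _
        _ = _ := by simp
    have h2 : (k + 1) * ∑ i, |σ i| ≤ k * ‖σ‖ := by
      rw [Finset.mul_sum]
      calc ∑ i, ((k : ℝ) + 1) * |σ i| ≤ ∑ i : Fin k, ‖σ‖ := Finset.sum_le_sum fun i _ => (hcon i).le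
        _ = _ := by simp
    have h3 : 0 ≤ (k : ℝ) := Nat.cast_nonneg k
    nlinarith
  obtain ⟨i, hi⟩ := this
  have h1 : Real.cosh ((k + 1) * a * σ i) ≤ coshSum ((k + 1) * a) σ := by
    unfold coshSum
    have := Finset.single_le_sum (f := fun i => Real.cosh ((k + 1) * a * σ i))
      (fun j _ => (Real.cosh_pos _).le) (Finset.mem_univ i)
    simp only at this; linarith
  have h2 : Real.exp (a * ‖σ‖) ≤ 2 * Real.cosh ((k + 1) * a * σ i) := by
    rw [← Real.cosh_abs, Real.cosh_eq, abs_mul, abs_of_nonneg (by positivity : 0 ≤ ((k : ℝ) + 1) * a)]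
    have : Real.exp (a * ‖σ‖) ≤ Real.exp ((k + 1) * a * |σ i|) :=
      Real.exp_le_exp.2 (by nlinarith)
    have := Real.exp_pos (-((k + 1) * a * |σ i|))
    linarith
  linarith

/-- A radial function in the kernel of `∂_rr + (2α-1)/r ∂_r`, normalized by
`r^(2α-1) ∂_r g = 1`. -/
noncomputable def radialBarrier (α r : ℝ) : ℝ := if α = 1 then Real.log r else r ^ (2 - 2 * α) / (2 - 2 * α)

theorem hasDerivAt_radialBarrier (α : ℝ) {r : ℝ} (hr : 0 < r) :
    HasDerivAt (radialBarrier α) (r ^ (1 - 2 * α)) r := by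
  by_cases h : α = 1
  · have e : radialBarrier α = Real.log := by ext; simp [radialBarrier, h]
    rw [e, h]
    convert Real.hasDerivAt_log hr.ne' using 1
    rw [show (1 : ℝ) - 2 * 1 = -1 by norm_num, Real.rpow_neg_one]
  · have e : radialBarrier α = fun r => r ^ (2 - 2 * α) / (2 - 2 * α) := by
      ext; simp [radialBarrier, h]
    rw [e]
    have h2 : (2 - 2 * α) ≠ 0 := fun h' => h (by linarith)
    refine ((Real.hasDerivAt_rpow_const (p := 2 - 2 * α) (Or.inl hr.ne')).div_const
      (2 - 2 * α)).congr_deriv ?_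
    rw [show 2 - 2 * α - 1 = 1 - 2 * α by ring]
    field_simp

theorem hasGrushinDerivs_radialBarrier {k : ℕ} (α R : ℝ) :
    HasGrushinDerivs (k := k) (fun r _ _ => radialBarrier α r - R) (fun r _ _ => r ^ (1 - 2 * α))
      (fun r _ _ => (1 - 2 * α) / r * r ^ (1 - 2 * α)) (fun _ _ _ => 0) (fun _ _ _ _ => 0)
      (fun _ _ _ _ => 0) := by
  refine ⟨fun r hr σ t _ => (hasDerivAt_radialBarrier α hr).sub_const R, fun r hr σ t _ => ?_,
    fun i r _ σ t _ => hasDerivAt_const _ _, fun i r _ σ t _ => hasDerivAt_const _ _,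
    fun r _ σ t _ => hasDerivAt_const _ _⟩
  refine (Real.hasDerivAt_rpow_const (p := 1 - 2 * α) (Or.inl hr.ne')).congr_deriv ?_
  rw [Real.rpow_sub_one hr.ne']
  field_simp

theorem radialBarrier_le {α r R : ℝ} (hr : 0 < r) (hrR : r ≤ R) :
    radialBarrier α r ≤ radialBarrier α R := by
  have hm : MonotoneOn (radialBarrier α) (Ioi 0) := by
    refine monotoneOn_of_deriv_nonneg (convex_Ioi 0)
      (fun x hx => (hasDerivAt_radialBarrier α hx).continuousAt.continuousWithinAt)
      (fun x hx => ?_) (fun x hx => ?_) <;> rw [interior_Ioi] at hx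
    · exact (hasDerivAt_radialBarrier α hx).differentiableAt.differentiableWithinAt
    · rw [(hasDerivAt_radialBarrier α hx).deriv]; exact Real.rpow_nonneg (le_of_lt hx) _
  exact hm hr (lt_of_lt_of_le hr hrR) hrR

/-- In this range the barrier by itself keeps maxima away from `r = 0`. -/
theorem tendsto_radialBarrier_atBot {α : ℝ} (hα : 1 ≤ α) :
    Tendsto (radialBarrier α) (𝓝[>] 0) atBot := by
  by_cases h : α = 1
  · have e : radialBarrier α = Real.log := by ext; simp [radialBarrier, h]
    rw [e]; exact Real.tendsto_log_nhdsGT_zero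
  · have h1 : 1 < α := lt_of_le_of_ne hα (Ne.symm h)
    have e : radialBarrier α = fun r => r ^ (2 - 2 * α) / (2 - 2 * α) := by
      ext; simp [radialBarrier, h]
    rw [e]
    have : Tendsto (fun r : ℝ => r ^ (2 - 2 * α)) (𝓝[>] 0) atTop := by
      have := (tendsto_rpow_atTop (y := 2 * α - 2) (by linarith)).comp tendsto_inv_nhdsGT_zero
      refine this.congr' ?_
      filter_upwards [self_mem_nhdsWithin] with r hr
      simp only [Function.comp]
      rw [Real.inv_rpow (le_of_lt hr), ← Real.rpow_neg (le_of_lt hr)]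
      congr 1; ring
    exact this.atTop_div_const_of_neg (by linarith)

/-- A positive limit of the weighted derivative makes `ζ'` positive near `0`, and the mean value
theorem applies. This excludes a maximum at `r = 0` when the radial barrier is finite there. -/
theorem exists_gt_of_flux_pos {α L R : ℝ} {ζ ζ' : ℝ → ℝ} (hL : 0 < L) (hR : 0 < R)
    (hc : ContinuousOn ζ (Icc 0 R)) (hd : ∀ r, 0 < r → HasDerivAt ζ (ζ' r) r)
    (hlim : Tendsto (fun r : ℝ => r ^ (2 * α - 1) * ζ' r) (𝓝[>] 0) (𝓝 L)) :
    ∃ r ∈ Ioc 0 R, ζ 0 < ζ r := by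
  have h1 := hlim.eventually (lt_mem_nhds hL)
  obtain ⟨η, hη, hsub⟩ := (mem_nhdsGT_iff_exists_Ioc_subset).1 h1
  have hη' : 0 < min η R := lt_min hη hR
  obtain ⟨c, hcm, hc2⟩ := exists_hasDerivAt_eq_slope ζ ζ' hη'
    (hc.mono (Icc_subset_Icc_right (min_le_right _ _))) (fun x hx => hd x hx.1)
  refine ⟨min η R, ⟨hη', min_le_right _ _⟩, ?_⟩
  have : 0 < c ^ (2 * α - 1) * ζ' c := hsub ⟨hcm.1, (hcm.2.le.trans (min_le_left _ _))⟩
  have h2 : 0 < ζ' c := (mul_pos_iff_of_pos_left (Real.rpow_pos_of_pos hcm.1 _)).1 this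
  rw [hc2] at h2
  have := (div_pos_iff_of_pos_right (by simpa using hη')).1 h2
  linarith

end BaouendiGrushin

/-! ### The comparison principle in the half space. -/

namespace BaouendiGrushin

open Filter Topology

/-- The content is `0 < r₀`. For `α ≥ 1` the radial barrier tends to `-∞` at `r = 0`, so the maximum
may be sought over a compact set with `r` bounded below. For `α < 1` the barrier is continuous up to
`r = 0`, but it adds the flux `δ > 0`, and a function with positive flux increases from `r = 0`. -/
theorem exists_max_of_pos {k : ℕ} {α δ R t₀ t₁ : ℝ} (hδ : 0 < δ) (ht₀ : 0 ≤ t₀)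
    {z zr : ℝ → E k → ℝ → ℝ}
    (hcont : ContinuousOn (fun x : (ℝ × E k) × ℝ => z x.1.1 x.1.2 x.2)
      ((Ici 0 ×ˢ univ) ×ˢ Ici 0))
    (hr : ∀ r : ℝ, 0 < r → ∀ σ t, 0 < t → HasDerivAt (fun s => z s σ t) (zr r σ t) r)
    (hneu : ∀ σ t, 0 < t → Tendsto (fun r : ℝ => r ^ (2 * α - 1) * zr r σ t) (𝓝[>] 0) (𝓝 0))
    (hinit : ∀ r : ℝ, 0 < r → ∀ σ, z r σ t₀ ≤ 0)
    {r₁ : ℝ} {σ₁ : E k} {s₁ : ℝ} (hr₁ : 0 < r₁) (hr₁' : r₁ ≤ R) (hσ₁ : ‖σ₁‖ ≤ R)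
    (hs₁ : s₁ ∈ Icc t₀ t₁)
    (hpos : 0 < z r₁ σ₁ s₁ + δ * (radialBarrier α r₁ - radialBarrier α R)) :
    ∃ r₀ σ₀ s₀, 0 < r₀ ∧ r₀ ≤ R ∧ ‖σ₀‖ ≤ R ∧ s₀ ∈ Icc t₀ t₁ ∧
      0 < z r₀ σ₀ s₀ + δ * (radialBarrier α r₀ - radialBarrier α R) ∧
      ∀ r σ s, 0 < r → r ≤ R → ‖σ‖ ≤ R → s ∈ Icc t₀ t₁ →
        z r σ s + δ * (radialBarrier α r - radialBarrier α R) ≤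
          z r₀ σ₀ s₀ + δ * (radialBarrier α r₀ - radialBarrier α R) := by
  have hR : 0 < R := hr₁.trans_le hr₁'
  have hcomp : ∀ η : ℝ, IsCompact
      ((Icc η R ×ˢ Metric.closedBall (0 : E k) R) ×ˢ Icc t₀ t₁) := fun η =>
    (isCompact_Icc.prod (isCompact_closedBall _ _)).prod isCompact_Icc
  have hsub : ∀ η : ℝ, 0 ≤ η → ((Icc η R ×ˢ Metric.closedBall (0 : E k) R) ×ˢ Icc t₀ t₁) ⊆
      ((Ici (0 : ℝ) ×ˢ univ) ×ˢ Ici (0 : ℝ)) := fun η hη x hx =>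
    ⟨⟨hη.trans hx.1.1.1, mem_univ _⟩, ht₀.trans hx.2.1⟩
  rcases le_or_gt 1 α with hα | hα
  · obtain ⟨M, hM⟩ := ((hcomp 0).bddAbove_image (hcont.mono (hsub 0 le_rfl)))
    have hM' : ∀ r σ s, 0 < r → r ≤ R → ‖σ‖ ≤ R → s ∈ Icc t₀ t₁ → z r σ s ≤ M :=
      fun r σ s h1 h2 h3 h4 => hM ⟨((r, σ), s), ⟨⟨⟨h1.le, h2⟩, by simpa using h3⟩, h4⟩, rfl⟩
    have hlim := (tendsto_radialBarrier_atBot hα).eventually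
      (eventually_lt_atBot (radialBarrier α R - M / δ))
    obtain ⟨η, hη, hηs⟩ := (mem_nhdsGT_iff_exists_Ioc_subset).1 hlim
    have hneg : ∀ r σ s, 0 < r → r ≤ η → r ≤ R → ‖σ‖ ≤ R → s ∈ Icc t₀ t₁ →
        z r σ s + δ * (radialBarrier α r - radialBarrier α R) < 0 := by
      intro r σ s h1 h2 h3 h4 h5
      have h6 : radialBarrier α r < radialBarrier α R - M / δ := hηs ⟨h1, h2⟩
      have h7 := hM' r σ s h1 h3 h4 h5
      have h8 : δ * (radialBarrier α r - radialBarrier α R) < δ * (-(M / δ)) :=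
        mul_lt_mul_of_pos_left (by linarith) hδ
      have h9 : δ * (-(M / δ)) = -M := by field_simp
      linarith
    have hη0 : 0 < η := hη
    have hr₁η : η ≤ r₁ := by
      by_contra! h
      exact (hneg r₁ σ₁ s₁ hr₁ h.le hr₁' hσ₁ hs₁).not_gt hpos
    obtain ⟨⟨⟨r₀, σ₀⟩, s₀⟩, hx, hmax⟩ := (hcomp η).exists_isMaxOn
      (f := fun x : (ℝ × E k) × ℝ => z x.1.1 x.1.2 x.2 +
        δ * (radialBarrier α x.1.1 - radialBarrier α R))
      ⟨((r₁, σ₁), s₁), ⟨⟨hr₁η, hr₁'⟩, by simpa using hσ₁⟩, hs₁⟩ (by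
        refine (hcont.mono (hsub η hη0.le)).add (continuousOn_const.mul (ContinuousOn.sub
          (fun x hx => ?_) continuousOn_const))
        have : ContinuousAt (radialBarrier α) x.1.1 :=
          (hasDerivAt_radialBarrier α (hη0.trans_le hx.1.1.1)).continuousAt
        exact (ContinuousAt.comp (f := fun x : (ℝ × E k) × ℝ => x.1.1) this
          (by fun_prop)).continuousWithinAt)
    have hp : 0 < z r₀ σ₀ s₀ + δ * (radialBarrier α r₀ - radialBarrier α R) :=
      hpos.trans_le (hmax (a := ((r₁, σ₁), s₁)) ⟨⟨⟨hr₁η, hr₁'⟩, by simpa using hσ₁⟩, hs₁⟩)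
    refine ⟨r₀, σ₀, s₀, hη0.trans_le hx.1.1.1, hx.1.1.2, by simpa using hx.1.2, hx.2, hp, ?_⟩
    intro r σ s h1 h2 h3 h4
    rcases le_or_gt η r with h5 | h5
    · exact hmax (a := ((r, σ), s)) ⟨⟨⟨h5, h2⟩, by simpa using h3⟩, h4⟩
    · exact ((hneg r σ s h1 h5.le h2 h3 h4).trans hp).le
  · have hg : ∀ r, radialBarrier α r = r ^ (2 - 2 * α) / (2 - 2 * α) := fun r => by
      simp [radialBarrier, hα.ne]
    have hgc : Continuous (radialBarrier α) := by
      have : radialBarrier α = fun r => r ^ (2 - 2 * α) / (2 - 2 * α) := funext hg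
      rw [this]
      exact (Real.continuous_rpow_const (by linarith)).div_const _
    have hZc : ContinuousOn (fun x : (ℝ × E k) × ℝ => z x.1.1 x.1.2 x.2 +
        δ * (radialBarrier α x.1.1 - radialBarrier α R)) ((Ici 0 ×ˢ univ) ×ˢ Ici 0) :=
      hcont.add (by fun_prop)
    obtain ⟨⟨⟨r₀, σ₀⟩, s₀⟩, hx, hmax⟩ := (hcomp 0).exists_isMaxOn
      ⟨((r₁, σ₁), s₁), ⟨⟨hr₁.le, hr₁'⟩, by simpa using hσ₁⟩, hs₁⟩ (hZc.mono (hsub 0 le_rfl))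
    have hp : 0 < z r₀ σ₀ s₀ + δ * (radialBarrier α r₀ - radialBarrier α R) :=
      hpos.trans_le (hmax (a := ((r₁, σ₁), s₁)) ⟨⟨⟨hr₁.le, hr₁'⟩, by simpa using hσ₁⟩, hs₁⟩)
    have hσ₀ : ‖σ₀‖ ≤ R := by simpa using hx.1.2
    rcases eq_or_lt_of_le hx.1.1.1 with h0 | h0
    · exfalso
      simp only at h0
      subst h0
      have hline : ContinuousOn (fun r => z r σ₀ s₀ +
          δ * (radialBarrier α r - radialBarrier α R)) (Ici 0) :=
        hZc.comp (f := fun r : ℝ => ((r, σ₀), s₀)) (by fun_prop)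
          (fun r hr => ⟨⟨hr, mem_univ _⟩, ht₀.trans hx.2.1⟩)
      -- The flux condition is available only at positive times, and `t₀` may be `0`. At time `t₀`
      -- the initial inequality extends to `r = 0` by continuity.
      have hs₀ : t₀ < s₀ := by
        refine lt_of_le_of_ne hx.2.1 fun h => ?_
        subst h
        have hcz : ContinuousWithinAt (fun r => z r σ₀ t₀ +
          δ * (radialBarrier α r - radialBarrier α R)) (Ioi 0) 0 :=
          (hline 0 (by simp)).mono Ioi_subset_Ici_self
        refine hp.not_ge (le_of_tendsto hcz ?_)
        filter_upwards [self_mem_nhdsWithin, mem_nhdsWithin_of_mem_nhds (gt_mem_nhds hR)] with r h1 h2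
        have h3 := hinit r h1 σ₀
        have h4 := radialBarrier_le (α := α) h1 (le_of_lt h2)
        have : δ * (radialBarrier α r - radialBarrier α R) ≤ 0 :=
          mul_nonpos_of_nonneg_of_nonpos hδ.le (by linarith)
        linarith
      have ht : 0 < s₀ := ht₀.trans_lt hs₀
      obtain ⟨r, hr1, hr2⟩ := exists_gt_of_flux_pos (α := α) (ζ := fun r => z r σ₀ s₀ +
          δ * (radialBarrier α r - radialBarrier α R)) hδ hR
        (hline.mono Icc_subset_Ici_self)
        (fun r h => (hr r h σ₀ s₀ ht).add
          (((hasDerivAt_radialBarrier α h).sub_const _).const_mul δ)) (by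
          have h2 : Tendsto (fun _ : ℝ => δ) (𝓝[>] (0 : ℝ)) (𝓝 δ) := tendsto_const_nhds
          have h3 := (hneu σ₀ s₀ ht).add h2
          rw [zero_add] at h3
          refine h3.congr' ?_
          filter_upwards [self_mem_nhdsWithin] with r hr
          rw [mul_add, mul_left_comm, ← Real.rpow_add hr]
          simp)
      exact hr2.not_ge (hmax (a := ((r, σ₀), s₀)) ⟨⟨⟨hr1.1.le, hr1.2⟩, by simpa using hσ₀⟩, hx.2⟩)
    · refine ⟨r₀, σ₀, s₀, h0, hx.1.1.2, hσ₀, hx.2, hp, fun r σ s h1 h2 h3 h4 => ?_⟩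
      exact hmax (a := ((r, σ), s)) ⟨⟨⟨h1.le, h2⟩, by simpa using h3⟩, h4⟩

/-- Consider `w - ε · barrier + δ · (radialBarrier α r - radialBarrier α R)`. A positive maximum
cannot lie far out, by growth, nor at `t = t₀`, nor at `r = 0`. At an interior maximum the
differential inequality contradicts the strictness of the barrier. Then `δ → 0` and `ε → 0`. The
bound `hstep` is the lifetime of the barrier. -/
theorem comparison_of_short_time {k : ℕ} {α : ℝ} (hα : 0 < α) {w wr wrr wt : ℝ → E k → ℝ → ℝ}
    {ws wss : Fin k → ℝ → E k → ℝ → ℝ} (hw : HasGrushinDerivs w wr wrr wt ws wss)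
    (hcont : ContinuousOn (fun x : (ℝ × E k) × ℝ => w x.1.1 x.1.2 x.2)
      ((Ici 0 ×ˢ univ) ×ˢ Ici 0))
    (heq : ∀ r : ℝ, 0 < r → ∀ σ t, 0 < t →
      wt r σ t ≤ wrr r σ t + (2 * α - 1) / r * wr r σ t + r ^ 2 / 4 * ∑ i, wss i r σ t)
    (hneu : ∀ σ t, 0 < t → Tendsto (fun r : ℝ => r ^ (2 * α - 1) * wr r σ t) (𝓝[>] 0) (𝓝 0))
    {A a t₀ t₁ : ℝ} (hA : 0 ≤ A) (ha : 0 ≤ a) (ht₀ : 0 ≤ t₀)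
    (hgrow : ∀ r : ℝ, 0 < r → ∀ σ, ∀ t ∈ Icc t₀ t₁,
      w r σ t ≤ A * Real.exp (a * (r ^ 2 + ‖σ‖)))
    (hstep : (17 * ((k + 1) * (a + 1)) + 8 * α + 1) * (t₁ - t₀) ≤ 1)
    (hinit : ∀ r : ℝ, 0 < r → ∀ σ, w r σ t₀ ≤ 0) :
    ∀ r : ℝ, 0 < r → ∀ σ, ∀ t ∈ Icc t₀ t₁, w r σ t ≤ 0 := by
  intro r₁ hr₁ σ₁ s₁ hs₁
  -- The exponent `a + 1` leaves a spare factor `exp (r² + ‖σ‖)` over the growth bound; the factor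
  -- `k + 1` is the one of `exp_norm_le_coshSum`.
  set b : ℝ := (k + 1) * (a + 1) with hb
  have hba : a + 1 ≤ b := by
    have : 0 ≤ (k : ℝ) := Nat.cast_nonneg k
    rw [hb]; nlinarith
  have hbp : 0 < b := by linarith
  set c : ℝ := 17 * b + 8 * α + 1 with hc
  have hcp : 0 < c := by positivity
  have hcs : ∀ s ∈ Icc t₀ t₁, c * (s - t₀) ≤ 1 := fun s hs =>
    (mul_le_mul_of_nonneg_left (by linarith [hs.2]) hcp.le).trans hstep
  have hlow : ∀ r (σ : E k), ∀ s ∈ Icc t₀ t₁,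
      Real.exp ((a + 1) * (r ^ 2 + ‖σ‖)) ≤ 2 * barrier b c t₀ r σ s := by
    intro r σ s hs
    have h1 := exp_norm_le_coshSum (by linarith : 0 ≤ a + 1) σ
    have h2 : Real.exp ((a + 1) * r ^ 2) ≤ Real.exp (b * (1 + c * (s - t₀)) * (1 + r ^ 2)) := by
      refine Real.exp_le_exp.2 ?_
      have h3 : 0 ≤ c * (s - t₀) := mul_nonneg hcp.le (by linarith [hs.1])
      have h4 : a + 1 ≤ b * (1 + c * (s - t₀)) := by nlinarith
      have h5 : 0 ≤ r ^ 2 := sq_nonneg r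
      nlinarith
    rw [mul_add, Real.exp_add]
    unfold barrier
    calc _ ≤ Real.exp (b * (1 + c * (s - t₀)) * (1 + r ^ 2)) * (2 * coshSum b σ) :=
          mul_le_mul h2 h1 (Real.exp_pos _).le (Real.exp_pos _).le
      _ = _ := by ring
  suffices H : ∀ ε : ℝ, 0 < ε → w r₁ σ₁ s₁ ≤ ε * barrier b c t₀ r₁ σ₁ s₁ by
    have hB := barrier_pos b c t₀ r₁ σ₁ s₁
    refine le_of_forall_pos_le_add fun ε hε => ?_
    have := H (ε / barrier b c t₀ r₁ σ₁ s₁) (by positivity)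
    rw [div_mul_cancel₀ _ hB.ne'] at this
    linarith
  intro ε hε
  -- The `1` gives `r ≤ r²` for `r ≥ R`, the term `2A/ε` lets the spare exponential beat the growth
  -- constant, and the last two terms put the given point inside.
  set R : ℝ := 1 + 2 * A / ε + r₁ + ‖σ₁‖ with hR
  have hR0 : 0 ≤ 2 * A / ε := by positivity
  have hσ₁ : 0 ≤ ‖σ₁‖ := norm_nonneg _
  have hR1 : 1 ≤ R := by rw [hR]; linarith
  have hout : ∀ r : ℝ, 0 < r → ∀ σ, ∀ s ∈ Icc t₀ t₁, (R ≤ r ∨ R ≤ ‖σ‖) →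
      w r σ s ≤ ε * barrier b c t₀ r σ s := by
    intro r hr σ s hs hor
    have h1 : R ≤ r ^ 2 + ‖σ‖ := by
      rcases hor with h | h
      · nlinarith [norm_nonneg σ]
      · nlinarith [sq_nonneg r]
    have h2 := hlow r σ s hs
    have h3 := hgrow r hr σ s hs
    have h4 : 2 * A ≤ ε * Real.exp (r ^ 2 + ‖σ‖) := by
      have h5 : 2 * A / ε ≤ R := by rw [hR]; linarith
      have h6 : r ^ 2 + ‖σ‖ + 1 ≤ Real.exp (r ^ 2 + ‖σ‖) := Real.add_one_le_exp _
      have h7 : 2 * A / ε ≤ Real.exp (r ^ 2 + ‖σ‖) := by linarith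
      rw [div_le_iff₀ hε] at h7; linarith
    have h8 : Real.exp ((a + 1) * (r ^ 2 + ‖σ‖)) =
        Real.exp (a * (r ^ 2 + ‖σ‖)) * Real.exp (r ^ 2 + ‖σ‖) := by
      rw [← Real.exp_add]; congr 1; ring
    have h9 := Real.exp_pos (a * (r ^ 2 + ‖σ‖))
    have h10 := mul_le_mul_of_nonneg_left h4 h9.le
    have h11 := mul_le_mul_of_nonneg_left h2 hε.le
    rw [h8] at h11
    nlinarith
  suffices H : ∀ δ : ℝ, 0 < δ → w r₁ σ₁ s₁ + -ε * barrier b c t₀ r₁ σ₁ s₁ +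
      δ * (radialBarrier α r₁ - radialBarrier α R) ≤ 0 by
    have hl : Tendsto (fun δ : ℝ => w r₁ σ₁ s₁ + -ε * barrier b c t₀ r₁ σ₁ s₁ +
      δ * (radialBarrier α r₁ - radialBarrier α R)) (𝓝[>] 0)
      (𝓝 (w r₁ σ₁ s₁ + -ε * barrier b c t₀ r₁ σ₁ s₁ +
        0 * (radialBarrier α r₁ - radialBarrier α R))) :=
      (Continuous.tendsto (by fun_prop) 0).mono_left nhdsWithin_le_nhds
    have := le_of_tendsto hl (by filter_upwards [self_mem_nhdsWithin] with δ hδ using H δ hδ)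
    linarith
  intro δ hδ
  by_contra! hpos
  have hz := hw.add ((hasGrushinDerivs_barrier b c t₀).const_mul (-ε))
  have hZ := hz.add ((hasGrushinDerivs_radialBarrier (k := k) α (radialBarrier α R)).const_mul δ)
  obtain ⟨r₀, σ₀, s₀, hr₀, hr₀R, hσ₀R, hs₀, hp, hmax⟩ := exists_max_of_pos (α := α)
    (z := fun r σ t => w r σ t + -ε * barrier b c t₀ r σ t) hδ ht₀
    (hcont.add (continuous_const.mul (continuous_barrier b c t₀)).continuousOn) hz.r
    (by
      intro σ t ht
      have h1 : Tendsto (fun r : ℝ => r ^ (2 * α) * (-ε * (2 * (b * (1 + c * (t - t₀))) *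
          barrier b c t₀ r σ t))) (𝓝[>] 0) (𝓝 (0 ^ (2 * α) *
          (-ε * (2 * (b * (1 + c * (t - t₀))) * barrier b c t₀ 0 σ t)))) := by
        refine ((Continuous.tendsto ?_ 0)).mono_left nhdsWithin_le_nhds
        refine (Real.continuous_rpow_const (by positivity)).mul ?_
        have := (continuous_barrier (k := k) b c t₀).comp
          (f := fun r : ℝ => (((r, σ), t) : (ℝ × E k) × ℝ)) (by fun_prop)
        exact continuous_const.mul (continuous_const.mul this)
      rw [Real.zero_rpow (by positivity), zero_mul] at h1
      have h2 := (hneu σ t ht).add h1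
      rw [add_zero] at h2
      refine h2.congr' ?_
      filter_upwards [self_mem_nhdsWithin] with r hr
      have : r ^ (2 * α) = r ^ (2 * α - 1) * r := by
        rw [← Real.rpow_add_one (ne_of_gt hr)]; congr 1; ring
      rw [this]; ring)
    (by
      intro r hr σ
      have := hinit r hr σ
      have := mul_pos hε (barrier_pos b c t₀ r σ t₀)
      linarith)
    hr₁ (by rw [hR]; linarith) (by rw [hR]; linarith) hs₁ hpos
  have hcl : δ * (radialBarrier α r₀ - radialBarrier α R) ≤ 0 :=
    mul_nonpos_of_nonneg_of_nonpos hδ.le (by linarith [radialBarrier_le (α := α) hr₀ hr₀R])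
  have hnot : ¬ (R ≤ r₀ ∨ R ≤ ‖σ₀‖) := fun h => by
    have := hout r₀ hr₀ σ₀ s₀ hs₀ h
    linarith
  rw [not_or, not_le, not_le] at hnot
  have hts : t₀ < s₀ := by
    refine lt_of_le_of_ne hs₀.1 fun h => ?_
    subst h
    have := hinit r₀ hr₀ σ₀
    have := mul_pos hε (barrier_pos b c t₀ r₀ σ₀ t₀)
    linarith
  have hfin := hZ.op_le_time_deriv_at_max α hr₀ (ht₀.trans_lt hts)
    (by
      filter_upwards [lt_mem_nhds hr₀, gt_mem_nhds hnot.1] with r h1 h2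
      exact hmax r σ₀ s₀ h1 h2.le hσ₀R hs₀)
    (by
      intro i
      have hcl : Continuous fun τ : ℝ => ‖σ₀ + τ • EuclideanSpace.single i (1 : ℝ)‖ := by fun_prop
      have : ∀ᶠ τ : ℝ in 𝓝 0, ‖σ₀ + τ • EuclideanSpace.single i (1 : ℝ)‖ < R :=
        (hcl.tendsto 0).eventually (gt_mem_nhds (by simpa using hnot.2))
      filter_upwards [this] with τ h
      simpa using hmax r₀ _ s₀ hr₀ hr₀R h.le hs₀)
    (by
      filter_upwards [self_mem_nhdsWithin, mem_nhdsWithin_of_mem_nhds (lt_mem_nhds hts)] with τ h1 h2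
      exact hmax r₀ σ₀ τ hr₀ hr₀R hσ₀R ⟨le_of_lt h2, (le_of_lt h1).trans hs₀.2⟩)
  have h1 := heq r₀ hr₀ σ₀ s₀ (ht₀.trans_lt hts)
  have h2 := barrier_strict_super hα hbp hr₀ hts.le (hcs s₀ hs₀) σ₀
  rw [← hc] at h2
  have h3 := mul_lt_mul_of_pos_left h2 hε
  simp only [Finset.sum_add_distrib, ← Finset.mul_sum, mul_zero, add_zero] at hfin h3
  -- The radial part of the operator annihilates the radial barrier, so `δ` drops out of the
  -- inequality at the maximum.
  have h4 : (2 * α - 1) / r₀ * (δ * r₀ ^ (1 - 2 * α)) =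
    - (δ * ((1 - 2 * α) / r₀ * r₀ ^ (1 - 2 * α))) := by field_simp; ring
  linarith

/-- The admissible step `1/C` depends only on `α`, `k` and the growth exponent, not on the starting
time, so finitely many short steps reach `t`. -/
theorem comparison {k : ℕ} {α : ℝ} (hα : 0 < α) {w wr wrr wt : ℝ → E k → ℝ → ℝ}
    {ws wss : Fin k → ℝ → E k → ℝ → ℝ} (hw : HasGrushinDerivs w wr wrr wt ws wss)
    (hcont : ContinuousOn (fun x : (ℝ × E k) × ℝ => w x.1.1 x.1.2 x.2)
      ((Ici 0 ×ˢ univ) ×ˢ Ici 0))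
    (heq : ∀ r : ℝ, 0 < r → ∀ σ t, 0 < t →
      wt r σ t ≤ wrr r σ t + (2 * α - 1) / r * wr r σ t + r ^ 2 / 4 * ∑ i, wss i r σ t)
    (hneu : ∀ σ t, 0 < t → Tendsto (fun r : ℝ => r ^ (2 * α - 1) * wr r σ t) (𝓝[>] 0) (𝓝 0))
    (hgrow : ∀ T : ℝ, 0 < T → ∃ A a : ℝ, ∀ r : ℝ, 0 < r → ∀ σ, ∀ t ∈ Icc 0 T,
      w r σ t ≤ A * Real.exp (a * (r ^ 2 + ‖σ‖)))
    (hinit : ∀ r : ℝ, 0 < r → ∀ σ, w r σ 0 ≤ 0) {r : ℝ} (hr : 0 < r) (σ : E k) {t : ℝ}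
    (ht : 0 ≤ t) : w r σ t ≤ 0 := by
  -- The growth hypothesis needs a positive horizon, and `t` may be `0`.
  obtain ⟨A', a', hg'⟩ := hgrow (t + 1) (by linarith)
  set A := max A' 0
  set a := max a' 0
  have hg : ∀ r : ℝ, 0 < r → ∀ σ, ∀ s ∈ Icc 0 (t + 1),
      w r σ s ≤ A * Real.exp (a * (r ^ 2 + ‖σ‖)) := by
    intro r hr σ s hs
    refine (hg' r hr σ s hs).trans ?_
    have h1 : Real.exp (a' * (r ^ 2 + ‖σ‖)) ≤ Real.exp (a * (r ^ 2 + ‖σ‖)) :=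
      Real.exp_le_exp.2 (mul_le_mul_of_nonneg_right (le_max_left _ _) (by positivity))
    exact mul_le_mul (le_max_left _ _) h1 (Real.exp_pos _).le (le_max_right _ _)
  set C : ℝ := 17 * ((k + 1) * (a + 1)) + 8 * α + 1 with hC
  have ha : 0 ≤ a := le_max_right _ _
  have hCp : 0 < C := by positivity
  have key : ∀ n : ℕ, ∀ r : ℝ, 0 < r → ∀ σ, ∀ s ∈ Icc 0 (min (n / C) t), w r σ s ≤ 0 := by
    intro n
    induction n with
    | zero =>
      intro r hr σ s hs
      have : s = 0 := le_antisymm (hs.2.trans ((min_le_left _ _).trans (by simp))) hs.1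
      rw [this]; exact hinit r hr σ
    | succ n ih =>
      intro r hr σ s hs
      rcases le_or_gt s (min (n / C) t) with h | h
      · exact ih r hr σ s ⟨hs.1, h⟩
      · have h0 : 0 ≤ min (n / C) t := le_min (by positivity) ht
        refine comparison_of_short_time (t₀ := min (n / C) t) (t₁ := min ((n + 1 : ℕ) / C) t) hα hw hcont heq hneu (le_max_right A' 0) ha h0
          (fun r hr σ s hs => hg r hr σ s ⟨h0.trans hs.1, hs.2.trans ((min_le_right _ _).trans
            (by linarith))⟩) ?_ (fun r hr σ => ih r hr σ _ ⟨h0, le_rfl⟩) r hr σ s ⟨h.le, hs.2⟩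
        have : min (((n + 1 : ℕ) : ℝ) / C) t - min (n / C) t ≤ 1 / C := by
          have h3 : ((n + 1 : ℕ) : ℝ) / C = n / C + 1 / C := by push_cast; ring
          have h4 : 0 < 1 / C := by positivity
          rw [h3]
          rcases le_total (n / C) t with h5 | h5
          · rw [min_eq_left h5]; linarith [min_le_left (n / C + 1 / C) t]
          · rw [min_eq_right h5]; linarith [min_le_right (n / C + 1 / C) t]
        calc C * _ ≤ C * (1 / C) := mul_le_mul_of_nonneg_left this hCp.le
          _ = 1 := by field_simp
  obtain ⟨n, hn⟩ := exists_nat_ge (t * C)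
  refine key n r hr σ t ⟨ht, le_min ?_ le_rfl⟩
  rwa [le_div_iff₀ hCp]

end BaouendiGrushin

namespace BaouendiGrushin

open Filter Topology

/-! ### Evolution of Gaussians under the radial operator with quadratic potential -/

/-- `sinh (2wt) / w`, with its limit value at `w = 0`. -/
noncomputable def mehlerT (w t : ℝ) : ℝ := if w = 0 then 2 * t else Real.sinh (2 * w * t) / w

/-- With `mehlerN` this solves the linear system `D' = 4N`, `N' = w² D`, `D(0) = 1`, `N(0) = a`,
which linearizes the Riccati equation for `N / D`. -/
noncomputable def mehlerD (a : ℂ) (w t : ℝ) : ℂ := Real.cosh (2 * w * t) + 2 * a * mehlerT w t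

noncomputable def mehlerN (a : ℂ) (w t : ℝ) : ℂ :=
  (w * Real.sinh (2 * w * t) / 2 : ℝ) + a * Real.cosh (2 * w * t)

/-- The exponent at time `t` of the Gaussian `exp (-a x)`, `x = r²`; it solves the Riccati equation
`A' = w² - 4A²`. -/
noncomputable def mehlerA (a : ℂ) (w t : ℝ) : ℂ := mehlerN a w t / mehlerD a w t

/-- The solution with initial value `exp (-a x)`, `x = r²`, of the heat equation for
`∂_rr + (2α-1)/r ∂_r - w² r²`. -/
noncomputable def gaussEvol (α : ℝ) (a : ℂ) (w x t : ℝ) : ℂ :=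
  mehlerD a w t ^ (-(α : ℂ)) * Complex.exp (-mehlerA a w t * x)

theorem mehlerT_nonneg (w : ℝ) {t : ℝ} (ht : 0 ≤ t) : 0 ≤ mehlerT w t := by
  unfold mehlerT
  split_ifs with h
  · positivity
  · rcases lt_or_gt_of_ne h with h | h
    · exact div_nonneg_of_nonpos (by rw [Real.sinh_nonpos_iff]; nlinarith) h.le
    · exact div_nonneg (by rw [Real.sinh_nonneg_iff]; positivity) h.le

theorem mehlerT_mul (w t : ℝ) : mehlerT w t * w = Real.sinh (2 * w * t) := by
  unfold mehlerT
  split_ifs with h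
  · simp [h]
  · field_simp

theorem hasDerivAt_mehlerT (w t : ℝ) :
    HasDerivAt (mehlerT w) (2 * Real.cosh (2 * w * t)) t := by
  by_cases h : w = 0
  · have e : mehlerT w = fun t => 2 * t := by ext; simp [mehlerT, h]
    rw [e, h]; simpa using (hasDerivAt_id t).const_mul 2
  · have e : mehlerT w = fun t => Real.sinh (2 * w * t) / w := by ext; simp [mehlerT, h]
    rw [e]
    have h0 : HasDerivAt (fun t : ℝ => 2 * w * t) (2 * w) t := by
      simpa using (hasDerivAt_id t).const_mul (2 * w)
    refine (h0.sinh.div_const w).congr_deriv ?_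
    field_simp

theorem mehlerD_re (a : ℂ) (w t : ℝ) :
    (mehlerD a w t).re = Real.cosh (2 * w * t) + 2 * a.re * mehlerT w t := by
  simp only [mehlerD, Complex.add_re, Complex.ofReal_re, Complex.re_mul_ofReal]
  simp

theorem mehlerD_im (a : ℂ) (w t : ℝ) : (mehlerD a w t).im = 2 * a.im * mehlerT w t := by
  simp only [mehlerD, Complex.add_im, Complex.ofReal_im, Complex.im_mul_ofReal]
  simp

theorem cosh_le_mehlerD_re {a : ℂ} (ha : 0 ≤ a.re) (w : ℝ) {t : ℝ} (ht : 0 ≤ t) :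
    Real.cosh (2 * w * t) ≤ (mehlerD a w t).re := by
  rw [mehlerD_re]
  have := mul_nonneg ha (mehlerT_nonneg w ht)
  linarith

theorem one_le_mehlerD_re {a : ℂ} (ha : 0 ≤ a.re) (w : ℝ) {t : ℝ} (ht : 0 ≤ t) :
    1 ≤ (mehlerD a w t).re := (Real.one_le_cosh _).trans (cosh_le_mehlerD_re ha w ht)

theorem mehlerD_mem_slitPlane {a : ℂ} (ha : 0 ≤ a.re) (w : ℝ) {t : ℝ} (ht : 0 ≤ t) :
    mehlerD a w t ∈ Complex.slitPlane :=
  Or.inl (one_pos.trans_le (one_le_mehlerD_re ha w ht))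

theorem mehlerD_ne_zero {a : ℂ} (ha : 0 ≤ a.re) (w : ℝ) {t : ℝ} (ht : 0 ≤ t) :
    mehlerD a w t ≠ 0 := Complex.slitPlane_ne_zero (mehlerD_mem_slitPlane ha w ht)

theorem cosh_le_norm_mehlerD {a : ℂ} (ha : 0 ≤ a.re) (w : ℝ) {t : ℝ} (ht : 0 ≤ t) :
    Real.cosh (2 * w * t) ≤ ‖mehlerD a w t‖ :=
  (cosh_le_mehlerD_re ha w ht).trans (Complex.re_le_norm _)

/-- Growth at most linear in the frequency, uniformly in time: this is why second moments of the
amplitude suffice for all derivatives in the equation. -/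
theorem norm_mehlerA_le {a : ℂ} (ha : 0 ≤ a.re) {w : ℝ} (hw : 0 ≤ w) {t : ℝ} (ht : 0 ≤ t) :
    ‖mehlerA a w t‖ ≤ w + ‖a‖ := by
  unfold mehlerA
  have hD := cosh_le_norm_mehlerD ha w ht
  have hc : 0 < Real.cosh (2 * w * t) := Real.cosh_pos _
  rw [norm_div, div_le_iff₀ (hc.trans_le hD)]
  have hs : 0 ≤ Real.sinh (2 * w * t) := by rw [Real.sinh_nonneg_iff]; positivity
  have hsc : Real.sinh (2 * w * t) ≤ Real.cosh (2 * w * t) := (Real.sinh_lt_cosh _).le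
  have h1 : ‖mehlerN a w t‖ ≤ w * Real.sinh (2 * w * t) / 2 + ‖a‖ * Real.cosh (2 * w * t) := by
    unfold mehlerN
    refine (norm_add_le _ _).trans ?_
    rw [norm_mul, Complex.norm_real, Complex.norm_real, Real.norm_of_nonneg hc.le,
      Real.norm_of_nonneg (by positivity)]
  have h2 := mul_le_mul_of_nonneg_left hsc hw
  have h3 := mul_le_mul_of_nonneg_left hD (by positivity : 0 ≤ w + ‖a‖)
  have := mul_nonneg hw hc.le
  nlinarith

/-- The sign is that of the real part of `N` times the conjugate of `D`. The imaginary parts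
contribute `2 (Im a)² cosh · T ≥ 0`, and the real parts are both nonnegative. -/
theorem mehlerA_re_nonneg {a : ℂ} (ha : 0 ≤ a.re) {w : ℝ} (hw : 0 ≤ w) {t : ℝ} (ht : 0 ≤ t) :
    0 ≤ (mehlerA a w t).re := by
  unfold mehlerA
  rw [Complex.div_re, ← add_div]
  refine div_nonneg ?_ (Complex.normSq_nonneg _)
  rw [mehlerD_re, mehlerD_im]
  have e1 : (mehlerN a w t).re = w * Real.sinh (2 * w * t) / 2 + a.re * Real.cosh (2 * w * t) := by
    simp only [mehlerN, Complex.add_re, Complex.ofReal_re, Complex.re_mul_ofReal]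
  have e2 : (mehlerN a w t).im = a.im * Real.cosh (2 * w * t) := by
    simp only [mehlerN, Complex.add_im, Complex.ofReal_im, Complex.im_mul_ofReal, zero_add]
  rw [e1, e2]
  have hs : 0 ≤ Real.sinh (2 * w * t) := by rw [Real.sinh_nonneg_iff]; positivity
  have hc : 0 < Real.cosh (2 * w * t) := Real.cosh_pos _
  have hT := mehlerT_nonneg w ht
  have e3 : a.im * Real.cosh (2 * w * t) * (2 * a.im * mehlerT w t) =
    2 * (a.im ^ 2 * (Real.cosh (2 * w * t) * mehlerT w t)) := by ring
  rw [e3]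
  positivity

theorem norm_gaussEvol_le {α : ℝ} (hα : 0 < α) {a : ℂ} (ha : 0 ≤ a.re) {w : ℝ} (hw : 0 ≤ w)
    {x t : ℝ} (hx : 0 ≤ x) (ht : 0 ≤ t) : ‖gaussEvol α a w x t‖ ≤ 1 := by
  unfold gaussEvol
  rw [norm_mul]
  refine mul_le_one₀ ?_ (norm_nonneg _) ?_
  · rw [← Complex.ofReal_neg, Complex.norm_cpow_real]
    exact Real.rpow_le_one_of_one_le_of_nonpos
      ((Real.one_le_cosh _).trans (cosh_le_norm_mehlerD ha w ht)) (by linarith)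
  · rw [Complex.norm_exp, Complex.re_mul_ofReal, Complex.neg_re]
    refine Real.exp_le_one_iff.2 ?_
    have := mul_nonneg (mehlerA_re_nonneg ha hw ht) hx
    linarith

theorem hasDerivAt_mehlerD (a : ℂ) (w t : ℝ) :
    HasDerivAt (mehlerD a w) (4 * mehlerN a w t) t := by
  unfold mehlerD
  have h0 : HasDerivAt (fun t : ℝ => 2 * w * t) (2 * w) t := by
    simpa using (hasDerivAt_id t).const_mul (2 * w)
  refine (h0.cosh.ofReal_comp.add ((hasDerivAt_mehlerT w t).ofReal_comp.const_mul
    (2 * a))).congr_deriv ?_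
  simp only [mehlerN]; push_cast; ring

theorem hasDerivAt_mehlerN (a : ℂ) (w t : ℝ) :
    HasDerivAt (mehlerN a w) (w ^ 2 * mehlerD a w t) t := by
  unfold mehlerN
  have h0 : HasDerivAt (fun t : ℝ => 2 * w * t) (2 * w) t := by
    simpa using (hasDerivAt_id t).const_mul (2 * w)
  refine (((h0.sinh.const_mul w).div_const 2).ofReal_comp.add (h0.cosh.ofReal_comp.const_mul
    a)).congr_deriv ?_
  rw [mehlerD, ← mehlerT_mul]; push_cast; ring

theorem hasDerivAt_mehlerA {a : ℂ} (ha : 0 ≤ a.re) (w : ℝ) {t : ℝ} (ht : 0 ≤ t) :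
    HasDerivAt (mehlerA a w) (w ^ 2 - 4 * mehlerA a w t ^ 2) t := by
  have hD := mehlerD_ne_zero ha w ht
  refine ((hasDerivAt_mehlerN a w t).div (hasDerivAt_mehlerD a w t) hD).congr_deriv ?_
  unfold mehlerA
  field_simp

/-- From `D'/D = 4A` and the Riccati equation. With `x = r²` the factor is exactly what `∂_rr +
(2α-1)/r ∂_r - w² r²` produces on `exp (-A r²)`. -/
theorem hasDerivAt_gaussEvol (α : ℝ) {a : ℂ} (ha : 0 ≤ a.re) (w x : ℝ) {t : ℝ} (ht : 0 ≤ t) :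
    HasDerivAt (gaussEvol α a w x)
      ((-4 * α * mehlerA a w t - (w ^ 2 - 4 * mehlerA a w t ^ 2) * x) * gaussEvol α a w x t) t := by
  have hD := mehlerD_ne_zero ha w ht
  have h1 : HasDerivAt (fun t => mehlerD a w t ^ (-(α : ℂ)))
      (-(α : ℂ) * mehlerD a w t ^ (-(α : ℂ) - 1) * (4 * mehlerN a w t)) t :=
    ((hasDerivAt_id (mehlerD a w t)).cpow_const (mehlerD_mem_slitPlane ha w ht)).comp_of_eq t
      (hasDerivAt_mehlerD a w t) rfl |>.congr_deriv (by simp)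
  have h2 := (((hasDerivAt_mehlerA ha w ht).neg.mul_const (x : ℂ))).cexp
  refine (h1.mul h2).congr_deriv ?_
  have e : mehlerD a w t ^ (-(α : ℂ) - 1) = mehlerD a w t ^ (-(α : ℂ)) / mehlerD a w t := by
    rw [Complex.cpow_sub _ _ hD, Complex.cpow_one]
  rw [e]
  simp only [gaussEvol, Pi.neg_apply]
  have e2 : mehlerN a w t = mehlerA a w t * mehlerD a w t := by
    unfold mehlerA; field_simp
  rw [e2]
  field_simp
  ring

/-- The derivative in the parameter of the initial Gaussian. -/
theorem hasDerivAt_gaussEvol_param (α : ℝ) {a : ℂ} (ha : 0 ≤ a.re) (w x : ℝ) {t : ℝ}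
    (ht : 0 ≤ t) :
    HasDerivAt (fun a => gaussEvol α a w x t)
      ((-2 * α * mehlerT w t / mehlerD a w t - x / mehlerD a w t ^ 2) * gaussEvol α a w x t) a := by
  have hD := mehlerD_ne_zero ha w ht
  have d1 : HasDerivAt (fun a => mehlerD a w t) (2 * mehlerT w t) a := by
    unfold mehlerD
    simpa using (((hasDerivAt_id a).const_mul 2).mul_const (mehlerT w t : ℂ)).const_add
      (Real.cosh (2 * w * t) : ℂ)
  have d2 : HasDerivAt (fun a => mehlerN a w t) (Real.cosh (2 * w * t)) a := by
    unfold mehlerN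
    simpa using ((hasDerivAt_id a).mul_const (Real.cosh (2 * w * t) : ℂ)).const_add
      ((w * Real.sinh (2 * w * t) / 2 : ℝ) : ℂ)
  -- The determinant of the Möbius map `a ↦ N / D` is `cosh² - sinh² = 1`, so its derivative is `1 /
  -- D²`.
  have hwr : (Real.cosh (2 * w * t) : ℂ) * mehlerD a w t - mehlerN a w t * (2 * mehlerT w t) = 1 := by
    have h := Real.cosh_sq (2 * w * t)
    have h' : (Real.cosh (2 * w * t) : ℂ) ^ 2 = (Real.sinh (2 * w * t) : ℂ) ^ 2 + 1 := by
      exact_mod_cast h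
    have h2 : (mehlerT w t : ℂ) * w = Real.sinh (2 * w * t) := by exact_mod_cast mehlerT_mul w t
    unfold mehlerD mehlerN
    push_cast at h2 h' ⊢
    linear_combination h' - Complex.sinh (2 * w * t) * h2
  have d3 : HasDerivAt (fun a => mehlerA a w t) (1 / mehlerD a w t ^ 2) a := by
    refine (d2.div d1 hD).congr_deriv ?_
    rw [hwr]
  have h1 := d1.cpow_const (c := -(α : ℂ)) (mehlerD_mem_slitPlane ha w ht)
  have h2 := (d3.neg.mul_const (x : ℂ)).cexp
  refine (h1.mul h2).congr_deriv ?_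
  have e : mehlerD a w t ^ (-(α : ℂ) - 1) = mehlerD a w t ^ (-(α : ℂ)) / mehlerD a w t := by
    rw [Complex.cpow_sub _ _ hD, Complex.cpow_one]
  rw [e]
  simp only [gaussEvol, Pi.neg_apply, neg_mul]
  field_simp
  ring

/-- The time derivative is the evolution of `((4a² - w²) x - 4αa) exp (-a x)`. -/
theorem gaussEvol_time_eq_param (α : ℝ) {a : ℂ} (ha : 0 ≤ a.re) (w x : ℝ) {t : ℝ} (ht : 0 ≤ t) :
    -4 * α * mehlerA a w t - (w ^ 2 - 4 * mehlerA a w t ^ 2) * x =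
      -(4 * a ^ 2 - w ^ 2) * (-2 * α * mehlerT w t / mehlerD a w t - x / mehlerD a w t ^ 2)
        - 4 * α * a := by
  have hD := mehlerD_ne_zero ha w ht
  have h := Real.cosh_sq (2 * w * t)
  have h' : (Real.cosh (2 * w * t) : ℂ) ^ 2 = (Real.sinh (2 * w * t) : ℂ) ^ 2 + 1 := by
    exact_mod_cast h
  have h2 : (mehlerT w t : ℂ) * w = Real.sinh (2 * w * t) := by exact_mod_cast mehlerT_mul w t
  have k1 : mehlerA a w t * mehlerD a w t = mehlerN a w t := by unfold mehlerA; field_simp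
  have hNdef : mehlerN a w t = w * Real.sinh (2 * w * t) / 2 + a * Real.cosh (2 * w * t) := by
    unfold mehlerN; push_cast; ring
  have hDdef : mehlerD a w t = Real.cosh (2 * w * t) + 2 * a * mehlerT w t := rfl
  have i1 : (4 * a ^ 2 - w ^ 2) * (2 * mehlerT w t) - 4 * a * mehlerD a w t +
      4 * mehlerN a w t = 0 := by
    rw [hNdef, hDdef]
    linear_combination (-2 * (w : ℂ)) * h2
  -- A quantity conserved by the linear system for `N` and `D`.
  have i2 : 4 * mehlerN a w t ^ 2 - w ^ 2 * mehlerD a w t ^ 2 = 4 * a ^ 2 - w ^ 2 := by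
    rw [hNdef, hDdef, ← h2]
    rw [← h2] at h'
    linear_combination (4 * a ^ 2 - (w : ℂ) ^ 2) * h'
  have hA : mehlerA a w t = mehlerN a w t / mehlerD a w t := rfl
  rw [hA]
  field_simp
  linear_combination (-(α : ℂ) * mehlerD a w t) * i1 + (x : ℂ) * i2

theorem gaussEvol_zero (α : ℝ) (a : ℂ) (w x : ℝ) :
    gaussEvol α a w x 0 = Complex.exp (-a * x) := by
  have h1 : mehlerD a w 0 = 1 := by
    simp [mehlerD, mehlerT]
  have h2 : mehlerA a w 0 = a := by simp [mehlerA, h1, mehlerN]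
  simp [gaussEvol, h1, h2]

theorem continuousOn_mehlerA {a : ℂ} (ha : 0 ≤ a.re) (w : ℝ) :
    ContinuousOn (mehlerA a w) (Ici 0) := fun _ ht =>
  (hasDerivAt_mehlerA ha w ht).continuousAt.continuousWithinAt

theorem continuousOn_gaussEvol (α : ℝ) {a : ℂ} (ha : 0 ≤ a.re) (w : ℝ) :
    ContinuousOn (fun p : ℝ × ℝ => gaussEvol α a w p.1 p.2) (univ ×ˢ Ici 0) := by
  unfold gaussEvol
  have hs : MapsTo (Prod.snd : ℝ × ℝ → ℝ) (univ ×ˢ Ici 0) (Ici 0) := fun p hp => hp.2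
  have h1 : ContinuousOn (fun p : ℝ × ℝ => mehlerA a w p.2) (univ ×ˢ Ici 0) :=
    (continuousOn_mehlerA ha w).comp continuous_snd.continuousOn hs
  have h2 : ContinuousOn (fun p : ℝ × ℝ => mehlerD a w p.2) (univ ×ˢ Ici 0) :=
    (Continuous.continuousOn (s := Ici 0) (continuous_iff_continuousAt.2 fun _ =>
      (hasDerivAt_mehlerD a w _).continuousAt)).comp continuous_snd.continuousOn hs
  refine ContinuousOn.mul (fun p hp => ?_) ?_
  · exact (continuousAt_cpow_const (mehlerD_mem_slitPlane ha w hp.2)).comp_continuousWithinAt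
      (f := fun p : ℝ × ℝ => mehlerD a w p.2) (h2 p hp)
  · exact Complex.continuous_exp.comp_continuousOn (h1.neg.mul
      (Complex.continuous_ofReal.comp continuous_fst).continuousOn)

theorem measurable_mehlerT (t : ℝ) : Measurable fun w => mehlerT w t := by
  unfold mehlerT
  exact Measurable.ite (measurableSet_singleton 0) (by fun_prop) (by fun_prop)

theorem measurable_mehlerD (t : ℝ) : Measurable fun p : ℂ × ℝ => mehlerD p.1 p.2 t := by
  have h2 : Measurable fun p : ℂ × ℝ => mehlerT p.2 t :=
    (measurable_mehlerT t).comp measurable_snd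
  unfold mehlerD
  fun_prop

theorem measurable_mehlerA (t : ℝ) : Measurable fun p : ℂ × ℝ => mehlerA p.1 p.2 t := by
  have h1 := measurable_mehlerD t
  unfold mehlerA mehlerN
  fun_prop

theorem measurable_gaussEvol (α x t : ℝ) :
    Measurable fun p : ℂ × ℝ => gaussEvol α p.1 p.2 x t := by
  have h1 := measurable_mehlerD t
  have h2 := measurable_mehlerA t
  unfold gaussEvol
  fun_prop

end BaouendiGrushin

namespace BaouendiGrushin

open Filter Topology

/-! ### Superpositions of explicit solutions -/

/-- The solution with initial value `exp (-a r²) exp (i ⟨ξ, σ⟩)`. -/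
noncomputable def mode {k : ℕ} (α : ℝ) (a : ℂ) (ξ : E k) (r : ℝ) (σ : E k) (t : ℝ) : ℂ :=
  Complex.exp (Complex.I * (inner ℝ ξ σ : ℝ)) * gaussEvol α a (‖ξ‖ / 2) (r ^ 2) t

theorem norm_mode_le {k : ℕ} {α : ℝ} (hα : 0 < α) {a : ℂ} (ha : 0 ≤ a.re) (ξ : E k) (r : ℝ)
    (σ : E k) {t : ℝ} (ht : 0 ≤ t) : ‖mode α a ξ r σ t‖ ≤ 1 := by
  unfold mode
  rw [norm_mul, mul_comm Complex.I, Complex.norm_exp_ofReal_mul_I, one_mul]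
  exact norm_gaussEvol_le hα ha (by positivity) (by positivity) ht

theorem mode_zero {k : ℕ} (α : ℝ) (a : ℂ) (ξ : E k) (r : ℝ) (σ : E k) :
    mode α a ξ r σ 0 = Complex.exp (Complex.I * (inner ℝ ξ σ : ℝ)) *
      Complex.exp (-a * (r ^ 2 : ℝ)) := by
  rw [mode, gaussEvol_zero]

theorem hasDerivAt_mode_r {k : ℕ} (α : ℝ) (a : ℂ) (ξ : E k) (r : ℝ) (σ : E k) (t : ℝ) :
    HasDerivAt (fun r => mode α a ξ r σ t)
      (-2 * r * mehlerA a (‖ξ‖ / 2) t * mode α a ξ r σ t) r := by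
  unfold mode gaussEvol
  have h1 : HasDerivAt (fun r : ℝ => ((r ^ 2 : ℝ) : ℂ)) ((2 * r : ℝ) : ℂ) r := by
    simpa using (hasDerivAt_pow 2 r).ofReal_comp
  refine (((h1.const_mul (-mehlerA a (‖ξ‖ / 2) t)).cexp.const_mul _).const_mul _).congr_deriv ?_
  push_cast; ring

theorem hasDerivAt_mode_s {k : ℕ} (α : ℝ) (a : ℂ) (ξ : E k) (r : ℝ) (σ y : E k) (t : ℝ) (τ : ℝ) :
    HasDerivAt (fun τ : ℝ => mode α a ξ r (σ + τ • y) t)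
      (Complex.I * (inner ℝ ξ y : ℝ) * mode α a ξ r (σ + τ • y) t) τ := by
  unfold mode
  have h0 : HasDerivAt (fun τ : ℝ => inner ℝ ξ (σ + τ • y)) (inner ℝ ξ y) τ := by
    simp only [inner_add_right, inner_smul_right]
    simpa using ((hasDerivAt_id τ).mul_const (inner ℝ ξ y)).const_add (inner ℝ ξ σ)
  refine ((h0.ofReal_comp.const_mul Complex.I).cexp.mul_const _).congr_deriv ?_
  ring

theorem hasDerivAt_mode_t {k : ℕ} (α : ℝ) {a : ℂ} (ha : 0 ≤ a.re) (ξ : E k) (r : ℝ) (σ : E k)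
    {t : ℝ} (ht : 0 ≤ t) :
    HasDerivAt (fun t => mode α a ξ r σ t)
      ((-4 * α * mehlerA a (‖ξ‖ / 2) t -
        ((‖ξ‖ / 2 : ℝ) ^ 2 - 4 * mehlerA a (‖ξ‖ / 2) t ^ 2) * (r ^ 2 : ℝ)) * mode α a ξ r σ t) t := by
  unfold mode
  refine ((hasDerivAt_gaussEvol α ha (‖ξ‖ / 2) (r ^ 2) ht).const_mul _).congr_deriv ?_
  ring

variable {W : Type*} [MeasurableSpace W] {k : ℕ}

/-- Amplitudes `h` of frequencies `(a, ξ)` with finite second moment. -/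
structure IsAmplitude (ν : Measure W) (h a : W → ℂ) (ξ : W → E k) : Prop where
  meas : AEStronglyMeasurable h ν
  meas_a : Measurable a
  meas_ξ : Measurable ξ
  re_nonneg : ∀ w, 0 ≤ (a w).re
  moment : Integrable (fun w => (1 + ‖a w‖ + ‖ξ w‖) ^ 2 * ‖h w‖) ν

/-- Multipliers of at most quadratic growth in the frequency. -/
structure IsMultiplier (a : W → ℂ) (ξ : W → E k) (q : W → ℝ → ℝ → ℂ) : Prop where
  meas : ∀ r t, Measurable fun w => q w r t
  cont : ∀ w, ContinuousOn (fun p : ℝ × ℝ => q w p.1 p.2) (univ ×ˢ Ici 0)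
  bound : ∀ R : ℝ, 0 ≤ R → ∃ C : ℝ, ∀ w r t, |r| ≤ R → 0 ≤ t →
    ‖q w r t‖ ≤ C * (1 + ‖a w‖ + ‖ξ w‖) ^ 2

/-- The superposition of the modes with amplitude `h` and multiplier `q`. -/
noncomputable def superpose (ν : Measure W) (α : ℝ) (h a : W → ℂ) (ξ : W → E k)
    (q : W → ℝ → ℝ → ℂ) (r : ℝ) (σ : E k) (t : ℝ) : ℂ :=
  ∫ w, h w * (q w r t * mode α (a w) (ξ w) r σ t) ∂ν

section superpose

variable {ν : Measure W} {α : ℝ} {h a : W → ℂ} {ξ : W → E k}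

theorem IsAmplitude.measurable_mode (ha : IsAmplitude ν h a ξ) (α r : ℝ) (σ : E k) (t : ℝ) :
    Measurable fun w => mode α (a w) (ξ w) r σ t := by
  have h1 := ha.meas_a
  have h2 := ha.meas_ξ
  have h3 : Measurable fun w => gaussEvol α (a w) (‖ξ w‖ / 2) (r ^ 2) t :=
    Measurable.comp (g := fun p : ℂ × ℝ => gaussEvol α p.1 p.2 (r ^ 2) t)
      (f := fun w => (a w, ‖ξ w‖ / 2)) (measurable_gaussEvol α (r ^ 2) t)
      (h1.prodMk (h2.norm.div_const 2))
  have h4 : Measurable fun w => (inner ℝ (ξ w) σ : ℝ) := h2.inner measurable_const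
  have h5 : Measurable fun w => Complex.exp (Complex.I * (inner ℝ (ξ w) σ : ℝ)) := by fun_prop
  exact h5.mul h3

theorem IsAmplitude.aestronglyMeasurable {q : W → ℝ → ℝ → ℂ} (ha : IsAmplitude ν h a ξ)
    (hq : IsMultiplier a ξ q) (α r : ℝ) (σ : E k) (t : ℝ) :
    AEStronglyMeasurable (fun w => h w * (q w r t * mode α (a w) (ξ w) r σ t)) ν :=
  ha.meas.mul ((hq.meas r t).mul (ha.measurable_mode α r σ t)).aestronglyMeasurable

/-- Modes have modulus at most one, so a multiplier of quadratic growth is paid for by the second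
moment. This is the dominating function behind the continuity and differentiation of superpositions.
-/
theorem IsAmplitude.norm_le {q : W → ℝ → ℝ → ℂ} (ha : IsAmplitude ν h a ξ)
    (hα : 0 < α) {C r t : ℝ} (ht : 0 ≤ t) (σ : E k) {w : W}
    (hC : ‖q w r t‖ ≤ C * (1 + ‖a w‖ + ‖ξ w‖) ^ 2) :
    ‖h w * (q w r t * mode α (a w) (ξ w) r σ t)‖ ≤ C * ((1 + ‖a w‖ + ‖ξ w‖) ^ 2 * ‖h w‖) := by
  rw [norm_mul, norm_mul]
  calc ‖h w‖ * (‖q w r t‖ * ‖mode α (a w) (ξ w) r σ t‖)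
      ≤ ‖h w‖ * (C * (1 + ‖a w‖ + ‖ξ w‖) ^ 2 * 1) := by
        refine mul_le_mul_of_nonneg_left ?_ (norm_nonneg _)
        exact mul_le_mul hC (norm_mode_le hα (ha.re_nonneg w) _ _ _ ht) (norm_nonneg _)
          ((norm_nonneg _).trans hC)
    _ = _ := by ring

theorem IsAmplitude.integrable {q : W → ℝ → ℝ → ℂ} (ha : IsAmplitude ν h a ξ)
    (hα : 0 < α) (hq : IsMultiplier a ξ q) (r : ℝ) (σ : E k) {t : ℝ} (ht : 0 ≤ t) :
    Integrable (fun w => h w * (q w r t * mode α (a w) (ξ w) r σ t)) ν := by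
  obtain ⟨C, hC⟩ := hq.bound |r| (abs_nonneg r)
  exact (ha.moment.const_mul C).mono' (ha.aestronglyMeasurable hq α r σ t)
    (Eventually.of_forall fun w => ha.norm_le hα ht σ (hC w r t le_rfl ht))

theorem IsAmplitude.continuousOn_superpose {q : W → ℝ → ℝ → ℂ} (ha : IsAmplitude ν h a ξ)
    (hα : 0 < α) (hq : IsMultiplier a ξ q) :
    ContinuousOn (fun x : (ℝ × E k) × ℝ => superpose ν α h a ξ q x.1.1 x.1.2 x.2)
      (univ ×ˢ Ici 0) := by
  intro x hx
  obtain ⟨C, hC⟩ := hq.bound (|x.1.1| + 1) (by positivity)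
  have hnear : ∀ᶠ y : (ℝ × E k) × ℝ in 𝓝[univ ×ˢ Ici 0] x, |y.1.1| ≤ |x.1.1| + 1 := by
    refine mem_nhdsWithin_of_mem_nhds ?_
    have : ContinuousAt (fun y : (ℝ × E k) × ℝ => |y.1.1|) x := by fun_prop
    filter_upwards [this.eventually (gt_mem_nhds (lt_add_one _))] with y hy using hy.le
  refine continuousWithinAt_of_dominated
    (bound := fun w => C * ((1 + ‖a w‖ + ‖ξ w‖) ^ 2 * ‖h w‖))
    (Eventually.of_forall fun y => ha.aestronglyMeasurable hq α _ _ _) ?_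
    (ha.moment.const_mul C) (Eventually.of_forall fun w => ?_)
  · filter_upwards [hnear, self_mem_nhdsWithin] with y hy hy2
    exact Eventually.of_forall fun w => ha.norm_le hα hy2.2 _ (hC w _ _ hy hy2.2)
  · have hmaps : MapsTo (fun y : (ℝ × E k) × ℝ => (y.1.1, y.2)) (univ ×ˢ Ici 0)
        (univ ×ˢ Ici 0) := fun y hy => ⟨mem_univ _, hy.2⟩
    have hmaps2 : MapsTo (fun y : (ℝ × E k) × ℝ => (y.1.1 ^ 2, y.2)) (univ ×ˢ Ici 0)
        (univ ×ˢ Ici 0) := fun y hy => ⟨mem_univ _, hy.2⟩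
    have c1 := (hq.cont w).comp (f := fun y : (ℝ × E k) × ℝ => (y.1.1, y.2))
      (by fun_prop) hmaps
    have c2 := (continuousOn_gaussEvol α (ha.re_nonneg w) (‖ξ w‖ / 2)).comp
      (f := fun y : (ℝ × E k) × ℝ => (y.1.1 ^ 2, y.2)) (by fun_prop) hmaps2
    have c3 : Continuous fun y : (ℝ × E k) × ℝ =>
        Complex.exp (Complex.I * (inner ℝ (ξ w) y.1.2 : ℝ)) := by fun_prop
    exact (continuousOn_const.mul (c1.mul (c3.continuousOn.mul c2))) x hx

theorem IsAmplitude.hasDerivAt_superpose_r {q q' : W → ℝ → ℝ → ℂ} (ha : IsAmplitude ν h a ξ)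
    (hα : 0 < α) (hq : IsMultiplier a ξ q) (hq' : IsMultiplier a ξ q') (σ : E k) {t : ℝ}
    (ht : 0 ≤ t) (hd : ∀ w r, HasDerivAt (fun r => q w r t * mode α (a w) (ξ w) r σ t)
      (q' w r t * mode α (a w) (ξ w) r σ t) r) (r : ℝ) :
    HasDerivAt (fun r => superpose ν α h a ξ q r σ t) (superpose ν α h a ξ q' r σ t) r := by
  obtain ⟨C, hC⟩ := hq'.bound (|r| + 1) (by positivity)
  refine (hasDerivAt_integral_of_dominated_loc_of_deriv_le (μ := ν)
    (F := fun (y : ℝ) w => h w * (q w y t * mode α (a w) (ξ w) y σ t))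
    (F' := fun (y : ℝ) w => h w * (q' w y t * mode α (a w) (ξ w) y σ t))
    (bound := fun w => C * ((1 + ‖a w‖ + ‖ξ w‖) ^ 2 * ‖h w‖)) (Metric.ball_mem_nhds r one_pos)
    (Eventually.of_forall fun y => ha.aestronglyMeasurable hq α _ _ _)
    (ha.integrable hα hq r σ ht) (ha.aestronglyMeasurable hq' α _ _ _)
    (Eventually.of_forall fun w y hy => ?_) (ha.moment.const_mul C)
    (Eventually.of_forall fun w y _ => (hd w y).const_mul (h w))).2
  refine ha.norm_le hα ht _ (hC w _ _ ?_ ht)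
  rw [Metric.mem_ball, Real.dist_eq] at hy
  have := abs_sub_abs_le_abs_sub y r
  linarith

theorem IsAmplitude.hasDerivAt_superpose_t {q q' : W → ℝ → ℝ → ℂ} (ha : IsAmplitude ν h a ξ)
    (hα : 0 < α) (hq : IsMultiplier a ξ q) (hq' : IsMultiplier a ξ q') (r : ℝ) (σ : E k) {t : ℝ}
    (ht : 0 < t) (hd : ∀ w, ∀ t : ℝ, 0 < t → HasDerivAt (fun t => q w r t *
      mode α (a w) (ξ w) r σ t) (q' w r t * mode α (a w) (ξ w) r σ t) t) :
    HasDerivAt (fun t => superpose ν α h a ξ q r σ t) (superpose ν α h a ξ q' r σ t) t := by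
  obtain ⟨C, hC⟩ := hq'.bound |r| (by positivity)
  exact (hasDerivAt_integral_of_dominated_loc_of_deriv_le (μ := ν)
    (F := fun (y : ℝ) w => h w * (q w r y * mode α (a w) (ξ w) r σ y))
    (F' := fun (y : ℝ) w => h w * (q' w r y * mode α (a w) (ξ w) r σ y))
    (bound := fun w => C * ((1 + ‖a w‖ + ‖ξ w‖) ^ 2 * ‖h w‖)) (Ioi_mem_nhds ht)
    (Eventually.of_forall fun y => ha.aestronglyMeasurable hq α _ _ _)
    (ha.integrable hα hq r σ ht.le) (ha.aestronglyMeasurable hq' α _ _ _)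
    (Eventually.of_forall fun w y hy => ha.norm_le hα (le_of_lt hy) _
      (hC w _ _ le_rfl (le_of_lt hy))) (ha.moment.const_mul C)
    (Eventually.of_forall fun w y hy => (hd w y hy).const_mul (h w))).2

theorem IsAmplitude.hasDerivAt_superpose_s {q q' : W → ℝ → ℝ → ℂ} (ha : IsAmplitude ν h a ξ)
    (hα : 0 < α) (hq : IsMultiplier a ξ q) (hq' : IsMultiplier a ξ q') (r : ℝ) (σ y : E k) {t : ℝ}
    (ht : 0 ≤ t) (hd : ∀ w, q' w r t = q w r t * (Complex.I * (inner ℝ (ξ w) y : ℝ))) :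
    HasDerivAt (fun τ : ℝ => superpose ν α h a ξ q r (σ + τ • y) t)
      (superpose ν α h a ξ q' r σ t) 0 := by
  obtain ⟨C, hC⟩ := hq'.bound |r| (by positivity)
  have := (hasDerivAt_integral_of_dominated_loc_of_deriv_le (μ := ν)
    (F := fun (τ : ℝ) w => h w * (q w r t * mode α (a w) (ξ w) r (σ + τ • y) t))
    (F' := fun (τ : ℝ) w => h w * (q' w r t * mode α (a w) (ξ w) r (σ + τ • y) t))
    (bound := fun w => C * ((1 + ‖a w‖ + ‖ξ w‖) ^ 2 * ‖h w‖))
    (Filter.univ_mem (f := 𝓝 (0 : ℝ)))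
    (Eventually.of_forall fun τ => ha.aestronglyMeasurable hq α _ _ _)
    (ha.integrable hα hq r _ ht) (ha.aestronglyMeasurable hq' α _ _ _)
    (Eventually.of_forall fun w τ _ => ha.norm_le hα ht _
      (hC w _ _ le_rfl ht)) (ha.moment.const_mul C)
    (Eventually.of_forall fun w τ _ => ?_)).2
  · simpa [superpose] using this
  · refine (((hasDerivAt_mode_s α (a w) (ξ w) r σ y t τ).const_mul (q w r t)).const_mul
      (h w)).congr_deriv ?_
    rw [hd]; ring

variable (a ξ)

/-- The multiplier of `∂_r`. -/
noncomputable def multR (w : W) (r t : ℝ) : ℂ := -2 * r * mehlerA (a w) (‖ξ w‖ / 2) t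

/-- The multiplier of `∂_rr`. -/
noncomputable def multRR (w : W) (r t : ℝ) : ℂ :=
  4 * mehlerA (a w) (‖ξ w‖ / 2) t ^ 2 * r ^ 2 - 2 * mehlerA (a w) (‖ξ w‖ / 2) t

/-- The multiplier of `∂_t`. -/
noncomputable def multT (α : ℝ) (w : W) (r t : ℝ) : ℂ :=
  -4 * α * mehlerA (a w) (‖ξ w‖ / 2) t -
    ((‖ξ w‖ / 2 : ℝ) ^ 2 - 4 * mehlerA (a w) (‖ξ w‖ / 2) t ^ 2) * (r ^ 2 : ℝ)

variable {a ξ}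

theorem IsAmplitude.isMultiplier_one (_ : IsAmplitude ν h a ξ) :
    IsMultiplier a ξ fun _ _ _ => 1 := by
  refine ⟨fun r t => measurable_const, fun w => continuousOn_const, fun R hR => ⟨1, ?_⟩⟩
  intro w r t _ _
  have : 1 ≤ 1 + ‖a w‖ + ‖ξ w‖ := by linarith [norm_nonneg (a w), norm_nonneg (ξ w)]
  simp only [norm_one, one_mul]
  exact one_le_pow₀ this

theorem IsAmplitude.isMultiplier_s (ha : IsAmplitude ν h a ξ) (y : E k) (n : ℕ) (hn : n ≤ 2) :
    IsMultiplier a ξ fun w _ _ => (Complex.I * (inner ℝ (ξ w) y : ℝ)) ^ n := by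
  have := ha.meas_ξ
  refine ⟨fun r t => by fun_prop, fun w => continuousOn_const, fun R hR => ⟨‖y‖ ^ n, ?_⟩⟩
  intro w r t _ _
  have h1 : 1 ≤ 1 + ‖a w‖ + ‖ξ w‖ := by linarith [norm_nonneg (a w), norm_nonneg (ξ w)]
  rw [norm_pow, norm_mul, Complex.norm_I, one_mul, Complex.norm_real]
  calc ‖inner ℝ (ξ w) y‖ ^ n ≤ (‖y‖ * (1 + ‖a w‖ + ‖ξ w‖)) ^ n := by
        refine pow_le_pow_left₀ (norm_nonneg _) ((norm_inner_le_norm _ _).trans ?_) n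
        rw [mul_comm]
        refine mul_le_mul_of_nonneg_left ?_ (norm_nonneg _)
        linarith [norm_nonneg (a w)]
    _ = ‖y‖ ^ n * (1 + ‖a w‖ + ‖ξ w‖) ^ n := mul_pow _ _ _
    _ ≤ _ := mul_le_mul_of_nonneg_left (pow_le_pow_right₀ h1 hn) (by positivity)

theorem IsAmplitude.measurable_mehlerA (ha : IsAmplitude ν h a ξ) (t : ℝ) :
    Measurable fun w => mehlerA (a w) (‖ξ w‖ / 2) t :=
  (BaouendiGrushin.measurable_mehlerA t).comp
    (f := fun w => (a w, ‖ξ w‖ / 2)) (ha.meas_a.prodMk (ha.meas_ξ.norm.div_const 2))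

theorem IsAmplitude.continuousOn_mehlerA (ha : IsAmplitude ν h a ξ) (w : W) :
    ContinuousOn (fun p : ℝ × ℝ => mehlerA (a w) (‖ξ w‖ / 2) p.2) (univ ×ˢ Ici 0) :=
  (BaouendiGrushin.continuousOn_mehlerA (ha.re_nonneg w) (‖ξ w‖ / 2)).comp
    continuous_snd.continuousOn (fun _ hp => hp.2)

theorem IsAmplitude.norm_mehlerA_le (ha : IsAmplitude ν h a ξ) (w : W) {t : ℝ} (ht : 0 ≤ t) :
    ‖mehlerA (a w) (‖ξ w‖ / 2) t‖ ≤ 1 + ‖a w‖ + ‖ξ w‖ := by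
  have := BaouendiGrushin.norm_mehlerA_le (ha.re_nonneg w) (by positivity : 0 ≤ ‖ξ w‖ / 2) ht
  linarith [norm_nonneg (ξ w)]

theorem IsAmplitude.isMultiplier_r (ha : IsAmplitude ν h a ξ) : IsMultiplier a ξ (multR a ξ) := by
  have m := ha.measurable_mehlerA
  unfold multR
  refine ⟨fun r t => (m t).const_mul _, fun w => ?_, fun R hR => ⟨2 * R, ?_⟩⟩
  · exact ContinuousOn.mul (by fun_prop) (ha.continuousOn_mehlerA w)
  · intro w r t hr ht
    have h1 : 1 ≤ 1 + ‖a w‖ + ‖ξ w‖ := by linarith [norm_nonneg (a w), norm_nonneg (ξ w)]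
    rw [norm_mul, norm_mul, Complex.norm_real, Real.norm_eq_abs]
    have h2 := ha.norm_mehlerA_le w ht
    have h3 : ‖mehlerA (a w) (‖ξ w‖ / 2) t‖ ≤ (1 + ‖a w‖ + ‖ξ w‖) ^ 2 := by nlinarith
    have : ‖(-2 : ℂ)‖ = 2 := by simp
    rw [this]
    exact mul_le_mul (by linarith) h3 (norm_nonneg _) (by positivity)

theorem IsAmplitude.isMultiplier_rr (ha : IsAmplitude ν h a ξ) :
    IsMultiplier a ξ (multRR a ξ) := by
  have m := ha.measurable_mehlerA
  unfold multRR
  refine ⟨fun r t => (((m t).pow_const 2).const_mul 4 |>.mul_const _).sub ((m t).const_mul _),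
    fun w => ?_, fun R hR => ⟨4 * R ^ 2 + 2, ?_⟩⟩
  · have := ha.continuousOn_mehlerA w
    exact ((continuousOn_const.mul (this.pow 2)).mul (by fun_prop)).sub
      (continuousOn_const.mul this)
  · intro w r t hr ht
    have h1 : 1 ≤ 1 + ‖a w‖ + ‖ξ w‖ := by linarith [norm_nonneg (a w), norm_nonneg (ξ w)]
    have h2 := ha.norm_mehlerA_le w ht
    refine (norm_sub_le _ _).trans ?_
    rw [norm_mul, norm_mul, norm_mul, norm_pow, norm_pow, Complex.norm_real, Real.norm_eq_abs]
    simp only [Complex.norm_ofNat]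
    have h3 : ‖mehlerA (a w) (‖ξ w‖ / 2) t‖ ≤ (1 + ‖a w‖ + ‖ξ w‖) ^ 2 := by nlinarith
    have h4 := pow_le_pow_left₀ (norm_nonneg _) h2 2
    have h5 := pow_le_pow_left₀ (abs_nonneg _) hr 2
    have h6 := mul_le_mul h4 h5 (by positivity) (by positivity)
    nlinarith

theorem IsAmplitude.isMultiplier_t (ha : IsAmplitude ν h a ξ) (α : ℝ) :
    IsMultiplier a ξ (multT a ξ α) := by
  have m := ha.measurable_mehlerA
  have mξ := ha.meas_ξ
  unfold multT
  refine ⟨fun r t => ?_, fun w => ?_, fun R hR => ⟨4 * |α| + 5 * R ^ 2, ?_⟩⟩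
  · have := m t
    fun_prop
  · have := ha.continuousOn_mehlerA w
    exact (continuousOn_const.mul this).sub ((continuousOn_const.sub
      (continuousOn_const.mul (this.pow 2))).mul (by fun_prop))
  · intro w r t hr ht
    have h1 : 1 ≤ 1 + ‖a w‖ + ‖ξ w‖ := by linarith [norm_nonneg (a w), norm_nonneg (ξ w)]
    have h2 := ha.norm_mehlerA_le w ht
    have h3 : ‖mehlerA (a w) (‖ξ w‖ / 2) t‖ ≤ (1 + ‖a w‖ + ‖ξ w‖) ^ 2 := by nlinarith
    have h4 := pow_le_pow_left₀ (norm_nonneg _) h2 2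
    have h5 := pow_le_pow_left₀ (abs_nonneg _) hr 2
    refine (norm_sub_le _ _).trans ?_
    have b1 : ‖-4 * (α : ℂ) * mehlerA (a w) (‖ξ w‖ / 2) t‖ ≤
        4 * |α| * (1 + ‖a w‖ + ‖ξ w‖) ^ 2 := by
      rw [norm_mul, norm_mul, Complex.norm_real, Real.norm_eq_abs, norm_neg, Complex.norm_ofNat]
      exact mul_le_mul_of_nonneg_left h3 (by positivity)
    have b2 : ‖((‖ξ w‖ / 2 : ℝ) : ℂ) ^ 2 - 4 * mehlerA (a w) (‖ξ w‖ / 2) t ^ 2‖ ≤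
        5 * (1 + ‖a w‖ + ‖ξ w‖) ^ 2 := by
      refine (norm_sub_le _ _).trans ?_
      rw [norm_mul, norm_pow, norm_pow, Complex.norm_real, Complex.norm_ofNat, Real.norm_eq_abs,
        sq_abs]
      have : (‖ξ w‖ / 2) ^ 2 ≤ (1 + ‖a w‖ + ‖ξ w‖) ^ 2 :=
        pow_le_pow_left₀ (by positivity) (by linarith [norm_nonneg (a w), norm_nonneg (ξ w)]) 2
      linarith
    have b3 : ‖((r ^ 2 : ℝ) : ℂ)‖ ≤ R ^ 2 := by
      rw [Complex.norm_real, norm_pow, Real.norm_eq_abs]; exact h5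
    rw [norm_mul (_ - _)]
    have := mul_le_mul b2 b3 (norm_nonneg _) (by positivity)
    nlinarith

theorem IsAmplitude.superpose_r (ha : IsAmplitude ν h a ξ) (hα : 0 < α) (r : ℝ) (σ : E k) {t : ℝ}
    (ht : 0 ≤ t) :
    HasDerivAt (fun r => superpose ν α h a ξ (fun _ _ _ => 1) r σ t)
      (superpose ν α h a ξ (multR a ξ) r σ t) r := by
  refine ha.hasDerivAt_superpose_r hα ha.isMultiplier_one ha.isMultiplier_r σ ht (fun w r => ?_) r
  simpa [multR] using hasDerivAt_mode_r α (a w) (ξ w) r σ t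

theorem IsAmplitude.superpose_rr (ha : IsAmplitude ν h a ξ) (hα : 0 < α) (r : ℝ) (σ : E k) {t : ℝ}
    (ht : 0 ≤ t) :
    HasDerivAt (fun r => superpose ν α h a ξ (multR a ξ) r σ t)
      (superpose ν α h a ξ (multRR a ξ) r σ t) r := by
  refine ha.hasDerivAt_superpose_r hα ha.isMultiplier_r ha.isMultiplier_rr σ ht (fun w r => ?_) r
  have h0 : HasDerivAt (fun r : ℝ => multR a ξ w r t) (-2 * mehlerA (a w) (‖ξ w‖ / 2) t) r := by
    unfold multR
    simpa using ((hasDerivAt_id r).ofReal_comp.const_mul (-2 : ℂ)).mul_const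
      (mehlerA (a w) (‖ξ w‖ / 2) t)
  refine (h0.mul (hasDerivAt_mode_r α (a w) (ξ w) r σ t)).congr_deriv ?_
  unfold multR multRR
  ring

theorem IsAmplitude.superpose_t (ha : IsAmplitude ν h a ξ) (hα : 0 < α) (r : ℝ) (σ : E k) {t : ℝ}
    (ht : 0 < t) :
    HasDerivAt (fun t => superpose ν α h a ξ (fun _ _ _ => 1) r σ t)
      (superpose ν α h a ξ (multT a ξ α) r σ t) t := by
  refine ha.hasDerivAt_superpose_t hα ha.isMultiplier_one (ha.isMultiplier_t α) r σ ht
    (fun w t ht => ?_)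
  simpa [multT] using hasDerivAt_mode_t α (ha.re_nonneg w) (ξ w) r σ ht.le

theorem IsAmplitude.superpose_s (ha : IsAmplitude ν h a ξ) (hα : 0 < α) (n : ℕ) (hn : n + 1 ≤ 2)
    (r : ℝ) (σ y : E k) {t : ℝ} (ht : 0 ≤ t) :
    HasDerivAt (fun τ : ℝ => superpose ν α h a ξ
        (fun w _ _ => (Complex.I * (inner ℝ (ξ w) y : ℝ)) ^ n) r (σ + τ • y) t)
      (superpose ν α h a ξ (fun w _ _ => (Complex.I * (inner ℝ (ξ w) y : ℝ)) ^ (n + 1)) r σ t) 0 :=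
  ha.hasDerivAt_superpose_s hα (ha.isMultiplier_s y n (by omega)) (ha.isMultiplier_s y (n + 1) hn)
    r σ y ht fun w => pow_succ _ _

/-- The multipliers satisfy the identity for each frequency separately: `∑ (i ξ_j)² = -‖ξ‖²`, and
`(r²/4) ‖ξ‖²` is the potential `w² r²` with `w = ‖ξ‖/2`. -/
theorem IsAmplitude.superpose_equation (ha : IsAmplitude ν h a ξ) (hα : 0 < α) {r : ℝ}
    (hr : 0 < r) (σ : E k) {t : ℝ} (ht : 0 ≤ t) :
    superpose ν α h a ξ (multT a ξ α) r σ t =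
      superpose ν α h a ξ (multRR a ξ) r σ t +
        ((2 * α - 1) / r : ℝ) * superpose ν α h a ξ (multR a ξ) r σ t +
        (r ^ 2 / 4 : ℝ) * ∑ i : Fin k, superpose ν α h a ξ (fun w _ _ => (Complex.I *
          (inner ℝ (ξ w) (EuclideanSpace.single i (1 : ℝ)) : ℝ)) ^ 2) r σ t := by
  have i1 := ha.integrable hα ha.isMultiplier_rr r σ ht
  have i2 := ha.integrable hα ha.isMultiplier_r r σ ht
  have i3 := fun i : Fin k =>
    ha.integrable hα (ha.isMultiplier_s (EuclideanSpace.single i (1 : ℝ)) 2 le_rfl) r σ ht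
  have i12 : Integrable (fun w => h w * (multRR a ξ w r t * mode α (a w) (ξ w) r σ t) +
      (((2 * α - 1) / r : ℝ) : ℂ) * (h w * (multR a ξ w r t * mode α (a w) (ξ w) r σ t))) ν :=
    i1.add (i2.const_mul _)
  unfold superpose
  rw [← integral_finsetSum _ fun i _ => i3 i, ← integral_const_mul, ← integral_const_mul,
    ← integral_add i1 (i2.const_mul _), ← integral_add i12
      ((integrable_finsetSum _ fun i _ => i3 i).const_mul _)]
  refine integral_congr_ae (Eventually.of_forall fun w => ?_)
  simp only
  have hs : ∑ i : Fin k, h w * ((Complex.I * (inner ℝ (ξ w) (EuclideanSpace.single i (1 : ℝ)) : ℝ))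
      ^ 2 * mode α (a w) (ξ w) r σ t) = h w * (-(‖ξ w‖ : ℂ) ^ 2 * mode α (a w) (ξ w) r σ t) := by
    rw [← Finset.mul_sum, ← Finset.sum_mul]
    congr 2
    have : (‖ξ w‖ : ℂ) ^ 2 = ∑ i, ((ξ w i : ℝ) : ℂ) ^ 2 := by
      exact_mod_cast EuclideanSpace.real_norm_sq_eq (ξ w)
    rw [this, ← Finset.sum_neg_distrib]
    refine Finset.sum_congr rfl fun i _ => ?_
    rw [mul_pow, Complex.I_sq, EuclideanSpace.inner_single_right]
    simp
  rw [hs]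
  have hr' : (r : ℂ) ≠ 0 := by exact_mod_cast hr.ne'
  unfold multT multRR multR
  push_cast
  field_simp
  ring

end superpose

end BaouendiGrushin

namespace BaouendiGrushin

open Filter Topology

/-! ### The radial heat kernel -/

/-- `∑ z^(2n) / (n! Γ(n+α))`, so that `I_(α-1)(2z) = z^(α-1) besselH α z`. -/
noncomputable def besselH (α z : ℝ) : ℝ :=
  ∑' n : ℕ, z ^ (2 * n) / ((n.factorial : ℝ) * Real.Gamma (n + α))

theorem summable_besselH {α : ℝ} (hα : 0 < α) (z : ℝ) :
    Summable fun n : ℕ => z ^ (2 * n) / ((n.factorial : ℝ) * Real.Gamma (n + α)) := by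
  have hG : ∀ n : ℕ, 0 < Real.Gamma (n + α) := fun n => Real.Gamma_pos_of_pos (by positivity)
  by_cases hz : z = 0
  · refine summable_of_ne_finset_zero (s := {0}) fun n hn => ?_
    have : n ≠ 0 := by simpa using hn
    simp [hz, this]
  refine summable_of_ratio_test_tendsto_lt_one (l := 0) one_pos (Eventually.of_forall fun n => ?_) ?_
  · have := hG n
    positivity
  have e : ∀ n : ℕ, ‖z ^ (2 * (n + 1)) / (((n + 1).factorial : ℝ) * Real.Gamma ((n + 1 : ℕ) + α))‖ /
      ‖z ^ (2 * n) / ((n.factorial : ℝ) * Real.Gamma (n + α))‖ =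
      z ^ 2 * ((1 / ((n : ℝ) + 1)) * (1 / (n + α))) := by
    intro n
    have h1 := hG n
    have h2 : Real.Gamma ((n + 1 : ℕ) + α) = (n + α) * Real.Gamma (n + α) := by
      rw [← Real.Gamma_add_one (by positivity)]; congr 1; push_cast; ring
    have h3 : 0 < z ^ 2 := by positivity
    rw [h2, pow_mul, pow_mul, Real.norm_of_nonneg (by positivity), Real.norm_of_nonneg (by positivity),
      Nat.factorial_succ, pow_succ (z ^ 2) n]
    push_cast
    field_simp
  simp_rw [e]
  have h1 : Tendsto (fun n : ℕ => 1 / ((n : ℝ) + 1)) atTop (𝓝 0) :=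
    tendsto_one_div_add_atTop_nhds_zero_nat
  have h2 : Tendsto (fun n : ℕ => 1 / ((n : ℝ) + α)) atTop (𝓝 0) := by
    have := (tendsto_natCast_atTop_atTop (R := ℝ)).atTop_add (tendsto_const_nhds (x := α))
    simp only [one_div]
    exact this.inv_tendsto_atTop
  simpa using (h1.mul h2).const_mul (z ^ 2)

theorem besselH_term_nonneg {α : ℝ} (hα : 0 < α) (z : ℝ) (n : ℕ) :
    0 ≤ z ^ (2 * n) / ((n.factorial : ℝ) * Real.Gamma (n + α)) := by
  have : 0 < Real.Gamma (n + α) := Real.Gamma_pos_of_pos (by positivity)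
  rw [pow_mul]
  positivity

theorem besselH_nonneg {α : ℝ} (hα : 0 < α) (z : ℝ) : 0 ≤ besselH α z :=
  tsum_nonneg fun n => besselH_term_nonneg hα z n

theorem besselH_term_le {α : ℝ} (hα : 0 < α) {z z' : ℝ} (h : |z| ≤ |z'|) (n : ℕ) :
    z ^ (2 * n) / ((n.factorial : ℝ) * Real.Gamma (n + α)) ≤
      z' ^ (2 * n) / ((n.factorial : ℝ) * Real.Gamma (n + α)) := by
  have : 0 < Real.Gamma (n + α) := Real.Gamma_pos_of_pos (by positivity)
  rw [pow_mul, pow_mul]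
  have := sq_le_sq.2 h
  gcongr

theorem besselH_le {α : ℝ} (hα : 0 < α) {z z' : ℝ} (h : |z| ≤ |z'|) :
    besselH α z ≤ besselH α z' :=
  (summable_besselH hα z).tsum_le_tsum (besselH_term_le hα h) (summable_besselH hα z')

theorem continuous_besselH {α : ℝ} (hα : 0 < α) : Continuous (besselH α) := by
  rw [continuous_iff_continuousAt]
  intro z
  have : ContinuousOn (besselH α) (Metric.ball 0 (|z| + 1)) := by
    refine continuousOn_tsum (fun n => by fun_prop) (summable_besselH hα (|z| + 1)) ?_
    intro n y hy
    rw [Real.norm_of_nonneg (besselH_term_nonneg hα y n)]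
    refine besselH_term_le hα ?_ n
    rw [abs_of_nonneg (by positivity : 0 ≤ |z| + 1)]
    simpa using (le_of_lt (by simpa using hy : |y| < |z| + 1))
  exact this.continuousAt (Metric.isOpen_ball.mem_nhds (by simp))

theorem besselI_eq {α z : ℝ} (hz : 0 < z) :
    besselI (α - 1) z = (z / 2) ^ (α - 1) * besselH α (z / 2) := by
  unfold besselI besselH
  rw [← tsum_mul_left]
  congr 1
  ext n
  have : (z / 2) ^ (α - 1 + 2 * (n : ℝ)) = (z / 2) ^ (α - 1) * (z / 2) ^ (2 * n) := by
    rw [Real.rpow_add (by positivity), ← Real.rpow_natCast _ (2 * n)]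
    push_cast; rfl
  rw [this, show α - 1 + (n : ℝ) + 1 = n + α by ring]
  ring

theorem mehlerT_pos (w : ℝ) {t : ℝ} (ht : 0 < t) : 0 < mehlerT w t := by
  unfold mehlerT
  split_ifs with h
  · positivity
  · rcases lt_or_gt_of_ne h with h | h
    · exact div_pos_of_neg_of_neg (by rw [Real.sinh_neg_iff]; nlinarith) h
    · exact div_pos (by rw [Real.sinh_pos_iff]; positivity) h

theorem two_mul_le_mehlerT {w : ℝ} (hw : 0 ≤ w) {t : ℝ} (ht : 0 < t) : 2 * t ≤ mehlerT w t := by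
  unfold mehlerT
  split_ifs with h
  · exact le_rfl
  · have hw' : 0 < w := lt_of_le_of_ne hw (Ne.symm h)
    rw [le_div_iff₀ hw']
    have := Real.self_le_sinh_iff.2 (by positivity : 0 ≤ 2 * w * t)
    linarith

/-- From `sinh 2x = 2 sinh x cosh x`, `sinh x ≥ x` and `2 cosh x ≥ exp x`. This growth is the source
of the exponential decay of the kernel's symbol in the frequency. -/
theorem exp_le_mehlerT {w : ℝ} (hw : 0 ≤ w) {t : ℝ} (ht : 0 < t) :
    t * Real.exp (w * t) ≤ mehlerT w t := by
  unfold mehlerT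
  split_ifs with h
  · rw [h]; simp; linarith
  · have hw' : 0 < w := lt_of_le_of_ne hw (Ne.symm h)
    rw [le_div_iff₀ hw', show 2 * w * t = 2 * (w * t) by ring, Real.sinh_two_mul, Real.cosh_eq]
    have h1 := Real.self_le_sinh_iff.2 (by positivity : 0 ≤ w * t)
    have h2 := Real.exp_pos (w * t)
    have h3 := Real.exp_pos (-(w * t))
    have h4 := mul_le_mul_of_nonneg_right h1 h2.le
    have h5 : 0 < Real.sinh (w * t) := Real.sinh_pos_iff.2 (by positivity)
    have h6 := mul_pos h5 h3
    nlinarith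

/-- The function is the difference quotient at `0` of `w ↦ sinh (2wt)`, completed by the derivative;
continuity at `w = 0` is differentiability of `sinh`. -/
theorem continuous_mehlerT (t : ℝ) : Continuous fun w => mehlerT w t := by
  have hd : ∀ w, HasDerivAt (fun w : ℝ => Real.sinh (2 * w * t)) (Real.cosh (2 * w * t) * (2 * t)) w := by
    intro w
    have h0 : HasDerivAt (fun w : ℝ => 2 * w * t) (2 * t) w := by
      simpa using ((hasDerivAt_id w).const_mul 2).mul_const t
    exact h0.sinh
  have e : (fun w => mehlerT w t) = dslope (fun w : ℝ => Real.sinh (2 * w * t)) 0 := by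
    ext w
    unfold mehlerT
    by_cases h : w = 0
    · subst h
      rw [dslope_same, (hd 0).deriv]; simp
    · rw [dslope_of_ne _ h, slope_def_field]; simp [h]
  rw [e, continuous_iff_continuousAt]
  intro w
  by_cases h : w = 0
  · subst h
    exact continuousAt_dslope_same.2 (hd 0).differentiableAt
  · exact (continuousAt_dslope_of_ne h).2 (hd w).continuousAt

/-- The heat kernel, with respect to `ρ^(2α-1) dρ`, of `∂_rr + (2α-1)/r ∂_r - w² r²`. -/
noncomputable def radialSym (α w t r ρ : ℝ) : ℝ :=
  2 ^ (1 - α) * mehlerT w t ^ (-α) *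
    Real.exp (-(Real.cosh (2 * w * t) / (2 * mehlerT w t)) * (r ^ 2 + ρ ^ 2)) *
    besselH α (ρ * r / (2 * mehlerT w t))

theorem radialSym_nonneg {α : ℝ} (hα : 0 < α) (w : ℝ) {t : ℝ} (ht : 0 < t) (r ρ : ℝ) :
    0 ≤ radialSym α w t r ρ := by
  have h1 := mehlerT_pos w ht
  have h2 := besselH_nonneg hα (ρ * r / (2 * mehlerT w t))
  unfold radialSym
  positivity

theorem continuous_radialSym {α : ℝ} (hα : 0 < α) {t : ℝ} (ht : 0 < t) (r : ℝ) :
    Continuous fun p : ℝ × ℝ => radialSym α p.1 t r p.2 := by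
  have h0 : Continuous fun p : ℝ × ℝ => mehlerT p.1 t := (continuous_mehlerT t).comp continuous_fst
  have h1 : ∀ p : ℝ × ℝ, mehlerT p.1 t ≠ 0 := fun p => (mehlerT_pos p.1 ht).ne'
  have h2 : ∀ p : ℝ × ℝ, 2 * mehlerT p.1 t ≠ 0 := fun p => mul_ne_zero two_ne_zero (h1 p)
  unfold radialSym
  refine ((continuous_const.mul (h0.rpow_const fun p => Or.inl (h1 p))).mul
    (Real.continuous_exp.comp ?_)).mul ((continuous_besselH hα).comp ?_)
  · exact (((Real.continuous_cosh.comp (by fun_prop)).div (continuous_const.mul h0) h2).neg).mul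
      (by fun_prop)
  · exact Continuous.div (by fun_prop) (continuous_const.mul h0) h2

/-- The decay in `w` comes from the power of `mehlerT`. The Bessel factor is even and increasing in
the modulus of its argument, and `mehlerT w t ≥ 2t` bounds that argument independently of `w`. -/
theorem radialSym_le {α : ℝ} (hα : 0 < α) {w : ℝ} (hw : 0 ≤ w) {t : ℝ} (ht : 0 < t) (r ρ : ℝ) :
    radialSym α w t r ρ ≤
      2 ^ (1 - α) * t ^ (-α) * besselH α (ρ * r / (4 * t)) * Real.exp (-(α * t) * w) := by
  have hT := mehlerT_pos w ht
  have h1 : mehlerT w t ^ (-α) ≤ t ^ (-α) * Real.exp (-(α * t) * w) := by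
    have := Real.rpow_le_rpow_of_nonpos (by positivity) (exp_le_mehlerT hw ht)
      (by linarith : -α ≤ 0)
    refine this.trans (le_of_eq ?_)
    rw [Real.mul_rpow ht.le (Real.exp_pos _).le, ← Real.exp_mul]
    congr 2; ring
  have h2 : Real.exp (-(Real.cosh (2 * w * t) / (2 * mehlerT w t)) * (r ^ 2 + ρ ^ 2)) ≤ 1 := by
    rw [Real.exp_le_one_iff]
    have := Real.cosh_pos (2 * w * t)
    have : 0 ≤ Real.cosh (2 * w * t) / (2 * mehlerT w t) * (r ^ 2 + ρ ^ 2) := by positivity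
    linarith
  have h3 : besselH α (ρ * r / (2 * mehlerT w t)) ≤ besselH α (ρ * r / (4 * t)) := by
    refine besselH_le hα ?_
    rw [abs_div, abs_div, abs_of_pos (by positivity : 0 < 2 * mehlerT w t),
      abs_of_pos (by positivity : 0 < 4 * t)]
    exact div_le_div_of_nonneg_left (abs_nonneg _) (by positivity)
      (by linarith [two_mul_le_mehlerT hw ht])
  unfold radialSym
  have h4 := besselH_nonneg hα (ρ * r / (2 * mehlerT w t))
  calc 2 ^ (1 - α) * mehlerT w t ^ (-α) *
      Real.exp (-(Real.cosh (2 * w * t) / (2 * mehlerT w t)) * (r ^ 2 + ρ ^ 2)) *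
      besselH α (ρ * r / (2 * mehlerT w t))
      ≤ 2 ^ (1 - α) * (t ^ (-α) * Real.exp (-(α * t) * w)) * 1 * besselH α (ρ * r / (4 * t)) := by
        gcongr
    _ = _ := by ring

theorem integral_rpow_mul_gaussian {s c : ℝ} (hs : 0 < s) (hc : 0 < c) :
    ∫ ρ in Ioi (0 : ℝ), ρ ^ (2 * s - 1) * Real.exp (-c * ρ ^ 2) =
      c ^ (-s) * (1 / 2) * Real.Gamma s := by
  have := integral_rpow_mul_exp_neg_mul_rpow (p := 2) (q := 2 * s - 1) (b := c) two_pos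
    (by linarith) hc
  simp only [Real.rpow_two] at this
  rw [this]
  congr 3 <;> ring

theorem integrableOn_rpow_mul_gaussian {s c : ℝ} (hs : 0 < s) (hc : 0 < c) :
    IntegrableOn (fun ρ : ℝ => ρ ^ (2 * s - 1) * Real.exp (-c * ρ ^ 2)) (Ioi 0) := by
  -- The integral of a non-integrable function is `0` by convention, so a nonzero value proves
  -- integrability.
  refine Integrable.of_integral_ne_zero ?_
  rw [integral_rpow_mul_gaussian hs hc]
  have := Real.Gamma_pos_of_pos hs
  positivity

/-- Weber's second exponential integral. -/
theorem integral_besselH_mul_gaussian {α : ℝ} (hα : 0 < α) {c : ℝ} (hc : 0 < c) (z : ℝ) :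
    ∫ ρ in Ioi (0 : ℝ), besselH α (ρ * z) * (ρ ^ (2 * α - 1) * Real.exp (-c * ρ ^ 2)) =
      c ^ (-α) / 2 * Real.exp (z ^ 2 / c) := by
  have hG : ∀ n : ℕ, 0 < Real.Gamma (n + α) := fun n => Real.Gamma_pos_of_pos (by positivity)
  -- Termwise integration of nonnegative terms. The Gaussian moment yields `Γ(n + α)`, which cancels
  -- the one in the coefficient and leaves the exponential series.
  set F : ℕ → ℝ → ℝ := fun n ρ => z ^ (2 * n) / ((n.factorial : ℝ) * Real.Gamma (n + α)) *
    (ρ ^ (2 * (n + α) - 1) * Real.exp (-c * ρ ^ 2)) with hF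
  have hFint : ∀ n, IntegrableOn (F n) (Ioi 0) := fun n =>
    (integrableOn_rpow_mul_gaussian (s := n + α) (by positivity) hc).const_mul _
  have hFval : ∀ n, ∫ ρ in Ioi (0 : ℝ), F n ρ = c ^ (-α) / 2 * ((z ^ 2 / c) ^ n / n.factorial) := by
    intro n
    rw [hF, integral_const_mul, integral_rpow_mul_gaussian (by positivity) hc]
    have h1 := hG n
    have : c ^ (-((n : ℝ) + α)) = c ^ (-α) / c ^ n := by
      rw [show -((n : ℝ) + α) = -α - n by ring, Real.rpow_sub hc, Real.rpow_natCast]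
    rw [this, div_pow, ← pow_mul]
    field_simp
  have hFnorm : ∀ n, ∫ ρ in Ioi (0 : ℝ), ‖F n ρ‖ = ∫ ρ in Ioi (0 : ℝ), F n ρ := by
    intro n
    refine setIntegral_congr_fun measurableSet_Ioi fun ρ hρ => ?_
    have hρ' : 0 < ρ := hρ
    have := besselH_term_nonneg hα z n
    exact Real.norm_of_nonneg (by simp only [hF]; positivity)
  have hsum : HasSum (fun n => ∫ ρ in Ioi (0 : ℝ), F n ρ)
      (c ^ (-α) / 2 * Real.exp (z ^ 2 / c)) := by
    simp_rw [hFval]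
    refine HasSum.mul_left _ ?_
    rw [Real.exp_eq_exp_ℝ]
    exact NormedSpace.expSeries_div_hasSum_exp (z ^ 2 / c)
  have key := hasSum_integral_of_summable_integral_norm hFint (by
    simp_rw [hFnorm]; exact hsum.summable)
  refine Eq.trans ?_ (hsum.unique key).symm
  refine setIntegral_congr_fun measurableSet_Ioi fun ρ hρ => ?_
  have hρ' : 0 < ρ := hρ
  simp only [besselH, hF]
  rw [← tsum_mul_right]
  refine tsum_congr fun n => ?_
  have : ρ ^ (2 * ((n : ℝ) + α) - 1) = ρ ^ (2 * n) * ρ ^ (2 * α - 1) := by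
    rw [← Real.rpow_natCast, ← Real.rpow_add hρ']; push_cast; congr 1; ring
  rw [this, mul_pow]
  ring

theorem gaussEvol_ofReal {α : ℝ} {a : ℝ} (ha : 0 ≤ a) (w x : ℝ) {t : ℝ} (ht : 0 ≤ t) :
    gaussEvol α a w x t =
      (((Real.cosh (2 * w * t) + 2 * a * mehlerT w t) ^ (-α) *
        Real.exp (-((w * Real.sinh (2 * w * t) / 2 + a * Real.cosh (2 * w * t)) /
          (Real.cosh (2 * w * t) + 2 * a * mehlerT w t)) * x) : ℝ) : ℂ) := by
  have hD : 0 ≤ Real.cosh (2 * w * t) + 2 * a * mehlerT w t := by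
    have := mehlerT_nonneg w ht
    have := Real.cosh_pos (2 * w * t)
    positivity
  unfold gaussEvol mehlerA mehlerN mehlerD
  rw [Complex.ofReal_mul, Complex.ofReal_cpow hD]
  push_cast
  rfl

/-- Weber's integral with `c = D / (2T)`; the two exponents in `r²` combine to `-N/D` because `cosh²
- sinh² = 1`. The right-hand side is `gaussEvol` for real `a`, which identifies `radialSym` as the
radial heat kernel. -/
theorem integral_radialSym_mul_gaussian {α : ℝ} (hα : 0 < α) (w : ℝ) {t : ℝ} (ht : 0 < t) (r : ℝ)
    {a : ℝ} (ha : 0 ≤ a) :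
    ∫ ρ in Ioi (0 : ℝ), radialSym α w t r ρ * ρ ^ (2 * α - 1) * Real.exp (-a * ρ ^ 2) =
      (Real.cosh (2 * w * t) + 2 * a * mehlerT w t) ^ (-α) *
        Real.exp (-((w * Real.sinh (2 * w * t) / 2 + a * Real.cosh (2 * w * t)) /
          (Real.cosh (2 * w * t) + 2 * a * mehlerT w t)) * r ^ 2) := by
  have hT := mehlerT_pos w ht
  have hch := Real.cosh_pos (2 * w * t)
  set T := mehlerT w t with hTdef
  set ch := Real.cosh (2 * w * t) with hch'
  have hD : 0 < ch + 2 * a * T := by positivity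
  have hc : 0 < (ch + 2 * a * T) / (2 * T) := by positivity
  have h1 := integral_besselH_mul_gaussian hα hc (r / (2 * T))
  have h2 : ∀ ρ, radialSym α w t r ρ * ρ ^ (2 * α - 1) * Real.exp (-a * ρ ^ 2) =
      2 ^ (1 - α) * T ^ (-α) * Real.exp (-(ch / (2 * T)) * r ^ 2) *
      (besselH α (ρ * (r / (2 * T))) * (ρ ^ (2 * α - 1) *
        Real.exp (-((ch + 2 * a * T) / (2 * T)) * ρ ^ 2))) := by
    intro ρ
    unfold radialSym
    rw [← hTdef, ← hch']
    have e1 : Real.exp (-(ch / (2 * T)) * (r ^ 2 + ρ ^ 2)) * Real.exp (-a * ρ ^ 2) =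
        Real.exp (-(ch / (2 * T)) * r ^ 2) * Real.exp (-((ch + 2 * a * T) / (2 * T)) * ρ ^ 2) := by
      rw [← Real.exp_add, ← Real.exp_add]; congr 1; field_simp; ring
    rw [mul_div_assoc]
    linear_combination (2 ^ (1 - α) * T ^ (-α) * besselH α (ρ * (r / (2 * T))) *
      ρ ^ (2 * α - 1)) * e1
  simp_rw [h2]
  rw [integral_const_mul, h1, Real.div_rpow hD.le (by positivity), Real.mul_rpow two_pos.le hT.le,
    show (1 : ℝ) - α = 1 + -α by ring, Real.rpow_add two_pos, Real.rpow_one]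
  have h3 : 0 < (2 : ℝ) ^ (-α) := by positivity
  have h4 : 0 < T ^ (-α) := by positivity
  have h5 : Real.exp (-(ch / (2 * T)) * r ^ 2) *
      Real.exp ((r / (2 * T)) ^ 2 / ((ch + 2 * a * T) / (2 * T))) =
      Real.exp (-((w * Real.sinh (2 * w * t) / 2 + a * ch) / (ch + 2 * a * T)) * r ^ 2) := by
    rw [← Real.exp_add]
    congr 1
    have hs := mehlerT_mul w t
    have hsq := Real.cosh_sq (2 * w * t)
    rw [← hTdef] at hs
    rw [← hs, ← hch'] at *
    field_simp
    linear_combination (-r ^ 2) * hsq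
  rw [← h5]
  field_simp

theorem integrableOn_radialSym_mul_gaussian {α : ℝ} (hα : 0 < α) (w : ℝ) {t : ℝ} (ht : 0 < t)
    (r : ℝ) {a : ℝ} (ha : 0 ≤ a) :
    IntegrableOn (fun ρ => radialSym α w t r ρ * ρ ^ (2 * α - 1) * Real.exp (-a * ρ ^ 2))
      (Ioi 0) := by
  refine Integrable.of_integral_ne_zero ?_
  rw [integral_radialSym_mul_gaussian hα w ht r ha]
  have := mehlerT_pos w ht
  have := Real.cosh_pos (2 * w * t)
  have : 0 < (Real.cosh (2 * w * t) + 2 * a * mehlerT w t) := by positivity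
  positivity

end BaouendiGrushin

namespace BaouendiGrushin

open Filter Topology

/-! ### Comparison for superpositions -/

section

variable {W : Type*} [MeasurableSpace W] {k : ℕ} {ν : Measure W} {α : ℝ} {h a : W → ℂ}
  {ξ : W → E k}

theorem _root_.HasDerivAt.re_const_mul {f : ℝ → ℂ} {f' : ℂ} {x : ℝ} (hf : HasDerivAt f f' x)
    (γ : ℂ) : HasDerivAt (fun x => (γ * f x).re) (γ * f').re x :=
  Complex.reCLM.hasFDerivAt.comp_hasDerivAt x (hf.const_mul γ)

/-- Superpositions are bounded and their radial derivative is `O(r)`, so the weighted flux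
`O(r^(2α))` vanishes at `r = 0` and `comparison` applies. The factor `γ` selects a half plane: it
will give both the sign of the kernel and its reality. -/
theorem IsAmplitude.re_superpose_le (ha : IsAmplitude ν h a ξ) (hα : 0 < α) {γ : ℂ} {c : ℝ}
    (h0 : ∀ r : ℝ, 0 < r → ∀ σ : E k, (γ * superpose ν α h a ξ (fun _ _ _ => 1) r σ 0).re ≤ c)
    {r : ℝ} (hr : 0 < r) (σ : E k) {t : ℝ} (ht : 0 ≤ t) :
    (γ * superpose ν α h a ξ (fun _ _ _ => 1) r σ t).re ≤ c := by
  set M := ∫ w, (1 + ‖a w‖ + ‖ξ w‖) ^ 2 * ‖h w‖ ∂ν with hM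
  have hM0 : 0 ≤ M := integral_nonneg fun w => by positivity
  have hbound : ∀ r σ t, 0 ≤ t → ‖superpose ν α h a ξ (fun _ _ _ => 1) r σ t‖ ≤ M := by
    intro r σ t ht
    refine norm_integral_le_of_norm_le ha.moment (Eventually.of_forall fun w => ?_)
    have h1 : 1 ≤ 1 + ‖a w‖ + ‖ξ w‖ := by linarith [norm_nonneg (a w), norm_nonneg (ξ w)]
    have := ha.norm_le (q := fun _ _ _ => 1) hα (C := 1) (r := r) ht σ (w := w)
      (by rw [norm_one, one_mul]; exact one_le_pow₀ h1)
    simpa using this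
  have hboundr : ∀ r : ℝ, 0 < r → ∀ σ t, 0 ≤ t →
      ‖superpose ν α h a ξ (multR a ξ) r σ t‖ ≤ 2 * r * M := by
    intro r hr σ t ht
    rw [hM, ← integral_const_mul]
    refine norm_integral_le_of_norm_le (ha.moment.const_mul _) (Eventually.of_forall fun w => ?_)
    refine ha.norm_le hα ht σ ?_
    have h1 : 1 ≤ 1 + ‖a w‖ + ‖ξ w‖ := by linarith [norm_nonneg (a w), norm_nonneg (ξ w)]
    have h2 := ha.norm_mehlerA_le w ht
    rw [multR, norm_mul, norm_mul, Complex.norm_real, Real.norm_of_nonneg hr.le, norm_neg,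
      Complex.norm_ofNat]
    exact mul_le_mul_of_nonneg_left (by nlinarith) (by positivity)
  have key : HasGrushinDerivs (k := k)
      (fun r σ t => (γ * superpose ν α h a ξ (fun _ _ _ => 1) r σ t).re - c)
      (fun r σ t => (γ * superpose ν α h a ξ (multR a ξ) r σ t).re)
      (fun r σ t => (γ * superpose ν α h a ξ (multRR a ξ) r σ t).re)
      (fun r σ t => (γ * superpose ν α h a ξ (multT a ξ α) r σ t).re)
      (fun i r σ t => (γ * superpose ν α h a ξ (fun w _ _ => (Complex.I *
          (inner ℝ (ξ w) (EuclideanSpace.single i (1 : ℝ)) : ℝ)) ^ 1) r σ t).re)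
      (fun i r σ t => (γ * superpose ν α h a ξ (fun w _ _ => (Complex.I *
          (inner ℝ (ξ w) (EuclideanSpace.single i (1 : ℝ)) : ℝ)) ^ 2) r σ t).re) := by
    refine ⟨fun r _ σ t ht => ((ha.superpose_r hα r σ ht.le).re_const_mul γ).sub_const c,
      fun r _ σ t ht => (ha.superpose_rr hα r σ ht.le).re_const_mul γ,
      fun i r _ σ t ht => ?_,
      fun i r _ σ t ht => (ha.superpose_s hα 1 le_rfl r σ _ ht.le).re_const_mul γ,
      fun r _ σ t ht => ((ha.superpose_t hα r σ ht).re_const_mul γ).sub_const c⟩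
    have := ((ha.superpose_s hα 0 (by norm_num) r σ (EuclideanSpace.single i (1 : ℝ))
      ht.le).re_const_mul γ).sub_const c
    simpa using this
  have hfin := comparison hα key ?_ ?_ ?_ ?_ (fun r hr σ => sub_nonpos.2 (h0 r hr σ)) hr σ ht
  · exact sub_nonpos.1 hfin
  · refine ContinuousOn.sub (Complex.continuous_re.comp_continuousOn (continuousOn_const.mul
      ((ha.continuousOn_superpose hα ha.isMultiplier_one).mono ?_))) continuousOn_const
    exact prod_mono (subset_univ _) le_rfl
  · intro r hr σ t ht
    rw [ha.superpose_equation hα hr σ ht.le]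
    refine le_of_eq ?_
    rw [mul_add, mul_add, Complex.add_re, Complex.add_re, mul_left_comm, Complex.re_ofReal_mul,
      mul_left_comm, Complex.re_ofReal_mul, Finset.mul_sum, Complex.re_sum]
  · intro σ t ht
    have hlim : Tendsto (fun r : ℝ => r ^ (2 * α) * (2 * ‖γ‖ * M)) (𝓝[>] 0)
        (𝓝 (0 ^ (2 * α) * (2 * ‖γ‖ * M))) :=
      (Continuous.tendsto ((Real.continuous_rpow_const (by positivity)).mul continuous_const)
        0).mono_left nhdsWithin_le_nhds
    rw [Real.zero_rpow (by positivity), zero_mul] at hlim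
    refine squeeze_zero_norm' ?_ hlim
    filter_upwards [self_mem_nhdsWithin] with r hr
    have hr' : 0 < r := hr
    have e : r ^ (2 * α) = r ^ (2 * α - 1) * r := by
      rw [← Real.rpow_add_one hr'.ne']; congr 1; ring
    rw [norm_mul, Real.norm_of_nonneg (by positivity), e, mul_assoc]
    refine mul_le_mul_of_nonneg_left ?_ (by positivity)
    refine (Complex.abs_re_le_norm _).trans ?_
    rw [norm_mul]
    have := mul_le_mul_of_nonneg_left (hboundr r hr' σ t ht.le) (norm_nonneg γ)
    linarith
  · intro T _
    refine ⟨‖γ‖ * M + |c|, 0, fun r _ σ t ht => ?_⟩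
    have h1 := (Complex.re_le_norm (γ * superpose ν α h a ξ (fun _ _ _ => 1) r σ t))
    rw [norm_mul] at h1
    have h2 := mul_le_mul_of_nonneg_left (hbound r σ t ht.1) (norm_nonneg γ)
    have h3 := neg_abs_le c
    simp only [zero_mul, Real.exp_zero, mul_one]
    linarith

end

/-! ### Laplace transforms -/

theorem mul_exp_neg_le {b x : ℝ} (hb : 0 < b) : x * Real.exp (-(b * x)) ≤ 1 / b := by
  have h1 : b * x ≤ Real.exp (b * x) := by linarith [Real.add_one_le_exp (b * x)]
  rw [Real.exp_neg, le_div_iff₀ hb, ← div_eq_mul_inv, div_mul_eq_mul_div,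
    div_le_one (Real.exp_pos _)]
  linarith

/-- Used twice: for holomorphy of the Laplace transform of the radial kernel, and for the moment
with the extra factor `r²` under the heat measures. -/
theorem hasDerivAt_laplace {X : Type*} [MeasurableSpace X] {μ : Measure X} {g : X → ℝ}
    (hg : AEStronglyMeasurable g μ) (hg0 : ∀ᵐ x ∂μ, 0 ≤ g x) {f : X → ℂ} (hf : Integrable f μ)
    {a : ℂ} (ha : 0 < a.re) :
    HasDerivAt (fun a : ℂ => ∫ x, Complex.exp (-a * g x) * f x ∂μ)
      (∫ x, -g x * Complex.exp (-a * g x) * f x ∂μ) a := by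
  have hgc : AEStronglyMeasurable (fun x => (g x : ℂ)) μ :=
    Complex.continuous_ofReal.comp_aestronglyMeasurable hg
  have hm : ∀ a : ℂ, AEStronglyMeasurable (fun x => Complex.exp (-a * g x)) μ := fun a =>
    Complex.continuous_exp.comp_aestronglyMeasurable (hgc.const_mul _)
  have hre : ∀ z ∈ Metric.ball a (a.re / 2), a.re / 2 ≤ z.re := by
    intro z hz
    rw [Metric.mem_ball, dist_eq_norm] at hz
    have := (Complex.abs_re_le_norm (z - a)).trans hz.le
    rw [Complex.sub_re, abs_le] at this
    linarith
  refine (hasDerivAt_integral_of_dominated_loc_of_deriv_le (μ := μ)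
    (F := fun a x => Complex.exp (-a * g x) * f x)
    (F' := fun a x => -g x * Complex.exp (-a * g x) * f x)
    (bound := fun x => (1 / (a.re / 2)) * ‖f x‖) (Metric.ball_mem_nhds a (half_pos ha))
    (Eventually.of_forall fun z => (hm z).mul hf.1) ?_ ((hgc.neg.mul (hm a)).mul hf.1) ?_
    (hf.norm.const_mul _) (Eventually.of_forall fun x z _ => ?_)).2
  · refine hf.norm.mono' ((hm a).mul hf.1) ?_
    filter_upwards [hg0] with x hx
    rw [norm_mul, Complex.norm_exp]
    refine mul_le_of_le_one_left (norm_nonneg _) (Real.exp_le_one_iff.2 ?_)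
    rw [Complex.re_mul_ofReal, Complex.neg_re]
    nlinarith
  · filter_upwards [hg0] with x hx z hz
    rw [norm_mul, norm_mul, norm_neg, Complex.norm_real, Real.norm_of_nonneg hx, Complex.norm_exp,
      Complex.re_mul_ofReal, Complex.neg_re]
    refine mul_le_mul_of_nonneg_right ?_ (norm_nonneg _)
    refine le_trans ?_ (mul_exp_neg_le (x := g x) (half_pos ha))
    refine mul_le_mul_of_nonneg_left (Real.exp_le_exp.2 ?_) hx
    have := mul_le_mul_of_nonneg_right (hre z hz) hx
    linarith
  · have h1 : HasDerivAt (fun z : ℂ => -z * g x) (-(g x : ℂ)) z := by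
      simpa using ((hasDerivAt_id z).neg).mul_const (g x : ℂ)
    refine (h1.cexp.mul_const (f x)).congr_deriv ?_
    ring

theorem eq_of_eq_on_pos_real {F G : ℂ → ℂ} (hF : ∀ a : ℂ, 0 < a.re → DifferentiableAt ℂ F a)
    (hG : ∀ a : ℂ, 0 < a.re → DifferentiableAt ℂ G a) (h : ∀ x : ℝ, 0 < x → F x = G x) {a : ℂ}
    (ha : 0 < a.re) : F a = G a := by
  have hopen : IsOpen {a : ℂ | 0 < a.re} := isOpen_lt continuous_const Complex.continuous_re
  have hconv : Convex ℝ {a : ℂ | 0 < a.re} := convex_halfSpace_re_gt 0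
  refine AnalyticOnNhd.eqOn_of_preconnected_of_frequently_eq (z₀ := 1) (U := {a : ℂ | 0 < a.re})
    (DifferentiableOn.analyticOnNhd (fun z hz => (hF z hz).differentiableWithinAt) hopen)
    (DifferentiableOn.analyticOnNhd (fun z hz => (hG z hz).differentiableWithinAt) hopen)
    hconv.isPreconnected (by simp) ?_ ha
  have ht : Tendsto (fun x : ℝ => (x : ℂ)) (𝓝[>] 1) (𝓝[≠] 1) := by
    refine tendsto_nhdsWithin_iff.2 ⟨?_, ?_⟩
    · exact (Complex.continuous_ofReal.tendsto 1).mono_left nhdsWithin_le_nhds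
    · filter_upwards [self_mem_nhdsWithin] with x hx
      have : x ≠ 1 := ne_of_gt hx
      simpa using this
  refine ht.frequently (Eventually.frequently ?_)
  filter_upwards [self_mem_nhdsWithin] with x hx
  exact h x (one_pos.trans hx)

theorem integrableOn_radialSym {α : ℝ} (hα : 0 < α) (w : ℝ) {t : ℝ} (ht : 0 < t) (r : ℝ) :
    IntegrableOn (fun ρ => radialSym α w t r ρ * ρ ^ (2 * α - 1)) (Ioi 0) := by
  simpa using integrableOn_radialSym_mul_gaussian hα w ht r le_rfl

/-- Both sides are holomorphic in the right half plane and agree on the positive reals by Weber's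
integral. Complex exponents are what Fourier inversion in `s = r²` requires. -/
theorem integral_radialSym_mul_cexp {α : ℝ} (hα : 0 < α) (w : ℝ) {t : ℝ} (ht : 0 < t) (r : ℝ)
    {a : ℂ} (ha : 0 < a.re) :
    ∫ ρ in Ioi (0 : ℝ), Complex.exp (-a * (ρ ^ 2 : ℝ)) *
      ((radialSym α w t r ρ * ρ ^ (2 * α - 1) : ℝ) : ℂ) = gaussEvol α a w (r ^ 2) t := by
  refine eq_of_eq_on_pos_real
    (F := fun a => ∫ ρ in Ioi (0 : ℝ), Complex.exp (-a * (ρ ^ 2 : ℝ)) *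
      ((radialSym α w t r ρ * ρ ^ (2 * α - 1) : ℝ) : ℂ)) (G := fun a => gaussEvol α a w (r ^ 2) t)
    (fun a ha => ?_) (fun a ha => ?_) (fun x hx => ?_) ha
  · exact (hasDerivAt_laplace (μ := volume.restrict (Ioi (0 : ℝ))) (g := fun ρ => ρ ^ 2)
      (by fun_prop) (Eventually.of_forall fun x => by positivity)
      (integrableOn_radialSym hα w ht r).ofReal ha).differentiableAt
  · exact (hasDerivAt_gaussEvol_param α ha.le w (r ^ 2) ht.le).differentiableAt
  · rw [gaussEvol_ofReal hx.le _ _ ht.le, ← integral_radialSym_mul_gaussian hα w ht r hx.le,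
      ← integral_complex_ofReal]
    refine integral_congr_ae (Eventually.of_forall fun ρ => ?_)
    simp only
    push_cast
    ring

/-! ### The Mehler kernel as a Fourier transform -/

open FourierTransform

theorem integrable_exp_neg_mul_norm (k : ℕ) {b : ℝ} (hb : 0 < b) :
    Integrable fun v : E k => Real.exp (-b * ‖v‖) := by
  have h := integrable_one_add_norm (E := E k) (μ := volume) (r := (k + 1 : ℕ)) (by simp)
  refine (h.const_mul ((k + 1).factorial * Real.exp b / b ^ (k + 1))).mono'
    (by fun_prop) (Eventually.of_forall fun v => ?_)
  have h1 := Real.pow_div_factorial_le_exp (b * (1 + ‖v‖)) (by positivity) (k + 1)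
  rw [Real.norm_of_nonneg (Real.exp_pos _).le, Real.rpow_neg (by positivity), Real.rpow_natCast]
  have h2 : Real.exp (-b * ‖v‖) = Real.exp b / Real.exp (b * (1 + ‖v‖)) := by
    rw [← Real.exp_sub]; congr 1; ring
  rw [h2, div_le_iff₀ (Real.exp_pos _)]
  rw [mul_pow, div_le_iff₀ (by positivity)] at h1
  have h3 : 0 < (1 + ‖v‖) ^ (k + 1) := by positivity
  rw [← div_eq_mul_inv, div_div, div_mul_eq_mul_div, le_div_iff₀ (by positivity)]
  have := mul_le_mul_of_nonneg_left h1 (Real.exp_pos b).le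
  linarith

/-- The symbol of the Mehler kernel in the variable `σ`. -/
noncomputable def symF {k : ℕ} (α t r ρ : ℝ) (v : E k) : ℂ :=
  (radialSym α (Real.pi * ‖v‖) t r ρ : ℂ)

/-- The Mehler kernel as a function of `ρ` and of the difference of the `σ` variables. -/
noncomputable def kernF {k : ℕ} (α t r ρ : ℝ) (η : E k) : ℂ := 𝓕 (symF (k := k) α t r ρ) η

section kernF

variable {k : ℕ} {α t : ℝ}

theorem continuous_symF (hα : 0 < α) (ht : 0 < t) (r : ℝ) :
    Continuous fun p : ℝ × E k => symF α t r p.1 p.2 := by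
  unfold symF
  exact Complex.continuous_ofReal.comp ((continuous_radialSym hα ht r).comp
    (f := fun p : ℝ × E k => (Real.pi * ‖p.2‖, p.1)) (by fun_prop))

theorem continuous_symF_right (hα : 0 < α) (ht : 0 < t) (r ρ : ℝ) :
    Continuous fun v : E k => symF α t r ρ v :=
  Continuous.comp (g := fun p : ℝ × E k => symF α t r p.1 p.2) (f := fun v : E k => (ρ, v))
    (continuous_symF hα ht r) (by fun_prop)

theorem continuous_symF_left (hα : 0 < α) (ht : 0 < t) (r : ℝ) (v : E k) :
    Continuous fun ρ : ℝ => symF α t r ρ v :=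
  Continuous.comp (g := fun p : ℝ × E k => symF α t r p.1 p.2) (f := fun ρ : ℝ => (ρ, v))
    (continuous_symF hα ht r) (by fun_prop)

theorem norm_symF_le (hα : 0 < α) (ht : 0 < t) (r ρ : ℝ) (v : E k) :
    ‖symF α t r ρ v‖ ≤ 2 ^ (1 - α) * t ^ (-α) * besselH α (ρ * r / (4 * t)) *
      Real.exp (-(α * t * Real.pi) * ‖v‖) := by
  unfold symF
  rw [Complex.norm_real, Real.norm_of_nonneg (radialSym_nonneg hα _ ht _ _)]
  refine (radialSym_le hα (by positivity) ht r ρ).trans (le_of_eq ?_)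
  congr 2; ring

theorem integrable_symF (hα : 0 < α) (ht : 0 < t) (r ρ : ℝ) :
    Integrable (symF (k := k) α t r ρ) := by
  refine ((integrable_exp_neg_mul_norm k (by positivity : 0 < α * t * Real.pi)).const_mul
    (2 ^ (1 - α) * t ^ (-α) * besselH α (ρ * r / (4 * t)))).mono' ?_
    (Eventually.of_forall fun v => norm_symF_le hα ht r ρ v)
  exact (continuous_symF_right hα ht r ρ).aestronglyMeasurable

theorem continuous_kernF (hα : 0 < α) (ht : 0 < t) (r : ℝ) :
    Continuous fun p : ℝ × E k => kernF α t r p.1 p.2 := by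
  rw [continuous_iff_continuousAt]
  intro p
  have e : ∀ q : ℝ × E k, kernF α t r q.1 q.2 =
      ∫ v : E k, Complex.exp ((-2 * Real.pi * inner ℝ v q.2 : ℝ) * Complex.I) *
        symF α t r q.1 v := fun q => by
    unfold kernF; rw [Real.fourier_eq']; rfl
  simp_rw [e]
  have hc : ∀ q : ℝ × E k, Continuous fun v : E k =>
      Complex.exp ((-2 * Real.pi * inner ℝ v q.2 : ℝ) * Complex.I) * symF α t r q.1 v := fun q =>
    Continuous.mul (by fun_prop) (continuous_symF_right hα ht r q.1)
  refine continuousAt_of_dominated (bound := fun v => 2 ^ (1 - α) * t ^ (-α) *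
      besselH α ((|p.1| + 1) * r / (4 * t)) * Real.exp (-(α * t * Real.pi) * ‖v‖))
    (Eventually.of_forall fun q => (hc q).aestronglyMeasurable) ?_
    ((integrable_exp_neg_mul_norm k (by positivity)).const_mul _)
    (Eventually.of_forall fun v => ?_)
  · have : ContinuousAt (fun q : ℝ × E k => |q.1|) p := by fun_prop
    filter_upwards [this.eventually (gt_mem_nhds (lt_add_one _))] with q hq
    refine Eventually.of_forall fun v => ?_
    rw [norm_mul, Complex.norm_exp_ofReal_mul_I, one_mul]
    refine (norm_symF_le hα ht r q.1 v).trans ?_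
    have : besselH α (q.1 * r / (4 * t)) ≤ besselH α ((|p.1| + 1) * r / (4 * t)) := by
      refine besselH_le hα ?_
      have h1 : |q.1| ≤ |(|p.1| + 1)| := hq.le.trans (le_abs_self _)
      rw [abs_div, abs_div, abs_mul q.1, abs_mul (|p.1| + 1)]
      gcongr
    gcongr
  · refine Continuous.continuousAt (Continuous.mul (by fun_prop) ?_)
    exact (continuous_symF_left hα ht r v).comp continuous_fst

/-- With `w = ‖ξ‖/(2t)` one has `sinh ‖ξ‖ = w T`, and the Bessel argument becomes `2 · ρr/(2T)`. The
frequency `0` is excluded because there `0 / sinh 0` evaluates to `0` instead of its limit `1`. -/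
theorem mehlerIntegrand_eq {r ρ : ℝ} (hr : 0 < r) (hρ : 0 < ρ) (ht : 0 < t) (σ σ' : E k) {ξ : E k}
    (hξ : ξ ≠ 0) :
    mehlerIntegrand α (r, σ) (ρ, σ') t ξ =
      (2 * t * (r * ρ) ^ (α - 1) : ℝ) * (Complex.exp (-(Complex.I / (t : ℂ)) *
        ((inner ℝ (σ' - σ) ξ : ℝ) : ℂ)) * (radialSym α (‖ξ‖ / (2 * t)) t r ρ : ℂ)) := by
  have hx : 0 < ‖ξ‖ := norm_pos_iff.2 hξ
  unfold mehlerIntegrand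
  simp only
  rw [mul_left_comm, ← Complex.ofReal_mul]
  congr 2
  set w := ‖ξ‖ / (2 * t) with hw
  have hxw : ‖ξ‖ = 2 * w * t := by rw [hw]; field_simp
  have hwp : 0 < w := by positivity
  have hT := mehlerT_pos w ht
  have hs := mehlerT_mul w t
  unfold radialSym
  rw [Real.tanh_eq_sinh_div_cosh, hxw, ← hs]
  set T := mehlerT w t
  have hz : 2 * w * t * ρ * r / (2 * t * (T * w)) = 2 * (ρ * r / (2 * T)) := by field_simp
  rw [hz, besselI_eq (by positivity)]
  have h2 : 2 * (ρ * r / (2 * T)) / 2 = ρ * r / (2 * T) := by ring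
  rw [h2]
  have h3 : (ρ * r / (2 * T)) ^ (α - 1) = (r * ρ) ^ (α - 1) * 2 ^ (1 - α) * T ^ (-α) * T := by
    rw [Real.div_rpow (by positivity) (by positivity), Real.mul_rpow two_pos.le hT.le,
      show (1 : ℝ) - α = -(α - 1) by ring, Real.rpow_neg two_pos.le, mul_comm ρ r]
    have : T ^ (α - 1) = (T ^ (-α) * T)⁻¹ := by
      rw [← Real.rpow_add_one hT.ne', ← Real.rpow_neg hT.le]; congr 1; ring
    rw [this]
    have : 0 < T ^ (-α) := by positivity
    field_simp
  rw [h3]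
  have h4 : -(2 * w * t / (T * w / Real.cosh (2 * w * t))) * ((r ^ 2 + ρ ^ 2) / (4 * t)) =
      -(Real.cosh (2 * w * t) / (2 * T)) * (r ^ 2 + ρ ^ 2) := by
    have := Real.cosh_pos (2 * w * t)
    field_simp
    ring
  rw [h4]
  field_simp

theorem integrable_mehlerIntegrand (hk : 1 ≤ k) (hα : 0 < α) {r ρ : ℝ} (hr : 0 < r) (hρ : 0 < ρ)
    (ht : 0 < t) (σ σ' : E k) : Integrable (mehlerIntegrand α (r, σ) (ρ, σ') t) := by
  -- Since `k ≥ 1` the origin is a null set, so the degenerate value of the integrand there is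
  -- harmless.
  have : Nonempty (Fin k) := ⟨⟨0, hk⟩⟩
  have hae : ∀ᵐ ξ : E k, ξ ≠ 0 := by
    rw [ae_iff]; simp
  have h1 : Integrable fun ξ : E k => symF α t r ρ ((2 * Real.pi * t)⁻¹ • ξ) :=
    (integrable_symF hα ht r ρ).comp_smul (by positivity)
  refine ((h1.norm.const_mul ‖((2 * t * (r * ρ) ^ (α - 1) : ℝ) : ℂ)‖)).mono' ?_ ?_
  · refine AEStronglyMeasurable.congr (f := fun ξ : E k => ((2 * t * (r * ρ) ^ (α - 1) : ℝ) : ℂ) *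
      (Complex.exp (-(Complex.I / (t : ℂ)) * ((inner ℝ (σ' - σ) ξ : ℝ) : ℂ)) *
        symF α t r ρ ((2 * Real.pi * t)⁻¹ • ξ))) ?_ ?_
    · refine (AEStronglyMeasurable.mul ?_ h1.1).const_mul _
      exact Continuous.aestronglyMeasurable (by fun_prop)
    · filter_upwards [hae] with ξ hξ
      rw [mehlerIntegrand_eq hr hρ ht σ σ' hξ, symF, norm_smul, Real.norm_of_nonneg (by positivity)]
      congr 4
      field_simp
  · filter_upwards [hae] with ξ hξ
    rw [mehlerIntegrand_eq hr hρ ht σ σ' hξ, norm_mul, norm_mul, symF, norm_smul,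
      Real.norm_of_nonneg (by positivity : 0 ≤ (2 * Real.pi * t)⁻¹)]
    have e1 : -(Complex.I / (t : ℂ)) * ((inner ℝ (σ' - σ) ξ : ℝ) : ℂ) =
      ((-(inner ℝ (σ' - σ) ξ / t) : ℝ) : ℂ) * Complex.I := by push_cast; ring
    have e2 : Real.pi * ((2 * Real.pi * t)⁻¹ * ‖ξ‖) = ‖ξ‖ / (2 * t) := by field_simp
    rw [e1, Complex.norm_exp_ofReal_mul_I, one_mul, e2]

/-- The substitution `ξ = 2πt v` turns the phase into the Fourier character; its Jacobian `(2πt)^k`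
and the factor `2t (rρ)^(α-1)` of `mehlerIntegrand_eq` match the normalization exactly. -/
theorem mehlerKernel_eq (hk : 1 ≤ k) {r ρ : ℝ} (hr : 0 < r) (hρ : 0 < ρ)
    (ht : 0 < t) (σ σ' : E k) :
    mehlerKernel α (r, σ) (ρ, σ') t = kernF α t r ρ (σ' - σ) := by
  have : Nonempty (Fin k) := ⟨⟨0, hk⟩⟩
  have hae : ∀ᵐ ξ : E k, ξ ≠ 0 := by
    rw [ae_iff]; simp
  set G : E k → ℂ := fun ξ => Complex.exp (-(Complex.I / (t : ℂ)) *
        ((inner ℝ (σ' - σ) ξ : ℝ) : ℂ)) * (radialSym α (‖ξ‖ / (2 * t)) t r ρ : ℂ) with hG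
  have h1 : ∫ ξ, mehlerIntegrand α (r, σ) (ρ, σ') t ξ =
      (2 * t * (r * ρ) ^ (α - 1) : ℝ) * ∫ ξ, G ξ := by
    rw [← integral_const_mul]
    refine integral_congr_ae ?_
    filter_upwards [hae] with ξ hξ
    exact mehlerIntegrand_eq hr hρ ht σ σ' hξ
  have h2 := Measure.integral_comp_smul (volume : Measure (E k)) G (2 * Real.pi * t)
  have h3 : kernF α t r ρ (σ' - σ) = ∫ v, G ((2 * Real.pi * t) • v) := by
    unfold kernF
    rw [Real.fourier_eq']
    refine integral_congr_ae (Eventually.of_forall fun v => ?_)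
    simp only [hG, symF, smul_eq_mul, norm_smul, inner_smul_right]
    rw [Real.norm_of_nonneg (by positivity : 0 ≤ 2 * Real.pi * t), real_inner_comm]
    have ht' : (t : ℂ) ≠ 0 := by exact_mod_cast ht.ne'
    congr 2
    · push_cast
      field_simp
    · have : Real.pi * ‖v‖ = 2 * Real.pi * t * ‖v‖ / (2 * t) := by field_simp
      rw [this]
  unfold mehlerKernel
  rw [h1, h3, h2, Complex.real_smul, ← mul_assoc, ← Complex.ofReal_mul]
  congr 2
  simp only [finrank_euclideanSpace, Fintype.card_fin]
  have h4 : (r * ρ) ^ (1 - α) * (r * ρ) ^ (α - 1) = 1 := by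
    rw [← Real.rpow_add (by positivity)]; simp
  rw [abs_of_pos (by positivity), mul_pow, mul_pow, mul_pow]
  field_simp
  linear_combination (2 * t * t ^ k * 2 ^ k) * h4

end kernF

end BaouendiGrushin

namespace BaouendiGrushin

open Filter Topology FourierTransform SchwartzMap

/-! ### Tensor product data -/

section tensor

variable {k : ℕ} {α t : ℝ}

theorem integral_radialSym_le_one (hα : 0 < α) (w : ℝ) (ht : 0 < t) (r : ℝ) :
    ∫ ρ in Ioi (0 : ℝ), radialSym α w t r ρ * ρ ^ (2 * α - 1) ≤ 1 := by
  have h := integral_radialSym_mul_gaussian hα w ht r le_rfl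
  simp only [neg_zero, zero_mul, Real.exp_zero, mul_one, mul_zero, add_zero] at h
  rw [h]
  refine mul_le_one₀ (Real.rpow_le_one_of_one_le_of_nonpos (Real.one_le_cosh _) (by linarith))
    (Real.exp_pos _).le (Real.exp_le_one_iff.2 ?_)
  have h1 : 0 ≤ w * Real.sinh (2 * w * t) := by
    rw [← mehlerT_mul]
    have := mehlerT_pos w ht
    nlinarith [mul_nonneg this.le (mul_self_nonneg w)]
  have h2 := Real.cosh_pos (2 * w * t)
  have : 0 ≤ w * Real.sinh (2 * w * t) / 2 / Real.cosh (2 * w * t) * r ^ 2 := by positivity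
  linarith

/-- Integrating first in `ρ`, the radial kernel has mass at most one for every `w`, so only the
integrability of `g` is needed. It justifies the exchanges of integrals in `ρ` and a frequency
variable. -/
theorem integrable_prod_radialSym {X : Type*} [MeasurableSpace X] {μ : Measure X} [SFinite μ]
    (hα : 0 < α) (ht : 0 < t) (r : ℝ) {w : X → ℝ} (hw : Measurable w) {f : ℝ × X → ℂ}
    (hf : Measurable f) {M : ℝ} (hM : ∀ p, 0 < p.1 → ‖f p‖ ≤ M) {g : X → ℂ} (hg : Integrable g μ) :
    Integrable (fun p : ℝ × X => ((radialSym α (w p.2) t r p.1 * p.1 ^ (2 * α - 1) : ℝ) : ℂ) *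
      f p * g p.2) ((volume.restrict (Ioi 0)).prod μ) := by
  have hmeas1 : Measurable fun p : ℝ × X => radialSym α (w p.2) t r p.1 * p.1 ^ (2 * α - 1) :=
    (Measurable.comp (g := fun p : ℝ × ℝ => radialSym α p.1 t r p.2)
      (f := fun p : ℝ × X => (w p.2, p.1)) (continuous_radialSym hα ht r).measurable
      (by fun_prop)).mul (by fun_prop)
  have hgm : AEStronglyMeasurable (fun p : ℝ × X => g p.2) ((volume.restrict (Ioi 0)).prod μ) :=
    hg.1.comp_snd
  have hm : AEStronglyMeasurable (fun p : ℝ × X =>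
      ((radialSym α (w p.2) t r p.1 * p.1 ^ (2 * α - 1) : ℝ) : ℂ) * f p * g p.2)
      ((volume.restrict (Ioi 0)).prod μ) :=
    ((Complex.measurable_ofReal.comp hmeas1).mul hf).aestronglyMeasurable.mul hgm
  have hslice : ∀ x, Integrable (fun ρ => ‖M‖ * ‖g x‖ * (radialSym α (w x) t r ρ *
      ρ ^ (2 * α - 1))) (volume.restrict (Ioi 0)) := fun x =>
    (integrableOn_radialSym hα (w x) ht r).const_mul _
  have hnorm : ∀ x, ∀ ρ ∈ Ioi (0 : ℝ),
      ‖((radialSym α (w x) t r ρ * ρ ^ (2 * α - 1) : ℝ) : ℂ) * f (ρ, x) * g x‖ ≤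
        ‖M‖ * ‖g x‖ * (radialSym α (w x) t r ρ * ρ ^ (2 * α - 1)) := by
    intro x ρ hρ
    have hρ' : 0 < ρ := hρ
    have h1 := radialSym_nonneg hα (w x) ht r ρ
    rw [norm_mul, norm_mul, Complex.norm_real, Real.norm_of_nonneg (by positivity)]
    have h2 : ‖f (ρ, x)‖ ≤ ‖M‖ := (hM (ρ, x) hρ').trans (le_abs_self M)
    calc _ ≤ radialSym α (w x) t r ρ * ρ ^ (2 * α - 1) * ‖M‖ * ‖g x‖ := by gcongr
      _ = _ := by ring
  have hae : ∀ x, ∀ᵐ ρ ∂(volume.restrict (Ioi (0 : ℝ))),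
      ‖((radialSym α (w x) t r ρ * ρ ^ (2 * α - 1) : ℝ) : ℂ) * f (ρ, x) * g x‖ ≤
        ‖M‖ * ‖g x‖ * (radialSym α (w x) t r ρ * ρ ^ (2 * α - 1)) := fun x =>
    (ae_restrict_iff' measurableSet_Ioi).2 (Eventually.of_forall (hnorm x))
  have hm1 : ∀ x, AEStronglyMeasurable (fun ρ =>
      ((radialSym α (w x) t r ρ * ρ ^ (2 * α - 1) : ℝ) : ℂ) * f (ρ, x) * g x)
      (volume.restrict (Ioi 0)) := fun x => by
    refine AEStronglyMeasurable.mul (Measurable.aestronglyMeasurable ?_) aestronglyMeasurable_const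
    exact ((Complex.measurable_ofReal.comp hmeas1).mul hf).comp
      (f := fun ρ : ℝ => (ρ, x)) (by fun_prop)
  rw [integrable_prod_iff' hm]
  refine ⟨Eventually.of_forall fun x => (hslice x).mono' (hm1 x) (hae x), ?_⟩
  refine (hg.norm.const_mul ‖M‖).mono' hm.norm.prod_swap.integral_prod_right'
    (Eventually.of_forall fun x => ?_)
  rw [Real.norm_of_nonneg (integral_nonneg fun ρ => norm_nonneg _)]
  calc _ ≤ ∫ ρ in Ioi (0 : ℝ), ‖M‖ * ‖g x‖ * (radialSym α (w x) t r ρ * ρ ^ (2 * α - 1)) :=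
        integral_mono_ae ((hslice x).mono' (hm1 x) (hae x)).norm (hslice x) (hae x)
    _ = ‖M‖ * ‖g x‖ * ∫ ρ in Ioi (0 : ℝ), radialSym α (w x) t r ρ * ρ ^ (2 * α - 1) :=
        integral_const_mul _ _
    _ ≤ ‖M‖ * ‖g x‖ * 1 := by
        gcongr
        exact integral_radialSym_le_one hα (w x) ht r
    _ = _ := mul_one _

/-- The amplitude of the data `exp (-s) A(s) B(σ)`, `s = r²`. -/
noncomputable def tensorAmp (A : 𝓢(ℝ, ℂ)) (B : 𝓢(E k, ℂ)) (w : E k × ℝ) : ℂ := 𝓕 B w.1 * 𝓕 A w.2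

/-- The Gaussian parameter attached to the frequency `x` in the variable `s = r²`. -/
noncomputable def freqA (x : ℝ) : ℂ := 1 - 2 * Real.pi * x * Complex.I

theorem freqA_re (x : ℝ) : (freqA x).re = 1 := by simp [freqA]

theorem norm_freqA_le (x : ℝ) : ‖freqA x‖ ≤ 1 + 2 * Real.pi * |x| := by
  refine (norm_sub_le _ _).trans ?_
  simp [abs_of_pos Real.pi_pos]

theorem measurable_freqA : Measurable freqA := by unfold freqA; fun_prop

/-- The real part `1` keeps the Gaussian parameter strictly inside the half plane where the Laplace
transform formula holds; the price is the factor `exp (-s)` in the data. -/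
theorem exp_freqA (x s : ℝ) : Complex.exp (-freqA x * s) =
    Complex.exp (-s : ℝ) * Complex.exp ((2 * Real.pi * (s * x) : ℝ) * Complex.I) := by
  rw [← Complex.exp_add]
  congr 1
  simp only [freqA]
  push_cast
  ring

theorem integrable_one_add_norm_pow {D : Type*} [NormedAddCommGroup D] [NormedSpace ℝ D]
    [MeasurableSpace D] [BorelSpace D] [SecondCountableTopology D] (μ : Measure D)
    [μ.HasTemperateGrowth] (f : 𝓢(D, ℂ)) : Integrable (fun x => (1 + ‖x‖) ^ 2 * ‖f x‖) μ := by
  have h0 := f.integrable_pow_mul μ 0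
  have h1 := f.integrable_pow_mul μ 1
  have h2 := f.integrable_pow_mul μ 2
  refine ((h0.add (h1.const_mul 2)).add h2).congr (Eventually.of_forall fun x => ?_)
  simp only [Pi.add_apply]
  ring

theorem isAmplitude_tensor (A : 𝓢(ℝ, ℂ)) (B : 𝓢(E k, ℂ)) :
    IsAmplitude (volume : Measure (E k × ℝ)) (tensorAmp A B) (fun w => freqA w.2)
      (fun w => (2 * Real.pi) • w.1) := by
  have hc : Continuous (tensorAmp A B) :=
    ((𝓕 B).continuous.comp continuous_fst).mul ((𝓕 A).continuous.comp continuous_snd)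
  refine ⟨hc.aestronglyMeasurable, measurable_freqA.comp measurable_snd, by fun_prop,
    fun w => by rw [freqA_re]; exact zero_le_one, ?_⟩
  have h1 := (integrable_one_add_norm_pow volume (𝓕 B)).mul_prod
    (integrable_one_add_norm_pow volume (𝓕 A))
  refine (h1.const_mul ((2 + 4 * Real.pi) ^ 2)).mono' ?_ (Eventually.of_forall fun w => ?_)
  · have := measurable_freqA
    refine AEStronglyMeasurable.mul (Measurable.aestronglyMeasurable ?_)
      hc.norm.aestronglyMeasurable
    fun_prop
  · rw [Real.norm_of_nonneg (by positivity)]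
    have e1 := norm_freqA_le w.2
    have e2 : ‖(2 * Real.pi) • w.1‖ = 2 * Real.pi * ‖w.1‖ := by
      rw [norm_smul, Real.norm_of_nonneg (by positivity)]
    have e3 : 1 + ‖freqA w.2‖ + ‖(2 * Real.pi) • w.1‖ ≤
        (2 + 4 * Real.pi) * ((1 + ‖w.1‖) * (1 + ‖w.2‖)) := by
      rw [e2]
      have := Real.pi_pos
      have h3 : 0 ≤ ‖w.1‖ := norm_nonneg _
      have h4 : 0 ≤ |w.2| := abs_nonneg _
      rw [Real.norm_eq_abs]
      have h5 : 0 ≤ Real.pi * ‖w.1‖ := by positivity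
      have h6 : 0 ≤ Real.pi * |w.2| := by positivity
      have h7 : 0 ≤ ‖w.1‖ * |w.2| := by positivity
      have h8 : 0 ≤ Real.pi * (‖w.1‖ * |w.2|) := by positivity
      nlinarith
    have e4 := pow_le_pow_left₀ (by positivity) e3 2
    unfold tensorAmp
    rw [norm_mul]
    calc _ ≤ ((2 + 4 * Real.pi) * ((1 + ‖w.1‖) * (1 + ‖w.2‖))) ^ 2 * (‖𝓕 B w.1‖ * ‖𝓕 A w.2‖) :=
          mul_le_mul_of_nonneg_right e4 (by positivity)
      _ = _ := by ring

theorem schwartz_inversion {V : Type*} [NormedAddCommGroup V] [InnerProductSpace ℝ V]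
    [MeasurableSpace V] [BorelSpace V] [FiniteDimensional ℝ V] (A : 𝓢(V, ℂ)) (x : V) :
    ∫ v, 𝓕 A v * Complex.exp ((2 * Real.pi * inner ℝ v x : ℝ) * Complex.I) = A x := by
  have h := A.continuous.fourierInv_fourier_eq A.integrable
    (by rw [← fourier_coe]; exact (𝓕 A).integrable)
  have h2 := congrFun h x
  rw [Real.fourierInv_eq'] at h2
  rw [← h2]
  refine integral_congr_ae (Eventually.of_forall fun v => ?_)
  simp only [smul_eq_mul, fourier_coe]
  rw [mul_comm]

theorem superpose_tensor_zero (A : 𝓢(ℝ, ℂ)) (B : 𝓢(E k, ℂ)) (r : ℝ) (σ : E k) :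
    superpose (volume : Measure (E k × ℝ)) α (tensorAmp A B) (fun w => freqA w.2)
      (fun w => (2 * Real.pi) • w.1) (fun _ _ _ => 1) r σ 0 =
      B σ * (Complex.exp (-(r ^ 2) : ℝ) * A (r ^ 2)) := by
  unfold superpose
  have e : ∀ w : E k × ℝ, tensorAmp A B w * (1 * mode α (freqA w.2) ((2 * Real.pi) • w.1) r σ 0) =
      (𝓕 B w.1 * Complex.exp ((2 * Real.pi * inner ℝ w.1 σ : ℝ) * Complex.I)) *
      (Complex.exp (-(r ^ 2) : ℝ) * (𝓕 A w.2 * Complex.exp ((2 * Real.pi * inner ℝ w.2 (r ^ 2) : ℝ) *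
        Complex.I))) := by
    intro w
    rw [mode_zero, exp_freqA, tensorAmp, real_inner_smul_left]
    have h2 : (inner ℝ w.2 (r ^ 2) : ℝ) = r ^ 2 * w.2 := by simp
    rw [h2]

    rw [mul_comm Complex.I]
    ring
  simp_rw [e]
  rw [← schwartz_inversion A (r ^ 2), ← schwartz_inversion B σ, ← integral_const_mul]
  exact integral_prod_mul (L := ℂ) (μ := (volume : Measure (E k))) (ν := (volume : Measure ℝ))
    (fun v : E k => 𝓕 B v * Complex.exp ((2 * Real.pi * inner ℝ v σ : ℝ) * Complex.I))
    (fun x : ℝ => Complex.exp (-(r ^ 2) : ℝ) * (𝓕 A x *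
      Complex.exp ((2 * Real.pi * inner ℝ x (r ^ 2) : ℝ) * Complex.I)))

/-- Moves the Fourier transform to the test function, so that the kernel can be tested before it is
known to be integrable. -/
theorem integral_kernF_mul (hα : 0 < α) (ht : 0 < t) (r ρ : ℝ) (B : 𝓢(E k, ℂ)) :
    ∫ η, kernF α t r ρ η * B η = ∫ v, symF α t r ρ v * 𝓕 B v := by
  have := VectorFourier.integral_fourierIntegral_smul_eq_flip (𝕜 := ℝ) (L := innerₗ (E k))
    (e := Real.fourierChar) (μ := volume) (ν := volume) (f := symF (k := k) α t r ρ) (g := B)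
    Real.continuous_fourierChar continuous_inner (integrable_symF hα ht r ρ) B.integrable
  rw [flip_innerₗ] at this
  exact this

/-- Fourier inversion of `A` in `s = ρ²` writes the data as Gaussians with complex parameter, and
two exchanges of integrals reduce to `integral_radialSym_mul_cexp`. The point `σ = 0` is enough
because the equation is invariant under translation in `σ`. -/
theorem integral_kernF_tensor (hα : 0 < α) (ht : 0 < t) (r : ℝ) (A : 𝓢(ℝ, ℂ)) (B : 𝓢(E k, ℂ)) :
    ∫ ρ in Ioi (0 : ℝ), ((ρ ^ (2 * α - 1) : ℝ) : ℂ) * (Complex.exp (-(ρ ^ 2) : ℝ) * A (ρ ^ 2)) *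
      ∫ η, kernF α t r ρ η * B η =
      superpose (volume : Measure (E k × ℝ)) α (tensorAmp A B) (fun w => freqA w.2)
      (fun w => (2 * Real.pi) • w.1) (fun _ _ _ => 1) r 0 t := by
  obtain ⟨M, hM⟩ : ∃ M, ∀ x, ‖A x‖ ≤ M := by
    obtain ⟨C, hC⟩ := A.decay 0 0
    exact ⟨C, fun x => by simpa using hC.2 x⟩
  have hA := A.continuous
  have i1 := integrable_prod_radialSym (X := E k) (μ := volume) hα ht r
    (w := fun v => Real.pi * ‖v‖) (by fun_prop)
    (f := fun p : ℝ × E k => Complex.exp (-(p.1 ^ 2) : ℝ) * A (p.1 ^ 2)) (by fun_prop) (M := M)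
    (fun p _ => by
      rw [norm_mul, ← Complex.ofReal_exp, Complex.norm_real, Real.norm_of_nonneg (Real.exp_pos _).le]
      exact (mul_le_of_le_one_left (norm_nonneg _) (Real.exp_le_one_iff.2
        (by linarith [sq_nonneg p.1]))).trans (hM _))
    (𝓕 B).integrable
  have s1 : ∀ ρ : ℝ, ((ρ ^ (2 * α - 1) : ℝ) : ℂ) * (Complex.exp (-(ρ ^ 2) : ℝ) * A (ρ ^ 2)) *
      ∫ η, kernF α t r ρ η * B η = ∫ v : E k, ((radialSym α (Real.pi * ‖v‖) t r ρ *
        ρ ^ (2 * α - 1) : ℝ) : ℂ) * (Complex.exp (-(ρ ^ 2) : ℝ) * A (ρ ^ 2)) * 𝓕 B v := by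
    intro ρ
    rw [integral_kernF_mul hα ht, ← integral_const_mul]
    refine integral_congr_ae (Eventually.of_forall fun v => ?_)
    simp only [symF]
    push_cast
    ring
  simp_rw [s1]
  rw [integral_integral_swap i1]
  have s2 : ∀ v : E k, ∫ ρ in Ioi (0 : ℝ), ((radialSym α (Real.pi * ‖v‖) t r ρ *
      ρ ^ (2 * α - 1) : ℝ) : ℂ) * (Complex.exp (-(ρ ^ 2) : ℝ) * A (ρ ^ 2)) * 𝓕 B v =
      ∫ x : ℝ, 𝓕 B v * 𝓕 A x * gaussEvol α (freqA x) (Real.pi * ‖v‖) (r ^ 2) t := by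
    intro v
    have i2 := integrable_prod_radialSym (X := ℝ) (μ := volume) hα ht r
      (w := fun _ => Real.pi * ‖v‖) (by fun_prop)
      (f := fun p : ℝ × ℝ => Complex.exp (-freqA p.2 * (p.1 ^ 2 : ℝ)))
      (by have := measurable_freqA; fun_prop) (M := 1)
      (fun p _ => by
        rw [Complex.norm_exp, Complex.re_mul_ofReal, Complex.neg_re, freqA_re]
        exact Real.exp_le_one_iff.2 (by linarith [sq_nonneg p.1]))
      (𝓕 A).integrable
    have s3 : ∀ ρ : ℝ, ((radialSym α (Real.pi * ‖v‖) t r ρ * ρ ^ (2 * α - 1) : ℝ) : ℂ) *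
        (Complex.exp (-(ρ ^ 2) : ℝ) * A (ρ ^ 2)) = ∫ x : ℝ, ((radialSym α (Real.pi * ‖v‖) t r ρ *
          ρ ^ (2 * α - 1) : ℝ) : ℂ) * Complex.exp (-freqA x * (ρ ^ 2 : ℝ)) * 𝓕 A x := by
      intro ρ
      rw [← schwartz_inversion A (ρ ^ 2), ← integral_const_mul, ← integral_const_mul]
      refine integral_congr_ae (Eventually.of_forall fun x => ?_)
      simp only
      rw [exp_freqA]
      have h2 : (inner ℝ x (ρ ^ 2) : ℝ) = ρ ^ 2 * x := by simp
      rw [h2]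
      ring
    rw [integral_mul_const]
    simp_rw [s3]
    rw [integral_integral_swap i2, ← integral_mul_const]
    refine integral_congr_ae (Eventually.of_forall fun x => ?_)
    simp only
    rw [integral_mul_const, ← integral_radialSym_mul_cexp hα (Real.pi * ‖v‖) ht r
      (by rw [freqA_re]; exact one_pos)]
    have : ∀ ρ : ℝ, Complex.exp (-freqA x * (ρ ^ 2 : ℝ)) *
        ((radialSym α (Real.pi * ‖v‖) t r ρ * ρ ^ (2 * α - 1) : ℝ) : ℂ) =
        ((radialSym α (Real.pi * ‖v‖) t r ρ * ρ ^ (2 * α - 1) : ℝ) : ℂ) *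
        Complex.exp (-freqA x * (ρ ^ 2 : ℝ)) := fun ρ => mul_comm _ _
    simp_rw [this]
    ring
  simp_rw [s2]
  have hamp := isAmplitude_tensor A B
  have hi := hamp.integrable hα hamp.isMultiplier_one r 0 ht.le
  unfold superpose
  rw [Measure.volume_eq_prod] at hi ⊢
  rw [integral_prod _ hi]
  refine integral_congr_ae (Eventually.of_forall fun v => integral_congr_ae
    (Eventually.of_forall fun x => ?_))
  simp only [tensorAmp, mode, inner_zero_right, Complex.ofReal_zero, mul_zero, Complex.exp_zero,
    one_mul]
  congr 2
  rw [norm_smul, Real.norm_of_nonneg (by positivity)]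
  ring

end tensor

end BaouendiGrushin

namespace BaouendiGrushin

open Filter Topology FourierTransform SchwartzMap

/-! ### Positivity of the heat kernel -/

/-- Gaussian summation of the Fourier integral converges to `f 0` at a point of continuity. As the
transform is nonnegative, Fatou's lemma bounds its full integral by `f 0`. -/
theorem integrable_fourier_of_nonneg {V : Type*} [NormedAddCommGroup V] [InnerProductSpace ℝ V]
    [MeasurableSpace V] [BorelSpace V] [FiniteDimensional ℝ V] {f : V → ℂ} (hf : Integrable f)
    (hc : ContinuousAt f 0) {g : V → ℝ} (hg : ∀ v, 𝓕 f v = g v) (hg0 : ∀ v, 0 ≤ g v) :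
    Integrable (𝓕 f) := by
  have hcont : Continuous (𝓕 f) := VectorFourier.fourierIntegral_continuous
    Real.continuous_fourierChar continuous_inner hf
  have hgc : Continuous g := by
    have : g = fun v => (𝓕 f v).re := by ext v; rw [hg, Complex.ofReal_re]
    rw [this]; exact Complex.continuous_re.comp hcont
  have key : Tendsto (fun n : ℕ => ∫ w : V, Complex.exp (-(((n : ℝ) + 1 : ℝ)⁻¹ : ℂ) * ‖w‖ ^ 2 +
      2 * Real.pi * Complex.I * (inner ℝ (0 : V) w : ℝ)) * 𝓕 f w) atTop (𝓝 (f 0)) := by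
    have h1 := (Real.tendsto_integral_gaussian_smul' hf hc).comp
      (tendsto_atTop_add_const_right atTop (1 : ℝ) tendsto_natCast_atTop_atTop)
    refine h1.congr fun n => ?_
    have hc : (0 : ℝ) < (n : ℝ) + 1 := by positivity
    simp only [Function.comp]
    generalize (n : ℝ) + 1 = c at hc
    have hcre : 0 < ((c : ℂ)⁻¹).re := by rw [← Complex.ofReal_inv, Complex.ofReal_re]; positivity
    have J : Integrable (fun w : V => Complex.exp (-(c : ℂ)⁻¹ * ‖w‖ ^ 2 +
        2 * Real.pi * Complex.I * (inner ℝ (0 : V) w : ℝ))) :=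
      GaussianFourier.integrable_cexp_neg_mul_sq_norm_add hcre _ _
    have e := VectorFourier.integral_fourierIntegral_smul_eq_flip (𝕜 := ℝ) (L := innerₗ V)
      (e := Real.fourierChar) (μ := volume) (ν := volume)
      Real.continuous_fourierChar continuous_inner J hf
    rw [flip_innerₗ] at e
    simp only [smul_eq_mul] at e
    refine Eq.trans ?_ e
    refine integral_congr_ae (Eventually.of_forall fun w => ?_)
    simp only [smul_eq_mul]
    congr 1
    have := fourier_gaussian_innerProductSpace' (V := V) hcre (0 : V) w
    refine Eq.trans ?_ this.symm
    congr 1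
    · simp
    · simp; ring_nf
  have hpos : ∀ n : ℕ, ∫⁻ w : V, ENNReal.ofReal (Real.exp (-((n : ℝ) + 1)⁻¹ * ‖w‖ ^ 2) * g w) =
      ENNReal.ofReal (∫ w : V, Complex.exp (-(((n : ℝ) + 1 : ℝ)⁻¹ : ℂ) * ‖w‖ ^ 2 +
      2 * Real.pi * Complex.I * (inner ℝ (0 : V) w : ℝ)) * 𝓕 f w).re := by
    intro n
    have e : ∀ w : V, Complex.exp (-(((n : ℝ) + 1 : ℝ)⁻¹ : ℂ) * ‖w‖ ^ 2 +
      2 * Real.pi * Complex.I * (inner ℝ (0 : V) w : ℝ)) * 𝓕 f w =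
      ((Real.exp (-((n : ℝ) + 1)⁻¹ * ‖w‖ ^ 2) * g w : ℝ) : ℂ) := by
      intro w
      rw [hg]
      simp
    simp_rw [e]
    rw [integral_complex_ofReal, Complex.ofReal_re, ofReal_integral_eq_lintegral_ofReal]
    · have hb : ∀ w, ‖g w‖ ≤ ∫ v, ‖f v‖ := fun w => by
        have := VectorFourier.norm_fourierIntegral_le_integral_norm Real.fourierChar volume
          (innerₗ V) f w
        have h2 : ‖𝓕 f w‖ ≤ ∫ v, ‖f v‖ := this
        rwa [hg, Complex.norm_real] at h2
      have hG : Integrable fun w : V => Real.exp (-((n : ℝ) + 1)⁻¹ * ‖w‖ ^ 2) := by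
        have := (GaussianFourier.integrable_cexp_neg_mul_sq_norm_add (V := V)
          (b := (((n : ℝ) + 1)⁻¹ : ℝ)) (by rw [Complex.ofReal_re]; positivity) 0 0).re
        refine this.congr (Eventually.of_forall fun w => ?_)
        simp only [zero_mul, add_zero]
        have : (-(((n : ℝ) + 1)⁻¹ : ℝ) : ℂ) * (‖w‖ : ℂ) ^ 2 =
          ((-((n : ℝ) + 1)⁻¹ * ‖w‖ ^ 2 : ℝ) : ℂ) := by push_cast; ring
        rw [this]
        exact Complex.exp_ofReal_re _
      exact hG.mul_bdd hgc.aestronglyMeasurable (Eventually.of_forall hb)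
    · exact Eventually.of_forall fun w => mul_nonneg (Real.exp_pos _).le (hg0 w)
  have hfatou : ∫⁻ w : V, ENNReal.ofReal (g w) ≤ ENNReal.ofReal (f 0).re := by
    have h1 : ∀ w : V, ENNReal.ofReal (g w) = liminf (fun n : ℕ =>
        ENNReal.ofReal (Real.exp (-((n : ℝ) + 1)⁻¹ * ‖w‖ ^ 2) * g w)) atTop := by
      intro w
      refine (Tendsto.liminf_eq ?_).symm
      refine ENNReal.tendsto_ofReal ?_
      have h2 : Tendsto (fun n : ℕ => ((n : ℝ) + 1)⁻¹) atTop (𝓝 0) :=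
        tendsto_inv_atTop_zero.comp
          (tendsto_atTop_add_const_right atTop (1 : ℝ) tendsto_natCast_atTop_atTop)
      have h3 : Tendsto (fun n : ℕ => Real.exp (-((n : ℝ) + 1)⁻¹ * ‖w‖ ^ 2) * g w) atTop
          (𝓝 (Real.exp (-0 * ‖w‖ ^ 2) * g w)) :=
        ((Real.continuous_exp.tendsto _).comp (h2.neg.mul_const _)).mul_const _
      simpa using h3
    simp_rw [h1]
    refine (lintegral_liminf_le fun n => by fun_prop).trans ?_
    simp_rw [hpos]
    refine le_of_eq (Tendsto.liminf_eq ?_)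
    exact ENNReal.tendsto_ofReal ((Complex.continuous_re.tendsto _).comp key)
  have hgint : Integrable g := by
    refine ⟨hgc.aestronglyMeasurable, ?_⟩
    rw [hasFiniteIntegral_iff_ofReal (Eventually.of_forall hg0)]
    exact hfatou.trans_lt ENNReal.ofReal_lt_top
  have : 𝓕 f = fun v => (g v : ℂ) := funext hg
  rw [this]
  exact hgint.ofReal

section

variable {k : ℕ} {α t : ℝ}

theorem integrableOn_kernF_tensor (hα : 0 < α) (ht : 0 < t) (r : ℝ) (A : 𝓢(ℝ, ℂ)) (B : 𝓢(E k, ℂ)) :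
    IntegrableOn (fun ρ : ℝ => ((ρ ^ (2 * α - 1) : ℝ) : ℂ) *
      (Complex.exp (-(ρ ^ 2) : ℝ) * A (ρ ^ 2)) * ∫ η, kernF α t r ρ η * B η) (Ioi 0) := by
  obtain ⟨M, hM⟩ : ∃ M, ∀ x, ‖A x‖ ≤ M := by
    obtain ⟨C, hC⟩ := A.decay 0 0
    exact ⟨C, fun x => by simpa using hC.2 x⟩
  have hA := A.continuous
  have i1 := integrable_prod_radialSym (X := E k) (μ := volume) hα ht r
    (w := fun v => Real.pi * ‖v‖) (by fun_prop)
    (f := fun p : ℝ × E k => Complex.exp (-(p.1 ^ 2) : ℝ) * A (p.1 ^ 2)) (by fun_prop) (M := M)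
    (fun p _ => by
      rw [norm_mul, ← Complex.ofReal_exp, Complex.norm_real, Real.norm_of_nonneg (Real.exp_pos _).le]
      exact (mul_le_of_le_one_left (norm_nonneg _) (Real.exp_le_one_iff.2
        (by linarith [sq_nonneg p.1]))).trans (hM _))
    (𝓕 B).integrable
  refine i1.integral_prod_left.congr (Eventually.of_forall fun ρ => ?_)
  simp only
  rw [integral_kernF_mul hα ht, ← integral_const_mul]
  refine integral_congr_ae (Eventually.of_forall fun v => ?_)
  simp only [symF]
  push_cast
  ring

/-- Testing the kernel against nonnegative product data. -/
theorem re_integral_kernF_bump_le (hα : 0 < α) (ht : 0 < t) {r : ℝ} (hr : 0 < r) {γ : ℂ}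
    (hγ : γ.re ≤ 0) {a : ℝ → ℝ} {b : E k → ℝ} (ha : ContDiff ℝ ∞ a) (ha' : HasCompactSupport a)
    (ha0 : ∀ x, 0 ≤ a x) (hb : ContDiff ℝ ∞ b) (hb' : HasCompactSupport b) (hb0 : ∀ x, 0 ≤ b x) :
    IntegrableOn (fun ρ : ℝ => ρ ^ (2 * α - 1) * a (ρ ^ 2) *
        ∫ η, (γ * kernF α t r ρ η).re * b η) (Ioi 0) ∧
    ∫ ρ in Ioi (0 : ℝ), ρ ^ (2 * α - 1) * a (ρ ^ 2) * ∫ η, (γ * kernF α t r ρ η).re * b η ≤ 0 := by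
  -- The factor `exp x` compensates the `exp (-s)` carried by the tensor data.
  have hA' : HasCompactSupport fun x : ℝ => ((Real.exp x * a x : ℝ) : ℂ) := by
    refine ha'.mono fun x hx => ?_
    simp only [Function.mem_support, ne_eq, Complex.ofReal_eq_zero, mul_eq_zero, not_or] at hx ⊢
    exact hx.2
  have hB' : HasCompactSupport fun x : E k => (b x : ℂ) := by
    refine hb'.mono fun x hx => ?_
    simpa using hx
  have hA : ContDiff ℝ ∞ fun x : ℝ => ((Real.exp x * a x : ℝ) : ℂ) :=
    Complex.ofRealCLM.contDiff.comp (Real.contDiff_exp.mul ha)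
  have hB : ContDiff ℝ ∞ fun x : E k => (b x : ℂ) := Complex.ofRealCLM.contDiff.comp hb
  set A := hA'.toSchwartzMap hA
  set B := hB'.toSchwartzMap hB
  have eA : ∀ x : ℝ, Complex.exp (-x : ℝ) * A x = a x := fun x => by
    change Complex.exp (-x : ℝ) * ((Real.exp x * a x : ℝ) : ℂ) = a x
    rw [← Complex.ofReal_exp, ← Complex.ofReal_mul, ← mul_assoc, ← Real.exp_add]
    simp
  have eB : ∀ x, B x = b x := fun x => rfl
  have h1 := integrableOn_kernF_tensor hα ht r A B
  have h2 := integral_kernF_tensor hα ht r A B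
  simp only [eA] at h1 h2
  have e3 : ∀ ρ : ℝ, (γ * (((ρ ^ (2 * α - 1) : ℝ) : ℂ) * (a (ρ ^ 2) : ℂ) *
      ∫ η, kernF α t r ρ η * B η)).re = ρ ^ (2 * α - 1) * a (ρ ^ 2) *
        ∫ η, (γ * kernF α t r ρ η).re * b η := by
    intro ρ
    have hi : Integrable fun η => γ * (kernF α t r ρ η * B η) := by
      refine Integrable.const_mul ?_ _
      refine Continuous.integrable_of_hasCompactSupport ?_ ?_
      · exact ((continuous_kernF hα ht r).comp (f := fun η : E k => (ρ, η)) (by fun_prop)).mul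
          B.continuous
      · exact HasCompactSupport.mul_left hB'
    have : ∫ η, (γ * kernF α t r ρ η).re * b η = (∫ η, γ * (kernF α t r ρ η * B η)).re := by
      have := integral_re hi
      simp only [RCLike.re_eq_complex_re] at this
      rw [← this]
      refine integral_congr_ae (Eventually.of_forall fun η => ?_)
      simp only
      rw [eB, ← mul_assoc, Complex.re_mul_ofReal]
    rw [this, integral_const_mul, ← Complex.re_ofReal_mul]
    congr 1
    push_cast
    ring
  have h4 : IntegrableOn (fun ρ : ℝ => (γ * (((ρ ^ (2 * α - 1) : ℝ) : ℂ) * (a (ρ ^ 2) : ℂ) *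
      ∫ η, kernF α t r ρ η * B η)).re) (Ioi 0) := (h1.const_mul γ).re
  refine ⟨h4.congr (Eventually.of_forall e3), ?_⟩
  have h5 := integral_re (h1.const_mul γ)
  simp only [RCLike.re_eq_complex_re] at h5
  simp_rw [← e3]
  rw [h5, integral_const_mul, h2]
  refine (isAmplitude_tensor A B).re_superpose_le hα (fun r hr σ => ?_) hr 0 ht.le
  rw [superpose_tensor_zero, eA, eB, ← Complex.ofReal_mul, Complex.re_mul_ofReal]
  exact mul_nonpos_of_nonpos_of_nonneg hγ (mul_nonneg (hb0 _) (ha0 _))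

/-- A positive value persists in a neighbourhood by continuity, and bumps supported there would make
the tested integral strictly positive, against the maximum principle. Taking `γ = -1` gives
nonnegativity of the real part, and `γ = ±i` gives reality. -/
theorem re_mul_kernF_nonpos (hα : 0 < α) (ht : 0 < t) {r : ℝ} (hr : 0 < r) {γ : ℂ}
    (hγ : γ.re ≤ 0) {ρ : ℝ} (hρ : 0 < ρ) (η : E k) : (γ * kernF α t r ρ η).re ≤ 0 := by
  by_contra! hlt
  have hc : Continuous fun p : ℝ × E k => (γ * kernF α t r p.1 p.2).re :=
    Complex.continuous_re.comp (continuous_const.mul (continuous_kernF hα ht r))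
  have hcη : ∀ ρ, Continuous fun η : E k => (γ * kernF α t r ρ η).re := fun ρ =>
    hc.comp (f := fun η : E k => (ρ, η)) (by fun_prop)
  have hnear : ∀ᶠ p in 𝓝 ((ρ, η) : ℝ × E k), 0 < (γ * kernF α t r p.1 p.2).re :=
    hc.continuousAt.eventually (lt_mem_nhds hlt)
  rw [nhds_prod_eq] at hnear
  obtain ⟨pa, hpa, pb, hpb, hp⟩ := eventually_prod_iff.1 hnear
  obtain ⟨δ, hδ, hpa⟩ := Metric.eventually_nhds_iff_ball.1 hpa
  obtain ⟨ε, hε, hpb⟩ := Metric.eventually_nhds_iff_ball.1 hpb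
  -- The radial bump lives in the variable `s = ρ²`; its radius must be small enough for `√s` to
  -- stay in the `δ`-ball around `ρ`.
  have hsq : ContinuousAt Real.sqrt (ρ ^ 2) := Real.continuous_sqrt.continuousAt
  have hsq' : ∀ᶠ s in 𝓝 (ρ ^ 2), 0 < s ∧ √s ∈ Metric.ball ρ δ := by
    refine (lt_mem_nhds (by positivity)).and (hsq ?_)
    rw [Real.sqrt_sq hρ.le]; exact Metric.ball_mem_nhds _ hδ
  obtain ⟨κ, hκ, hsq'⟩ := Metric.eventually_nhds_iff_ball.1 hsq'
  obtain ⟨fa, hfa⟩ : ∃ fa : ContDiffBump (ρ ^ 2 : ℝ), fa.rOut = κ :=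
    ⟨⟨κ / 2, κ, by positivity, by linarith⟩, rfl⟩
  obtain ⟨fb, hfb⟩ : ∃ fb : ContDiffBump (η : E k), fb.rOut = ε :=
    ⟨⟨ε / 2, ε, by positivity, by linarith⟩, rfl⟩
  obtain ⟨hint, hle⟩ := re_integral_kernF_bump_le hα ht hr hγ (a := fa) (b := fb) fa.contDiff
    fa.hasCompactSupport (fun x => fa.nonneg) fb.contDiff fb.hasCompactSupport (fun x => fb.nonneg)
  have hin : ∀ s, 0 < s → fa (s ^ 2) ≠ 0 → s ∈ Metric.ball ρ δ := by
    intro s hs hne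
    have : s ^ 2 ∈ Function.support fa := hne
    rw [fa.support_eq, hfa] at this
    have := (hsq' _ this).2
    rwa [Real.sqrt_sq hs.le] at this
  have hinner0 : ∀ s, s ∈ Metric.ball ρ δ → ∀ x, 0 ≤ (γ * kernF α t r s x).re * fb x := by
    intro s hs x
    by_cases hx : fb x = 0
    · rw [hx, mul_zero]
    · have : x ∈ Function.support fb := hx
      rw [fb.support_eq, hfb] at this
      exact mul_nonneg (hp (hpa s hs) (hpb x this)).le fb.nonneg
  have hinner : ∀ s, s ∈ Metric.ball ρ δ → 0 < ∫ x, (γ * kernF α t r s x).re * fb x := by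
    intro s hs
    refine Continuous.integral_pos_of_hasCompactSupport_nonneg_nonzero
      ((hcη s).mul fb.continuous) (HasCompactSupport.mul_left fb.hasCompactSupport)
      (hinner0 s hs) (x := η) ?_
    have h1 := hp (hpa s hs) (hpb η (Metric.mem_ball_self hε))
    have h2 : 0 < fb η := fb.pos_of_mem_ball (by rw [hfb]; exact Metric.mem_ball_self hε)
    positivity
  have hnn : ∀ s ∈ Ioi (0 : ℝ), 0 ≤ s ^ (2 * α - 1) * fa (s ^ 2) *
      ∫ x, (γ * kernF α t r s x).re * fb x := by
    intro s hs
    have hs' : (0 : ℝ) < s := hs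
    by_cases hz : fa (s ^ 2) = 0
    · simp [hz]
    · exact mul_nonneg (mul_nonneg (by positivity) fa.nonneg) (hinner s (hin s hs hz)).le
  refine absurd hle (not_le.2 ?_)
  rw [setIntegral_pos_iff_support_of_nonneg_ae
    ((ae_restrict_iff' measurableSet_Ioi).2 (Eventually.of_forall hnn)) hint]
  have hopen : IsOpen ({s : ℝ | s ^ 2 ∈ Metric.ball (ρ ^ 2) κ} ∩ Ioi 0) :=
    (Metric.isOpen_ball.preimage (continuous_pow 2)).inter isOpen_Ioi
  refine (hopen.measure_pos volume ⟨ρ, Metric.mem_ball_self hκ, hρ⟩).trans_le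
    (measure_mono fun s hs => ⟨?_, hs.2⟩)
  have hs' : (0 : ℝ) < s := hs.2
  have h1 : 0 < fa (s ^ 2) := fa.pos_of_mem_ball (by rw [hfa]; exact hs.1)
  have h2 := hinner s (hin s hs' h1.ne')
  exact (mul_pos (mul_pos (Real.rpow_pos_of_pos hs' _) h1) h2).ne'

theorem re_kernF_nonneg (hα : 0 < α) (ht : 0 < t) {r : ℝ} (hr : 0 < r) {ρ : ℝ} (hρ : 0 < ρ)
    (η : E k) : 0 ≤ (kernF α t r ρ η).re := by
  have := re_mul_kernF_nonpos hα ht hr (γ := -1) (by simp) hρ η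
  simp at this
  exact this

theorem kernF_eq_re (hα : 0 < α) (ht : 0 < t) {r : ℝ} (hr : 0 < r) {ρ : ℝ} (hρ : 0 < ρ)
    (η : E k) : kernF α t r ρ η = ((kernF α t r ρ η).re : ℂ) := by
  have h1 := re_mul_kernF_nonpos hα ht hr (γ := Complex.I) (by simp) hρ η
  have h2 := re_mul_kernF_nonpos hα ht hr (γ := -Complex.I) (by simp) hρ η
  simp at h1 h2
  exact Complex.ext (by simp) (by simpa using le_antisymm h2 h1)

theorem integrable_kernF (hα : 0 < α) (ht : 0 < t) {r : ℝ} (hr : 0 < r) {ρ : ℝ} (hρ : 0 < ρ) :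
    Integrable (kernF (k := k) α t r ρ) :=
  integrable_fourier_of_nonneg (integrable_symF hα ht r ρ)
    (continuous_symF_right hα ht r ρ).continuousAt (g := fun η => (kernF α t r ρ η).re)
    (kernF_eq_re hα ht hr hρ) (re_kernF_nonneg hα ht hr hρ)

theorem integral_kernF_mul_exp (hα : 0 < α) (ht : 0 < t) {r : ℝ} (hr : 0 < r) {ρ : ℝ} (hρ : 0 < ρ)
    (v : E k) : ∫ η, kernF α t r ρ η * Complex.exp ((2 * Real.pi * inner ℝ η v : ℝ) * Complex.I) =
      symF α t r ρ v := by
  have h := (continuous_symF_right (k := k) hα ht r ρ).fourierInv_fourier_eq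
    (integrable_symF hα ht r ρ) (integrable_kernF hα ht hr hρ)
  rw [← congrFun h v, Real.fourierInv_eq']
  refine integral_congr_ae (Eventually.of_forall fun η => ?_)
  simp only [smul_eq_mul]
  rw [mul_comm]
  rfl

end

end BaouendiGrushin

namespace BaouendiGrushin

open Filter Topology FourierTransform SchwartzMap

/-! ### The heat semigroup as a family of measures -/

section heatMeasure

variable {k : ℕ} {α r t : ℝ}

/-- The density of the heat measure with respect to `dρ dη`. -/
noncomputable def heatDensity (k : ℕ) (α r t : ℝ) (q : ℝ × E k) : ℝ :=
  q.1 ^ (2 * α - 1) * (kernF α t r q.1 q.2).re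

/-- The distribution at time `t` of the diffusion started from `(r, 0)`. -/
noncomputable def heatMeasure (k : ℕ) (α r t : ℝ) : Measure (ℝ × E k) :=
  if 0 < t then ((volume.restrict (Ioi 0)).prod volume).withDensity
    fun q => ENNReal.ofReal (heatDensity k α r t q)
  else Measure.dirac (r, 0)

theorem heatMeasure_of_pos (ht : 0 < t) : heatMeasure k α r t =
    ((volume.restrict (Ioi 0)).prod volume).withDensity
      fun q => ENNReal.ofReal (heatDensity k α r t q) := if_pos ht

theorem heatMeasure_zero : heatMeasure k α r 0 = Measure.dirac (r, 0) := if_neg (lt_irrefl _)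

theorem ae_fst_pos : ∀ᵐ q : ℝ × E k ∂((volume.restrict (Ioi (0 : ℝ))).prod volume), 0 < q.1 := by
  have : (volume.restrict (Ioi (0 : ℝ))).prod (volume : Measure (E k)) =
      (volume : Measure (ℝ × E k)).restrict (Ioi 0 ×ˢ univ) := by
    rw [Measure.volume_eq_prod, ← Measure.prod_restrict, Measure.restrict_univ]
  rw [this]
  filter_upwards [ae_restrict_mem (measurableSet_Ioi.prod MeasurableSet.univ)] with q hq using hq.1

theorem heatDensity_nonneg (hα : 0 < α) (ht : 0 < t) (hr : 0 < r) {q : ℝ × E k} (hq : 0 < q.1) :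
    0 ≤ heatDensity k α r t q :=
  mul_nonneg (Real.rpow_nonneg hq.le _) (re_kernF_nonneg hα ht hr hq _)

theorem measurable_heatDensity (hα : 0 < α) (ht : 0 < t) : Measurable (heatDensity k α r t) := by
  unfold heatDensity
  have := (continuous_kernF (k := k) hα ht r).measurable
  have h2 : Measurable fun q : ℝ × E k => (kernF α t r q.1 q.2).re :=
    Complex.measurable_re.comp this
  exact Measurable.mul (by fun_prop) h2

/-- Fourier inversion at frequency `0`; together with positivity it gives the mass of the kernel in
`η`. -/
theorem integral_re_kernF (hα : 0 < α) (ht : 0 < t) (hr : 0 < r) {ρ : ℝ} (hρ : 0 < ρ) :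
    ∫ η : E k, (kernF α t r ρ η).re = radialSym α 0 t r ρ := by
  have h := integral_kernF_mul_exp hα ht hr hρ (0 : E k)
  simp only [inner_zero_right, mul_zero, Complex.ofReal_zero, zero_mul, Complex.exp_zero, mul_one,
    symF, norm_zero] at h
  have h2 := integral_re (integrable_kernF (k := k) hα ht hr hρ)
  simp only [RCLike.re_eq_complex_re] at h2
  rw [h2, h, Complex.ofReal_re]

theorem integrable_heatDensity (hα : 0 < α) (ht : 0 < t) (hr : 0 < r) :
    Integrable (heatDensity k α r t) ((volume.restrict (Ioi 0)).prod volume) := by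
  rw [integrable_prod_iff (measurable_heatDensity hα ht).aestronglyMeasurable]
  have hpos : ∀ᵐ ρ ∂(volume.restrict (Ioi (0 : ℝ))), 0 < ρ := ae_restrict_mem measurableSet_Ioi
  constructor
  · filter_upwards [hpos] with ρ hρ
    exact (integrable_kernF hα ht hr hρ).re.const_mul (ρ ^ (2 * α - 1))
  · refine (integrableOn_radialSym hα 0 ht r).congr ?_
    filter_upwards [hpos] with ρ hρ
    rw [← integral_re_kernF (k := k) hα ht hr hρ, mul_comm, ← integral_const_mul]
    refine integral_congr_ae (Eventually.of_forall fun η => ?_)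
    exact (Real.norm_of_nonneg (heatDensity_nonneg hα ht hr (q := (ρ, η)) hρ)).symm

theorem integral_heatDensity_le_one (hα : 0 < α) (ht : 0 < t) (hr : 0 < r) :
    ∫ q, heatDensity k α r t q ∂((volume.restrict (Ioi 0)).prod volume) ≤ 1 := by
  rw [integral_prod _ (integrable_heatDensity hα ht hr)]
  refine le_of_eq_of_le ?_ (integral_radialSym_le_one hα 0 ht r)
  refine setIntegral_congr_fun measurableSet_Ioi fun ρ hρ => ?_
  simp only [heatDensity]
  rw [integral_const_mul, integral_re_kernF hα ht hr hρ, mul_comm]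

theorem heatMeasure_univ_le_one (hα : 0 < α) (hr : 0 < r) : heatMeasure k α r t univ ≤ 1 := by
  by_cases ht : 0 < t
  · rw [heatMeasure_of_pos ht, withDensity_apply _ MeasurableSet.univ, Measure.restrict_univ,
      ← ofReal_integral_eq_lintegral_ofReal (integrable_heatDensity hα ht hr)]
    · exact ENNReal.ofReal_le_one.2 (integral_heatDensity_le_one hα ht hr)
    · filter_upwards [ae_fst_pos] with q hq using heatDensity_nonneg hα ht hr hq
  · rw [heatMeasure, if_neg ht]
    simp

theorem isFiniteMeasure_heatMeasure (hα : 0 < α) (hr : 0 < r) :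
    IsFiniteMeasure (heatMeasure k α r t) :=
  ⟨(heatMeasure_univ_le_one hα hr).trans_lt ENNReal.one_lt_top⟩

theorem ae_heatMeasure (hr : 0 < r) : ∀ᵐ q ∂(heatMeasure k α r t), 0 < q.1 := by
  by_cases ht : 0 < t
  · rw [heatMeasure_of_pos ht]
    exact (withDensity_absolutelyContinuous _ _).ae_le ae_fst_pos
  · rw [heatMeasure, if_neg ht]
    rw [ae_dirac_iff (measurableSet_lt measurable_const measurable_fst)]
    exact hr

theorem aestronglyMeasurable_heatMeasure {f : ℝ × E k → ℂ} (hf : ContinuousOn f (halfSpace k)) :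
    AEStronglyMeasurable f (heatMeasure k α r t) := by
  by_cases ht : 0 < t
  · rw [heatMeasure_of_pos ht]
    refine AEStronglyMeasurable.mono_ac (withDensity_absolutelyContinuous _ _) ?_
    have := hf.aestronglyMeasurable (μ := volume) (measurableSet_Ioi.prod MeasurableSet.univ)
    unfold halfSpace at this
    rwa [Measure.volume_eq_prod, ← Measure.prod_restrict, Measure.restrict_univ] at this
  · rw [heatMeasure, if_neg ht]
    exact aestronglyMeasurable_dirac

theorem norm_integral_heatMeasure_le (hα : 0 < α) (hr : 0 < r) {f : ℝ × E k → ℂ} {C : ℝ}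
    (hC0 : 0 ≤ C) (hC : ∀ q, 0 < q.1 → ‖f q‖ ≤ C) : ‖∫ q, f q ∂(heatMeasure k α r t)‖ ≤ C := by
  have := isFiniteMeasure_heatMeasure (k := k) (t := t) hα hr
  refine (norm_integral_le_of_norm_le_const (C := C) ?_).trans ?_
  · filter_upwards [ae_heatMeasure hr] with q hq using hC q hq
  · refine mul_le_of_le_one_right hC0 ?_
    exact ENNReal.toReal_le_of_le_ofReal zero_le_one (by simpa using heatMeasure_univ_le_one hα hr)

theorem integrable_heatMeasure (hα : 0 < α) (hr : 0 < r) {f : ℝ × E k → ℂ}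
    (hf : AEStronglyMeasurable f (heatMeasure k α r t)) {C : ℝ} (hC : ∀ q, 0 < q.1 → ‖f q‖ ≤ C) :
    Integrable f (heatMeasure k α r t) := by
  have := isFiniteMeasure_heatMeasure (k := k) (t := t) hα hr
  refine Integrable.of_bound hf C ?_
  filter_upwards [ae_heatMeasure hr] with q hq using hC q hq

theorem integral_heatMeasure (hα : 0 < α) (ht : 0 < t) (hr : 0 < r) (f : ℝ × E k → ℂ) :
    ∫ q, f q ∂(heatMeasure k α r t) =
      ∫ q, heatDensity k α r t q * f q ∂((volume.restrict (Ioi 0)).prod volume) := by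
  rw [heatMeasure_of_pos ht, integral_withDensity_eq_integral_toReal_smul
    (measurable_heatDensity hα ht).ennreal_ofReal
    (Eventually.of_forall fun _ => ENNReal.ofReal_lt_top)]
  refine integral_congr_ae ?_
  filter_upwards [ae_fst_pos] with q hq
  rw [ENNReal.toReal_ofReal (heatDensity_nonneg hα ht hr hq), Complex.real_smul]

theorem integrable_heatDensity_mul (hα : 0 < α) (ht : 0 < t) (hr : 0 < r) {f : ℝ × E k → ℂ}
    (hf : Integrable f (heatMeasure k α r t)) :
    Integrable (fun q => heatDensity k α r t q * f q) ((volume.restrict (Ioi 0)).prod volume) := by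
  rw [heatMeasure_of_pos ht, integrable_withDensity_iff_integrable_smul'
    (measurable_heatDensity hα ht).ennreal_ofReal
    (Eventually.of_forall fun _ => ENNReal.ofReal_lt_top)] at hf
  refine hf.congr ?_
  filter_upwards [ae_fst_pos] with q hq
  rw [ENNReal.toReal_ofReal (heatDensity_nonneg hα ht hr hq), Complex.real_smul]

theorem integral_heatMeasure_eq_iterated (hα : 0 < α) (ht : 0 < t) (hr : 0 < r) {f : ℝ × E k → ℂ}
    (hf : Integrable f (heatMeasure k α r t)) :
    ∫ q, f q ∂(heatMeasure k α r t) =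
      ∫ ρ in Ioi (0 : ℝ), (∫ η, kernF α t r ρ η * f (ρ, η)) * ((ρ ^ (2 * α - 1) : ℝ) : ℂ) := by
  rw [integral_heatMeasure hα ht hr, integral_prod _ (integrable_heatDensity_mul hα ht hr hf)]
  refine setIntegral_congr_fun measurableSet_Ioi fun ρ hρ => ?_
  simp only [heatDensity]
  rw [← integral_mul_const]
  refine integral_congr_ae (Eventually.of_forall fun η => ?_)
  simp only
  rw [kernF_eq_re hα ht hr hρ]
  push_cast
  simp only [Complex.ofReal_re]
  ring

theorem integrableOn_kernF (hα : 0 < α) (ht : 0 < t) (hr : 0 < r) {f : ℝ × E k → ℂ}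
    (hf : Integrable f (heatMeasure k α r t)) :
    IntegrableOn (fun ρ : ℝ => (∫ η, kernF α t r ρ η * f (ρ, η)) * ((ρ ^ (2 * α - 1) : ℝ) : ℂ))
      (Ioi 0) := by
  refine (integrable_heatDensity_mul hα ht hr hf).integral_prod_left.congr ?_
  filter_upwards [ae_restrict_mem measurableSet_Ioi] with ρ hρ
  simp only [heatDensity]
  rw [← integral_mul_const]
  refine integral_congr_ae (Eventually.of_forall fun η => ?_)
  simp only
  rw [kernF_eq_re hα ht hr hρ]
  push_cast
  simp only [Complex.ofReal_re]
  ring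

/-- The integral in `η` inverts the Fourier transform and leaves the radial kernel with `w = ‖ξ‖/2`;
the integral in `ρ` is then the Laplace formula. Hence the heat measures propagate every mode. -/
theorem integral_exp_heatMeasure (hα : 0 < α) (hr : 0 < r) (ht : 0 ≤ t) {a : ℂ} (ha : 0 < a.re)
    (ξ : E k) : ∫ q, Complex.exp (-a * (q.1 ^ 2 : ℝ)) * Complex.exp (Complex.I * (inner ℝ ξ q.2 : ℝ))
      ∂(heatMeasure k α r t) = gaussEvol α a (‖ξ‖ / 2) (r ^ 2) t := by
  rcases ht.eq_or_lt with rfl | ht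
  · rw [heatMeasure_zero, integral_dirac, gaussEvol_zero]
    simp
  have hm : Measurable fun q : ℝ × E k => Complex.exp (-a * (q.1 ^ 2 : ℝ)) *
      Complex.exp (Complex.I * (inner ℝ ξ q.2 : ℝ)) := by fun_prop
  have hb : ∀ q : ℝ × E k, 0 < q.1 → ‖Complex.exp (-a * (q.1 ^ 2 : ℝ)) *
      Complex.exp (Complex.I * (inner ℝ ξ q.2 : ℝ))‖ ≤ 1 := fun q _ => by
    rw [norm_mul, mul_comm Complex.I, Complex.norm_exp_ofReal_mul_I, mul_one, Complex.norm_exp,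
      Complex.re_mul_ofReal, Complex.neg_re]
    refine Real.exp_le_one_iff.2 ?_
    nlinarith [mul_nonneg ha.le (sq_nonneg q.1)]
  rw [integral_heatMeasure_eq_iterated hα ht hr
    (integrable_heatMeasure hα hr hm.aestronglyMeasurable hb)]
  rw [← integral_radialSym_mul_cexp hα (‖ξ‖ / 2) ht r ha]
  refine setIntegral_congr_fun measurableSet_Ioi fun ρ hρ => ?_
  simp only
  have h := integral_kernF_mul_exp hα ht hr hρ ((2 * Real.pi)⁻¹ • ξ)
  have h3 : Real.pi * ‖(2 * Real.pi)⁻¹ • ξ‖ = ‖ξ‖ / 2 := by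
    rw [norm_smul, Real.norm_of_nonneg (by positivity)]
    field_simp
  rw [symF, h3] at h
  have h2 : ∫ η, kernF α t r ρ η * (Complex.exp (-a * (ρ ^ 2 : ℝ)) *
      Complex.exp (Complex.I * (inner ℝ ξ η : ℝ))) =
      Complex.exp (-a * (ρ ^ 2 : ℝ)) * (radialSym α (‖ξ‖ / 2) t r ρ : ℂ) := by
    rw [← h, ← integral_const_mul]
    refine integral_congr_ae (Eventually.of_forall fun η => ?_)
    simp only
    rw [real_inner_smul_right, real_inner_comm]
    have : 2 * Real.pi * ((2 * Real.pi)⁻¹ * inner ℝ η ξ) = inner ℝ η ξ := by field_simp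
    rw [this, mul_comm Complex.I]
    ring
  rw [h2]
  push_cast
  ring

/-- The previous identity differentiated in `a`. The factor `r²` is needed because the multiplier of
`∂_t` at time `0` is affine in `r²`. -/
theorem integral_sq_mul_exp_heatMeasure (hα : 0 < α) (hr : 0 < r) (ht : 0 ≤ t) {a : ℂ}
    (ha : 0 < a.re) (ξ : E k) :
    ∫ q, (q.1 ^ 2 : ℝ) * (Complex.exp (-a * (q.1 ^ 2 : ℝ)) *
      Complex.exp (Complex.I * (inner ℝ ξ q.2 : ℝ))) ∂(heatMeasure k α r t) =
      -((-2 * α * mehlerT (‖ξ‖ / 2) t / mehlerD a (‖ξ‖ / 2) t -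
        (r ^ 2 : ℝ) / mehlerD a (‖ξ‖ / 2) t ^ 2) * gaussEvol α a (‖ξ‖ / 2) (r ^ 2) t) := by
  have hfin := isFiniteMeasure_heatMeasure (k := k) (t := t) hα hr
  have hf : Integrable (fun q : ℝ × E k => Complex.exp (Complex.I * (inner ℝ ξ q.2 : ℝ)))
      (heatMeasure k α r t) := by
    refine Integrable.of_bound (by fun_prop) 1 (Eventually.of_forall fun q => ?_)
    rw [mul_comm Complex.I, Complex.norm_exp_ofReal_mul_I]
  have h1 := hasDerivAt_laplace (μ := heatMeasure k α r t) (g := fun q : ℝ × E k => q.1 ^ 2)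
    (by fun_prop) (Eventually.of_forall fun q => sq_nonneg _) hf ha
  have h2 := hasDerivAt_gaussEvol_param α ha.le (‖ξ‖ / 2) (r ^ 2) ht
  have h3 : (fun a : ℂ => ∫ q, Complex.exp (-a * (q.1 ^ 2 : ℝ)) *
      Complex.exp (Complex.I * (inner ℝ ξ q.2 : ℝ)) ∂(heatMeasure k α r t)) =ᶠ[𝓝 a]
      fun a => gaussEvol α a (‖ξ‖ / 2) (r ^ 2) t := by
    filter_upwards [(isOpen_lt continuous_const Complex.continuous_re).mem_nhds ha] with b hb
    exact integral_exp_heatMeasure hα hr ht hb ξ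
  have h4 := h1.unique (h2.congr_of_eventuallyEq h3)
  rw [← h4, ← integral_neg]
  refine integral_congr_ae (Eventually.of_forall fun q => ?_)
  simp only
  push_cast
  ring

variable {W : Type*} [MeasurableSpace W] {ν : Measure W} [SFinite ν] {h a : W → ℂ} {ξ : W → E k}

/-- The heat measure propagates the superposition of modes with multiplier `q`. -/
theorem IsAmplitude.integral_superpose (ha : IsAmplitude ν h a ξ) (hα : 0 < α) (hr : 0 < r)
    {q : W → ℝ → ℝ → ℂ} (σ : E k) {C : ℝ}
    (hmeas : Measurable fun p : W × ℝ => q p.1 p.2 0)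
    (hbound : ∀ w ρ, ‖q w ρ 0‖ * Real.exp (-(a w).re * ρ ^ 2) ≤ C * (1 + ‖a w‖ + ‖ξ w‖) ^ 2)
    (hmode : ∀ w, ∫ p, q w p.1 0 * mode α (a w) (ξ w) p.1 (σ + p.2) 0 ∂(heatMeasure k α r t) =
      q w r t * mode α (a w) (ξ w) r σ t) :
    ∫ p, superpose ν α h a ξ q p.1 (σ + p.2) 0 ∂(heatMeasure k α r t) =
      superpose ν α h a ξ q r σ t := by
  have hfin := isFiniteMeasure_heatMeasure (k := k) (t := t) hα hr
  have ma := ha.meas_a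
  have mξ := ha.meas_ξ
  have hmm : Measurable fun x : (ℝ × E k) × W => q x.2 x.1.1 0 *
      mode α (a x.2) (ξ x.2) x.1.1 (σ + x.1.2) 0 := by
    simp only [mode_zero]
    have m1 : Measurable fun x : (ℝ × E k) × W => q x.2 x.1.1 0 :=
      hmeas.comp (f := fun x : (ℝ × E k) × W => (x.2, x.1.1)) (by fun_prop)
    have m2 : Measurable fun x : (ℝ × E k) × W => (inner ℝ (ξ x.2) (σ + x.1.2) : ℝ) := by
      exact Measurable.inner (by fun_prop) (by fun_prop)
    fun_prop
  have hint : Integrable (fun x : (ℝ × E k) × W => h x.2 * (q x.2 x.1.1 0 *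
      mode α (a x.2) (ξ x.2) x.1.1 (σ + x.1.2) 0)) ((heatMeasure k α r t).prod ν) := by
    have hg : Integrable (fun x : (ℝ × E k) × W => C * ((1 + ‖a x.2‖ + ‖ξ x.2‖) ^ 2 * ‖h x.2‖))
        ((heatMeasure k α r t).prod ν) := (ha.moment.comp_snd _).const_mul C
    refine hg.mono' ?_ (Eventually.of_forall fun x => ?_)
    · exact (ha.meas.comp_snd).mul hmm.aestronglyMeasurable
    · rw [norm_mul, norm_mul, mode_zero, norm_mul, mul_comm Complex.I,
        Complex.norm_exp_ofReal_mul_I, one_mul, Complex.norm_exp, Complex.re_mul_ofReal,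
        Complex.neg_re]
      calc _ ≤ ‖h x.2‖ * (C * (1 + ‖a x.2‖ + ‖ξ x.2‖) ^ 2) :=
            mul_le_mul_of_nonneg_left (hbound _ _) (norm_nonneg _)
        _ = _ := by ring
  unfold superpose
  rw [integral_integral_swap hint]
  refine integral_congr_ae (Eventually.of_forall fun w => ?_)
  simp only
  rw [integral_const_mul, hmode]

theorem mode_add (a : ℂ) (ξ : E k) (ρ : ℝ) (σ η : E k) : mode α a ξ ρ (σ + η) 0 =
    Complex.exp (Complex.I * (inner ℝ ξ σ : ℝ)) * (Complex.exp (-a * (ρ ^ 2 : ℝ)) *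
      Complex.exp (Complex.I * (inner ℝ ξ η : ℝ))) := by
  rw [mode_zero, inner_add_right, Complex.ofReal_add, mul_add, Complex.exp_add]
  ring

theorem integral_mode (hα : 0 < α) (hr : 0 < r) (ht : 0 ≤ t) {a : ℂ} (ha : 0 < a.re) (ξ : E k)
    (σ : E k) : ∫ p, mode α a ξ p.1 (σ + p.2) 0 ∂(heatMeasure k α r t) = mode α a ξ r σ t := by
  simp_rw [mode_add]
  rw [integral_const_mul, integral_exp_heatMeasure hα hr ht ha]
  rfl

theorem integral_mode_mul_sq (hα : 0 < α) (hr : 0 < r) (ht : 0 ≤ t) {a : ℂ} (ha : 0 < a.re)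
    (ξ : E k) (σ : E k) :
    ∫ p, (p.1 ^ 2 : ℝ) * mode α a ξ p.1 (σ + p.2) 0 ∂(heatMeasure k α r t) =
      -((-2 * α * mehlerT (‖ξ‖ / 2) t / mehlerD a (‖ξ‖ / 2) t -
        (r ^ 2 : ℝ) / mehlerD a (‖ξ‖ / 2) t ^ 2) * mode α a ξ r σ t) := by
  have : ∀ p : ℝ × E k, ((p.1 ^ 2 : ℝ) : ℂ) * mode α a ξ p.1 (σ + p.2) 0 =
      Complex.exp (Complex.I * (inner ℝ ξ σ : ℝ)) * ((p.1 ^ 2 : ℝ) * (Complex.exp (-a *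
        (p.1 ^ 2 : ℝ)) * Complex.exp (Complex.I * (inner ℝ ξ p.2 : ℝ)))) := fun p => by
    rw [mode_add]; ring
  simp_rw [this]
  rw [integral_const_mul, integral_sq_mul_exp_heatMeasure hα hr ht ha, mode]
  ring

theorem mehlerA_zero (a : ℂ) (w : ℝ) : mehlerA a w 0 = a := by
  simp [mehlerA, mehlerD, mehlerT, mehlerN]

theorem multT_zero {X : Type*} (a : X → ℂ) (ξ : X → E k) (α : ℝ) (w : X) (ρ : ℝ) : multT a ξ α w ρ 0 =
    -4 * α * a w - ((‖ξ w‖ / 2 : ℝ) ^ 2 - 4 * a w ^ 2) * (ρ ^ 2 : ℝ) := by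
  rw [multT, mehlerA_zero]

theorem integrable_sq_mul_mode (hα : 0 < α) (hr : 0 < r) {a : ℂ} (ha : a.re = 1) (ξ : E k)
    (σ : E k) : Integrable (fun p : ℝ × E k => ((p.1 ^ 2 : ℝ) : ℂ) * mode α a ξ p.1 (σ + p.2) 0)
      (heatMeasure k α r t) := by
  refine integrable_heatMeasure hα hr (C := 1) ?_ fun q _ => ?_
  · simp only [mode_zero]
    exact Continuous.aestronglyMeasurable (by fun_prop)
  · rw [norm_mul, mode_zero, norm_mul, mul_comm Complex.I, Complex.norm_exp_ofReal_mul_I, one_mul,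
      Complex.norm_exp, Complex.re_mul_ofReal, Complex.neg_re, ha, Complex.norm_real,
      Real.norm_of_nonneg (by positivity), neg_mul]
    simpa using mul_exp_neg_le (x := q.1 ^ 2) one_pos

theorem IsAmplitude.integral_superpose_one (ha : IsAmplitude ν h a ξ) (hα : 0 < α) (hr : 0 < r)
    (ht : 0 ≤ t) (ha1 : ∀ w, (a w).re = 1) (σ : E k) :
    ∫ p, superpose ν α h a ξ (fun _ _ _ => 1) p.1 (σ + p.2) 0 ∂(heatMeasure k α r t) =
      superpose ν α h a ξ (fun _ _ _ => 1) r σ t := by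
  refine ha.integral_superpose hα hr σ measurable_const (C := 1) (fun w ρ => ?_) fun w => ?_
  · have h1 : 1 ≤ 1 + ‖a w‖ + ‖ξ w‖ := by linarith [norm_nonneg (a w), norm_nonneg (ξ w)]
    rw [ha1, norm_one, one_mul, one_mul]
    exact (Real.exp_le_one_iff.2 (by nlinarith [sq_nonneg ρ])).trans (one_le_pow₀ h1)
  · simp only [one_mul]
    exact integral_mode hα hr ht (by rw [ha1]; exact one_pos) _ _

theorem IsAmplitude.integral_superpose_s (ha : IsAmplitude ν h a ξ) (hα : 0 < α) (hr : 0 < r)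
    (ht : 0 ≤ t) (ha1 : ∀ w, (a w).re = 1) (σ y : E k) (n : ℕ) (hn : n ≤ 2) :
    ∫ p, superpose ν α h a ξ (fun w _ _ => (Complex.I * (inner ℝ (ξ w) y : ℝ)) ^ n) p.1 (σ + p.2) 0
        ∂(heatMeasure k α r t) =
      superpose ν α h a ξ (fun w _ _ => (Complex.I * (inner ℝ (ξ w) y : ℝ)) ^ n) r σ t := by
  have mξ := ha.meas_ξ
  obtain ⟨C, hC⟩ := (ha.isMultiplier_s y n hn).bound 0 le_rfl
  refine ha.integral_superpose hα hr σ (by fun_prop) (C := C) (fun w ρ => ?_) fun w => ?_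
  · refine (mul_le_of_le_one_right (norm_nonneg _) ?_).trans (hC w 0 0 (by simp) le_rfl)
    rw [ha1]
    exact Real.exp_le_one_iff.2 (by nlinarith [sq_nonneg ρ])
  · rw [integral_const_mul, integral_mode hα hr ht (by rw [ha1]; exact one_pos)]

/-- The evolution commutes with its generator. At time `0` the multiplier is affine in `ρ²`, so the
two moments just computed suffice, and `gaussEvol_time_eq_param` identifies the result. -/
theorem IsAmplitude.integral_superpose_t (ha : IsAmplitude ν h a ξ) (hα : 0 < α) (hr : 0 < r)
    (ht : 0 ≤ t) (ha1 : ∀ w, (a w).re = 1) (σ : E k) :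
    ∫ p, superpose ν α h a ξ (multT a ξ α) p.1 (σ + p.2) 0 ∂(heatMeasure k α r t) =
      superpose ν α h a ξ (multT a ξ α) r σ t := by
  have mξ := ha.meas_ξ
  have ma := ha.meas_a
  obtain ⟨C, hC⟩ := (ha.isMultiplier_t α).bound 1 zero_le_one
  have hfin := isFiniteMeasure_heatMeasure (k := k) (t := t) hα hr
  refine ha.integral_superpose hα hr σ (by simp only [multT_zero]; fun_prop) (C := 2 * C + C)
    (fun w ρ => ?_) fun w => ?_
  · have e0 := hC w 0 0 (by simp) le_rfl
    have e1 := hC w 1 0 (by simp) le_rfl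
    -- An affine function of `ρ²` is interpolated from `ρ = 0` and `ρ = 1`, where the multiplier
    -- bound applies; the factor `exp (-ρ²)` absorbs the growth in `ρ`.
    have e2 : multT a ξ α w ρ 0 = (1 - (ρ ^ 2 : ℝ)) * multT a ξ α w 0 0 +
        (ρ ^ 2 : ℝ) * multT a ξ α w 1 0 := by
      simp only [multT_zero]; push_cast; ring
    have e3 := mul_exp_neg_le (x := ρ ^ 2) one_pos
    have e4 : Real.exp (-(1 * ρ ^ 2)) ≤ 1 := Real.exp_le_one_iff.2 (by nlinarith [sq_nonneg ρ])
    rw [ha1]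
    have e5 : -(1 : ℝ) * ρ ^ 2 = -(1 * ρ ^ 2) := by ring
    rw [e5]
    have e6 : ‖multT a ξ α w ρ 0‖ ≤ (1 + ρ ^ 2) * (C * (1 + ‖a w‖ + ‖ξ w‖) ^ 2) +
        ρ ^ 2 * (C * (1 + ‖a w‖ + ‖ξ w‖) ^ 2) := by
      rw [e2]
      refine (norm_add_le _ _).trans (add_le_add ?_ ?_)
      · rw [norm_mul]
        refine mul_le_mul ?_ e0 (norm_nonneg _) (by positivity)
        refine (norm_sub_le _ _).trans ?_
        rw [norm_one, Complex.norm_real, Real.norm_of_nonneg (by positivity)]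
      · rw [norm_mul, Complex.norm_real, Real.norm_of_nonneg (by positivity)]
        exact mul_le_mul_of_nonneg_left e1 (by positivity)
    have e7 : 0 ≤ C * (1 + ‖a w‖ + ‖ξ w‖) ^ 2 := (norm_nonneg _).trans e0
    calc _ ≤ ((1 + ρ ^ 2) * (C * (1 + ‖a w‖ + ‖ξ w‖) ^ 2) +
        ρ ^ 2 * (C * (1 + ‖a w‖ + ‖ξ w‖) ^ 2)) * Real.exp (-(1 * ρ ^ 2)) :=
          mul_le_mul_of_nonneg_right e6 (Real.exp_pos _).le
      _ = (Real.exp (-(1 * ρ ^ 2)) + 2 * (ρ ^ 2 * Real.exp (-(1 * ρ ^ 2)))) *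
          (C * (1 + ‖a w‖ + ‖ξ w‖) ^ 2) := by ring
      _ ≤ (1 + 2 * (1 / 1)) * (C * (1 + ‖a w‖ + ‖ξ w‖) ^ 2) := by gcongr
      _ = _ := by ring
  · have hre : 0 < (a w).re := by rw [ha1]; exact one_pos
    have hi : Integrable (fun p : ℝ × E k => mode α (a w) (ξ w) p.1 (σ + p.2) 0)
        (heatMeasure k α r t) := by
      refine integrable_heatMeasure hα hr (C := 1) ?_ fun q _ => norm_mode_le hα hre.le _ _ _ le_rfl
      simp only [mode_zero]
      exact Continuous.aestronglyMeasurable (by fun_prop)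
    have e : ∀ p : ℝ × E k, multT a ξ α w p.1 0 * mode α (a w) (ξ w) p.1 (σ + p.2) 0 =
        (-4 * α * a w) * mode α (a w) (ξ w) p.1 (σ + p.2) 0 +
        (-((‖ξ w‖ / 2 : ℝ) ^ 2 - 4 * a w ^ 2)) * ((p.1 ^ 2 : ℝ) *
          mode α (a w) (ξ w) p.1 (σ + p.2) 0) := fun p => by
      rw [multT_zero]; ring
    simp_rw [e]
    rw [integral_add (hi.const_mul _) ((integrable_sq_mul_mode hα hr (ha1 w) _ _).const_mul _),
      integral_const_mul, integral_const_mul, integral_mode hα hr ht hre,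
      integral_mode_mul_sq hα hr ht hre, multT, gaussEvol_time_eq_param α hre.le _ _ ht]
    push_cast
    ring

end heatMeasure

end BaouendiGrushin

namespace BaouendiGrushin

open Filter Topology

/-! ### Functions of `(s, σ)`, `s = r²`, with bounded derivatives -/

section tame

variable {k : ℕ}

/-- The coordinate vectors of `ℝ × ℝ^k`. -/
noncomputable def dirVec {k : ℕ} : Option (Fin k) → ℝ × E k
  | none => (1, 0)
  | some i => (0, EuclideanSpace.single i 1)

/-- The partial derivative in a coordinate direction. -/
noncomputable def pd (d : Option (Fin k)) (F : ℝ × E k → ℂ) (p : ℝ × E k) : ℂ :=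
  fderiv ℝ F p (dirVec d)

/-- Iterated partial derivatives, the head of the list being applied first. -/
noncomputable def iterPd : List (Option (Fin k)) → (ℝ × E k → ℂ) → ℝ × E k → ℂ
  | [], F => F
  | d :: L, F => iterPd L (pd d F)

theorem isOpen_halfSpace : IsOpen (halfSpace k) := isOpen_Ioi.prod isOpen_univ

theorem halfSpace_mem_nhds {p : ℝ × E k} (hp : p ∈ halfSpace k) : halfSpace k ∈ 𝓝 p :=
  isOpen_halfSpace.mem_nhds hp

theorem mem_halfSpace {p : ℝ × E k} : p ∈ halfSpace k ↔ 0 < p.1 := by simp [halfSpace]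

theorem _root_.ContDiffOn.differentiableAt_halfSpace {F : ℝ × E k → ℂ}
    (hF : ContDiffOn ℝ ∞ F (halfSpace k)) {p : ℝ × E k} (hp : p ∈ halfSpace k) :
    DifferentiableAt ℝ F p :=
  (hF.differentiableOn (by simp)).differentiableAt (halfSpace_mem_nhds hp)

theorem contDiffOn_pd {F : ℝ × E k → ℂ} (hF : ContDiffOn ℝ ∞ F (halfSpace k))
    (d : Option (Fin k)) : ContDiffOn ℝ ∞ (pd d F) (halfSpace k) := by
  unfold pd
  exact (hF.fderiv_of_isOpen (m := ∞) isOpen_halfSpace (by simp)).clm_apply contDiffOn_const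

theorem pd_congr {F G : ℝ × E k → ℂ} (h : EqOn F G (halfSpace k)) (d : Option (Fin k)) :
    EqOn (pd d F) (pd d G) (halfSpace k) := fun p hp => by
  unfold pd
  rw [(h.eventuallyEq_of_mem (halfSpace_mem_nhds hp)).fderiv_eq]

theorem iterPd_congr {F G : ℝ × E k → ℂ} (h : EqOn F G (halfSpace k))
    (L : List (Option (Fin k))) : EqOn (iterPd L F) (iterPd L G) (halfSpace k) := by
  induction L generalizing F G with
  | nil => exact h
  | cons d L ih => exact ih (pd_congr h d)

theorem iterPd_append (L L' : List (Option (Fin k))) (F : ℝ × E k → ℂ) :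
    iterPd (L ++ L') F = iterPd L' (iterPd L F) := by
  induction L generalizing F with
  | nil => rfl
  | cons d L ih => exact ih (pd d F)

theorem pd_add {F G : ℝ × E k → ℂ} (hF : ContDiffOn ℝ ∞ F (halfSpace k))
    (hG : ContDiffOn ℝ ∞ G (halfSpace k)) (d : Option (Fin k)) :
    EqOn (pd d (F + G)) (pd d F + pd d G) (halfSpace k) := fun p hp => by
  simp only [pd, Pi.add_apply]
  rw [fderiv_add (hF.differentiableAt_halfSpace hp) (hG.differentiableAt_halfSpace hp)]
  rfl

theorem iterPd_add {F G : ℝ × E k → ℂ} (hF : ContDiffOn ℝ ∞ F (halfSpace k))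
    (hG : ContDiffOn ℝ ∞ G (halfSpace k)) (L : List (Option (Fin k))) :
    EqOn (iterPd L (F + G)) (iterPd L F + iterPd L G) (halfSpace k) := by
  induction L generalizing F G with
  | nil => exact fun _ _ => rfl
  | cons d L ih =>
    exact (iterPd_congr (pd_add hF hG d) L).trans (ih (contDiffOn_pd hF d) (contDiffOn_pd hG d))

theorem pd_mul {F G : ℝ × E k → ℂ} {p : ℝ × E k} (hF : DifferentiableAt ℝ F p)
    (hG : DifferentiableAt ℝ G p) (d : Option (Fin k)) :
    pd d (F * G) p = pd d F p * G p + F p * pd d G p := by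
  simp only [pd]
  rw [fderiv_mul hF hG]
  simp only [add_apply, smul_apply, smul_eq_mul]
  ring

theorem pd_const_mul (c : ℂ) {F : ℝ × E k → ℂ} (hF : ContDiffOn ℝ ∞ F (halfSpace k))
    (d : Option (Fin k)) : EqOn (pd d fun p => c * F p) (fun p => c * pd d F p) (halfSpace k) :=
  fun p hp => by
    simp only [pd]
    rw [fderiv_const_mul (hF.differentiableAt_halfSpace hp)]
    rfl

theorem contDiffOn_const_mul (c : ℂ) {F : ℝ × E k → ℂ} (hF : ContDiffOn ℝ ∞ F (halfSpace k)) :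
    ContDiffOn ℝ ∞ (fun p => c * F p) (halfSpace k) := contDiffOn_const.mul hF

theorem iterPd_const_mul (c : ℂ) {F : ℝ × E k → ℂ} (hF : ContDiffOn ℝ ∞ F (halfSpace k))
    (L : List (Option (Fin k))) :
    EqOn (iterPd L fun p => c * F p) (fun p => c * iterPd L F p) (halfSpace k) := by
  induction L generalizing F with
  | nil => exact fun _ _ => rfl
  | cons d L ih => exact (iterPd_congr (pd_const_mul c hF d) L).trans (ih (contDiffOn_pd hF d))

theorem contDiff_fst_ofReal : ContDiff ℝ ∞ fun p : ℝ × E k => (p.1 : ℂ) :=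
  Complex.ofRealCLM.contDiff.comp contDiff_fst

theorem pd_fst (d : Option (Fin k)) (p : ℝ × E k) :
    pd d (fun p => (p.1 : ℂ)) p = if d = none then 1 else 0 := by
  have : HasFDerivAt (fun p : ℝ × E k => (p.1 : ℂ))
      (Complex.ofRealCLM.comp (ContinuousLinearMap.fst ℝ ℝ (E k))) p :=
    (Complex.ofRealCLM.comp (ContinuousLinearMap.fst ℝ ℝ (E k))).hasFDerivAt
  rw [pd, this.fderiv]
  cases d <;> simp [dirVec]

theorem pd_comm {F : ℝ × E k → ℂ} (hF : ContDiffOn ℝ ∞ F (halfSpace k)) (d d' : Option (Fin k)) :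
    EqOn (pd d (pd d' F)) (pd d' (pd d F)) (halfSpace k) := by
  intro p hp
  have hat : ContDiffAt ℝ ∞ F p := hF.contDiffAt (halfSpace_mem_nhds hp)
  have hsymm : IsSymmSndFDerivAt ℝ F p := hat.isSymmSndFDerivAt
    (by rw [minSmoothness_of_isRCLikeNormedField]; exact WithTop.coe_le_coe.2 (le_top : (2 : ℕ∞) ≤ ⊤))
  have hd : DifferentiableAt ℝ (fderiv ℝ F) p :=
    ((hF.fderiv_of_isOpen (m := ∞) isOpen_halfSpace (by simp)).differentiableOn
      (by simp)).differentiableAt (halfSpace_mem_nhds hp)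
  have e : ∀ v w : ℝ × E k, fderiv ℝ (fun q => fderiv ℝ F q v) p w =
      fderiv ℝ (fderiv ℝ F) p w v := fun v w => by
    rw [fderiv_clm_apply hd (differentiableAt_const v)]
    simp
  unfold pd
  rw [e, e]
  exact hsymm _ _

theorem iterPd_perm {L L' : List (Option (Fin k))} (h : L.Perm L') {F : ℝ × E k → ℂ}
    (hF : ContDiffOn ℝ ∞ F (halfSpace k)) : EqOn (iterPd L F) (iterPd L' F) (halfSpace k) := by
  induction h generalizing F with
  | nil => exact fun _ _ => rfl
  | cons d _ ih => exact ih (contDiffOn_pd hF d)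
  | swap d d' l => exact iterPd_congr (pd_comm hF d d') l
  | trans _ _ ih1 ih2 => exact (ih1 hF).trans (ih2 hF)

/-- Smooth functions of `(s, σ)` all of whose derivatives are bounded on `s > 0`, also after
multiplication by powers of `s`. -/
structure Tame (F : ℝ × E k → ℂ) : Prop where
  smooth : ContDiffOn ℝ ∞ F (halfSpace k)
  bounded : ∀ (l : ℕ) (L : List (Option (Fin k))), ∃ C : ℝ, ∀ p ∈ halfSpace k,
    p.1 ^ l * ‖iterPd L F p‖ ≤ C

namespace Tame

variable {F G : ℝ × E k → ℂ}

theorem pderiv (hF : Tame F) (d : Option (Fin k)) : Tame (pd d F) :=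
  ⟨contDiffOn_pd hF.smooth d, fun l L => hF.bounded l (d :: L)⟩

theorem add (hF : Tame F) (hG : Tame G) : Tame (F + G) := by
  refine ⟨hF.smooth.add hG.smooth, fun l L => ?_⟩
  obtain ⟨C, hC⟩ := hF.bounded l L
  obtain ⟨C', hC'⟩ := hG.bounded l L
  refine ⟨C + C', fun p hp => ?_⟩
  have hp' : 0 ≤ p.1 ^ l := pow_nonneg (mem_halfSpace.1 hp).le l
  rw [iterPd_add hF.smooth hG.smooth L hp]
  calc _ ≤ p.1 ^ l * (‖iterPd L F p‖ + ‖iterPd L G p‖) :=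
        mul_le_mul_of_nonneg_left (norm_add_le _ _) hp'
    _ ≤ _ := by rw [mul_add]; exact add_le_add (hC p hp) (hC' p hp)

theorem const_mul (hF : Tame F) (c : ℂ) : Tame fun p => c * F p := by
  refine ⟨contDiffOn_const_mul c hF.smooth, fun l L => ?_⟩
  obtain ⟨C, hC⟩ := hF.bounded l L
  refine ⟨‖c‖ * C, fun p hp => ?_⟩
  rw [iterPd_const_mul c hF.smooth L hp, norm_mul]
  calc _ = ‖c‖ * (p.1 ^ l * ‖iterPd L F p‖) := by ring
    _ ≤ _ := mul_le_mul_of_nonneg_left (hC p hp) (norm_nonneg _)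

theorem zero : Tame (0 : ℝ × E k → ℂ) := by
  refine ⟨contDiffOn_const, fun l L => ⟨0, fun p hp => ?_⟩⟩
  have h := iterPd_const_mul (F := (0 : ℝ × E k → ℂ)) 0 contDiffOn_const L hp
  have e : (fun p : ℝ × E k => (0 : ℂ) * (0 : ℝ × E k → ℂ) p) = 0 := by ext; simp
  rw [e] at h
  rw [h]; simp

theorem sum {ι : Type*} (s : Finset ι) {F : ι → ℝ × E k → ℂ} (hF : ∀ i, Tame (F i)) :
    Tame (∑ i ∈ s, F i) := by
  classical
  induction s using Finset.induction_on with
  | empty => simpa using zero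
  | insert i s hi ih => rw [Finset.sum_insert hi]; exact (hF i).add ih

/-- By Leibniz, a derivative of `s F` is `s ∂F` plus, in the direction `s` only, `F` itself; the
remaining factor `s` is absorbed by raising the weight by one. -/
theorem fst_mul (hF : Tame F) : Tame fun p => (p.1 : ℂ) * F p := by
  refine ⟨contDiff_fst_ofReal.contDiffOn.mul hF.smooth, fun l L => ?_⟩
  induction L generalizing F with
  | nil =>
    obtain ⟨C, hC⟩ := hF.bounded (l + 1) []
    refine ⟨C, fun p hp => ?_⟩
    have hp' := (mem_halfSpace.1 hp).le
    have := hC p hp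
    simp only [iterPd, norm_mul, Complex.norm_real, Real.norm_of_nonneg hp'] at this ⊢
    rw [pow_succ] at this
    linarith
  | cons d L ih =>
    obtain ⟨C, hC⟩ := ih (hF.pderiv d)
    obtain ⟨C', hC'⟩ := (hF.const_mul (if d = none then 1 else 0)).bounded l L
    refine ⟨C' + C, fun p hp => ?_⟩
    have hp' : 0 ≤ p.1 ^ l := pow_nonneg (mem_halfSpace.1 hp).le l
    have e : EqOn (pd d fun p => (p.1 : ℂ) * F p)
        ((fun p => (if d = none then 1 else 0) * F p) +
          fun p => (p.1 : ℂ) * pd d F p) (halfSpace k) := fun q hq => by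
      have := pd_mul (F := fun p : ℝ × E k => (p.1 : ℂ)) (G := F) (p := q)
        (contDiff_fst_ofReal.differentiable (by simp) q)
        (hF.smooth.differentiableAt_halfSpace hq) d
      rw [pd_fst] at this
      exact this
    have e2 := iterPd_add (hF.const_mul (if d = none then 1 else 0)).smooth
      (contDiff_fst_ofReal.contDiffOn.mul (hF.pderiv d).smooth) L
    rw [iterPd, iterPd_congr e L hp, e2 hp]
    calc _ ≤ p.1 ^ l * (_ + _) := mul_le_mul_of_nonneg_left (norm_add_le _ _) hp'
      _ ≤ _ := by rw [mul_add]; exact add_le_add (hC' p hp) (hC p hp)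

end Tame

/-- The Laplacian in `σ`. -/
noncomputable def lapS (F : ℝ × E k → ℂ) (p : ℝ × E k) : ℂ := ∑ i, pd (some i) (pd (some i) F) p

/-- The operator `ℒ` in the variables `s = r²` and `σ`. -/
noncomputable def grushinS (α : ℝ) (F : ℝ × E k → ℂ) (p : ℝ × E k) : ℂ :=
  4 * (p.1 * pd none (pd none F) p) + 4 * α * pd none F p + 1 / 4 * (p.1 * lapS F p)

theorem Tame.laplacian {F : ℝ × E k → ℂ} (hF : Tame F) : Tame (lapS F) := by
  have : lapS F =
      ∑ i, pd (some i) (pd (some i) F) := by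
    ext p; simp [lapS]
  rw [this]
  exact Tame.sum _ fun i => (hF.pderiv _).pderiv _

/-- In the variable `s = r²` the singular coefficient disappears and the others are polynomial. This
stability is the reason for the change of variable and for the weights `s^l`. -/
theorem Tame.generator {F : ℝ × E k → ℂ} (hF : Tame F) (α : ℝ) : Tame (grushinS α F) :=
  ((((hF.pderiv none).pderiv none).fst_mul.const_mul 4).add ((hF.pderiv none).const_mul (4 * α))).add
    (hF.laplacian.fst_mul.const_mul (1 / 4))

/-! ### The class `Σ⁺` in the variables `(r², σ)` -/

/-- `f(r, σ) = c F(r², σ)` with smooth functions `f` and `F`. -/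
structure SquareRel (c : ℂ) (f F : ℝ × E k → ℂ) : Prop where
  left : ContDiffOn ℝ ∞ f (halfSpace k)
  right : ContDiffOn ℝ ∞ F (halfSpace k)
  eq : ∀ p ∈ halfSpace k, f p = c * F (p.1 ^ 2, p.2)

theorem hasDerivAt_comp_sq {F : ℝ × E k → ℂ} (hF : ContDiffOn ℝ ∞ F (halfSpace k))
    {r : ℝ} (hr : 0 < r) (σ : E k) :
    HasDerivAt (fun s : ℝ => F (s ^ 2, σ)) (2 * r * pd none F (r ^ 2, σ)) r := by
  have h1 : HasFDerivAt F (fderiv ℝ F (r ^ 2, σ)) (r ^ 2, σ) :=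
    (hF.differentiableAt_halfSpace (mem_halfSpace.2 (by simpa using by positivity))).hasFDerivAt
  have h2 : HasDerivAt (fun s : ℝ => ((s ^ 2, σ) : ℝ × E k)) (2 * r, 0) r := by
    simpa using (hasDerivAt_pow 2 r).prodMk (hasDerivAt_const r σ)
  refine (h1.comp_hasDerivAt r h2).congr_deriv ?_
  have : ((2 * r, 0) : ℝ × E k) = (2 * r) • dirVec none := by simp [dirVec]
  rw [this, map_smul, pd, Complex.real_smul]
  push_cast; ring

theorem hasDerivAt_line {F : ℝ × E k → ℂ} {p : ℝ × E k} (hF : DifferentiableAt ℝ F p)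
    (i : Fin k) : HasDerivAt (fun τ : ℝ => F (p.1, p.2 + τ • EuclideanSpace.single i (1 : ℝ)))
      (pd (some i) F p) 0 := by
  have h2 : HasDerivAt (fun τ : ℝ => ((p.1, p.2 + τ • EuclideanSpace.single i (1 : ℝ)) : ℝ × E k))
      (0, EuclideanSpace.single i (1 : ℝ)) 0 := by
    refine (hasDerivAt_const 0 p.1).prodMk ?_
    simpa using ((hasDerivAt_id (0 : ℝ)).smul_const (EuclideanSpace.single i (1 : ℝ))).const_add p.2
  exact hF.hasFDerivAt.comp_hasDerivAt_of_eq 0 h2 (by simp)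

theorem SquareRel.sigma {c : ℂ} {f F : ℝ × E k → ℂ} (h : SquareRel c f F) (i : Fin k) :
    SquareRel c (sigmaPartial i f) (pd (some i) F) := by
  have e1 : EqOn (sigmaPartial i f) (pd (some i) f) (halfSpace k) := fun p hp =>
    (hasDerivAt_line (h.left.differentiableAt_halfSpace hp) i).deriv
  refine ⟨(contDiffOn_pd h.left _).congr e1, contDiffOn_pd h.right _, fun p hp => ?_⟩
  have hp' := mem_halfSpace.1 hp
  have h2 := hasDerivAt_line (h.right.differentiableAt_halfSpace (p := (p.1 ^ 2, p.2))
    (mem_halfSpace.2 (by simpa using by positivity))) i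
  rw [e1 hp]
  refine (hasDerivAt_line (h.left.differentiableAt_halfSpace hp) i).unique
    ((h2.const_mul c).congr_of_eventuallyEq (Eventually.of_forall fun τ => ?_))
  exact h.eq (p.1, _) (mem_halfSpace.2 hp')

theorem SquareRel.radial {c : ℂ} {f F : ℝ × E k → ℂ} (h : SquareRel c f F) :
    SquareRel (2 * c) (radialOp f) (pd none F) := by
  have heq : ∀ p ∈ halfSpace k, radialOp f p = 2 * c * pd none F (p.1 ^ 2, p.2) := fun p hp => by
    have hp' := mem_halfSpace.1 hp
    have h1 : HasDerivAt (fun s : ℝ => f (s, p.2)) (c * (2 * p.1 * pd none F (p.1 ^ 2, p.2))) p.1 := by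
      refine ((hasDerivAt_comp_sq h.right hp' p.2).const_mul c).congr_of_eventuallyEq ?_
      filter_upwards [lt_mem_nhds hp'] with s hs using h.eq (s, p.2) (mem_halfSpace.2 hs)
    have : (p.1 : ℂ) ≠ 0 := by exact_mod_cast hp'.ne'
    rw [radialOp, h1.deriv]
    push_cast
    field_simp
  refine ⟨ContDiffOn.congr ?_ heq, contDiffOn_pd h.right _, heq⟩
  refine contDiffOn_const.mul ((contDiffOn_pd h.right none).comp (t := halfSpace k)
    (f := fun p : ℝ × E k => (p.1 ^ 2, p.2)) (by fun_prop) fun p hp => ?_)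
  have hp' := mem_halfSpace.1 hp
  exact mem_halfSpace.2 (by simpa using by positivity)

theorem SquareRel.sigma_iterate {c : ℂ} {f F : ℝ × E k → ℂ} (h : SquareRel c f F) (i : Fin k)
    (n : ℕ) : SquareRel c ((sigmaPartial i)^[n] f) (iterPd (List.replicate n (some i)) F) := by
  induction n generalizing f F with
  | zero => exact h
  | succ n ih => exact ih (h.sigma i)

theorem SquareRel.radial_iterate {c : ℂ} {f F : ℝ × E k → ℂ} (h : SquareRel c f F)
    (n : ℕ) : SquareRel (2 ^ n * c) (radialOp^[n] f) (iterPd (List.replicate n none) F) := by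
  induction n generalizing f F c with
  | zero => simpa [iterPd] using h
  | succ n ih =>
    have := ih h.radial
    rwa [← mul_assoc, ← pow_succ] at this

/-- The list of coordinate directions with multiplicities `β`. -/
def multiList (l : List (Fin k)) (β : Fin k → ℕ) : List (Option (Fin k)) :=
  -- `reverse` because `foldr` applies the last index first, whereas `iterPd` applies the head of
  -- the list first.
  l.reverse.flatMap fun i => List.replicate (β i) (some i)

theorem SquareRel.multi {c : ℂ} {f F : ℝ × E k → ℂ} (h : SquareRel c f F) (β : Fin k → ℕ)
    (l : List (Fin k)) : SquareRel c (l.foldr (fun i g => (sigmaPartial i)^[β i] g) f)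
      (iterPd (multiList l β) F) := by
  induction l with
  | nil => exact h
  | cons i l ih =>
    have := ih.sigma_iterate i (β i)
    rw [← iterPd_append] at this
    simpa [multiList] using this

/-- `Tame` quantifies over words in the directions and the seminorms over multi-indices; sorting a
word is harmless since partial derivatives commute. -/
theorem perm_multiList (L : List (Option (Fin k))) :
    L.Perm (multiList (List.finRange k) (fun i => L.count (some i)) ++
      List.replicate (L.count none) none) := by
  classical
  rw [List.perm_iff_count]
  intro d
  rw [List.count_append, multiList, List.count_flatMap, List.count_replicate]
  have e : ((List.finRange k).reverse.map (List.count d ∘ fun i =>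
      List.replicate (List.count (some i) L) (some i))).sum =
      ∑ i, List.count d (List.replicate (List.count (some i) L) (some i)) := by
    rw [Fin.sum_univ_def]
    rw [List.map_reverse, List.sum_reverse]
    rfl
  rw [e]
  cases d with
  | none => simp [List.count_replicate]
  | some j => simp [List.count_replicate]

/-- Under `s = r²` the operator `(1/r) ∂_r` is `2 ∂_s`, so the seminorm with `ℓ = 2l` bounds `s^l`
times the corresponding derivative; the extra factor `2^m ≥ 1` only helps. -/
theorem tame_of_mem_sigmaPlus {φ : ℝ × E k → ℂ} (hφ : φ ∈ SigmaPlus k) :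
    Tame fun p : ℝ × E k => φ (√p.1, p.2) := by
  obtain ⟨hs, hb⟩ := hφ
  have hF : ContDiffOn ℝ ∞ (fun p : ℝ × E k => φ (√p.1, p.2)) (halfSpace k) := by
    refine hs.comp (t := halfSpace k) (f := fun p : ℝ × E k => (√p.1, p.2)) ?_ fun p hp =>
      mem_halfSpace.2 (Real.sqrt_pos.2 (mem_halfSpace.1 hp))
    exact (contDiffOn_fst.sqrt fun p hp => (mem_halfSpace.1 hp).ne').prodMk contDiffOn_snd
  have hrel : SquareRel 1 φ (fun p : ℝ × E k => φ (√p.1, p.2)) :=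
    ⟨hs, hF, fun p hp => by simp [Real.sqrt_sq (mem_halfSpace.1 hp).le]⟩
  refine ⟨hF, fun l L => ?_⟩
  have h1 := (hrel.multi (fun i => L.count (some i)) (List.finRange k)).radial_iterate (L.count none)
  rw [← iterPd_append] at h1
  refine ⟨(gammaSeminorm (2 * l) (L.count none) (fun i => L.count (some i)) φ).toReal,
    fun p hp => ?_⟩
  have hp' := mem_halfSpace.1 hp
  rw [iterPd_perm (perm_multiList L) hF hp]
  have hq : ((√p.1, p.2) : ℝ × E k) ∈ halfSpace k := mem_halfSpace.2 (Real.sqrt_pos.2 hp')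
  have h2 := h1.eq _ hq
  simp only [Real.sq_sqrt hp'.le] at h2
  have h3 : ‖(((√p.1) ^ (2 * l) : ℝ) : ℂ) * (radialOp^[L.count none]
      (sigmaMulti (fun i => L.count (some i)) φ)) (√p.1, p.2)‖ₑ ≤
      gammaSeminorm (2 * l) (L.count none) (fun i => L.count (some i)) φ :=
    le_iSup₂ (f := fun (p : ℝ × E k) (_ : p ∈ halfSpace k) =>
      ‖((p.1 ^ (2 * l) : ℝ) : ℂ) * (radialOp^[L.count none]
      (sigmaMulti (fun i => L.count (some i)) φ)) p‖ₑ) (√p.1, p.2) hq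
  have h4 := ENNReal.toReal_mono (hb _ _ _).ne h3
  rw [toReal_enorm, norm_mul, Complex.norm_real, sigmaMulti, h2, norm_mul, pow_mul,
    Real.sq_sqrt hp'.le, Real.norm_of_nonneg (by positivity)] at h4
  refine le_trans ?_ h4
  refine mul_le_mul_of_nonneg_left ?_ (by positivity)
  refine le_mul_of_one_le_left (norm_nonneg _) ?_
  rw [mul_one, norm_pow, Complex.norm_ofNat]
  exact one_le_pow₀ one_le_two

end tame

end BaouendiGrushin

namespace BaouendiGrushin

open Filter Topology FourierTransform SchwartzMap

/-! ### Approximation of tame functions by superpositions of modes -/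

section approx

variable {k : ℕ} {α : ℝ}

/-- The space of frequencies dual to `(r², σ)`, as an inner product space. -/
abbrev FreqSpace (k : ℕ) : Type := WithLp 2 (ℝ × E k)

/-- The superposition of modes whose initial value is `exp (-r²) G(r², σ)`. -/
noncomputable def schwartzEvol (α : ℝ) (G : 𝓢(FreqSpace k, ℂ)) (q : FreqSpace k → ℝ → ℝ → ℂ)
    (r : ℝ) (σ : E k) (t : ℝ) : ℂ :=
  superpose (volume : Measure (FreqSpace k)) α (fun w => 𝓕 G w) (fun w => freqA w.fst)
    (fun w => (2 * Real.pi) • w.snd) q r σ t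

theorem isAmplitude_schwartz (G : 𝓢(FreqSpace k, ℂ)) :
    IsAmplitude (volume : Measure (FreqSpace k)) (fun w => 𝓕 G w) (fun w => freqA w.fst)
      (fun w => (2 * Real.pi) • w.snd) := by
  have hm := measurable_freqA
  refine ⟨(𝓕 G).continuous.aestronglyMeasurable, by fun_prop, by fun_prop,
    fun w => by rw [freqA_re]; exact zero_le_one, ?_⟩
  refine ((integrable_one_add_norm_pow volume (𝓕 G)).const_mul ((2 + 4 * Real.pi) ^ 2)).mono' ?_
    (Eventually.of_forall fun w => ?_)
  · refine AEStronglyMeasurable.mul (Measurable.aestronglyMeasurable ?_)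
      (𝓕 G).continuous.norm.aestronglyMeasurable
    fun_prop
  · rw [Real.norm_of_nonneg (by positivity)]
    have e1 := norm_freqA_le w.fst
    have e2 : ‖(2 * Real.pi) • w.snd‖ = 2 * Real.pi * ‖w.snd‖ := by
      rw [norm_smul, Real.norm_of_nonneg (by positivity)]
    have e3 : |w.fst| ≤ ‖w‖ := WithLp.norm_fst_le _ w
    have e4 : ‖w.snd‖ ≤ ‖w‖ := WithLp.norm_snd_le _ w
    have e5 : 1 + ‖freqA w.fst‖ + ‖(2 * Real.pi) • w.snd‖ ≤ (2 + 4 * Real.pi) * (1 + ‖w‖) := by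
      rw [e2]
      have := Real.pi_pos
      have h1 := mul_le_mul_of_nonneg_left e3 Real.pi_pos.le
      have h2 := mul_le_mul_of_nonneg_left e4 Real.pi_pos.le
      nlinarith [norm_nonneg w]
    have e6 := pow_le_pow_left₀ (by positivity) e5 2
    calc _ ≤ ((2 + 4 * Real.pi) * (1 + ‖w‖)) ^ 2 * ‖𝓕 G w‖ :=
          mul_le_mul_of_nonneg_right e6 (norm_nonneg _)
      _ = _ := by ring

theorem schwartzEvol_zero (G : 𝓢(FreqSpace k, ℂ)) (r : ℝ) (σ : E k) :
    schwartzEvol α G (fun _ _ _ => 1) r σ 0 =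
      Complex.exp (-(r ^ 2) : ℝ) * G (WithLp.toLp 2 (r ^ 2, σ)) := by
  unfold schwartzEvol superpose
  rw [← schwartz_inversion G, ← integral_const_mul]
  refine integral_congr_ae (Eventually.of_forall fun w => ?_)
  simp only
  rw [mode_zero, exp_freqA, real_inner_smul_left, WithLp.prod_inner_apply]
  have h2 : (inner ℝ w.fst (r ^ 2) : ℝ) = r ^ 2 * w.fst := by simp
  have h3 : w.ofLp.2 = w.snd := rfl
  have h4 : w.ofLp.1 = w.fst := rfl
  rw [h3, h4, h2, mul_add, Complex.ofReal_add, add_mul, Complex.exp_add, mul_comm Complex.I]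
  ring

variable {W : Type*} [MeasurableSpace W] {ν : Measure W} {h a : W → ℂ} {ξ : W → E k}

/-- Uniqueness of derivatives: at time `0` the spatial multipliers differentiate the initial value,
and the equation gives the time multiplier. Bounds on `F` thereby become bounds on the evolution. -/
theorem IsAmplitude.superpose_derivs (ha : IsAmplitude ν h a ξ) (hα : 0 < α) {F : ℝ × E k → ℂ}
    (hF : ContDiffOn ℝ ∞ F (halfSpace k))
    (h0 : ∀ r : ℝ, 0 < r → ∀ σ, superpose ν α h a ξ (fun _ _ _ => 1) r σ 0 = F (r ^ 2, σ))
    {r : ℝ} (hr : 0 < r) (σ : E k) :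
    (∀ i : Fin k, superpose ν α h a ξ (fun w _ _ => (Complex.I *
      (inner ℝ (ξ w) (EuclideanSpace.single i (1 : ℝ)) : ℝ)) ^ 2) r σ 0 =
      pd (some i) (pd (some i) F) (r ^ 2, σ)) ∧
    superpose ν α h a ξ (multT a ξ α) r σ 0 = grushinS α F (r ^ 2, σ) := by
  have hmem : ∀ {r : ℝ}, 0 < r → ∀ σ : E k, ((r ^ 2, σ) : ℝ × E k) ∈ halfSpace k := fun hr σ =>
    mem_halfSpace.2 (by simpa using by positivity)
  have r1 : ∀ r : ℝ, 0 < r → superpose ν α h a ξ (multR a ξ) r σ 0 = 2 * r * pd none F (r ^ 2, σ) := by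
    intro r hr
    refine (ha.superpose_r hα r σ le_rfl).unique
      ((hasDerivAt_comp_sq hF hr σ).congr_of_eventuallyEq ?_)
    filter_upwards [lt_mem_nhds hr] with s hs using h0 s hs σ
  have r2 : superpose ν α h a ξ (multRR a ξ) r σ 0 =
      2 * pd none F (r ^ 2, σ) + 2 * r * (2 * r * pd none (pd none F) (r ^ 2, σ)) := by
    refine (ha.superpose_rr hα r σ le_rfl).unique (HasDerivAt.congr_of_eventuallyEq
      (f := fun s : ℝ => 2 * (s : ℂ) * pd none F (s ^ 2, σ)) ?_ ?_)
    · have h1 : HasDerivAt (fun s : ℝ => 2 * (s : ℂ)) 2 r := by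
        simpa using (hasDerivAt_id r).ofReal_comp.const_mul (2 : ℂ)
      exact h1.mul (hasDerivAt_comp_sq (contDiffOn_pd hF none) hr σ)
    · filter_upwards [lt_mem_nhds hr] with s hs using r1 s hs
  have s1 : ∀ (i : Fin k) (σ : E k), superpose ν α h a ξ (fun w _ _ => (Complex.I *
      (inner ℝ (ξ w) (EuclideanSpace.single i (1 : ℝ)) : ℝ)) ^ 1) r σ 0 =
      pd (some i) F (r ^ 2, σ) := by
    intro i σ
    have e := ha.superpose_s hα 0 (by norm_num) r σ (EuclideanSpace.single i (1 : ℝ)) le_rfl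
    simp only [pow_zero, zero_add, h0 r hr] at e
    exact e.unique (hasDerivAt_line (p := (r ^ 2, σ))
      (hF.differentiableAt_halfSpace (hmem hr σ)) i)
  have s2 : ∀ i : Fin k, superpose ν α h a ξ (fun w _ _ => (Complex.I *
      (inner ℝ (ξ w) (EuclideanSpace.single i (1 : ℝ)) : ℝ)) ^ 2) r σ 0 =
      pd (some i) (pd (some i) F) (r ^ 2, σ) := by
    intro i
    have e := ha.superpose_s hα 1 (by norm_num) r σ (EuclideanSpace.single i (1 : ℝ)) le_rfl
    simp only [s1] at e
    exact e.unique (hasDerivAt_line (p := (r ^ 2, σ))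
      ((contDiffOn_pd hF (some i)).differentiableAt_halfSpace (hmem hr σ)) i)
  refine ⟨s2, ?_⟩
  rw [ha.superpose_equation hα hr σ le_rfl, r2, r1 r hr, Finset.sum_congr rfl fun i _ => s2 i,
    grushinS, lapS]
  have : (r : ℂ) ≠ 0 := by exact_mod_cast hr.ne'
  push_cast
  field_simp
  ring

/-- A smooth cutoff function equal to `1` near the origin. -/
noncomputable def cutoff (k : ℕ) : ContDiffBump (0 : ℝ × E k) := ⟨1, 2, one_pos, one_lt_two⟩

/-- Cutoff and translation of `F` away from the boundary `s = 0`. -/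
noncomputable def truncate (c : ℝ) (F : ℝ × E k → ℂ) (p : ℝ × E k) : ℂ :=
  (cutoff k (c • p) : ℂ) * F (p + (c, 0))

theorem contDiff_cutoff : ContDiff ℝ ∞ fun p : ℝ × E k => (cutoff k p : ℂ) :=
  Complex.ofRealCLM.contDiff.comp (cutoff k).contDiff

theorem add_mem_halfSpace {p : ℝ × E k} (hp : p ∈ halfSpace k) {c : ℝ} (hc : 0 ≤ c) :
    p + (c, 0) ∈ halfSpace k := by
  have := mem_halfSpace.1 hp
  exact mem_halfSpace.2 (by simpa using by linarith)

theorem contDiffOn_shift {F : ℝ × E k → ℂ} (hF : ContDiffOn ℝ ∞ F (halfSpace k)) {c : ℝ}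
    (hc : 0 ≤ c) : ContDiffOn ℝ ∞ (fun p => F (p + (c, 0))) (halfSpace k) :=
  hF.comp (by fun_prop) fun _ hp => add_mem_halfSpace hp hc

theorem contDiffOn_truncate {F : ℝ × E k → ℂ} (hF : ContDiffOn ℝ ∞ F (halfSpace k)) {c : ℝ}
    (hc : 0 ≤ c) : ContDiffOn ℝ ∞ (truncate c F) (halfSpace k) :=
  (contDiff_cutoff.comp (contDiff_const_smul c)).contDiffOn.mul (contDiffOn_shift hF hc)

theorem pd_shift (c : ℝ) (F : ℝ × E k → ℂ) (d : Option (Fin k)) :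
    pd d (fun p => F (p + (c, 0))) = fun p => pd d F (p + (c, 0)) := by
  ext p
  simp only [pd]
  rw [fderiv_comp_add_right]

theorem pd_dilate (c : ℝ) (F : ℝ × E k → ℂ) (d : Option (Fin k)) (p : ℝ × E k) :
    pd d (fun p => F (c • p)) p = c * pd d F (c • p) := by
  simp only [pd]
  rw [fderiv_comp_smul, smul_apply, Complex.real_smul]

theorem pd_truncate {F : ℝ × E k → ℂ} (hF : ContDiffOn ℝ ∞ F (halfSpace k)) {c : ℝ}
    (hc : 0 ≤ c) (d : Option (Fin k)) : EqOn (pd d (truncate c F))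
      ((fun p => c * (pd d (fun p => (cutoff k p : ℂ)) (c • p) * F (p + (c, 0)))) +
        truncate c (pd d F)) (halfSpace k) := fun p hp => by
  have h := pd_mul (F := fun p : ℝ × E k => (cutoff k (c • p) : ℂ))
    (G := fun p => F (p + (c, 0))) (p := p)
    ((contDiff_cutoff.comp (contDiff_const_smul c)).differentiable (by simp) p)
    ((contDiffOn_shift hF hc).differentiableAt_halfSpace hp) d
  rw [pd_dilate c (fun p => (cutoff k p : ℂ)), pd_shift, mul_assoc] at h
  exact h

theorem contDiff_pd_cutoff (d : Option (Fin k)) :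
    ContDiff ℝ ∞ (pd d fun p : ℝ × E k => (cutoff k p : ℂ)) :=
  (contDiff_cutoff.fderiv_right (m := ∞) (by simp)).clm_apply contDiff_const

theorem pd_pd_truncate {F : ℝ × E k → ℂ} (hF : ContDiffOn ℝ ∞ F (halfSpace k)) {c : ℝ}
    (hc : 0 ≤ c) (d : Option (Fin k)) {p : ℝ × E k} (hp : p ∈ halfSpace k) :
    pd d (pd d (truncate c F)) p =
      c * (c * pd d (pd d fun p => (cutoff k p : ℂ)) (c • p) * F (p + (c, 0)) +
        2 * (pd d (fun p => (cutoff k p : ℂ)) (c • p) * pd d F (p + (c, 0)))) +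
      truncate c (pd d (pd d F)) p := by
  have hsh := contDiffOn_shift hF hc
  have hcut : ContDiff ℝ ∞ fun p : ℝ × E k => pd d (fun p => (cutoff k p : ℂ)) (c • p) :=
    (contDiff_pd_cutoff d).comp (contDiff_const_smul c)
  have hprod : ContDiffOn ℝ ∞ (fun p => pd d (fun p => (cutoff k p : ℂ)) (c • p) * F (p + (c, 0)))
      (halfSpace k) := hcut.contDiffOn.mul hsh
  rw [pd_congr (pd_truncate hF hc d) d hp,
    pd_add (contDiffOn_const_mul _ hprod) (contDiffOn_truncate (contDiffOn_pd hF d) hc) d hp,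
    Pi.add_apply, pd_const_mul _ hprod d hp, pd_truncate (contDiffOn_pd hF d) hc d hp]
  have h := pd_mul (F := fun p : ℝ × E k => pd d (fun p => (cutoff k p : ℂ)) (c • p))
    (G := fun p => F (p + (c, 0))) (p := p) (hcut.differentiable (by simp) p)
    (hsh.differentiableAt_halfSpace hp) d
  rw [pd_dilate c, pd_shift] at h
  simp only [Pi.add_apply]
  have h' : pd d (fun p => pd d (fun p => (cutoff k p : ℂ)) (c • p) * F (p + (c, 0))) p =
    c * pd d (pd d fun p => (cutoff k p : ℂ)) (c • p) * F (p + (c, 0)) +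
      pd d (fun p => (cutoff k p : ℂ)) (c • p) * pd d F (p + (c, 0)) := h
  rw [h']
  ring

theorem exists_bound_cutoff (d : Option (Fin k)) : ∃ M : ℝ, 0 ≤ M ∧
    ∀ p, ‖(cutoff k p : ℂ)‖ ≤ M ∧ ‖pd d (fun p => (cutoff k p : ℂ)) p‖ ≤ M ∧
      ‖pd d (pd d fun p => (cutoff k p : ℂ)) p‖ ≤ M := by
  have hc : HasCompactSupport fun p : ℝ × E k => (cutoff k p : ℂ) := by
    refine (cutoff k).hasCompactSupport.mono fun x hx => ?_
    simpa using hx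
  have hc1 : HasCompactSupport (pd d fun p : ℝ × E k => (cutoff k p : ℂ)) := hc.fderiv_apply ℝ _
  have hc2 : HasCompactSupport (pd d (pd d fun p : ℝ × E k => (cutoff k p : ℂ))) :=
    hc1.fderiv_apply ℝ _
  obtain ⟨M0, h0⟩ := hc.exists_bound_of_continuous contDiff_cutoff.continuous
  obtain ⟨M1, h1⟩ := hc1.exists_bound_of_continuous (contDiff_pd_cutoff d).continuous
  obtain ⟨M2, h2⟩ := hc2.exists_bound_of_continuous
    (((contDiff_pd_cutoff d).fderiv_right (m := ∞) (by simp)).clm_apply contDiff_const).continuous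
  have n0 := (norm_nonneg _).trans (h0 0)
  have n1 := (norm_nonneg _).trans (h1 0)
  have n2 := (norm_nonneg _).trans (h2 0)
  exact ⟨M0 + M1 + M2, by positivity, fun p => ⟨(h0 p).trans (by linarith),
    (h1 p).trans (by linarith), (h2 p).trans (by linarith)⟩⟩

/-- The shift moves away from `s = 0` and increases the weight, so the constant does not depend on
`c`. -/
theorem Tame.bound_shift {F : ℝ × E k → ℂ} (hF : Tame F) (l : ℕ) : ∃ C : ℝ, ∀ c : ℝ, 0 ≤ c →
    ∀ p ∈ halfSpace k, p.1 ^ l * ‖F (p + (c, 0))‖ ≤ C := by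
  obtain ⟨C, hC⟩ := hF.bounded l []
  refine ⟨C, fun c hc p hp => le_trans ?_ (hC _ (add_mem_halfSpace hp hc))⟩
  refine mul_le_mul_of_nonneg_right (pow_le_pow_left₀ (mem_halfSpace.1 hp).le ?_ l) (norm_nonneg _)
  simpa using hc

theorem Tame.bound_truncate {F : ℝ × E k → ℂ} (hF : Tame F) (l : ℕ) : ∃ C : ℝ, ∀ c : ℝ, 0 ≤ c →
    ∀ p ∈ halfSpace k, p.1 ^ l * ‖truncate c F p‖ ≤ C := by
  obtain ⟨C, hC⟩ := hF.bound_shift l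
  refine ⟨C, fun c hc p hp => le_trans ?_ (hC c hc p hp)⟩
  refine mul_le_mul_of_nonneg_left ?_ (pow_nonneg (mem_halfSpace.1 hp).le l)
  rw [truncate, norm_mul, Complex.norm_real, Real.norm_of_nonneg (cutoff k).nonneg]
  exact mul_le_of_le_one_left (norm_nonneg _) (cutoff k).le_one

/-- Each derivative falling on the dilated cutoff brings a factor `c ≤ 1`, hence uniformity in `c`.
No mixed second derivatives are required, since the generator contains none. -/
theorem Tame.bound_pd_truncate {F : ℝ × E k → ℂ} (hF : Tame F) (d : Option (Fin k)) (l : ℕ) :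
    ∃ C : ℝ, ∀ c : ℝ, 0 ≤ c → c ≤ 1 → ∀ p ∈ halfSpace k,
      p.1 ^ l * ‖pd d (truncate c F) p‖ ≤ C ∧ p.1 ^ l * ‖pd d (pd d (truncate c F)) p‖ ≤ C := by
  obtain ⟨M, hM0, hM⟩ := exists_bound_cutoff (k := k) d
  obtain ⟨C0, h0⟩ := hF.bound_shift l
  obtain ⟨C1, h1⟩ := (hF.pderiv d).bound_shift l
  obtain ⟨C2, h2⟩ := (hF.pderiv d).bound_truncate l
  obtain ⟨C3, h3⟩ := ((hF.pderiv d).pderiv d).bound_truncate l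
  refine ⟨max (M * C0 + C2) (M * C0 + 2 * (M * C1) + C3), fun c hc hc1 p hp => ⟨?_, ?_⟩⟩
  · refine le_trans ?_ (le_max_left _ _)
    have hp' : 0 ≤ p.1 ^ l := pow_nonneg (mem_halfSpace.1 hp).le l
    rw [pd_truncate hF.smooth hc d hp, Pi.add_apply]
    have b1 : ‖(c : ℂ) * (pd d (fun p => (cutoff k p : ℂ)) (c • p) * F (p + (c, 0)))‖ ≤
        M * ‖F (p + (c, 0))‖ := by
      rw [norm_mul, norm_mul, Complex.norm_real, Real.norm_of_nonneg hc]
      calc _ ≤ 1 * (M * ‖F (p + (c, 0))‖) := by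
            gcongr
            exact (hM _).2.1
        _ = _ := one_mul _
    calc _ ≤ p.1 ^ l * (M * ‖F (p + (c, 0))‖ + ‖truncate c (pd d F) p‖) :=
          mul_le_mul_of_nonneg_left ((norm_add_le _ _).trans (add_le_add_left b1 _)) hp'
      _ = M * (p.1 ^ l * ‖F (p + (c, 0))‖) + p.1 ^ l * ‖truncate c (pd d F) p‖ := by ring
      _ ≤ _ := add_le_add (mul_le_mul_of_nonneg_left (h0 c hc p hp) hM0) (h2 c hc p hp)
  · refine le_trans ?_ (le_max_right _ _)
    have hp' : 0 ≤ p.1 ^ l := pow_nonneg (mem_halfSpace.1 hp).le l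
    rw [pd_pd_truncate hF.smooth hc d hp]
    have b1 : ‖(c : ℂ) * (c * pd d (pd d fun p => (cutoff k p : ℂ)) (c • p) * F (p + (c, 0)) +
        2 * (pd d (fun p => (cutoff k p : ℂ)) (c • p) * pd d F (p + (c, 0))))‖ ≤
        M * ‖F (p + (c, 0))‖ + 2 * (M * ‖pd d F (p + (c, 0))‖) := by
      rw [norm_mul, Complex.norm_real, Real.norm_of_nonneg hc]
      have b2 : ‖(c : ℂ) * pd d (pd d fun p => (cutoff k p : ℂ)) (c • p) * F (p + (c, 0)) +
        2 * (pd d (fun p => (cutoff k p : ℂ)) (c • p) * pd d F (p + (c, 0)))‖ ≤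
        1 * M * ‖F (p + (c, 0))‖ + 2 * (M * ‖pd d F (p + (c, 0))‖) := by
        refine (norm_add_le _ _).trans ?_
        rw [norm_mul, norm_mul, norm_mul, norm_mul, Complex.norm_real, Real.norm_of_nonneg hc,
          Complex.norm_ofNat]
        gcongr
        · exact (hM _).2.2
        · exact (hM _).2.1
      calc _ ≤ 1 * (1 * M * ‖F (p + (c, 0))‖ + 2 * (M * ‖pd d F (p + (c, 0))‖)) :=
            mul_le_mul hc1 b2 (norm_nonneg _) zero_le_one
        _ = _ := by ring
    calc _ ≤ p.1 ^ l * (M * ‖F (p + (c, 0))‖ + 2 * (M * ‖pd d F (p + (c, 0))‖) +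
            ‖truncate c (pd d (pd d F)) p‖) :=
          mul_le_mul_of_nonneg_left ((norm_add_le _ _).trans (add_le_add_left b1 _)) hp'
      _ = M * (p.1 ^ l * ‖F (p + (c, 0))‖) + 2 * (M * (p.1 ^ l * ‖pd d F (p + (c, 0))‖)) +
          p.1 ^ l * ‖truncate c (pd d (pd d F)) p‖ := by ring
      _ ≤ _ := by
          refine add_le_add (add_le_add (mul_le_mul_of_nonneg_left (h0 c hc p hp) hM0) ?_)
            (h3 c hc p hp)
          exact mul_le_mul_of_nonneg_left (mul_le_mul_of_nonneg_left (h1 c hc p hp) hM0) zero_le_two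

/-- The sequence of truncation parameters. -/
noncomputable def truncSeq (n : ℕ) : ℝ := 1 / ((n : ℝ) + 1)

theorem truncSeq_pos (n : ℕ) : 0 < truncSeq n := by unfold truncSeq; positivity

theorem truncSeq_le_one (n : ℕ) : truncSeq n ≤ 1 := by
  unfold truncSeq
  rw [div_le_one (by positivity)]
  linarith [(Nat.cast_nonneg n : (0 : ℝ) ≤ n)]

theorem tendsto_truncSeq : Tendsto truncSeq atTop (𝓝 0) := tendsto_one_div_add_atTop_nhds_zero_nat

theorem tendsto_shift {F : ℝ × E k → ℂ} (hF : ContDiffOn ℝ ∞ F (halfSpace k)) {p : ℝ × E k}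
    (hp : p ∈ halfSpace k) : Tendsto (fun n => F (p + (truncSeq n, 0))) atTop (𝓝 (F p)) := by
  have h1 : ContinuousAt F p := (hF.differentiableAt_halfSpace hp).continuousAt
  have h2 : Tendsto (fun n => p + (truncSeq n, (0 : E k))) atTop (𝓝 p) := by
    have : Tendsto (fun n => (truncSeq n, (0 : E k))) atTop (𝓝 (0, 0)) :=
      tendsto_truncSeq.prodMk_nhds tendsto_const_nhds
    have h3 := this.const_add p
    rwa [Prod.mk_zero_zero, add_zero] at h3
  exact h1.tendsto.comp h2

theorem tendsto_dilate {K : ℝ × E k → ℂ} (hK : Continuous K) (p : ℝ × E k) :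
    Tendsto (fun n => K (truncSeq n • p)) atTop (𝓝 (K 0)) := by
  have h2 : Tendsto (fun n => truncSeq n • p) atTop (𝓝 0) := by
    simpa using tendsto_truncSeq.smul_const p
  exact (hK.tendsto 0).comp h2

theorem tendsto_truncate {F : ℝ × E k → ℂ} (hF : ContDiffOn ℝ ∞ F (halfSpace k)) {p : ℝ × E k}
    (hp : p ∈ halfSpace k) : Tendsto (fun n => truncate (truncSeq n) F p) atTop (𝓝 (F p)) := by
  have h := (tendsto_dilate contDiff_cutoff.continuous p).mul (tendsto_shift hF hp)
  have e : (cutoff k 0 : ℂ) = 1 := by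
    rw [(cutoff k).one_of_mem_closedBall (Metric.mem_closedBall_self (cutoff k).rIn_pos.le)]
    simp
  rw [e, one_mul] at h
  exact h

theorem tendsto_ofReal_truncSeq : Tendsto (fun n => (truncSeq n : ℂ)) atTop (𝓝 0) := by
  exact_mod_cast (Complex.continuous_ofReal.tendsto 0).comp tendsto_truncSeq

theorem tendsto_pd_truncate {F : ℝ × E k → ℂ} (hF : ContDiffOn ℝ ∞ F (halfSpace k))
    (d : Option (Fin k)) {p : ℝ × E k} (hp : p ∈ halfSpace k) :
    Tendsto (fun n => pd d (truncate (truncSeq n) F) p) atTop (𝓝 (pd d F p)) := by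
  simp_rw [fun n => pd_truncate hF (truncSeq_pos n).le d hp]
  have h1 := tendsto_ofReal_truncSeq.mul
    ((tendsto_dilate (contDiff_pd_cutoff d).continuous p).mul (tendsto_shift hF hp))
  have h2 := h1.add (tendsto_truncate (contDiffOn_pd hF d) hp)
  rw [zero_mul, zero_add] at h2
  exact h2

theorem tendsto_pd_pd_truncate {F : ℝ × E k → ℂ} (hF : ContDiffOn ℝ ∞ F (halfSpace k))
    (d : Option (Fin k)) {p : ℝ × E k} (hp : p ∈ halfSpace k) :
    Tendsto (fun n => pd d (pd d (truncate (truncSeq n) F)) p) atTop (𝓝 (pd d (pd d F) p)) := by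
  simp_rw [fun n => pd_pd_truncate hF (truncSeq_pos n).le d hp]
  have c2 : Continuous (pd d (pd d fun p : ℝ × E k => (cutoff k p : ℂ))) :=
    (((contDiff_pd_cutoff d).fderiv_right (m := ∞) (by simp)).clm_apply contDiff_const).continuous
  have h1 := tendsto_ofReal_truncSeq.mul
    (((tendsto_ofReal_truncSeq.mul (tendsto_dilate c2 p)).mul (tendsto_shift hF hp)).add
    (((tendsto_dilate (contDiff_pd_cutoff d).continuous p).mul
      (tendsto_shift (contDiffOn_pd hF d) hp)).const_mul 2))
  have h2 := h1.add (tendsto_truncate (contDiffOn_pd (contDiffOn_pd hF d) d) hp)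
  rw [zero_mul, zero_add] at h2
  exact h2

/-- The smooth function with compact support whose evolution has the truncated initial value. -/
noncomputable def truncData (c : ℝ) (F : ℝ × E k → ℂ) (p : ℝ × E k) : ℂ :=
  (Real.exp p.1 * Real.smoothTransition (2 * p.1 / c + 1) : ℝ) * truncate c F p

/-- The shifted function is smooth for `s > -c`, while the transition vanishes for `s ≤ -c/2`, so
the product extends by zero to all of `ℝ × ℝ^k`. For `s ≥ 0` the transition equals `1`, so nothing
changes on the half space. -/
theorem contDiff_truncData {F : ℝ × E k → ℂ} (hF : ContDiffOn ℝ ∞ F (halfSpace k)) {c : ℝ}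
    (hc : 0 < c) : ContDiff ℝ ∞ (truncData c F) := by
  rw [contDiff_iff_contDiffAt]
  intro p
  by_cases hp : -c < p.1
  · have hmem : p + (c, 0) ∈ halfSpace k := mem_halfSpace.2 (by simpa using by linarith)
    have h1 : ContDiffAt ℝ ∞ (fun p => F (p + (c, 0))) p :=
      ContDiffAt.comp p (f := fun p : ℝ × E k => p + (c, 0))
        (hF.contDiffAt (halfSpace_mem_nhds hmem)) (by fun_prop)
    have h2 : ContDiff ℝ ∞ fun p : ℝ × E k =>
        ((Real.exp p.1 * Real.smoothTransition (2 * p.1 / c + 1) : ℝ) : ℂ) := by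
      refine Complex.ofRealCLM.contDiff.comp (contDiff_fst.exp.mul
        (Real.smoothTransition.contDiff.comp ?_))
      fun_prop
    exact h2.contDiffAt.mul
      (((contDiff_cutoff.comp (contDiff_const_smul c)).contDiffAt).mul h1)
  · have h0 : truncData c F =ᶠ[𝓝 p] fun _ => 0 := by
      have : ∀ᶠ q : ℝ × E k in 𝓝 p, q.1 < -c / 2 :=
        continuous_fst.continuousAt.eventually (gt_mem_nhds (by linarith))
      filter_upwards [this] with q hq
      have : 2 * q.1 / c + 1 ≤ 0 := by
        rw [div_add_one hc.ne']
        exact div_nonpos_of_nonpos_of_nonneg (by linarith) hc.le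
      simp [truncData, Real.smoothTransition.zero_of_nonpos this]
    exact contDiffAt_const.congr_of_eventuallyEq h0

theorem hasCompactSupport_truncData (F : ℝ × E k → ℂ) {c : ℝ} (hc : 0 < c) :
    HasCompactSupport (truncData c F) := by
  have h1 : HasCompactSupport fun p : ℝ × E k => cutoff k (c • p) :=
    (cutoff k).hasCompactSupport.comp_smul hc.ne'
  refine h1.mono fun p hp => ?_
  intro h0
  exact hp (by simp [truncData, truncate, h0])

/-- The value of the evolution of `exp (-r²) G(r², σ)`. -/
noncomputable def evolOne (α : ℝ) (G : 𝓢(FreqSpace k, ℂ)) (r : ℝ) (σ : E k) (t : ℝ) : ℂ :=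
  schwartzEvol α G (fun _ _ _ => 1) r σ t

/-- The time derivative of `evolOne`. -/
noncomputable def evolTime (α : ℝ) (G : 𝓢(FreqSpace k, ℂ)) (r : ℝ) (σ : E k) (t : ℝ) : ℂ :=
  schwartzEvol α G (multT (fun w => freqA w.fst) (fun w => (2 * Real.pi) • w.snd) α) r σ t

/-- The Laplacian in `σ` of `evolOne`. -/
noncomputable def evolLap (α : ℝ) (G : 𝓢(FreqSpace k, ℂ)) (r : ℝ) (σ : E k) (t : ℝ) : ℂ :=
  ∑ i : Fin k, schwartzEvol α G (fun w _ _ => (Complex.I * (inner ℝ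
    ((2 * Real.pi) • w.snd) (EuclideanSpace.single i (1 : ℝ)) : ℝ)) ^ 2) r σ t

/-- The radial derivative of `evolOne`. -/
noncomputable def evolRadial (α : ℝ) (G : 𝓢(FreqSpace k, ℂ)) (r : ℝ) (σ : E k) (t : ℝ) : ℂ :=
  schwartzEvol α G (multR (fun w => freqA w.fst) (fun w => (2 * Real.pi) • w.snd)) r σ t

theorem exists_schwartz_truncate {F : ℝ × E k → ℂ} (hF : ContDiffOn ℝ ∞ F (halfSpace k)) {c : ℝ}
    (hc : 0 < c) : ∃ G : 𝓢(FreqSpace k, ℂ), ∀ r : ℝ, 0 < r → ∀ σ : E k,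
      evolOne α G r σ 0 = truncate c F (r ^ 2, σ) := by
  set e := WithLp.prodContinuousLinearEquiv 2 ℝ ℝ (E k)
  have h1 : ContDiff ℝ ∞ (truncData c F ∘ e) := (contDiff_truncData hF hc).comp e.contDiff
  have h2 : HasCompactSupport (truncData c F ∘ e) :=
    (hasCompactSupport_truncData F hc).comp_homeomorph e.toHomeomorph
  refine ⟨h2.toSchwartzMap h1, fun r hr σ => ?_⟩
  rw [evolOne, schwartzEvol_zero]
  change _ * truncData c F (r ^ 2, σ) = _
  have : 1 ≤ 2 * r ^ 2 / c + 1 := by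
    have : 0 ≤ 2 * r ^ 2 / c := by positivity
    linarith
  rw [truncData, Real.smoothTransition.one_of_one_le this, ← Complex.ofReal_exp, ← mul_assoc,
    ← Complex.ofReal_mul, mul_one, ← Real.exp_add]
  simp

/-- `f` is the bounded limit of initial values of superpositions of modes, and so are `ℒ f = g` and
`Δ_σ f = h`. -/
def HeatApprox (α : ℝ) (f g h : ℝ × E k → ℂ) : Prop :=
  ∃ (G : ℕ → 𝓢(FreqSpace k, ℂ)) (C : ℝ), ∀ p ∈ halfSpace k,
    (∀ n, ‖evolOne α (G n) p.1 p.2 0‖ ≤ C ∧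
      ‖evolTime α (G n)
        p.1 p.2 0‖ ≤ C ∧
      ‖evolLap α (G n) p.1 p.2 0‖ ≤ C) ∧
    Tendsto (fun n => evolOne α (G n) p.1 p.2 0) atTop (𝓝 (f p)) ∧
    Tendsto (fun n => evolTime α (G n) p.1 p.2 0) atTop (𝓝 (g p)) ∧
    Tendsto (fun n => evolLap α (G n) p.1 p.2 0)
      atTop (𝓝 (h p))

theorem Tame.heatApprox {F : ℝ × E k → ℂ} (hF : Tame F) (hα : 0 < α) :
    HeatApprox α (fun p => F (p.1 ^ 2, p.2)) (fun p => grushinS α F (p.1 ^ 2, p.2))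
      (fun p => lapS F (p.1 ^ 2, p.2)) := by
  choose G hG using fun n => exists_schwartz_truncate (α := α) hF.smooth (truncSeq_pos n)
  have hsm := fun n => contDiffOn_truncate hF.smooth (truncSeq_pos n).le
  have hd := fun n r hr σ => (isAmplitude_schwartz (G n)).superpose_derivs hα (hsm n) (hG n)
    (r := r) hr σ
  obtain ⟨C0, h0⟩ := hF.bound_truncate 0
  choose B hB using fun d : Option (Fin k) => hF.bound_pd_truncate d 0
  -- Weight one for the second-order terms of the generator, which carry a factor `s`; weight zero
  -- for its first-order term and for `Δ_σ` alone.
  choose B' hB' using fun d : Option (Fin k) => hF.bound_pd_truncate d 1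
  simp only [pow_zero, one_mul, pow_one] at h0 hB hB'
  refine ⟨G, max C0 (max (4 * B' none + 4 * |α| * B none + 1 / 4 * ∑ i : Fin k, B' (some i))
    (∑ i : Fin k, B (some i))), fun p hp => ?_⟩
  have hp' := mem_halfSpace.1 hp
  have hq : ((p.1 ^ 2, p.2) : ℝ × E k) ∈ halfSpace k :=
    mem_halfSpace.2 (by simpa using by positivity)
  have eT : ∀ n, evolTime α (G n) p.1 p.2 0 =
      grushinS α (truncate (truncSeq n) F) (p.1 ^ 2, p.2) := fun n => (hd n p.1 hp' p.2).2
  have eS : ∀ n, evolLap α (G n) p.1 p.2 0 =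
      lapS (truncate (truncSeq n) F) (p.1 ^ 2, p.2) := fun n =>
    Finset.sum_congr rfl fun i _ => (hd n p.1 hp' p.2).1 i
  simp only [eT, eS, hG _ _ hp']
  have tL : Tendsto (fun n => lapS (truncate (truncSeq n) F) (p.1 ^ 2, p.2)) atTop
      (𝓝 (lapS F (p.1 ^ 2, p.2))) :=
    tendsto_finsetSum _ fun i _ => tendsto_pd_pd_truncate hF.smooth (some i) hq
  refine ⟨fun n => ?_, tendsto_truncate hF.smooth hq, ?_, tL⟩
  · have hc0 := (truncSeq_pos n).le
    have hc1 := truncSeq_le_one n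
    refine ⟨(h0 _ hc0 _ hq).trans (le_max_left _ _),
      le_trans ?_ ((le_max_left _ _).trans (le_max_right _ _)),
      le_trans ?_ ((le_max_right _ _).trans (le_max_right _ _))⟩
    · have e : ‖((p.1 ^ 2 : ℝ) : ℂ)‖ = p.1 ^ 2 := by
        rw [Complex.norm_real, Real.norm_of_nonneg (by positivity)]
      have b1 := (hB' none _ hc0 hc1 _ hq).2
      have b2 := (hB none _ hc0 hc1 _ hq).1
      have b3 := fun i : Fin k => (hB' (some i) _ hc0 hc1 _ hq).2
      simp only at b1 b2 b3
      unfold grushinS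
      refine (norm_add_le _ _).trans (add_le_add ((norm_add_le _ _).trans (add_le_add ?_ ?_)) ?_)
      · rw [norm_mul, norm_mul, e, Complex.norm_ofNat]
        exact mul_le_mul_of_nonneg_left b1 (by norm_num)
      · rw [norm_mul, norm_mul, Complex.norm_real, Complex.norm_ofNat, Real.norm_eq_abs]
        exact mul_le_mul_of_nonneg_left b2 (by positivity)
      · rw [norm_mul, norm_mul, e]
        have : ‖(1 / 4 : ℂ)‖ = 1 / 4 := by simp
        rw [this]
        refine mul_le_mul_of_nonneg_left ?_ (by norm_num)
        unfold lapS
        calc _ ≤ p.1 ^ 2 * ∑ i : Fin k, ‖pd (some i) (pd (some i) (truncate (truncSeq n) F))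
              (p.1 ^ 2, p.2)‖ := mul_le_mul_of_nonneg_left (norm_sum_le _ _) (by positivity)
          _ ≤ _ := by
            rw [Finset.mul_sum]
            exact Finset.sum_le_sum fun i _ => b3 i
    · exact (norm_sum_le _ _).trans (Finset.sum_le_sum fun i _ => (hB (some i) _ hc0 hc1 _ hq).2)
  · exact (((tendsto_pd_pd_truncate hF.smooth none hq).const_mul _).const_mul _ |>.add
      ((tendsto_pd_truncate hF.smooth none hq).const_mul _)).add ((tL.const_mul _).const_mul _)

end approx

end BaouendiGrushin

namespace BaouendiGrushin

open Filter Topology FourierTransform SchwartzMap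

/-! ### Integrated equations for the heat semigroup -/

section heat

variable {k : ℕ} {α : ℝ}

theorem intervalIntegrable_weight (hα : 0 < α) (a b : ℝ) :
    IntervalIntegrable (fun x : ℝ => x ^ (2 * α - 1)) volume a b :=
  intervalIntegral.intervalIntegrable_rpow' (by linarith)

theorem integral_weight (hα : 0 < α) : ∫ x in (0 : ℝ)..1, x ^ (2 * α - 1) = 1 / (2 * α) := by
  rw [integral_rpow (Or.inl (by linarith))]
  have : 2 * α - 1 + 1 = 2 * α := by ring
  rw [this, Real.one_rpow, Real.zero_rpow (by positivity), sub_zero]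

theorem norm_integral_weight_le (hα : 0 < α) {w : ℝ → ℂ} {M : ℝ}
    (hw : ∀ x ∈ Ioc (0 : ℝ) 1, ‖w x‖ ≤ M) :
    ‖∫ x in (0 : ℝ)..1, ((x ^ (2 * α - 1) : ℝ) : ℂ) * w x‖ ≤ M / (2 * α) := by
  have h := intervalIntegral.norm_integral_le_of_norm_le (μ := volume) (a := 0) (b := 1) zero_le_one
    (f := fun x : ℝ => ((x ^ (2 * α - 1) : ℝ) : ℂ) * w x) (g := fun x => M * x ^ (2 * α - 1))
    (Eventually.of_forall fun x hx => ?_) ((intervalIntegrable_weight hα 0 1).const_mul M)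
  · rw [intervalIntegral.integral_const_mul, integral_weight hα] at h
    exact h.trans (le_of_eq (by ring))
  · rw [norm_mul, Complex.norm_real, Real.norm_of_nonneg (Real.rpow_nonneg hx.1.le _), mul_comm]
    exact mul_le_mul_of_nonneg_right (hw x hx) (Real.rpow_nonneg hx.1.le _)

variable {W : Type*} [MeasurableSpace W] {ν : Measure W} {h a : W → ℂ} {ξ : W → E k}

theorem IsAmplitude.continuous_superpose_r (ha : IsAmplitude ν h a ξ) (hα : 0 < α)
    {q : W → ℝ → ℝ → ℂ} (hq : IsMultiplier a ξ q) (σ : E k) {t : ℝ} (ht : 0 ≤ t) :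
    Continuous fun r => superpose ν α h a ξ q r σ t := by
  rw [← continuousOn_univ]
  exact (ha.continuousOn_superpose hα hq).comp (f := fun r : ℝ => ((r, σ), t)) (by fun_prop)
    fun r _ => ⟨mem_univ _, ht⟩

theorem IsAmplitude.continuousOn_superpose_t (ha : IsAmplitude ν h a ξ) (hα : 0 < α)
    {q : W → ℝ → ℝ → ℂ} (hq : IsMultiplier a ξ q) (r : ℝ) (σ : E k) :
    ContinuousOn (fun t => superpose ν α h a ξ q r σ t) (Ici 0) :=
  (ha.continuousOn_superpose hα hq).comp (f := fun t : ℝ => ((r, σ), t)) (by fun_prop)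
    fun _ ht => ⟨mem_univ _, ht⟩

/-- The equation reads `∂_r (r^(2α-1) ∂_r u) = r^(2α-1) (∂_t u - (r²/4) Δ_σ u)`. Integrating from
`0` and rescaling to `[0, 1]` expresses `∂_r u` through quantities that survive the approximation
limit. -/
theorem IsAmplitude.superpose_flux (ha : IsAmplitude ν h a ξ) (hα : 0 < α) {r : ℝ} (hr : 0 < r)
    (σ : E k) {t : ℝ} (ht : 0 ≤ t) :
    superpose ν α h a ξ (multR a ξ) r σ t = r * ∫ x in (0 : ℝ)..1, ((x ^ (2 * α - 1) : ℝ) : ℂ) *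
      (superpose ν α h a ξ (multT a ξ α) (r * x) σ t - ((r * x) ^ 2 / 4 : ℝ) *
        ∑ i : Fin k, superpose ν α h a ξ (fun w _ _ => (Complex.I *
          (inner ℝ (ξ w) (EuclideanSpace.single i (1 : ℝ)) : ℝ)) ^ 2) (r * x) σ t) := by
  set T := fun s => superpose ν α h a ξ (multT a ξ α) s σ t with hT
  set D := fun s => ∑ i : Fin k, superpose ν α h a ξ (fun w _ _ => (Complex.I *
          (inner ℝ (ξ w) (EuclideanSpace.single i (1 : ℝ)) : ℝ)) ^ 2) s σ t with hD
  set R := fun s => superpose ν α h a ξ (multR a ξ) s σ t with hR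
  set RR := fun s => superpose ν α h a ξ (multRR a ξ) s σ t with hRR
  have cT : Continuous T := ha.continuous_superpose_r hα (ha.isMultiplier_t α) σ ht
  have cD : Continuous D := continuous_finsetSum _ fun i _ =>
    ha.continuous_superpose_r hα (ha.isMultiplier_s _ 2 le_rfl) σ ht
  have dR : ∀ s, HasDerivAt R (RR s) s := fun s => ha.superpose_rr hα s σ ht
  have R0 : R 0 = 0 := by simp [hR, superpose, multR]
  have heq : ∀ s : ℝ, 0 < s → T s - (s ^ 2 / 4 : ℝ) * D s = RR s + ((2 * α - 1) / s : ℝ) * R s := by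
    intro s hs
    have := ha.superpose_equation hα hs σ ht
    simp only [hT, hD, hR, hRR]
    rw [this]; ring
  have hder : ∀ x ∈ Ioo (0 : ℝ) 1, HasDerivAt (fun x : ℝ => ((x ^ (2 * α - 1) : ℝ) : ℂ) * R (r * x))
      (r * (((x ^ (2 * α - 1) : ℝ) : ℂ) * (T (r * x) - ((r * x) ^ 2 / 4 : ℝ) * D (r * x)))) x := by
    intro x hx
    have hx0 := hx.1
    have h1 : HasDerivAt (fun x : ℝ => x ^ (2 * α - 1)) ((2 * α - 1) * x ^ (2 * α - 1 - 1)) x :=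
      Real.hasDerivAt_rpow_const (Or.inl hx0.ne')
    have h2 : HasDerivAt (fun x : ℝ => R (r * x)) (r * RR (r * x)) x := by
      have h3 : HasDerivAt (fun x : ℝ => r * x) r x := by
        simpa using (hasDerivAt_id x).const_mul r
      have := (dR (r * x)).scomp x h3
      rwa [Complex.real_smul] at this
    refine (h1.ofReal_comp.mul h2).congr_deriv ?_
    rw [heq _ (by positivity), Real.rpow_sub_one hx0.ne']
    have : (x : ℂ) ≠ 0 := by exact_mod_cast hx0.ne'
    have : (r : ℂ) ≠ 0 := by exact_mod_cast hr.ne'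
    push_cast
    field_simp
    ring
  have hint : IntervalIntegrable (fun x : ℝ => r * (((x ^ (2 * α - 1) : ℝ) : ℂ) *
      (T (r * x) - ((r * x) ^ 2 / 4 : ℝ) * D (r * x)))) volume 0 1 := by
    refine IntervalIntegrable.const_mul ?_ _
    refine IntervalIntegrable.mul_continuousOn ⟨(intervalIntegrable_weight hα 0 1).1.ofReal,
      (intervalIntegrable_weight hα 0 1).2.ofReal⟩ ?_
    exact Continuous.continuousOn (by fun_prop)
  -- The weight blows up when `α < 1/2`. As `R` vanishes at `0` and is differentiable, it supplies
  -- one power of `x`, and `x^(2α) → 0`.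
  have hzero : Tendsto (fun x : ℝ => ((x ^ (2 * α - 1) : ℝ) : ℂ) * R (r * x)) (𝓝[>] 0) (𝓝 0) := by
    have h1 : Tendsto (fun x : ℝ => x⁻¹ • R (r * x)) (𝓝[>] 0) (𝓝 (r * RR (r * 0))) := by
      have h3 : HasDerivAt (fun x : ℝ => r * x) r 0 := by
        simpa using (hasDerivAt_id (0 : ℝ)).const_mul r
      have h2 := (dR (r * 0)).scomp 0 h3
      rw [Complex.real_smul] at h2
      have h4 := h2.tendsto_slope_zero_right
      simpa [R0] using h4
    have h2 : Tendsto (fun x : ℝ => ((x ^ (2 * α) : ℝ) : ℂ)) (𝓝[>] 0) (𝓝 0) := by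
      have h5 : ContinuousAt (fun x : ℝ => x ^ (2 * α)) 0 :=
        Real.continuousAt_rpow_const _ _ (Or.inr (by positivity))
      have h6 := h5.tendsto
      rw [Real.zero_rpow (by positivity)] at h6
      have h7 := (Complex.continuous_ofReal.tendsto 0).comp h6
      rw [Complex.ofReal_zero] at h7
      exact h7.mono_left nhdsWithin_le_nhds
    have h3 := h2.mul h1
    rw [zero_mul] at h3
    refine h3.congr' ?_
    filter_upwards [self_mem_nhdsWithin] with x hx
    have hx' : (0 : ℝ) < x := hx
    have hxc : (x : ℂ) ≠ 0 := by exact_mod_cast hx'.ne'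
    rw [Real.rpow_sub_one hx'.ne', Complex.real_smul]
    push_cast
    field_simp
  have hone : Tendsto (fun x : ℝ => ((x ^ (2 * α - 1) : ℝ) : ℂ) * R (r * x)) (𝓝[<] 1)
      (𝓝 (R r)) := by
    have c1 : ContinuousAt (fun x : ℝ => ((x ^ (2 * α - 1) : ℝ) : ℂ) * R (r * x)) 1 := by
      refine ContinuousAt.mul ?_ ?_
      · exact Complex.continuous_ofReal.continuousAt.comp
          (Real.continuousAt_rpow_const _ _ (Or.inl one_ne_zero))
      · have : Continuous R := ha.continuous_superpose_r hα ha.isMultiplier_r σ ht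
        fun_prop
    have := c1.tendsto
    simp only [Real.one_rpow, Complex.ofReal_one, one_mul, mul_one] at this
    exact this.mono_left nhdsWithin_le_nhds
  have := intervalIntegral.integral_eq_sub_of_hasDerivAt_of_tendsto zero_lt_one hder hint hzero hone
  rw [sub_zero, intervalIntegral.integral_const_mul] at this
  exact this.symm

theorem IsAmplitude.exists_bound_superpose_s (ha : IsAmplitude ν h a ξ) (hα : 0 < α) (y : E k)
    (n : ℕ) (hn : n ≤ 2) : ∃ K : ℝ, ∀ (r : ℝ) (σ : E k) (t : ℝ), 0 ≤ t →
      ‖superpose ν α h a ξ (fun w _ _ => (Complex.I * (inner ℝ (ξ w) y : ℝ)) ^ n) r σ t‖ ≤ K := by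
  obtain ⟨C, hC⟩ := (ha.isMultiplier_s y n hn).bound 0 le_rfl
  refine ⟨∫ w, C * ((1 + ‖a w‖ + ‖ξ w‖) ^ 2 * ‖h w‖) ∂ν, fun r σ t ht => ?_⟩
  exact norm_integral_le_of_norm_le (ha.moment.const_mul C) (Eventually.of_forall fun w =>
    ha.norm_le hα ht σ (q := fun w _ _ => (Complex.I * (inner ℝ (ξ w) y : ℝ)) ^ n)
      (hC w 0 0 (by simp) le_rfl))

/-- The action of the heat measures on functions of `(r, σ)`. -/
noncomputable def heat (α : ℝ) (f : ℝ × E k → ℂ) (r : ℝ) (σ : E k) (t : ℝ) : ℂ :=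
  ∫ q, f (q.1, σ + q.2) ∂(heatMeasure k α r t)

/-- The radial derivative of `heat α f` when `ℒ f = g` and `Δ_σ f = h`. -/
noncomputable def heatFlux (α : ℝ) (g h : ℝ × E k → ℂ) (r : ℝ) (σ : E k) (t : ℝ) : ℂ :=
  r * ∫ x in (0 : ℝ)..1, ((x ^ (2 * α - 1) : ℝ) : ℂ) *
    (heat α g (r * x) σ t - ((r * x) ^ 2 / 4 : ℝ) * heat α h (r * x) σ t)

theorem tendsto_heat (hα : 0 < α) {f : ℝ × E k → ℂ} {fn : ℕ → ℝ × E k → ℂ} {C : ℝ}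
    (hc : ∀ n, Continuous (fn n)) (hC : ∀ n, ∀ p ∈ halfSpace k, ‖fn n p‖ ≤ C)
    (hlim : ∀ p ∈ halfSpace k, Tendsto (fun n => fn n p) atTop (𝓝 (f p))) {r : ℝ} (hr : 0 < r)
    (σ : E k) (t : ℝ) : Tendsto (fun n => heat α (fn n) r σ t) atTop (𝓝 (heat α f r σ t)) := by
  have := isFiniteMeasure_heatMeasure (k := k) (t := t) hα hr
  refine tendsto_integral_of_dominated_convergence (fun _ => C) (fun n => ?_) (integrable_const C)
    (fun n => ?_) ?_
  · have := hc n
    exact Continuous.aestronglyMeasurable (by fun_prop)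
  · filter_upwards [ae_heatMeasure hr] with q hq using hC n _ (mem_halfSpace.2 hq)
  · filter_upwards [ae_heatMeasure hr] with q hq using hlim _ (mem_halfSpace.2 hq)

theorem norm_heat_le (hα : 0 < α) {f : ℝ × E k → ℂ} {C : ℝ} (hC : ∀ p ∈ halfSpace k, ‖f p‖ ≤ C)
    {r : ℝ} (hr : 0 < r) (σ : E k) (t : ℝ) : ‖heat α f r σ t‖ ≤ C :=
  norm_integral_heatMeasure_le hα hr
    ((norm_nonneg _).trans (hC (1, 0) (mem_halfSpace.2 one_pos)))
    fun _ hq => hC _ (mem_halfSpace.2 hq)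

theorem heat_zero (α : ℝ) (f : ℝ × E k → ℂ) (r : ℝ) (σ : E k) : heat α f r σ 0 = f (r, σ) := by
  rw [heat, heatMeasure_zero, integral_dirac]
  simp

theorem continuous_schwartzEvol (hα : 0 < α) (G : 𝓢(FreqSpace k, ℂ)) {q : FreqSpace k → ℝ → ℝ → ℂ}
    (hq : IsMultiplier (fun w : FreqSpace k => freqA w.fst) (fun w => (2 * Real.pi) • w.snd) q) :
    Continuous fun p : ℝ × E k => schwartzEvol α G q p.1 p.2 0 := by
  rw [← continuousOn_univ]
  exact ((isAmplitude_schwartz G).continuousOn_superpose hα hq).comp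
    (f := fun p : ℝ × E k => (p, (0 : ℝ))) (by fun_prop) fun p _ => ⟨mem_univ _, mem_Ici.2 le_rfl⟩

variable {f g h : ℝ × E k → ℂ}

theorem continuous_evolOne (hα : 0 < α) (G : 𝓢(FreqSpace k, ℂ)) :
    Continuous fun p : ℝ × E k => evolOne α G p.1 p.2 0 :=
  continuous_schwartzEvol hα G (isAmplitude_schwartz G).isMultiplier_one

theorem continuous_evolTime (hα : 0 < α) (G : 𝓢(FreqSpace k, ℂ)) :
    Continuous fun p : ℝ × E k => evolTime α G p.1 p.2 0 :=
  continuous_schwartzEvol hα G ((isAmplitude_schwartz G).isMultiplier_t α)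

theorem continuous_evolLap (hα : 0 < α) (G : 𝓢(FreqSpace k, ℂ)) :
    Continuous fun p : ℝ × E k => evolLap α G p.1 p.2 0 :=
  continuous_finsetSum _ fun _ _ => continuous_schwartzEvol hα G
    ((isAmplitude_schwartz G).isMultiplier_s _ 2 le_rfl)

theorem heat_evolOne (hα : 0 < α) (G : 𝓢(FreqSpace k, ℂ)) {r : ℝ} (hr : 0 < r) (σ : E k) {t : ℝ}
    (ht : 0 ≤ t) : heat α (fun p => evolOne α G p.1 p.2 0) r σ t = evolOne α G r σ t :=
  (isAmplitude_schwartz G).integral_superpose_one hα hr ht (fun _ => freqA_re _) σ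

theorem heat_evolTime (hα : 0 < α) (G : 𝓢(FreqSpace k, ℂ)) {r : ℝ} (hr : 0 < r) (σ : E k) {t : ℝ}
    (ht : 0 ≤ t) : heat α (fun p => evolTime α G p.1 p.2 0) r σ t = evolTime α G r σ t :=
  (isAmplitude_schwartz G).integral_superpose_t hα hr ht (fun _ => freqA_re _) σ

theorem heat_evolLap (hα : 0 < α) (G : 𝓢(FreqSpace k, ℂ)) {r : ℝ} (hr : 0 < r) (σ : E k) {t : ℝ}
    (ht : 0 ≤ t) : heat α (fun p => evolLap α G p.1 p.2 0) r σ t = evolLap α G r σ t := by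
  have hfin := isFiniteMeasure_heatMeasure (k := k) (t := t) hα hr
  have ha := isAmplitude_schwartz G
  unfold heat evolLap
  rw [integral_finsetSum]
  · exact Finset.sum_congr rfl fun i _ =>
      ha.integral_superpose_s hα hr ht (fun _ => freqA_re _) σ _ 2 le_rfl
  · intro i _
    have hq := ha.isMultiplier_s (EuclideanSpace.single i (1 : ℝ)) 2 le_rfl
    obtain ⟨K, hK⟩ := ha.exists_bound_superpose_s hα (EuclideanSpace.single i (1 : ℝ)) 2 le_rfl
    have hc := continuous_schwartzEvol hα G hq
    have hm : Continuous fun q : ℝ × E k => (q.1, σ + q.2) := by fun_prop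
    exact Integrable.of_bound (hc.comp hm).aestronglyMeasurable K
      (Eventually.of_forall fun q => hK q.1 (σ + q.2) 0 le_rfl)

/-- On superpositions the heat measures agree with the explicit evolution. Having mass at most one,
they propagate the bounds and the pointwise limits from time `0` to all times. -/
theorem HeatApprox.evol (H : HeatApprox α f g h) (hα : 0 < α) :
    ∃ (G : ℕ → 𝓢(FreqSpace k, ℂ)) (C : ℝ), ∀ r : ℝ, 0 < r → ∀ (σ : E k) (t : ℝ), 0 ≤ t →
    (∀ n, ‖evolTime α (G n) r σ t‖ ≤ C ∧ ‖evolLap α (G n) r σ t‖ ≤ C) ∧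
    Tendsto (fun n => evolOne α (G n) r σ t) atTop (𝓝 (heat α f r σ t)) ∧
    Tendsto (fun n => evolTime α (G n) r σ t) atTop (𝓝 (heat α g r σ t)) ∧
    Tendsto (fun n => evolLap α (G n) r σ t) atTop (𝓝 (heat α h r σ t)) := by
  obtain ⟨G, C, H⟩ := H
  refine ⟨G, C, fun r hr σ t ht => ?_⟩
  simp only [← heat_evolOne hα _ hr σ ht, ← heat_evolTime hα _ hr σ ht, ← heat_evolLap hα _ hr σ ht]
  refine ⟨fun n => ⟨?_, ?_⟩, ?_, ?_, ?_⟩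
  · exact norm_heat_le hα (fun p hp => ((H p hp).1 n).2.1) hr σ t
  · exact norm_heat_le hα (fun p hp => ((H p hp).1 n).2.2) hr σ t
  · exact tendsto_heat hα (fun n => continuous_evolOne hα (G n)) (fun n p hp => ((H p hp).1 n).1)
      (fun p hp => (H p hp).2.1) hr σ t
  · exact tendsto_heat hα (fun n => continuous_evolTime hα (G n))
      (fun n p hp => ((H p hp).1 n).2.1) (fun p hp => (H p hp).2.2.1) hr σ t
  · exact tendsto_heat hα (fun n => continuous_evolLap hα (G n))
      (fun n p hp => ((H p hp).1 n).2.2) (fun p hp => (H p hp).2.2.2) hr σ t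

/-- Pointwise bounded convergence does not carry derivatives to the limit, but it does carry the
integrated equation. -/
theorem HeatApprox.heat_sub_time (H : HeatApprox α f g h) (hα : 0 < α) {r : ℝ} (hr : 0 < r)
    (σ : E k) {t₁ t₂ : ℝ} (h1 : 0 ≤ t₁) (h12 : t₁ ≤ t₂) :
    heat α f r σ t₂ - heat α f r σ t₁ = ∫ τ in t₁..t₂, heat α g r σ τ := by
  obtain ⟨G, C, H⟩ := H.evol hα
  have hn : ∀ n, evolOne α (G n) r σ t₂ -
      evolOne α (G n) r σ t₁ = ∫ τ in t₁..t₂, evolTime α (G n) r σ τ := by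
    intro n
    have ha := isAmplitude_schwartz (G n)
    have hsub : Icc t₁ t₂ ⊆ Ici 0 := fun x hx => h1.trans hx.1
    refine (intervalIntegral.integral_eq_sub_of_hasDerivAt_of_le h12
      ((ha.continuousOn_superpose_t hα ha.isMultiplier_one r σ).mono hsub)
      (fun x hx => ha.superpose_t hα r σ (h1.trans_lt hx.1)) ?_).symm
    refine ContinuousOn.intervalIntegrable ?_
    rw [uIcc_of_le h12]
    exact (ha.continuousOn_superpose_t hα (ha.isMultiplier_t α) r σ).mono hsub
  have l1 := (H r hr σ t₂ (h1.trans h12)).2.1.sub (H r hr σ t₁ h1).2.1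
  refine tendsto_nhds_unique l1 ?_
  simp_rw [hn]
  refine intervalIntegral.tendsto_integral_filter_of_dominated_convergence (fun _ => C)
    (Eventually.of_forall fun n => ?_) (Eventually.of_forall fun n => Eventually.of_forall
      fun x hx => ?_) (by simp) (Eventually.of_forall fun x hx => ?_)
  · have ha := isAmplitude_schwartz (G n)
    refine ContinuousOn.aestronglyMeasurable ?_ measurableSet_uIoc
    refine (ha.continuousOn_superpose_t hα (ha.isMultiplier_t α) r σ).mono fun x hx => ?_
    rw [uIoc_of_le h12] at hx
    exact h1.trans hx.1.le
  · rw [uIoc_of_le h12] at hx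
    exact ((H r hr σ x (h1.trans hx.1.le)).1 n).1
  · rw [uIoc_of_le h12] at hx
    exact (H r hr σ x (h1.trans hx.1.le)).2.2.1

/-- Dominated convergence is used twice, in the flux integral and in the integral over `r`;
`superpose_flux` supplies a flux bound independent of `n`. -/
theorem HeatApprox.heat_sub_radial (H : HeatApprox α f g h) (hα : 0 < α) {r₁ r₂ : ℝ} (h1 : 0 < r₁)
    (h12 : r₁ ≤ r₂) (σ : E k) {t : ℝ} (ht : 0 ≤ t) :
    heat α f r₂ σ t - heat α f r₁ σ t = ∫ r in r₁..r₂, heatFlux α g h r σ t := by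
  obtain ⟨G, C, H⟩ := H.evol hα
  have hC : 0 ≤ C := (norm_nonneg _).trans ((H r₁ h1 σ t ht).1 0).1
  have hn : ∀ n, evolOne α (G n) r₂ σ t -
      evolOne α (G n) r₁ σ t = ∫ r in r₁..r₂, evolRadial α (G n) r σ t := by
    intro n
    have ha := isAmplitude_schwartz (G n)
    exact (intervalIntegral.integral_eq_sub_of_hasDerivAt (fun x _ => ha.superpose_r hα x σ ht)
      (ha.continuous_superpose_r hα ha.isMultiplier_r σ ht).continuousOn.intervalIntegrable).symm
  have hw : ∀ n, ∀ r : ℝ, 0 < r → ‖evolTime α (G n) r σ t - (r ^ 2 / 4 : ℝ) *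
        evolLap α (G n) r σ t‖ ≤
        (1 + r ^ 2 / 4) * C := by
    intro n r hr
    obtain ⟨b1, b2⟩ := (H r hr σ t ht).1 n
    refine (norm_sub_le _ _).trans ?_
    rw [norm_mul, Complex.norm_real, Real.norm_of_nonneg (by positivity), add_mul, one_mul]
    exact add_le_add b1 (mul_le_mul_of_nonneg_left b2 (by positivity))
  have hflux : ∀ n, ∀ r : ℝ, 0 < r → evolRadial α (G n) r σ t = r * ∫ x in (0 : ℝ)..1,
      ((x ^ (2 * α - 1) : ℝ) : ℂ) * (evolTime α (G n) (r * x) σ t - ((r * x) ^ 2 / 4 : ℝ) *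
        evolLap α (G n) (r * x) σ t) :=
    fun n r hr => (isAmplitude_schwartz (G n)).superpose_flux hα hr σ ht
  have hmeas : ∀ n, Continuous fun r => evolTime α (G n) r σ t - (r ^ 2 / 4 : ℝ) *
        evolLap α (G n) r σ t := by
    intro n
    have ha := isAmplitude_schwartz (G n)
    refine (ha.continuous_superpose_r hα (ha.isMultiplier_t α) σ ht).sub
      (Continuous.mul (by fun_prop) (continuous_finsetSum _ fun i _ => ?_))
    exact ha.continuous_superpose_r hα (ha.isMultiplier_s _ 2 le_rfl) σ ht
  have hbd : ∀ r ∈ Ioc r₁ r₂, ∀ x ∈ Ioc (0 : ℝ) 1, (1 + (r * x) ^ 2 / 4) * C ≤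
      (1 + r₂ ^ 2 / 4) * C := by
    intro r hr x hx
    have hr0 : 0 < r := h1.trans hr.1
    have hle : r * x ≤ r₂ := (mul_le_of_le_one_right hr0.le hx.2).trans hr.2
    have := pow_le_pow_left₀ (mul_nonneg hr0.le hx.1.le) hle 2
    gcongr
  have l1 := (H r₂ (h1.trans_le h12) σ t ht).2.1.sub (H r₁ h1 σ t ht).2.1
  refine tendsto_nhds_unique l1 ?_
  simp_rw [hn]
  refine intervalIntegral.tendsto_integral_filter_of_dominated_convergence
    (fun _ => r₂ * ((1 + r₂ ^ 2 / 4) * C / (2 * α)))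
    (Eventually.of_forall fun n => ?_) (Eventually.of_forall fun n => Eventually.of_forall
      fun r hr => ?_) (by simp) (Eventually.of_forall fun r hr => ?_)
  · have ha := isAmplitude_schwartz (G n)
    exact (ha.continuous_superpose_r hα ha.isMultiplier_r σ ht).aestronglyMeasurable
  · rw [uIoc_of_le h12] at hr
    have hr0 : 0 < r := h1.trans hr.1
    rw [hflux n r hr0, norm_mul, Complex.norm_real, Real.norm_of_nonneg hr0.le]
    exact mul_le_mul hr.2 (norm_integral_weight_le hα fun x hx =>
      (hw n (r * x) (mul_pos hr0 hx.1)).trans (hbd r hr x hx)) (norm_nonneg _)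
      (h1.le.trans h12)
  · rw [uIoc_of_le h12] at hr
    have hr0 : 0 < r := h1.trans hr.1
    simp_rw [fun n => hflux n r hr0]
    refine Tendsto.const_mul _ ?_
    refine intervalIntegral.tendsto_integral_filter_of_dominated_convergence
      (fun x => x ^ (2 * α - 1) * ((1 + r₂ ^ 2 / 4) * C)) (Eventually.of_forall fun n => ?_)
      (Eventually.of_forall fun n => Eventually.of_forall fun x hx => ?_)
      ((intervalIntegrable_weight hα 0 1).mul_const _) (Eventually.of_forall fun x hx => ?_)
    · refine AEStronglyMeasurable.mul (by fun_prop) ?_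
      exact ((hmeas n).comp (continuous_const.mul continuous_id)).aestronglyMeasurable
    · rw [uIoc_of_le zero_le_one] at hx
      rw [norm_mul, Complex.norm_real, Real.norm_of_nonneg (Real.rpow_nonneg hx.1.le _)]
      exact mul_le_mul_of_nonneg_left ((hw n (r * x) (mul_pos hr0 hx.1)).trans (hbd r hr x hx))
        (Real.rpow_nonneg hx.1.le _)
    · rw [uIoc_of_le zero_le_one] at hx
      have := H (r * x) (mul_pos hr0 hx.1) σ t ht
      exact (this.2.2.1.sub (this.2.2.2.const_mul _)).const_mul _

theorem norm_heatFlux_le (hα : 0 < α) {C : ℝ} (hg : ∀ p ∈ halfSpace k, ‖g p‖ ≤ C)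
    (hh : ∀ p ∈ halfSpace k, ‖h p‖ ≤ C) {r : ℝ} (hr : 0 < r) (σ : E k) (t : ℝ) :
    ‖heatFlux α g h r σ t‖ ≤ r * ((1 + r ^ 2 / 4) * C / (2 * α)) := by
  have hC : 0 ≤ C := (norm_nonneg _).trans (hg (1, 0) (mem_halfSpace.2 one_pos))
  rw [heatFlux, norm_mul, Complex.norm_real, Real.norm_of_nonneg hr.le]
  refine mul_le_mul_of_nonneg_left (norm_integral_weight_le hα fun x hx => ?_) hr.le
  have hx0 : 0 < r * x := mul_pos hr hx.1
  have hle : r * x ≤ r := mul_le_of_le_one_right hr.le hx.2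
  have h2 := pow_le_pow_left₀ hx0.le hle 2
  refine (norm_sub_le _ _).trans ?_
  rw [norm_mul, Complex.norm_real, Real.norm_of_nonneg (by positivity)]
  have b1 := norm_heat_le hα hg hx0 σ t
  have b2 := norm_heat_le hα hh hx0 σ t
  calc _ ≤ C + (r * x) ^ 2 / 4 * C := add_le_add b1 (mul_le_mul_of_nonneg_left b2 (by positivity))
    _ ≤ C + r ^ 2 / 4 * C := by gcongr
    _ = _ := by ring

end heat

end BaouendiGrushin

namespace BaouendiGrushin

open Filter Topology

/-! ### Regularity of the heat evolution of tame functions -/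

section calculus

variable {k : ℕ}

theorem hasDerivAt_of_sub_eq_integral {f g : ℝ → ℂ} (hg : ContinuousOn g (Ioi 0))
    (h : ∀ a b : ℝ, 0 < a → a ≤ b → f b - f a = ∫ x in a..b, g x) {x : ℝ} (hx : 0 < x) :
    HasDerivAt f (g x) x := by
  have hx2 : 0 < x / 2 := by positivity
  have hc : ContinuousAt g x := hg.continuousAt (Ioi_mem_nhds hx)
  have hsub : uIcc (x / 2) x ⊆ Ioi 0 := by
    rw [uIcc_of_le (by linarith)]
    exact fun y hy => hx2.trans_le hy.1
  have h1 := intervalIntegral.integral_hasDerivAt_right (hg.mono hsub).intervalIntegrable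
    (hg.stronglyMeasurableAtFilter isOpen_Ioi x hx) hc
  refine (h1.const_add (f (x / 2))).congr_of_eventuallyEq ?_
  filter_upwards [lt_mem_nhds (show x / 2 < x by linarith)] with y hy
  rw [← h _ _ hx2 hy.le]
  ring

/-- The real linear form on `ℝ^k` with given values on the coordinate vectors. -/
noncomputable def gradS : (Fin k → ℂ) →L[ℝ] (E k →L[ℝ] ℂ) :=
  ∑ i, (ContinuousLinearMap.smulRightL ℝ (E k) ℂ (EuclideanSpace.proj i)).comp
    (ContinuousLinearMap.proj i)

theorem gradS_apply (c : Fin k → ℂ) (v : E k) : gradS c v = ∑ i, v i • c i := by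
  simp [gradS]

theorem eq_gradS (L : E k →L[ℝ] ℂ) :
    L = gradS fun i => L (EuclideanSpace.single i 1) := by
  ext v
  rw [gradS_apply]
  conv_lhs => rw [← (EuclideanSpace.basisFun (Fin k) ℝ).sum_repr v]
  simp

theorem norm_gradS_le {c : Fin k → ℂ} {C : ℝ} (hC : 0 ≤ C) (hc : ∀ i, ‖c i‖ ≤ C) :
    ‖gradS c‖ ≤ ‖(gradS : (Fin k → ℂ) →L[ℝ] _)‖ * C :=
  (gradS.le_opNorm c).trans
    (mul_le_mul_of_nonneg_left ((pi_norm_le_iff_of_nonneg hC).2 hc) (norm_nonneg _))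

theorem hasFDerivAt_integral_gradS {X : Type*} [MeasurableSpace X] {μ : Measure X}
    {f : X → E k → ℂ} {c : Fin k → X → E k → ℂ} {B : X → ℝ} (hB : Integrable B μ)
    (hf : ∀ σ, Integrable (fun x => f x σ) μ)
    (hc : ∀ i σ, AEStronglyMeasurable (fun x => c i x σ) μ)
    (hbd : ∀ᵐ x ∂μ, ∀ i σ, ‖c i x σ‖ ≤ B x)
    (hd : ∀ᵐ x ∂μ, ∀ σ, HasFDerivAt (f x) (gradS fun i => c i x σ) σ) (σ : E k) :
    HasFDerivAt (fun σ => ∫ x, f x σ ∂μ) (gradS fun i => ∫ x, c i x σ ∂μ) σ := by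
  have hci : ∀ i, Integrable (fun x => c i x σ) μ := fun i =>
    hB.mono' (hc i σ) (hbd.mono fun x hx => hx i σ)
  have hpi : Integrable (fun x => fun i => c i x σ) μ := Integrable.of_eval hci
  have h := hasFDerivAt_integral_of_dominated_of_fderiv_le (𝕜 := ℝ) (μ := μ) (s := univ) (x₀ := σ)
    (F := fun σ x => f x σ) (F' := fun σ x => gradS fun i => c i x σ)
    (bound := fun x => ‖(gradS : (Fin k → ℂ) →L[ℝ] _)‖ * |B x|) univ_mem
    (Eventually.of_forall fun σ => (hf σ).aestronglyMeasurable) (hf σ)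
    (gradS.continuous.comp_aestronglyMeasurable hpi.aestronglyMeasurable)
    (hbd.mono fun x hx τ _ => norm_gradS_le (abs_nonneg _) fun i => (hx i τ).trans (le_abs_self _))
    (hB.abs.const_mul _) (hd.mono fun x hx τ _ => hx τ)
  refine h.congr_fderiv ?_
  have e := ContinuousLinearMap.integral_comp_comm (gradS : (Fin k → ℂ) →L[ℝ] _) hpi
  rw [e]
  congr 1
  ext i
  exact eval_integral hci i

end calculus

section regularity

variable {k : ℕ} {α : ℝ} {F G H : ℝ × E k → ℂ}

/-- The heat evolution of `F(r², σ)`. -/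
noncomputable def tameHeat (α : ℝ) (F : ℝ × E k → ℂ) (r : ℝ) (σ : E k) (t : ℝ) : ℂ :=
  heat α (fun p => F (p.1 ^ 2, p.2)) r σ t

/-- The flux `heatFlux` for functions of `(r², σ)`. -/
noncomputable def tameFlux (α : ℝ) (G H : ℝ × E k → ℂ) (r : ℝ) (σ : E k) (t : ℝ) : ℂ :=
  heatFlux α (fun p => G (p.1 ^ 2, p.2)) (fun p => H (p.1 ^ 2, p.2)) r σ t

theorem sq_mem_halfSpace {p : ℝ × E k} (hp : p ∈ halfSpace k) : (p.1 ^ 2, p.2) ∈ halfSpace k :=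
  mem_halfSpace.2 (pow_pos (mem_halfSpace.1 hp) 2)

theorem Tame.exists_bound (hF : Tame F) : ∃ C, ∀ p ∈ halfSpace k, ‖F p‖ ≤ C := by
  simpa [iterPd] using hF.bounded 0 []

theorem Tame.exists_bound_sq (hF : Tame F) :
    ∃ C, ∀ p ∈ halfSpace k, ‖F (p.1 ^ 2, p.2)‖ ≤ C := by
  obtain ⟨C, hC⟩ := hF.exists_bound
  exact ⟨C, fun p hp => hC _ (sq_mem_halfSpace hp)⟩

theorem Tame.exists_norm_tameHeat_le (hF : Tame F) (hα : 0 < α) :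
    ∃ C, ∀ r : ℝ, 0 < r → ∀ σ t, ‖tameHeat α F r σ t‖ ≤ C := by
  obtain ⟨C, hC⟩ := hF.exists_bound_sq
  exact ⟨C, fun r hr σ t => norm_heat_le hα hC hr σ t⟩

theorem Tame.continuousOn_translate (hF : Tame F) (σ : E k) :
    ContinuousOn (fun q : ℝ × E k => F (q.1 ^ 2, σ + q.2)) (halfSpace k) :=
  hF.smooth.continuousOn.comp (f := fun q : ℝ × E k => (q.1 ^ 2, σ + q.2)) (by fun_prop)
    fun q hq => mem_halfSpace.2 (pow_pos (mem_halfSpace.1 hq) 2)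

theorem Tame.integrable_translate (hF : Tame F) (hα : 0 < α) {r : ℝ} (hr : 0 < r) (σ : E k)
    (t : ℝ) : Integrable (fun q : ℝ × E k => F (q.1 ^ 2, σ + q.2)) (heatMeasure k α r t) := by
  obtain ⟨C, hC⟩ := hF.exists_bound
  exact integrable_heatMeasure hα hr
    (aestronglyMeasurable_heatMeasure (hF.continuousOn_translate σ))
    fun q hq => hC _ (mem_halfSpace.2 (pow_pos hq 2))

theorem hasFDerivAt_slice {s : ℝ} {σ : E k} (hF : DifferentiableAt ℝ F (s, σ)) :
    HasFDerivAt (fun σ : E k => F (s, σ)) (gradS fun i => pd (some i) F (s, σ)) σ := by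
  refine (hF.hasFDerivAt.comp σ (hasFDerivAt_prodMk_right s σ)).congr_fderiv ?_
  rw [eq_gradS ((fderiv ℝ F (s, σ)).comp _)]
  rfl

theorem Tame.hasFDerivAt_sigma (hF : Tame F) {s : ℝ} (hs : 0 < s) (σ : E k) :
    HasFDerivAt (fun σ : E k => F (s, σ)) (gradS fun i => pd (some i) F (s, σ)) σ :=
  hasFDerivAt_slice (hF.smooth.differentiableAt_halfSpace (mem_halfSpace.2 hs))

/-- The variable `σ` enters only as a translation of the data, so these derivatives need no
approximation: they fall on `F` under the integral. -/
theorem Tame.hasFDerivAt_tameHeat_sigma (hF : Tame F) (hα : 0 < α) {r : ℝ} (hr : 0 < r) (σ : E k)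
    (t : ℝ) : HasFDerivAt (fun σ => tameHeat α F r σ t)
      (gradS fun i => tameHeat α (pd (some i) F) r σ t) σ := by
  have := isFiniteMeasure_heatMeasure (k := k) (t := t) hα hr
  choose C hC using fun i => (hF.pderiv (some i)).exists_bound
  refine hasFDerivAt_integral_gradS (μ := heatMeasure k α r t)
    (f := fun q σ => F (q.1 ^ 2, σ + q.2))
    (c := fun i q σ => pd (some i) F (q.1 ^ 2, σ + q.2)) (B := fun _ => ∑ i, |C i|)
    (integrable_const _) (fun σ => hF.integrable_translate hα hr σ t)
    (fun i σ => ((hF.pderiv (some i)).integrable_translate hα hr σ t).aestronglyMeasurable) ?_ ?_ σ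
  · filter_upwards [ae_heatMeasure hr] with q hq i σ
    refine (hC i _ (mem_halfSpace.2 (pow_pos hq 2))).trans ((le_abs_self _).trans ?_)
    exact Finset.single_le_sum (f := fun i => |C i|) (fun i _ => abs_nonneg _) (Finset.mem_univ i)
  · filter_upwards [ae_heatMeasure hr] with q hq σ
    exact (hF.hasFDerivAt_sigma (pow_pos hq 2) (σ + q.2)).comp σ ((hasFDerivAt_id σ).add_const q.2)

theorem Tame.tameHeat_sub_time (hF : Tame F) (hα : 0 < α) {r : ℝ} (hr : 0 < r)
    (σ : E k) {t₁ t₂ : ℝ} (h1 : 0 ≤ t₁) (h12 : t₁ ≤ t₂) :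
    tameHeat α F r σ t₂ - tameHeat α F r σ t₁ = ∫ τ in t₁..t₂, tameHeat α (grushinS α F) r σ τ :=
  (hF.heatApprox hα).heat_sub_time hα hr σ h1 h12

theorem Tame.tameHeat_sub_radial (hF : Tame F) (hα : 0 < α) {r₁ r₂ : ℝ} (h1 : 0 < r₁)
    (h12 : r₁ ≤ r₂) (σ : E k) {t : ℝ} (ht : 0 ≤ t) :
    tameHeat α F r₂ σ t - tameHeat α F r₁ σ t =
      ∫ r in r₁..r₂, tameFlux α (grushinS α F) (lapS F) r σ t :=
  (hF.heatApprox hα).heat_sub_radial hα h1 h12 σ ht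

theorem Tame.exists_norm_tameFlux_le (hG : Tame G) (hH : Tame H) (hα : 0 < α) :
    ∃ C, 0 ≤ C ∧ ∀ r : ℝ, 0 < r → ∀ σ t, ‖tameFlux α G H r σ t‖ ≤ r * ((1 + r ^ 2) * C) := by
  obtain ⟨C, hC⟩ := hG.exists_bound_sq
  obtain ⟨C', hC'⟩ := hH.exists_bound_sq
  have h0 : 0 ≤ max C C' := ((norm_nonneg _).trans (hC (1, 0) (mem_halfSpace.2 one_pos))).trans
    (le_max_left _ _)
  refine ⟨max C C' / (2 * α), by positivity, fun r hr σ t => ?_⟩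
  refine (norm_heatFlux_le hα (fun p hp => (hC p hp).trans (le_max_left C C'))
    (fun p hp => (hC' p hp).trans (le_max_right C C')) hr σ t).trans ?_
  rw [mul_div_assoc]
  have : r ^ 2 / 4 ≤ r ^ 2 := by linarith [sq_nonneg r]
  gcongr

/-- Lipschitz bound on `0 < r ≤ R`, `t ≥ 0`. -/
theorem Tame.exists_lipschitz (hF : Tame F) (hα : 0 < α) (R : ℝ) : ∃ K : NNReal,
    LipschitzOnWith K (fun x : (ℝ × E k) × ℝ => tameHeat α F x.1.1 x.1.2 x.2)
      ((Ioo 0 R ×ˢ univ) ×ˢ Ici 0) := by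
  obtain ⟨C₁, hC₁, b₁⟩ := (hF.generator α).exists_norm_tameFlux_le hF.laplacian hα
  obtain ⟨C₂, b₂⟩ := (hF.generator α).exists_norm_tameHeat_le hα
  choose C hC using fun i => (hF.pderiv (some i)).exists_norm_tameHeat_le hα
  -- `K₁` bounds the flux for `r ≤ R`, `K₃` the gradient in `σ`, and `C₂` the evolution of the
  -- generator, which is the rate of change in time.
  set K₁ := R * ((1 + R ^ 2) * C₁)
  set K₃ := ‖(gradS : (Fin k → ℂ) →L[ℝ] _)‖ * ∑ i, |C i|
  have l1 : ∀ r₁ ∈ Ioo 0 R, ∀ r₂ ∈ Ioo 0 R, ∀ σ t, 0 ≤ t →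
      ‖tameHeat α F r₂ σ t - tameHeat α F r₁ σ t‖ ≤ K₁ * |r₂ - r₁| := by
    intro r₁ h1 r₂ h2 σ t ht
    wlog h : r₁ ≤ r₂ generalizing r₁ r₂
    · rw [norm_sub_rev, abs_sub_comm]
      exact this r₂ h2 r₁ h1 (le_of_not_ge h)
    rw [hF.tameHeat_sub_radial hα h1.1 h σ ht]
    refine intervalIntegral.norm_integral_le_of_norm_le_const fun x hx => ?_
    rw [uIoc_of_le h] at hx
    have hx0 : 0 < x := h1.1.trans hx.1
    have hxR : x ≤ R := hx.2.trans h2.2.le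
    refine (b₁ x hx0 σ t).trans ?_
    have : 0 ≤ R := hx0.le.trans hxR
    change _ ≤ R * ((1 + R ^ 2) * C₁)
    gcongr
  have l2 : ∀ r, 0 < r → ∀ σ t₁ t₂, 0 ≤ t₁ → 0 ≤ t₂ →
      ‖tameHeat α F r σ t₂ - tameHeat α F r σ t₁‖ ≤ C₂ * |t₂ - t₁| := by
    intro r hr σ t₁ t₂ h1 h2
    wlog h : t₁ ≤ t₂ generalizing t₁ t₂
    · rw [norm_sub_rev, abs_sub_comm]
      exact this t₂ t₁ h2 h1 (le_of_not_ge h)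
    rw [hF.tameHeat_sub_time hα hr σ h1 h]
    exact intervalIntegral.norm_integral_le_of_norm_le_const fun x hx => b₂ r hr σ x
  have l3 : ∀ r, 0 < r → ∀ σ₁ σ₂ t,
      ‖tameHeat α F r σ₂ t - tameHeat α F r σ₁ t‖ ≤ K₃ * ‖σ₂ - σ₁‖ := by
    intro r hr σ₁ σ₂ t
    refine (convex_univ (𝕜 := ℝ)).norm_image_sub_le_of_norm_hasFDerivWithin_le
      (fun σ _ => (hF.hasFDerivAt_tameHeat_sigma hα hr σ t).hasFDerivWithinAt)
      (fun σ _ => norm_gradS_le (Finset.sum_nonneg fun i _ => abs_nonneg _) fun i => ?_)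
      (mem_univ σ₁) (mem_univ σ₂)
    refine (hC i r hr σ t).trans ((le_abs_self _).trans ?_)
    exact Finset.single_le_sum (f := fun i => |C i|) (fun i _ => abs_nonneg _) (Finset.mem_univ i)
  refine ⟨Real.toNNReal (K₁ + K₃ + C₂), LipschitzOnWith.of_dist_le' ?_⟩
  rintro ⟨⟨r, σ⟩, t⟩ ⟨⟨hr, -⟩, ht⟩ ⟨⟨r', σ'⟩, t'⟩ ⟨⟨hr', -⟩, ht'⟩
  simp only at hr ht hr' ht'
  have hK₁ : 0 ≤ K₁ := mul_nonneg (hr.1.trans hr.2).le (by positivity)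
  have hK₃ : 0 ≤ K₃ := by positivity
  have hC₂ : 0 ≤ C₂ := (norm_nonneg _).trans (b₂ 1 one_pos 0 0)
  set d := dist ((r, σ), t) ((r', σ'), t')
  have d1 : |r - r'| ≤ d := (le_max_left _ _).trans (le_max_left _ _)
  have d2 : ‖σ - σ'‖ ≤ d := by
    rw [← dist_eq_norm]; exact (le_max_right _ _).trans (le_max_left _ _)
  have d3 : |t - t'| ≤ d := le_max_right _ _
  rw [dist_eq_norm]
  calc _ ≤ ‖tameHeat α F r σ t - tameHeat α F r' σ t‖ + ‖tameHeat α F r' σ t - tameHeat α F r' σ' t‖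
        + ‖tameHeat α F r' σ' t - tameHeat α F r' σ' t'‖ := by
        have := norm_add₃_le (a := tameHeat α F r σ t - tameHeat α F r' σ t)
          (b := tameHeat α F r' σ t - tameHeat α F r' σ' t)
          (c := tameHeat α F r' σ' t - tameHeat α F r' σ' t')
        simpa using this
    _ ≤ K₁ * |r - r'| + K₃ * ‖σ - σ'‖ + C₂ * |t - t'| :=
        add_le_add (add_le_add (l1 r' hr' r hr σ t ht) (l3 r' hr'.1 σ' σ t))
          (l2 r' hr'.1 σ' t' t ht' ht)
    _ ≤ K₁ * d + K₃ * d + C₂ * d := by gcongr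
    _ = _ := by ring

/-- The Lipschitz bound does not degenerate at `r = 0` or `t = 0`, so near `x` the function extends
to a Lipschitz function on the whole space, whose value at `x` is the limit. -/
theorem Tame.tendsto_tameHeat (hF : Tame F) (hα : 0 < α) (x : (ℝ × E k) × ℝ) :
    ∃ y, Tendsto (fun x : (ℝ × E k) × ℝ => tameHeat α F x.1.1 x.1.2 x.2)
      (𝓝[halfSpace k ×ˢ Ici 0] x) (𝓝 y) ∧
      (x ∈ halfSpace k ×ˢ Ici 0 → y = tameHeat α F x.1.1 x.1.2 x.2) := by
  obtain ⟨K, hK⟩ := hF.exists_lipschitz hα (x.1.1 + 1)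
  obtain ⟨g, hg, hgf⟩ := hK.extend_finite_dimension
  refine ⟨g x, ?_, fun hx => ?_⟩
  · refine (hg.continuous.tendsto x |>.mono_left nhdsWithin_le_nhds).congr' ?_
    have : ∀ᶠ y in 𝓝 x, y.1.1 < x.1.1 + 1 :=
      (continuous_fst.fst.tendsto x).eventually (gt_mem_nhds (by linarith))
    filter_upwards [self_mem_nhdsWithin, nhdsWithin_le_nhds this] with y hy hy'
    exact (hgf ⟨⟨⟨mem_halfSpace.1 hy.1, hy'⟩, mem_univ _⟩, hy.2⟩).symm
  · exact (hgf ⟨⟨⟨mem_halfSpace.1 hx.1, by simp⟩, mem_univ _⟩, hx.2⟩).symm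

theorem Tame.continuousOn_tameHeat (hF : Tame F) (hα : 0 < α) :
    ContinuousOn (fun x : (ℝ × E k) × ℝ => tameHeat α F x.1.1 x.1.2 x.2)
      (halfSpace k ×ˢ Ici 0) := fun x hx => by
  obtain ⟨y, hy, hyx⟩ := hF.tendsto_tameHeat hα x
  rwa [hyx hx] at hy

theorem Tame.exists_continuous_extension (hF : Tame F) (hα : 0 < α) :
    ∃ U : (ℝ × E k) × ℝ → ℂ, ContinuousOn U ((Ici (0 : ℝ) ×ˢ univ) ×ˢ Ici (0 : ℝ)) ∧
      ∀ p ∈ halfSpace k, ∀ t : ℝ, 0 ≤ t → U (p, t) = tameHeat α F p.1 p.2 t := by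
  refine ⟨extendFrom (halfSpace k ×ˢ Ici 0) fun x : (ℝ × E k) × ℝ => tameHeat α F x.1.1 x.1.2 x.2,
    continuousOn_extendFrom ?_ fun x _ => ?_, fun p hp t ht => ?_⟩
  · rw [closure_prod_eq, halfSpace, closure_prod_eq, closure_Ioi, closure_univ, isClosed_Ici.closure_eq]
  · obtain ⟨y, hy, -⟩ := hF.tendsto_tameHeat hα x
    exact ⟨y, hy⟩
  · exact extendFrom_eq (subset_closure ⟨hp, ht⟩) (hF.continuousOn_tameHeat hα (p, t) ⟨hp, ht⟩)

end regularity

end BaouendiGrushin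

namespace BaouendiGrushin

open Filter Topology

/-! ### The radial derivative and its own derivatives. -/

section flux

variable {k : ℕ} {α : ℝ} {F G H : ℝ × E k → ℂ}

/-- The function `ℒ f` minus its `σ`-part, when `ℒ f = G(r², σ)` and `Δ_σ f = H(r², σ)`. -/
noncomputable def tameRadial (α : ℝ) (G H : ℝ × E k → ℂ) (r : ℝ) (σ : E k) (t : ℝ) : ℂ :=
  tameHeat α G r σ t - (r ^ 2 / 4 : ℝ) * tameHeat α H r σ t

theorem tameFlux_eq (α : ℝ) (G H : ℝ × E k → ℂ) (r : ℝ) (σ : E k) (t : ℝ) :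
    tameFlux α G H r σ t =
      r * ∫ x in (0 : ℝ)..1, ((x ^ (2 * α - 1) : ℝ) : ℂ) * tameRadial α G H (r * x) σ t := rfl

theorem continuousOn_tameRadial (hG : Tame G) (hH : Tame H) (hα : 0 < α) :
    ContinuousOn (fun x : (ℝ × E k) × ℝ => tameRadial α G H x.1.1 x.1.2 x.2)
      (halfSpace k ×ˢ Ici 0) :=
  (hG.continuousOn_tameHeat hα).sub (ContinuousOn.mul (by fun_prop) (hH.continuousOn_tameHeat hα))

theorem exists_norm_tameRadial_le (hG : Tame G) (hH : Tame H) (hα : 0 < α) :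
    ∃ C, 0 ≤ C ∧ ∀ r : ℝ, 0 < r → ∀ σ t, ‖tameRadial α G H r σ t‖ ≤ (1 + r ^ 2) * C := by
  obtain ⟨C, hC⟩ := hG.exists_norm_tameHeat_le hα
  obtain ⟨C', hC'⟩ := hH.exists_norm_tameHeat_le hα
  have h0 : 0 ≤ max C C' := ((norm_nonneg _).trans (hC 1 one_pos 0 0)).trans (le_max_left _ _)
  refine ⟨max C C', h0, fun r hr σ t => (norm_sub_le _ _).trans ?_⟩
  rw [norm_mul, Complex.norm_real, Real.norm_of_nonneg (by positivity), add_mul, one_mul]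
  have : r ^ 2 / 4 ≤ r ^ 2 := by linarith [sq_nonneg r]
  exact add_le_add ((hC r hr σ t).trans (le_max_left _ _))
    (mul_le_mul this ((hC' r hr σ t).trans (le_max_right _ _)) (norm_nonneg _) (sq_nonneg _))

theorem aestronglyMeasurable_flux_integrand (hG : Tame G) (hH : Tame H) (hα : 0 < α) {r : ℝ}
    (hr : 0 < r) (σ : E k) {t : ℝ} (ht : 0 ≤ t) :
    AEStronglyMeasurable (fun x : ℝ => ((x ^ (2 * α - 1) : ℝ) : ℂ) * tameRadial α G H (r * x) σ t)
      (volume.restrict (Ioc 0 1)) := by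
  refine AEStronglyMeasurable.mul (by fun_prop)
    (ContinuousOn.aestronglyMeasurable ?_ measurableSet_Ioc)
  exact (continuousOn_tameRadial hG hH hα).comp (f := fun x : ℝ => ((r * x, σ), t)) (by fun_prop)
    fun x hx => ⟨mem_halfSpace.2 (mul_pos hr hx.1), ht⟩

theorem norm_flux_integrand_le {C : ℝ} (hC0 : 0 ≤ C)
    (hC : ∀ r : ℝ, 0 < r → ∀ σ t, ‖tameRadial α G H r σ t‖ ≤ (1 + r ^ 2) * C) {r R : ℝ} (hr : 0 < r)
    (hrR : r ≤ R) (σ : E k) (t : ℝ) {x : ℝ} (hx : x ∈ Ioc (0 : ℝ) 1) :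
    ‖((x ^ (2 * α - 1) : ℝ) : ℂ) * tameRadial α G H (r * x) σ t‖ ≤
      x ^ (2 * α - 1) * ((1 + R ^ 2) * C) := by
  rw [norm_mul, Complex.norm_real, Real.norm_of_nonneg (Real.rpow_nonneg hx.1.le _)]
  refine mul_le_mul_of_nonneg_left ((hC _ (mul_pos hr hx.1) σ t).trans ?_)
    (Real.rpow_nonneg hx.1.le _)
  have h1 : r * x ≤ R := (mul_le_of_le_one_right hr.le hx.2).trans hrR
  have h2 : 0 ≤ r * x := (mul_pos hr hx.1).le
  gcongr

theorem continuousOn_tameFlux (hG : Tame G) (hH : Tame H) (hα : 0 < α) :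
    ContinuousOn (fun x : (ℝ × E k) × ℝ => tameFlux α G H x.1.1 x.1.2 x.2)
      (halfSpace k ×ˢ Ici 0) := by
  obtain ⟨C, hC0, hC⟩ := exists_norm_tameRadial_le hG hH hα
  simp_rw [tameFlux_eq]
  refine ContinuousOn.mul (by fun_prop) fun y hy => ?_
  refine intervalIntegral.continuousWithinAt_of_dominated_interval
    (bound := fun x => x ^ (2 * α - 1) * ((1 + (y.1.1 + 1) ^ 2) * C)) ?_ ?_
    ((intervalIntegrable_weight hα 0 1).mul_const _) (Eventually.of_forall fun x hx => ?_)
  · filter_upwards [self_mem_nhdsWithin] with z hz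
    rw [uIoc_of_le zero_le_one]
    exact aestronglyMeasurable_flux_integrand hG hH hα (mem_halfSpace.1 hz.1) _ hz.2
  · have : ∀ᶠ z in 𝓝 y, z.1.1 < y.1.1 + 1 :=
      (continuous_fst.fst.tendsto y).eventually (gt_mem_nhds (by linarith))
    filter_upwards [self_mem_nhdsWithin, nhdsWithin_le_nhds this] with z hz hz'
    refine Eventually.of_forall fun x hx => ?_
    rw [uIoc_of_le zero_le_one] at hx
    exact norm_flux_integrand_le hC0 hC (mem_halfSpace.1 hz.1) hz'.le _ _ hx
  · rw [uIoc_of_le zero_le_one] at hx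
    refine ContinuousWithinAt.mul continuousWithinAt_const ?_
    exact (continuousOn_tameRadial hG hH hα).comp
      (f := fun z : (ℝ × E k) × ℝ => ((z.1.1 * x, z.1.2), z.2)) (by fun_prop)
      (fun z hz => ⟨mem_halfSpace.2 (mul_pos (mem_halfSpace.1 hz.1) hx.1), hz.2⟩) y hy

theorem integrable_flux_integrand (hG : Tame G) (hH : Tame H) (hα : 0 < α) {r : ℝ}
    (hr : 0 < r) (σ : E k) {t : ℝ} (ht : 0 ≤ t) :
    Integrable (fun x : ℝ => ((x ^ (2 * α - 1) : ℝ) : ℂ) * tameRadial α G H (r * x) σ t)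
      (volume.restrict (Ioc 0 1)) := by
  obtain ⟨C, hC0, hC⟩ := exists_norm_tameRadial_le hG hH hα
  refine Integrable.mono' (((intervalIntegrable_weight hα 0 1).mul_const ((1 + r ^ 2) * C)).1)
    (aestronglyMeasurable_flux_integrand hG hH hα hr σ ht) ?_
  filter_upwards [ae_restrict_mem measurableSet_Ioc] with x hx
  exact norm_flux_integrand_le hC0 hC hr le_rfl σ t hx

theorem hasFDerivAt_tameRadial_sigma (hG : Tame G) (hH : Tame H) (hα : 0 < α) {r : ℝ}
    (hr : 0 < r) (σ : E k) (t : ℝ) : HasFDerivAt (fun σ => tameRadial α G H r σ t)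
      (gradS fun i => tameRadial α (pd (some i) G) (pd (some i) H) r σ t) σ := by
  refine ((hG.hasFDerivAt_tameHeat_sigma hα hr σ t).sub
    ((hH.hasFDerivAt_tameHeat_sigma hα hr σ t).const_mul _)).congr_fderiv ?_
  ext v
  simp only [tameRadial, gradS_apply, _root_.sub_apply, _root_.smul_apply, smul_eq_mul, Finset.mul_sum,
    ← Finset.sum_sub_distrib, Complex.real_smul]
  exact Finset.sum_congr rfl fun i _ => by ring

theorem hasFDerivAt_tameFlux_sigma (hG : Tame G) (hH : Tame H) (hα : 0 < α) {r : ℝ} (hr : 0 < r)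
    (σ : E k) {t : ℝ} (ht : 0 ≤ t) : HasFDerivAt (fun σ => tameFlux α G H r σ t)
      (gradS fun i => tameFlux α (pd (some i) G) (pd (some i) H) r σ t) σ := by
  choose C hC0 hC using fun i =>
    exists_norm_tameRadial_le (hG.pderiv (some i)) (hH.pderiv (some i)) hα
  have hC' : ∀ i, ∀ r : ℝ, 0 < r → ∀ σ t,
      ‖tameRadial α (pd (some i) G) (pd (some i) H) r σ t‖ ≤ (1 + r ^ 2) * ∑ i, C i :=
    fun i r hr σ t => (hC i r hr σ t).trans (mul_le_mul_of_nonneg_left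
      (Finset.single_le_sum (f := C) (fun i _ => hC0 i) (Finset.mem_univ i)) (by positivity))
  have key := hasFDerivAt_integral_gradS (μ := volume.restrict (Ioc (0 : ℝ) 1))
    (f := fun x σ => ((x ^ (2 * α - 1) : ℝ) : ℂ) * tameRadial α G H (r * x) σ t)
    (c := fun i x σ => ((x ^ (2 * α - 1) : ℝ) : ℂ) *
      tameRadial α (pd (some i) G) (pd (some i) H) (r * x) σ t)
    (((intervalIntegrable_weight hα 0 1).mul_const ((1 + r ^ 2) * ∑ i, C i)).1)
    (fun σ => integrable_flux_integrand hG hH hα hr σ ht)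
    (fun i σ => aestronglyMeasurable_flux_integrand (hG.pderiv _) (hH.pderiv _) hα hr σ ht)
    ((ae_restrict_mem measurableSet_Ioc).mono fun x hx i σ =>
      norm_flux_integrand_le (Finset.sum_nonneg fun i _ => hC0 i) (hC' i) hr le_rfl σ t hx)
    ((ae_restrict_mem measurableSet_Ioc).mono fun x hx σ => ?_) σ
  · simp_rw [tameFlux_eq, intervalIntegral.integral_of_le zero_le_one]
    refine (key.const_mul _).congr_fderiv ?_
    ext v
    simp only [gradS_apply, _root_.smul_apply, smul_eq_mul, Finset.mul_sum, Complex.real_smul]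
    exact Finset.sum_congr rfl fun i _ => by ring
  · refine ((hasFDerivAt_tameRadial_sigma hG hH hα (mul_pos hr hx.1) σ t).const_mul _).congr_fderiv ?_
    ext v
    simp only [gradS_apply, _root_.smul_apply, smul_eq_mul, Finset.mul_sum, Complex.real_smul]
    exact Finset.sum_congr rfl fun i _ => by ring

/-- Undoing the rescaling moves `r` to the endpoint of the integral, where the fundamental theorem
of calculus can differentiate. -/
theorem tameFlux_eq_integral {r : ℝ} (hr : 0 < r) (σ : E k) (t : ℝ) :
    tameFlux α G H r σ t = ((r ^ (1 - 2 * α) : ℝ) : ℂ) *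
      ∫ x in (0 : ℝ)..r, ((x ^ (2 * α - 1) : ℝ) : ℂ) * tameRadial α G H x σ t := by
  have h' := intervalIntegral.smul_integral_comp_mul_left (a := 0) (b := 1)
    (f := fun x : ℝ => ((x ^ (2 * α - 1) : ℝ) : ℂ) * tameRadial α G H x σ t) r
  rw [mul_zero, mul_one, Complex.real_smul] at h'
  rw [← h', tameFlux_eq]
  have e : ∫ x in (0 : ℝ)..1, (((r * x) ^ (2 * α - 1) : ℝ) : ℂ) * tameRadial α G H (r * x) σ t =
      ((r ^ (2 * α - 1) : ℝ) : ℂ) *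
        ∫ x in (0 : ℝ)..1, ((x ^ (2 * α - 1) : ℝ) : ℂ) * tameRadial α G H (r * x) σ t := by
    rw [← intervalIntegral.integral_const_mul]
    refine intervalIntegral.integral_congr_ae (Eventually.of_forall fun x hx => ?_)
    rw [uIoc_of_le zero_le_one] at hx
    rw [Real.mul_rpow hr.le hx.1.le]
    push_cast; ring
  rw [e]
  have e2 : r ^ (1 - 2 * α) * r ^ (2 * α - 1) = 1 := by
    rw [← Real.rpow_add hr]; simp
  have e3 : ((r ^ (1 - 2 * α) : ℝ) : ℂ) * ((r ^ (2 * α - 1) : ℝ) : ℂ) = 1 := by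
    rw [← Complex.ofReal_mul, e2, Complex.ofReal_one]
  linear_combination (-(r : ℂ) * ∫ x in (0 : ℝ)..1, ((x ^ (2 * α - 1) : ℝ) : ℂ) *
    tameRadial α G H (r * x) σ t) * e3

/-- For `G = ℒ f` and `H = Δ_σ f` this is the equation solved for `∂_rr`: the second radial
derivative exists without differentiating the heat measures twice in `r`. -/
theorem hasDerivAt_tameFlux_r (hG : Tame G) (hH : Tame H) (hα : 0 < α) {r : ℝ} (hr : 0 < r)
    (σ : E k) {t : ℝ} (ht : 0 ≤ t) : HasDerivAt (fun r => tameFlux α G H r σ t)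
      (tameRadial α G H r σ t - ((2 * α - 1) / r : ℝ) * tameFlux α G H r σ t) r := by
  have hc : ContinuousOn (fun x : ℝ => ((x ^ (2 * α - 1) : ℝ) : ℂ) * tameRadial α G H x σ t)
      (Ioi 0) := by
    refine ContinuousOn.mul ?_ ?_
    · exact Complex.continuous_ofReal.comp_continuousOn
        (continuousOn_id.rpow_const fun x hx => Or.inl (mem_Ioi.1 hx).ne')
    · exact (continuousOn_tameRadial hG hH hα).comp (f := fun x : ℝ => ((x, σ), t)) (by fun_prop)
        fun x hx => ⟨mem_halfSpace.2 hx, ht⟩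
  obtain ⟨C, hC0, hC⟩ := exists_norm_tameRadial_le hG hH hα
  have hint : IntervalIntegrable (fun x : ℝ => ((x ^ (2 * α - 1) : ℝ) : ℂ) *
      tameRadial α G H x σ t) volume 0 r := by
    refine ((intervalIntegrable_weight hα 0 r).mul_const ((1 + r ^ 2) * C)).mono_fun' ?_ ?_
    · rw [uIoc_of_le hr.le]
      exact (hc.mono fun x hx => hx.1).aestronglyMeasurable measurableSet_Ioc
    · rw [uIoc_of_le hr.le]
      filter_upwards [ae_restrict_mem measurableSet_Ioc] with x hx
      have hx0 := hx.1
      rw [norm_mul, Complex.norm_real, Real.norm_of_nonneg (Real.rpow_nonneg hx.1.le _)]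
      refine mul_le_mul_of_nonneg_left ((hC _ hx.1 σ t).trans ?_) (Real.rpow_nonneg hx.1.le _)
      have := hx.2
      gcongr
  have h1 := intervalIntegral.integral_hasDerivAt_right hint
    (hc.stronglyMeasurableAtFilter isOpen_Ioi r hr) (hc.continuousAt (Ioi_mem_nhds hr))
  have h2 : HasDerivAt (fun x : ℝ => x ^ (1 - 2 * α)) ((1 - 2 * α) * r ^ (1 - 2 * α - 1)) r :=
    Real.hasDerivAt_rpow_const (Or.inl hr.ne')
  have h3 := (h2.ofReal_comp.mul h1).congr_of_eventuallyEq
    (f₁ := fun r => tameFlux α G H r σ t) (by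
      filter_upwards [lt_mem_nhds hr] with s hs using tameFlux_eq_integral hs σ t)
  refine h3.congr_deriv ?_
  rw [tameFlux_eq_integral hr σ t, Real.rpow_sub_one hr.ne']
  have e2 : r ^ (1 - 2 * α) * r ^ (2 * α - 1) = 1 := by
    rw [← Real.rpow_add hr]; simp
  have e3 : ((r ^ (1 - 2 * α) : ℝ) : ℂ) * ((r ^ (2 * α - 1) : ℝ) : ℂ) = 1 := by
    rw [← Complex.ofReal_mul, e2, Complex.ofReal_one]
  rw [← mul_assoc, e3]
  push_cast
  ring

theorem Tame.hasDerivAt_tameHeat_r (hF : Tame F) (hα : 0 < α) {r : ℝ} (hr : 0 < r)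
    (σ : E k) {t : ℝ} (ht : 0 ≤ t) : HasDerivAt (fun r => tameHeat α F r σ t)
      (tameFlux α (grushinS α F) (lapS F) r σ t) r := by
  refine hasDerivAt_of_sub_eq_integral
    (f := fun r => tameHeat α F r σ t) (g := fun r => tameFlux α (grushinS α F) (lapS F) r σ t) ?_
    (fun a b ha hab => hF.tameHeat_sub_radial hα ha hab σ ht) hr
  exact (continuousOn_tameFlux (hF.generator α) hF.laplacian hα).comp
    (f := fun x : ℝ => ((x, σ), t)) (by fun_prop) fun x hx => ⟨mem_halfSpace.2 hx, ht⟩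

theorem Tame.hasDerivAt_tameHeat_t (hF : Tame F) (hα : 0 < α) {r : ℝ} (hr : 0 < r)
    (σ : E k) {t : ℝ} (ht : 0 < t) : HasDerivAt (fun t => tameHeat α F r σ t)
      (tameHeat α (grushinS α F) r σ t) t := by
  refine hasDerivAt_of_sub_eq_integral
    (f := fun t => tameHeat α F r σ t) (g := fun t => tameHeat α (grushinS α F) r σ t) ?_
    (fun a b ha hab => hF.tameHeat_sub_time hα hr σ ha.le hab) ht
  exact ((hF.generator α).continuousOn_tameHeat hα).comp
    (f := fun x : ℝ => ((r, σ), x)) (by fun_prop) fun x hx => ⟨mem_halfSpace.2 hr, (mem_Ioi.1 hx).le⟩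

theorem Tame.tameHeat_lapS (hF : Tame F) (hα : 0 < α) {r : ℝ} (hr : 0 < r) (σ : E k) (t : ℝ) :
    tameHeat α (lapS F) r σ t = ∑ i, tameHeat α (pd (some i) (pd (some i) F)) r σ t :=
  integral_finsetSum _ fun i _ =>
    ((hF.pderiv (some i)).pderiv (some i)).integrable_translate hα hr σ t

end flux

end BaouendiGrushin

namespace BaouendiGrushin

open Filter Topology

/-! ### From continuous partial derivatives to class `C²`. -/

section c2

/-- Up to order two the iterated derivatives are the images of `u`, `u'`, `u''` under the currying
isometries, which do not depend on the point or the time. -/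
theorem iteratedFDeriv_jointly_continuousOn {X : Type*} [NormedAddCommGroup X] [NormedSpace ℝ X]
    {S : Set X} (hS : IsOpen S) {J : Set ℝ} {u : X → ℝ → ℂ} {u' : X → ℝ → X →L[ℝ] ℂ}
    {u'' : X → ℝ → X →L[ℝ] X →L[ℝ] ℂ}
    (h1 : ∀ p ∈ S, ∀ t ∈ J, HasFDerivAt (fun q => u q t) (u' p t) p)
    (h2 : ∀ p ∈ S, ∀ t ∈ J, HasFDerivAt (fun q => u' q t) (u'' p t) p)
    (c0 : ContinuousOn (fun x : X × ℝ => u x.1 x.2) (S ×ˢ J))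
    (c1 : ContinuousOn (fun x : X × ℝ => u' x.1 x.2) (S ×ˢ J))
    (c2 : ContinuousOn (fun x : X × ℝ => u'' x.1 x.2) (S ×ˢ J)) {j : ℕ} (hj : j ≤ 2) :
    ContinuousOn (fun x : X × ℝ => iteratedFDeriv ℝ j (fun p => u p x.2) x.1) (S ×ˢ J) := by
  have e1 : ∀ t ∈ J, ∀ p ∈ S, fderiv ℝ (fun q => u q t) p = u' p t := fun t ht p hp =>
    (h1 p hp t ht).fderiv
  have e2 : ∀ t ∈ J, ∀ p ∈ S, fderiv ℝ (fderiv ℝ fun q => u q t) p = u'' p t := fun t ht p hp => by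
    rw [((show EqOn _ _ S from e1 t ht).eventuallyEq_of_mem (hS.mem_nhds hp)).fderiv_eq]
    exact (h2 p hp t ht).fderiv
  interval_cases j
  · simp_rw [iteratedFDeriv_zero_eq_comp]
    exact (LinearIsometryEquiv.continuous _).comp_continuousOn c0
  · refine ((continuousMultilinearCurryRightEquiv' ℝ 0 X ℂ).symm.continuous.comp_continuousOn
      ((continuousMultilinearCurryFin0 ℝ X (X →L[ℝ] ℂ)).symm.continuous.comp_continuousOn
        c1)).congr fun x hx => ?_
    refine (iteratedFDeriv_succ_eq_comp_right (𝕜 := ℝ) (n := 0)).trans ?_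
    exact congrArg (fun L => (continuousMultilinearCurryRightEquiv' ℝ 0 X ℂ).symm
      ((continuousMultilinearCurryFin0 ℝ X (X →L[ℝ] ℂ)).symm L)) (e1 x.2 hx.2 x.1 hx.1)
  · refine ((continuousMultilinearCurryRightEquiv' ℝ 1 X ℂ).symm.continuous.comp_continuousOn
      ((continuousMultilinearCurryRightEquiv' ℝ 0 X (X →L[ℝ] ℂ)).symm.continuous.comp_continuousOn
      ((continuousMultilinearCurryFin0 ℝ X (X →L[ℝ] X →L[ℝ] ℂ)).symm.continuous.comp_continuousOn
        c2))).congr fun x hx => ?_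
    refine (iteratedFDeriv_succ_eq_comp_right (𝕜 := ℝ) (n := 1)).trans ?_
    refine congrArg (continuousMultilinearCurryRightEquiv' ℝ 1 X ℂ).symm
      ((iteratedFDeriv_succ_eq_comp_right (𝕜 := ℝ) (n := 0)).trans ?_)
    exact congrArg (fun L => (continuousMultilinearCurryRightEquiv' ℝ 0 X (X →L[ℝ] ℂ)).symm
      ((continuousMultilinearCurryFin0 ℝ X (X →L[ℝ] X →L[ℝ] ℂ)).symm L)) (e2 x.2 hx.2 x.1 hx.1)

theorem contDiffOn_two_of_hasFDerivAt {X : Type*} [NormedAddCommGroup X] [NormedSpace ℝ X]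
    {S : Set X} (hS : IsOpen S) {u : X → ℂ} {u' : X → X →L[ℝ] ℂ}
    {u'' : X → X →L[ℝ] X →L[ℝ] ℂ} (h1 : ∀ p ∈ S, HasFDerivAt u (u' p) p)
    (h2 : ∀ p ∈ S, HasFDerivAt u' (u'' p) p) (c2 : ContinuousOn u'' S) : ContDiffOn ℝ 2 u S := by
  have hone : ContDiffOn ℝ 1 u' S := by
    rw [show (1 : WithTop ℕ∞) = 0 + 1 from rfl, contDiffOn_succ_iff_fderiv_of_isOpen hS]
    refine ⟨fun p hp => (h2 p hp).differentiableAt.differentiableWithinAt, by simp, ?_⟩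
    rw [contDiffOn_zero]
    exact c2.congr fun p hp => (h2 p hp).fderiv
  rw [show (2 : WithTop ℕ∞) = 1 + 1 from one_add_one_eq_two.symm,
    contDiffOn_succ_iff_fderiv_of_isOpen hS]
  exact ⟨fun p hp => (h1 p hp).differentiableAt.differentiableWithinAt, by simp,
    hone.congr fun p hp => (h1 p hp).fderiv⟩

variable {k : ℕ}

/-- The real linear form on `ℝ × ℝ^k` with given values on the coordinate vectors. -/
noncomputable def gradP : (Option (Fin k) → ℂ) →L[ℝ] (ℝ × E k →L[ℝ] ℂ) :=
  ∑ d, (ContinuousLinearMap.smulRightL ℝ (ℝ × E k) ℂ (d.elim (ContinuousLinearMap.fst ℝ ℝ (E k))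
    fun i => (EuclideanSpace.proj i).comp (ContinuousLinearMap.snd ℝ ℝ (E k)))).comp
    (ContinuousLinearMap.proj d)

theorem gradP_apply (c : Option (Fin k) → ℂ) (v : ℝ × E k) :
    gradP c v = v.1 • c none + ∑ i, v.2 i • c (some i) := by
  simp [gradP, Fintype.sum_option]

/-- Continuous partial derivatives give total differentiability. The `σ`-derivative is already a
total one, so only the two blocks `r` and `σ` have to be combined. -/
theorem hasFDerivAt_gradP {u : ℝ × E k → ℂ} {c : Option (Fin k) → ℝ × E k → ℂ}
    (hr : ∀ q ∈ halfSpace k, HasDerivAt (fun r => u (r, q.2)) (c none q) q.1)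
    (hs : ∀ q ∈ halfSpace k, HasFDerivAt (fun σ => u (q.1, σ)) (gradS fun i => c (some i) q) q.2)
    (hc : ∀ d, ContinuousOn (c d) (halfSpace k)) {p : ℝ × E k} (hp : p ∈ halfSpace k) :
    HasFDerivAt u (gradP fun d => c d p) p := by
  have hnb := halfSpace_mem_nhds hp
  have h := hasStrictFDerivAt_uncurry_coprod (𝕜 := ℝ) (u := p) (f := fun r σ => u (r, σ))
    (f₁ := fun r σ => ContinuousLinearMap.toSpanSingleton ℝ (c none (r, σ)))
    (f₂ := fun r σ => gradS fun i => c (some i) (r, σ))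
    (by filter_upwards [hnb] with q hq using (hr q hq).hasFDerivAt)
    (by filter_upwards [hnb] with q hq using hs q hq)
    ?_ ?_
  · refine h.hasFDerivAt.congr_fderiv ?_
    ext v
    · simp [gradP_apply, Function.HasUncurry.uncurry]
    · simp [gradP_apply, gradS_apply, Function.HasUncurry.uncurry]
  · exact (ContinuousLinearMap.toSpanSingletonCLE (𝕜 := ℝ) (E := ℂ)).continuous.continuousAt.comp
      ((hc none).continuousAt hnb)
  · exact gradS.continuous.continuousAt.comp
      (continuousAt_pi.2 fun i => (hc (some i)).continuousAt hnb)

end c2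

end BaouendiGrushin

namespace BaouendiGrushin

open Filter Topology

/-! ### The evolution of a tame function solves the Cauchy problem. -/

section solution

variable {k : ℕ} {α : ℝ} {F G H : ℝ × E k → ℂ}

/-- The partial derivatives of `tameHeat`. -/
noncomputable def heatGrad (α : ℝ) (F : ℝ × E k → ℂ) :
    Option (Fin k) → ℝ × E k → ℝ → ℂ
  | none, p, t => tameFlux α (grushinS α F) (lapS F) p.1 p.2 t
  | some i, p, t => tameHeat α (pd (some i) F) p.1 p.2 t

/-- The partial derivatives of `tameFlux`. -/
noncomputable def fluxGrad (α : ℝ) (G H : ℝ × E k → ℂ) :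
    Option (Fin k) → ℝ × E k → ℝ → ℂ
  | none, p, t => tameRadial α G H p.1 p.2 t - ((2 * α - 1) / p.1 : ℝ) * tameFlux α G H p.1 p.2 t
  | some i, p, t => tameFlux α (pd (some i) G) (pd (some i) H) p.1 p.2 t

theorem Tame.continuousOn_heatGrad (hF : Tame F) (hα : 0 < α) (d : Option (Fin k)) :
    ContinuousOn (fun x : (ℝ × E k) × ℝ => heatGrad α F d x.1 x.2) (halfSpace k ×ˢ Ici 0) := by
  cases d with
  | none => exact continuousOn_tameFlux (hF.generator α) hF.laplacian hα
  | some i => exact (hF.pderiv _).continuousOn_tameHeat hα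

theorem continuousOn_fluxGrad (hG : Tame G) (hH : Tame H) (hα : 0 < α) (d : Option (Fin k)) :
    ContinuousOn (fun x : (ℝ × E k) × ℝ => fluxGrad α G H d x.1 x.2)
      (halfSpace k ×ˢ Ici 0) := by
  cases d with
  | none =>
    refine (continuousOn_tameRadial hG hH hα).sub (ContinuousOn.mul ?_
      (continuousOn_tameFlux hG hH hα))
    refine Complex.continuous_ofReal.comp_continuousOn (continuousOn_const.div (by fun_prop) ?_)
    exact fun x hx => (mem_halfSpace.1 hx.1).ne'
  | some i => exact continuousOn_tameFlux (hG.pderiv _) (hH.pderiv _) hα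

theorem ContinuousOn.at_time {c : ℝ × E k → ℝ → ℂ}
    (hc : ContinuousOn (fun x : (ℝ × E k) × ℝ => c x.1 x.2) (halfSpace k ×ˢ Ici 0)) {t : ℝ}
    (ht : 0 ≤ t) : ContinuousOn (fun p => c p t) (halfSpace k) :=
  hc.comp (f := fun p => (p, t)) (by fun_prop) fun _ hp => ⟨hp, ht⟩

theorem Tame.hasFDerivAt_tameHeat (hF : Tame F) (hα : 0 < α) {p : ℝ × E k} (hp : p ∈ halfSpace k)
    {t : ℝ} (ht : 0 ≤ t) : HasFDerivAt (fun p : ℝ × E k => tameHeat α F p.1 p.2 t)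
      (gradP fun d => heatGrad α F d p t) p :=
  hasFDerivAt_gradP (c := fun d p => heatGrad α F d p t)
    (fun q hq => hF.hasDerivAt_tameHeat_r hα (mem_halfSpace.1 hq) q.2 ht)
    (fun q hq => hF.hasFDerivAt_tameHeat_sigma hα (mem_halfSpace.1 hq) q.2 t)
    (fun d => ContinuousOn.at_time (hF.continuousOn_heatGrad hα d) ht) hp

theorem hasFDerivAt_tameFlux (hG : Tame G) (hH : Tame H) (hα : 0 < α) {p : ℝ × E k}
    (hp : p ∈ halfSpace k) {t : ℝ} (ht : 0 ≤ t) :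
    HasFDerivAt (fun p : ℝ × E k => tameFlux α G H p.1 p.2 t)
      (gradP fun d => fluxGrad α G H d p t) p :=
  hasFDerivAt_gradP (c := fun d p => fluxGrad α G H d p t)
    (fun q hq => hasDerivAt_tameFlux_r hG hH hα (mem_halfSpace.1 hq) q.2 ht)
    (fun q hq => hasFDerivAt_tameFlux_sigma hG hH hα (mem_halfSpace.1 hq) q.2 ht)
    (fun d => ContinuousOn.at_time (continuousOn_fluxGrad hG hH hα d) ht) hp

/-- The second partial derivatives of `tameHeat`. -/
noncomputable def heatHess (α : ℝ) (F : ℝ × E k → ℂ) :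
    Option (Fin k) → Option (Fin k) → ℝ × E k → ℝ → ℂ
  | none => fluxGrad α (grushinS α F) (lapS F)
  | some i => heatGrad α (pd (some i) F)

theorem Tame.hasFDerivAt_heatGrad (hF : Tame F) (hα : 0 < α) (d : Option (Fin k)) {p : ℝ × E k}
    (hp : p ∈ halfSpace k) {t : ℝ} (ht : 0 ≤ t) : HasFDerivAt (fun p => heatGrad α F d p t)
      (gradP fun d' => heatHess α F d d' p t) p := by
  cases d with
  | none => exact BaouendiGrushin.hasFDerivAt_tameFlux (hF.generator α) hF.laplacian hα hp ht
  | some i => exact (hF.pderiv _).hasFDerivAt_tameHeat hα hp ht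

theorem Tame.continuousOn_heatHess (hF : Tame F) (hα : 0 < α) (d d' : Option (Fin k)) :
    ContinuousOn (fun x : (ℝ × E k) × ℝ => heatHess α F d d' x.1 x.2)
      (halfSpace k ×ˢ Ici 0) := by
  cases d with
  | none => exact continuousOn_fluxGrad (hF.generator α) hF.laplacian hα d'
  | some i => exact (hF.pderiv _).continuousOn_heatGrad hα d'

theorem continuousOn_gradP {X : Type*} [TopologicalSpace X] {S : Set X}
    {c : Option (Fin k) → X → ℂ} (hc : ∀ d, ContinuousOn (c d) S) :
    ContinuousOn (fun x => gradP fun d => c d x) S :=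
  gradP.continuous.comp_continuousOn (continuousOn_pi.2 hc)

set_option maxSynthPendingDepth 3 in
theorem continuousOn_sum_comp {V X ι : Type*} [NormedAddCommGroup V] [NormedSpace ℝ V]
    [TopologicalSpace X] [Fintype ι] {S : Set X} {A : ι → ℂ →L[ℝ] V →L[ℝ] ℂ}
    {L : ι → X → V →L[ℝ] ℂ} (hL : ∀ d, ContinuousOn (L d) S) :
    ContinuousOn (fun x => ∑ d, (A d).comp (L d x)) S :=
  continuousOn_finsetSum _ fun d _ => continuousOn_const.clm_comp (hL d)

theorem Tame.isC21 (hF : Tame F) (hα : 0 < α) :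
    IsC21 fun (p : ℝ × E k) t => tameHeat α F p.1 p.2 t := by
  have hsub : halfSpace k ×ˢ Ioi (0 : ℝ) ⊆ halfSpace k ×ˢ Ici 0 :=
    prod_mono_right Ioi_subset_Ici_self
  have h1 : ∀ p ∈ halfSpace k, ∀ t ∈ Ioi (0 : ℝ),
      HasFDerivAt (fun p : ℝ × E k => tameHeat α F p.1 p.2 t)
      (gradP fun d => heatGrad α F d p t) p := fun p hp t ht =>
    hF.hasFDerivAt_tameHeat hα hp (le_of_lt ht)
  have h2 : ∀ p ∈ halfSpace k, ∀ t ∈ Ioi (0 : ℝ),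
      HasFDerivAt (fun p => gradP fun d => heatGrad α F d p t)
        (∑ d, (gradP.comp (ContinuousLinearMap.single ℝ (fun _ => ℂ) d)).comp
          (gradP fun d' => heatHess α F d d' p t)) p := fun p hp t ht => by
    refine (gradP.hasFDerivAt.comp p (hasFDerivAt_pi.2 fun d =>
      hF.hasFDerivAt_heatGrad hα d hp (le_of_lt ht))).congr_fderiv ?_
    refine ContinuousLinearMap.ext fun v => ?_
    simp only [ContinuousLinearMap.comp_apply, sum_apply, ← map_sum, ContinuousLinearMap.single_apply]
    congr 1
    exact (Finset.univ_sum_single _).symm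
  have c1 : ContinuousOn (fun x : (ℝ × E k) × ℝ => gradP fun d => heatGrad α F d x.1 x.2)
      (halfSpace k ×ˢ Ioi 0) :=
    continuousOn_gradP fun d => (hF.continuousOn_heatGrad hα d).mono hsub
  have c2 : ContinuousOn (fun x : (ℝ × E k) × ℝ =>
      ∑ d, (gradP.comp (ContinuousLinearMap.single ℝ (fun _ => ℂ) d)).comp
          (gradP fun d' => heatHess α F d d' x.1 x.2)) (halfSpace k ×ˢ Ioi 0) :=
    continuousOn_sum_comp fun d =>
      continuousOn_gradP fun d' => (hF.continuousOn_heatHess hα d d').mono hsub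
  refine ⟨fun t ht => ?_, fun j hj => ?_, fun p hp t ht => ?_, ?_⟩
  · exact contDiffOn_two_of_hasFDerivAt isOpen_halfSpace (fun p hp => h1 p hp t ht)
      (fun p hp => h2 p hp t ht)
      (c2.comp (f := fun p => (p, t)) (by fun_prop) fun p hp => ⟨hp, ht⟩)
  · exact iteratedFDeriv_jointly_continuousOn isOpen_halfSpace h1 h2
      ((hF.continuousOn_tameHeat hα).mono hsub) c1 c2 hj
  · exact (hF.hasDerivAt_tameHeat_t hα (mem_halfSpace.1 hp) p.2
      ht).differentiableAt.differentiableWithinAt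
  · exact (((hF.generator α).continuousOn_tameHeat hα).mono hsub).congr fun x hx =>
      (hF.hasDerivAt_tameHeat_t hα (mem_halfSpace.1 hx.1) x.1.2 hx.2).deriv

theorem laplacian_eq_sum_of_hasFDerivAt {f : E k → ℂ} {c : Fin k → E k → ℂ}
    {e : Fin k → E k → Fin k → ℂ} (h1 : ∀ σ, HasFDerivAt f (gradS fun i => c i σ) σ) {σ : E k}
    (h2 : ∀ i, HasFDerivAt (c i) (gradS (e i σ)) σ) :
    Laplacian.laplacian f σ = ∑ i, e i σ i := by
  have e1 : fderiv ℝ f = fun σ => gradS fun i => c i σ := funext fun σ => (h1 σ).fderiv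
  have e2 : HasFDerivAt (fderiv ℝ f)
      (gradS.comp (ContinuousLinearMap.pi fun i => gradS (e i σ))) σ := by
    rw [e1]
    exact gradS.hasFDerivAt.comp σ (hasFDerivAt_pi.2 h2)
  rw [InnerProductSpace.laplacian_eq_iteratedFDeriv_orthonormalBasis f
    (EuclideanSpace.basisFun (Fin k) ℝ)]
  refine Finset.sum_congr rfl fun i _ => ?_
  rw [iteratedFDeriv_two_apply, e2.fderiv]
  simp [gradS_apply]

/-- The formula for the `r`-derivative of the flux is the equation once `∂_t u` is the evolution of
`ℒ f` and `Δ_σ u` that of `Δ_σ f`. The flux is `O(r)`, so `r^(2α-1) ∂_r u = O(r^(2α))`; growth is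
trivial because the solution is bounded. -/
theorem Tame.isSolution (hF : Tame F) (hα : 0 < α) :
    IsSolution α (fun p => F (p.1 ^ 2, p.2)) fun (p : ℝ × E k) t => tameHeat α F p.1 p.2 t := by
  have hG := hF.generator α
  have hH := hF.laplacian
  refine ⟨hF.isC21 hα, hF.exists_continuous_extension hα, fun T _ => ?_, fun p hp t ht => ?_,
    fun p _ => heat_zero α _ _ _, fun σ t ht => ?_⟩
  · obtain ⟨C, hC⟩ := hF.exists_norm_tameHeat_le hα
    exact ⟨C, 0, fun p hp t _ => by simpa using hC p.1 (mem_halfSpace.1 hp) p.2 t⟩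
  · have hp' := mem_halfSpace.1 hp
    have e1 : (deriv fun s : ℝ => tameHeat α F s p.2 t) =ᶠ[𝓝 p.1]
        fun s => tameFlux α (grushinS α F) (lapS F) s p.2 t := by
      filter_upwards [lt_mem_nhds hp'] with s hs
        using (hF.hasDerivAt_tameHeat_r hα hs p.2 ht.le).deriv
    have e2 : iteratedDeriv 2 (fun s : ℝ => tameHeat α F s p.2 t) p.1 =
        tameRadial α (grushinS α F) (lapS F) p.1 p.2 t - ((2 * α - 1) / p.1 : ℝ) *
          tameFlux α (grushinS α F) (lapS F) p.1 p.2 t := by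
      rw [iteratedDeriv_succ, iteratedDeriv_one, e1.deriv_eq]
      exact (hasDerivAt_tameFlux_r hG hH hα hp' p.2 ht.le).deriv
    have e3 : Laplacian.laplacian (fun σ : E k => tameHeat α F p.1 σ t) p.2 =
        tameHeat α (lapS F) p.1 p.2 t := by
      rw [hF.tameHeat_lapS hα hp']
      exact laplacian_eq_sum_of_hasFDerivAt
        (c := fun i σ => tameHeat α (pd (some i) F) p.1 σ t)
        (e := fun i σ j => tameHeat α (pd (some j) (pd (some i) F)) p.1 σ t)
        (fun σ => hF.hasFDerivAt_tameHeat_sigma hα hp' σ t)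
        fun i => (hF.pderiv (some i)).hasFDerivAt_tameHeat_sigma hα hp' p.2 t
    simp only [grushinOp]
    rw [e2, e3, e1.eq_of_nhds, (hF.hasDerivAt_tameHeat_t hα hp' p.2 ht).deriv, tameRadial]
    ring
  · obtain ⟨C, hC0, hC⟩ := BaouendiGrushin.Tame.exists_norm_tameFlux_le hG hH hα
    have hlim : Tendsto (fun r : ℝ => r ^ (2 * α) * (2 * C)) (𝓝[>] 0) (𝓝 0) := by
      have h5 : ContinuousAt (fun x : ℝ => x ^ (2 * α)) 0 :=
        Real.continuousAt_rpow_const _ _ (Or.inr (by positivity))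
      have h6 := (h5.tendsto.mul_const (2 * C)).mono_left (nhdsWithin_le_nhds (s := Ioi 0))
      rwa [Real.zero_rpow (by positivity), zero_mul] at h6
    refine squeeze_zero_norm' ?_ hlim
    have h1 : ∀ᶠ r : ℝ in 𝓝[>] 0, r < 1 := nhdsWithin_le_nhds (gt_mem_nhds one_pos)
    filter_upwards [self_mem_nhdsWithin, h1] with r hr hr1
    have hr0 : 0 < r := hr
    rw [(hF.hasDerivAt_tameHeat_r hα hr0 σ ht.le).deriv, norm_mul, Complex.norm_real,
      Real.norm_of_nonneg (Real.rpow_nonneg hr0.le _)]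
    have e : r ^ (2 * α) = r ^ (2 * α - 1) * r := by
      rw [Real.rpow_sub_one hr0.ne']; field_simp
    rw [e, mul_assoc]
    refine mul_le_mul_of_nonneg_left ((hC r hr0 σ t).trans ?_) (Real.rpow_nonneg hr0.le _)
    have : r ^ 2 ≤ 1 := pow_le_one₀ hr0.le hr1.le
    have h3 : 1 + r ^ 2 ≤ 2 := by linarith
    gcongr

end solution

/-! ### Transfer of solutions -/

section transfer

variable {k : ℕ} {α : ℝ}

theorem grushinOp_congr {f g : ℝ × E k → ℂ} (h : EqOn f g (halfSpace k)) {p : ℝ × E k}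
    (hp : p ∈ halfSpace k) : grushinOp α f p = grushinOp α g p := by
  have h1 : (fun s : ℝ => f (s, p.2)) =ᶠ[𝓝 p.1] fun s => g (s, p.2) := by
    filter_upwards [lt_mem_nhds (mem_halfSpace.1 hp)] with s hs using h (mem_halfSpace.2 hs)
  have h2 : (fun y : E k => f (p.1, y)) = fun y => g (p.1, y) :=
    funext fun y => h (mem_halfSpace.2 (mem_halfSpace.1 hp))
  simp only [grushinOp]
  rw [h1.deriv_eq, h2]
  congr 2
  rw [iteratedDeriv_succ, iteratedDeriv_one, iteratedDeriv_succ, iteratedDeriv_one]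
  exact h1.deriv.deriv_eq

/-- All conditions are local on the open set `r > 0`, `t > 0`, or concern values with `r > 0`, `t ≥
0`. The Mehler integral and the heat evolution are only known to agree at such points. -/
theorem IsSolution.congr {φ ψ : ℝ × E k → ℂ} {u v : ℝ × E k → ℝ → ℂ} (hu : IsSolution α φ u)
    (h : ∀ p ∈ halfSpace k, ∀ t : ℝ, 0 ≤ t → v p t = u p t)
    (hφ : ∀ p ∈ halfSpace k, ψ p = φ p) : IsSolution α ψ v := by
  have ht : ∀ p ∈ halfSpace k, ∀ t : ℝ, 0 < t → v p =ᶠ[𝓝 t] u p := fun p hp t ht => by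
    filter_upwards [lt_mem_nhds ht] with s hs using h p hp s hs.le
  have hs : ∀ t : ℝ, 0 < t → EqOn (fun p => v p t) (fun p => u p t) (halfSpace k) :=
    fun t ht p hp => h p hp t ht.le
  refine ⟨⟨fun t ht => (hu.regular.space t ht).congr (hs t ht), fun j hj => ?_, fun p hp => ?_, ?_⟩,
    ?_, fun T hT => ?_, fun p hp t h0 => ?_, fun p hp => ?_, fun σ t h0 => ?_⟩
  · exact (hu.regular.space_cont j hj).congr fun x hx =>
      (((hs x.2 hx.2).eventuallyEq_of_mem (halfSpace_mem_nhds hx.1)).iteratedFDeriv ℝ j).eq_of_nhds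
  · exact (hu.regular.time p hp).congr fun t ht => h p hp t (le_of_lt ht)
  · exact hu.regular.time_cont.congr fun x hx => (ht x.1 hx.1 x.2 hx.2).deriv_eq
  · obtain ⟨U, hU, hUu⟩ := hu.extends_continuously
    exact ⟨U, hU, fun p hp t ht => (hUu p hp t ht).trans (h p hp t ht).symm⟩
  · obtain ⟨A, a, hA⟩ := hu.growth T hT
    exact ⟨A, a, fun p hp t ht => by rw [h p hp t ht.1]; exact hA p hp t ht⟩
  · rw [(ht p hp t h0).deriv_eq, grushinOp_congr (hs t h0) hp]
    exact hu.equation p hp t h0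
  · rw [h p hp 0 le_rfl, hu.initial p hp, hφ p hp]
  · refine (hu.neumann σ t h0).congr' ?_
    filter_upwards [self_mem_nhdsWithin] with r hr
    have : (fun s : ℝ => u (s, σ) t) =ᶠ[𝓝 r] fun s => v (s, σ) t := by
      filter_upwards [lt_mem_nhds (mem_Ioi.1 hr)] with s hs
        using (h (s, σ) (mem_halfSpace.2 hs) t h0.le).symm
    rw [this.deriv_eq]

end transfer

end BaouendiGrushin

namespace BaouendiGrushin

open Filter Topology

/-! ### Uniqueness by the comparison principle. -/

section uniqueness

variable {k : ℕ} {α : ℝ} {f : ℝ × E k → ℂ}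

theorem _root_.ContDiffOn.differentiableAt_pd (hf : ContDiffOn ℝ 2 f (halfSpace k))
    (d : Option (Fin k)) {p : ℝ × E k} (hp : p ∈ halfSpace k) : DifferentiableAt ℝ (pd d f) p := by
  have h := (hf.fderiv_of_isOpen (m := 1) isOpen_halfSpace (by norm_num)).differentiableOn
    (by simp)
  exact (h.differentiableAt (halfSpace_mem_nhds hp)).clm_apply (differentiableAt_const _)

theorem hasDerivAt_radial {p : ℝ × E k} (hf : DifferentiableAt ℝ f p) :
    HasDerivAt (fun s : ℝ => f (s, p.2)) (pd none f p) p.1 :=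
  hf.hasFDerivAt.comp_hasDerivAt p.1 ((hasDerivAt_id p.1).prodMk (hasDerivAt_const p.1 p.2))

theorem grushinOp_eq (hf : ContDiffOn ℝ 2 f (halfSpace k)) {p : ℝ × E k} (hp : p ∈ halfSpace k) :
    grushinOp α f p = pd none (pd none f) p + ((2 * α - 1) / p.1 : ℝ) * pd none f p +
      (p.1 ^ 2 / 4 : ℝ) * ∑ i, pd (some i) (pd (some i) f) p := by
  have hd : ∀ q ∈ halfSpace k, DifferentiableAt ℝ f q := fun q hq =>
    (hf.differentiableOn (by simp)).differentiableAt (halfSpace_mem_nhds hq)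
  have hp' := mem_halfSpace.1 hp
  have e1 : (deriv fun s : ℝ => f (s, p.2)) =ᶠ[𝓝 p.1] fun s => pd none f (s, p.2) := by
    filter_upwards [lt_mem_nhds hp'] with s hs
      using (hasDerivAt_radial (hd (s, p.2) (mem_halfSpace.2 hs))).deriv
  rw [grushinOp, iteratedDeriv_succ, iteratedDeriv_one, e1.deriv_eq, e1.eq_of_nhds,
    (hasDerivAt_radial (hf.differentiableAt_pd none hp)).deriv,
    laplacian_eq_sum_of_hasFDerivAt (c := fun i σ => pd (some i) f (p.1, σ))
      (e := fun i σ j => pd (some j) (pd (some i) f) (p.1, σ))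
      (fun σ => hasFDerivAt_slice (hd (p.1, σ) (mem_halfSpace.2 hp')))
      fun i => hasFDerivAt_slice (hf.differentiableAt_pd (some i) hp)]

theorem tendsto_re_const_mul_sub {γ : ℂ} {a b : ℝ → ℂ} {c : ℝ → ℝ} {l : Filter ℝ}
    (ha : Tendsto (fun r => (c r : ℂ) * a r) l (𝓝 0))
    (hb : Tendsto (fun r => (c r : ℂ) * b r) l (𝓝 0)) :
    Tendsto (fun r => c r * (γ * (a r - b r)).re) l (𝓝 0) := by
  have h := (Complex.continuous_re.tendsto _).comp ((ha.sub hb).const_mul γ)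
  simp only [sub_zero, mul_zero, Complex.zero_re] at h
  refine h.congr fun r => ?_
  simp only [Function.comp_apply]
  rw [← mul_sub, mul_left_comm, Complex.re_ofReal_mul]

/-- `comparison` is applied to the continuous extensions, because it needs continuity up to `r = 0`,
where `u` and `v` themselves carry no information. -/
theorem IsSolution.re_sub_nonpos (hα : 0 < α) {φ : ℝ × E k → ℂ} {u v : ℝ × E k → ℝ → ℂ}
    (hu : IsSolution α φ u) (hv : IsSolution α φ v) (γ : ℂ) {p : ℝ × E k} (hp : p ∈ halfSpace k)
    {t : ℝ} (ht : 0 ≤ t) : (γ * (u p t - v p t)).re ≤ 0 := by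
  obtain ⟨U, hU, hUu⟩ := hu.extends_continuously
  obtain ⟨V, hV, hVv⟩ := hv.extends_continuously
  have hd : ∀ {u : ℝ × E k → ℝ → ℂ}, IsSolution α φ u → ∀ q ∈ halfSpace k, ∀ t : ℝ, 0 < t →
      DifferentiableAt ℝ (fun p => u p t) q := fun hu q hq t ht =>
    ((hu.regular.space t ht).differentiableOn (by simp)).differentiableAt (halfSpace_mem_nhds hq)
  have hdt : ∀ {u : ℝ × E k → ℝ → ℂ}, IsSolution α φ u → ∀ q ∈ halfSpace k, ∀ t : ℝ, 0 < t →
      HasDerivAt (u q) (deriv (u q) t) t := fun hu q hq t ht =>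
    ((hu.regular.time q hq).differentiableAt (Ioi_mem_nhds ht)).hasDerivAt
  have heqw : ∀ r : ℝ, 0 < r → ∀ σ t, 0 ≤ t →
      U ((r, σ), t) - V ((r, σ), t) = u (r, σ) t - v (r, σ) t := fun r hr σ t ht => by
    rw [hUu (r, σ) (mem_halfSpace.2 hr) t ht, hVv (r, σ) (mem_halfSpace.2 hr) t ht]
  have key := comparison (k := k) hα
    (w := fun r σ t => (γ * (U ((r, σ), t) - V ((r, σ), t))).re)
    (wr := fun r σ t => (γ * (pd none (fun p => u p t) (r, σ) -
      pd none (fun p => v p t) (r, σ))).re)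
    (wrr := fun r σ t => (γ * (pd none (pd none fun p => u p t) (r, σ) -
      pd none (pd none fun p => v p t) (r, σ))).re)
    (wt := fun r σ t => (γ * (deriv (u (r, σ)) t - deriv (v (r, σ)) t)).re)
    (ws := fun i r σ t => (γ * (pd (some i) (fun p => u p t) (r, σ) -
      pd (some i) (fun p => v p t) (r, σ))).re)
    (wss := fun i r σ t => (γ * (pd (some i) (pd (some i) fun p => u p t) (r, σ) -
      pd (some i) (pd (some i) fun p => v p t) (r, σ))).re)
    ?_ ?_ ?_ ?_ ?_ ?_ (mem_halfSpace.1 hp) p.2 ht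
  · simpa only [heqw p.1 (mem_halfSpace.1 hp) p.2 t ht] using key
  · refine ⟨fun r hr σ t ht => ?_, fun r hr σ t ht => ?_, fun i r hr σ t ht => ?_,
      fun i r hr σ t ht => ?_, fun r hr σ t ht => ?_⟩
    all_goals have hq : ((r, σ) : ℝ × E k) ∈ halfSpace k := mem_halfSpace.2 hr
    · refine (((hasDerivAt_radial (hd hu _ hq t ht)).sub
        (hasDerivAt_radial (hd hv _ hq t ht))).re_const_mul γ).congr_of_eventuallyEq ?_
      filter_upwards [lt_mem_nhds hr] with s hs
      rw [heqw s hs σ t ht.le]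
      rfl
    · exact ((hasDerivAt_radial ((hu.regular.space t ht).differentiableAt_pd none hq)).sub
        (hasDerivAt_radial ((hv.regular.space t ht).differentiableAt_pd none hq))).re_const_mul γ
    · refine (((hasDerivAt_line (hd hu _ hq t ht) i).sub
        (hasDerivAt_line (hd hv _ hq t ht) i)).re_const_mul γ).congr_of_eventuallyEq
          (Eventually.of_forall fun τ => ?_)
      simp only [heqw r hr _ t ht.le]
      rfl
    · exact ((hasDerivAt_line ((hu.regular.space t ht).differentiableAt_pd (some i) hq) i).sub
        (hasDerivAt_line ((hv.regular.space t ht).differentiableAt_pd (some i) hq) i)).re_const_mul γ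
    · refine (((hdt hu _ hq t ht).sub (hdt hv _ hq t ht)).re_const_mul γ).congr_of_eventuallyEq ?_
      filter_upwards [lt_mem_nhds ht] with s hs
      rw [heqw r hr σ s hs.le]
      rfl
  · exact Complex.continuous_re.comp_continuousOn (continuousOn_const.mul (hU.sub hV))
  · intro r hr σ t ht
    have hq : ((r, σ) : ℝ × E k) ∈ halfSpace k := mem_halfSpace.2 hr
    have eu := sub_eq_zero.1 (hu.equation _ hq t ht)
    have ev := sub_eq_zero.1 (hv.equation _ hq t ht)
    rw [grushinOp_eq (hu.regular.space t ht) hq] at eu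
    rw [grushinOp_eq (hv.regular.space t ht) hq] at ev
    refine le_of_eq ?_
    simp only [eu, ev]
    rw [← Complex.re_ofReal_mul, ← Complex.re_sum, ← Complex.re_ofReal_mul, ← Complex.add_re,
      ← Complex.add_re, ← Finset.mul_sum, Finset.sum_sub_distrib]
    congr 1
    ring
  · intro σ t ht
    have e : ∀ {u : ℝ × E k → ℝ → ℂ}, IsSolution α φ u → Tendsto (fun r : ℝ =>
        ((r ^ (2 * α - 1) : ℝ) : ℂ) * pd none (fun p => u p t) (r, σ)) (𝓝[>] 0) (𝓝 0) := by
      intro u hu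
      refine (hu.neumann σ t ht).congr' ?_
      filter_upwards [self_mem_nhdsWithin] with r hr
      rw [(hasDerivAt_radial (hd hu (r, σ) (mem_halfSpace.2 hr) t ht)).deriv]
    exact tendsto_re_const_mul_sub (e hu) (e hv)
  · intro T hT
    obtain ⟨A, a, hA⟩ := hu.growth T hT
    obtain ⟨B, b, hB⟩ := hv.growth T hT
    refine ⟨‖γ‖ * (|A| + |B|), max a b, fun r hr σ t ht => ?_⟩
    have hq : ((r, σ) : ℝ × E k) ∈ halfSpace k := mem_halfSpace.2 hr
    have hn : 0 ≤ r ^ 2 + ‖σ‖ := by positivity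
    rw [heqw r hr σ t ht.1]
    have h1 : ‖u (r, σ) t‖ ≤ |A| * Real.exp (max a b * (r ^ 2 + ‖σ‖)) :=
      (hA _ hq t ht).trans (mul_le_mul (le_abs_self A) (Real.exp_le_exp.2
        (mul_le_mul_of_nonneg_right (le_max_left _ _) hn)) (Real.exp_pos _).le (abs_nonneg _))
    have h2 : ‖v (r, σ) t‖ ≤ |B| * Real.exp (max a b * (r ^ 2 + ‖σ‖)) :=
      (hB _ hq t ht).trans (mul_le_mul (le_abs_self B) (Real.exp_le_exp.2
        (mul_le_mul_of_nonneg_right (le_max_right _ _) hn)) (Real.exp_pos _).le (abs_nonneg _))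
    refine (Complex.re_le_norm _).trans ?_
    rw [norm_mul, mul_assoc, add_mul]
    exact mul_le_mul_of_nonneg_left ((norm_sub_le _ _).trans (add_le_add h1 h2)) (norm_nonneg _)
  · intro r hr σ
    rw [heqw r hr σ 0 le_rfl, hu.initial _ (mem_halfSpace.2 hr), hv.initial _ (mem_halfSpace.2 hr)]
    simp

theorem IsSolution.eq (hα : 0 < α) {φ : ℝ × E k → ℂ} {u v : ℝ × E k → ℝ → ℂ}
    (hu : IsSolution α φ u) (hv : IsSolution α φ v) {p : ℝ × E k} (hp : p ∈ halfSpace k)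
    {t : ℝ} (ht : 0 ≤ t) : u p t = v p t := by
  -- With `γ` the conjugate of the difference at the given point, the real part there is `|u - v|²`.
  have h := hu.re_sub_nonpos hα hv (starRingEnd ℂ (u p t - v p t)) hp ht
  rw [mul_comm, Complex.mul_conj, Complex.ofReal_re] at h
  exact sub_eq_zero.1 (Complex.normSq_eq_zero.1 (le_antisymm h (Complex.normSq_nonneg _)))

end uniqueness

/-! ### The representation formula and its absolute convergence. -/

section representation

variable {k : ℕ} {α : ℝ} {φ : ℝ × E k → ℂ}

/-- The substitution `σ' = σ + η`. The radius is left as `√(ρ²)` to match the data rewritten in the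
variable `s = ρ²`. -/
theorem inner_integral_eq (hk : 1 ≤ k) {p : ℝ × E k} (hp : p ∈ halfSpace k) {ρ : ℝ} (hρ : 0 < ρ)
    {t : ℝ} (ht : 0 < t) : ∫ σ', mehlerKernel α p (ρ, σ') t * φ (ρ, σ') =
      ∫ η, kernF α t p.1 ρ η * φ (√(ρ ^ 2), p.2 + η) := by
  rw [← integral_add_left_eq_self _ p.2, Real.sqrt_sq hρ.le]
  refine integral_congr_ae (Eventually.of_forall fun η => ?_)
  have := mehlerKernel_eq (α := α) hk (mem_halfSpace.1 hp) hρ ht p.2 (p.2 + η)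
  rw [add_sub_cancel_left] at this
  simp only
  rw [← this]

theorem mehlerSolution_eq (hk : 1 ≤ k) (hα : 0 < α) (hφ : φ ∈ SigmaPlus k) {p : ℝ × E k}
    (hp : p ∈ halfSpace k) {t : ℝ} (ht : 0 ≤ t) :
    mehlerSolution α φ p t = tameHeat α (fun p => φ (√p.1, p.2)) p.1 p.2 t := by
  have hp' := mem_halfSpace.1 hp
  rw [mehlerSolution]
  split_ifs with h
  · have hint := (tame_of_mem_sigmaPlus hφ).integrable_translate hα hp' p.2 t
    rw [tameHeat, heat, integral_heatMeasure_eq_iterated hα h hp' hint]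
    refine setIntegral_congr_fun measurableSet_Ioi fun ρ hρ => ?_
    simp only
    rw [inner_integral_eq hk hp hρ h]
  · obtain rfl : t = 0 := le_antisymm (not_lt.1 h) ht
    rw [tameHeat, heat_zero, Real.sqrt_sq hp'.le]

theorem integrable_mehlerKernel_mul (hk : 1 ≤ k) (hα : 0 < α) (hφ : φ ∈ SigmaPlus k) {p : ℝ × E k}
    (hp : p ∈ halfSpace k) {t : ℝ} (ht : 0 < t) {ρ : ℝ} (hρ : 0 < ρ) :
    Integrable fun σ' : E k => mehlerKernel α p (ρ, σ') t * φ (ρ, σ') := by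
  have hp' := mem_halfSpace.1 hp
  obtain ⟨C, hC⟩ := (tame_of_mem_sigmaPlus hφ).exists_bound_sq
  have hcont : Continuous fun σ' : E k => φ (ρ, σ') :=
    continuousOn_univ.1 (hφ.1.continuousOn.comp (f := fun σ' : E k => (ρ, σ')) (by fun_prop)
      fun _ _ => mem_halfSpace.2 hρ)
  refine (((integrable_kernF (k := k) hα ht hp' hρ).comp_sub_right p.2).mul_bdd (c := C)
    hcont.aestronglyMeasurable (Eventually.of_forall fun σ' => ?_)).congr
    (Eventually.of_forall fun σ' => ?_)
  · have := hC (ρ, σ') (mem_halfSpace.2 hρ)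
    rwa [Real.sqrt_sq hρ.le] at this
  · simp only
    rw [← mehlerKernel_eq (α := α) hk hp' hρ ht p.2 σ']

theorem integrableOn_mehlerKernel (hk : 1 ≤ k) (hα : 0 < α) (hφ : φ ∈ SigmaPlus k) {p : ℝ × E k}
    (hp : p ∈ halfSpace k) {t : ℝ} (ht : 0 < t) :
    IntegrableOn (fun ρ : ℝ => (∫ σ' : E k, mehlerKernel α p (ρ, σ') t * φ (ρ, σ')) *
      ((ρ ^ (2 * α - 1) : ℝ) : ℂ)) (Ioi (0 : ℝ)) := by
  have hint := (tame_of_mem_sigmaPlus hφ).integrable_translate hα (mem_halfSpace.1 hp) p.2 t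
  refine (integrableOn_kernF hα ht (mem_halfSpace.1 hp) hint).congr_fun (fun ρ hρ => ?_)
    measurableSet_Ioi
  simp only
  rw [inner_integral_eq hk hp hρ ht]

theorem isSolution_mehlerSolution (hk : 1 ≤ k) (hα : 0 < α) (hφ : φ ∈ SigmaPlus k) :
    IsSolution α φ (mehlerSolution α φ) := by
  refine ((tame_of_mem_sigmaPlus hφ).isSolution hα).congr
    (fun p hp t ht => mehlerSolution_eq hk hα hφ hp ht) fun p hp => ?_
  rw [Real.sqrt_sq (mem_halfSpace.1 hp).le]

end representation

end BaouendiGrushin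
theorem theorem1p1 (k : ℕ) (hk : 1 ≤ k) (α : ℝ) (hα : 0 < α)
    (φ : ℝ × BaouendiGrushin.E k → ℂ) (hφ : φ ∈ BaouendiGrushin.SigmaPlus k) :
    -- the integrals in the kernel and in the representation formula converge absolutely
    (∀ p ∈ BaouendiGrushin.halfSpace k, ∀ q ∈ BaouendiGrushin.halfSpace k, ∀ t : ℝ, 0 < t →
      Integrable (BaouendiGrushin.mehlerIntegrand α p q t)) ∧
    (∀ p ∈ BaouendiGrushin.halfSpace k, ∀ t : ℝ, 0 < t →
      (∀ ρ : ℝ, 0 < ρ →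
        Integrable fun σ' : BaouendiGrushin.E k =>
          BaouendiGrushin.mehlerKernel α p (ρ, σ') t * φ (ρ, σ')) ∧
      IntegrableOn
        (fun ρ : ℝ =>
          (∫ σ' : BaouendiGrushin.E k,
            BaouendiGrushin.mehlerKernel α p (ρ, σ') t * φ (ρ, σ')) *
            ((ρ ^ (2 * α - 1) : ℝ) : ℂ))
        (Ioi (0 : ℝ))) ∧
    -- the representation formula gives a solution
    BaouendiGrushin.IsSolution α φ (BaouendiGrushin.mehlerSolution α φ) ∧
    -- and there is no other solution
    (∀ v : ℝ × BaouendiGrushin.E k → ℝ → ℂ, BaouendiGrushin.IsSolution α φ v →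
      ∀ p ∈ BaouendiGrushin.halfSpace k, ∀ t : ℝ, 0 ≤ t →
        v p t = BaouendiGrushin.mehlerSolution α φ p t) := by
  refine ⟨fun p hp q hq t ht => ?_, fun p hp t ht => ⟨fun ρ hρ => ?_, ?_⟩, ?_,
    fun v hv p hp t ht => ?_⟩
  · exact BaouendiGrushin.integrable_mehlerIntegrand hk hα (BaouendiGrushin.mem_halfSpace.1 hp)
      (BaouendiGrushin.mem_halfSpace.1 hq) ht p.2 q.2
  · exact BaouendiGrushin.integrable_mehlerKernel_mul hk hα hφ hp ht hρ
  · exact BaouendiGrushin.integrableOn_mehlerKernel hk hα hφ hp ht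
  · exact BaouendiGrushin.isSolution_mehlerSolution hk hα hφ
  · exact hv.eq hα (BaouendiGrushin.isSolution_mehlerSolution hk hα hφ) hp ht
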